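/- **Theorem (Persistent double-ended eertrees).** Let $\Sigma=\{0,\dots,\sigma-1\}$ be an alphabet of size $\sigma$. For a string $s$ over $\Sigma$, the *eertree* of $s$ is the tuple $(V,\mathsf{even},\mathsf{odd},\operatorname{next},\operatorname{link})$, where $V$ consists of the root $\mathsf{odd}$ (which represents an "empty string of length $-1$") and one node for each palindromic substring of $s$, the node of the empty string being the root $\mathsf{even}$; $\operatorname{next}(v,c)$ is the node of the palindrome $c\,\mathrm{str}(v)\,c$ (of the palindrome $c$ if $v=\mathsf{odd}$) if this is a substring of $s$, and null otherwise; $\operatorname{link}(v)$ is the node of the longest proper palindromic suffix of $\mathrm{str}(v)$, with $\operatorname{link}(\mathsf{even})=\operatorname{link}(\mathsf{odd})=\mathsf{odd}$. Write $\operatorname{len}(v)=|\mathrm{str}(v)|$, so that $\operatorname{len}(\mathsf{odd})=-1$. A *fully persistent double-ended eertree* maintains a growing collection of versions, each holding a string over $\Sigma$; initially there is one version, holding the empty string. At any time, to any existing version, with string $s$, one may apply * an update: $\mathtt{push\_back}(c)$, $\mathtt{push\_front}(c)$, or, if $s$ is nonempty, $\mathtt{pop\_back}()$, $\mathtt{pop\_front}()$,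 which creates a new version, holding respectively $sc$, $cs$, $s$ without its last character, $s$ without its first character, and leaves all the existing versions available; * a query: the length or a given character of $s$; the eertree of $s$, that is, (pointers to) its nodes $\mathsf{even}$ and $\mathsf{odd}$, and $\operatorname{next}(v,c)$, $\operatorname{link}(v)$, $\operatorname{len}(v)$ for a given node $v$ and character $c$; the number of distinct palindromic substrings of $s$ (including the empty string); if $s$ is nonempty, the nodes of the longest palindromic prefix and of the longest palindromic suffix of $s$, and whether each of them occurs only once in $s$. The model is the word RAM with $w$-bit words, with addition and subtraction modulo $2^w$ and comparisons as its only arithmetic, where every instruction costs one unit of time. The space used by an operation is the growth of the initial segment of the memory that contains all the cells accessed so far. There are fixed programs (independent of $\sigma$, $m$, $w$) and constants $C$, $K$ such that for all $\sigma$, $m$ and all $w\ge K\log_2(\sigma+m+2)$ the programs implement fully persistent double-ended eertrees over the alphabet of size $\sigma$ correctly through any sequence of $m$ operations, where, in the worst case and with $n$ the length of the string in the version to which the operation is applied, * the initialization, which is given $\sigma$, takes time and space at most $C(1+\log\sigma)$; * every operation takes time and space at most $C(1+\log n+\log\sigma)$, in particular every $\mathtt{push\_back}$ or $\mathtt{push\_front}$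 operation does; * every $\mathtt{pop\_back}$ or $\mathtt{pop\_front}$ operation takes time and space at most $C(1+\log n)$. Here $\log$ is the binary logarithm rounded down, with $\log 0=0$. -/

import Mathlib

/-! ## Palindromes and the eertree of a string

Strings over an alphabet `α` are lists. A substring of `s` is an infix `t <:+: s`. -/

namespace Eer

variable {α : Type*} [DecidableEq α]

/-- The longest palindromic prefix of `s` (nonempty as soon as `s` is). -/
def prepal (s : List α) : List α :=
  s.take (Nat.findGreatest (fun l => (s.take l).Palindrome) s.length)

/-- The longest palindromic suffix of `s` (nonempty as soon as `s` is). -/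
def sufpal (s : List α) : List α :=
  s.drop (s.length - Nat.findGreatest (fun l => (s.drop (s.length - l)).Palindrome) s.length)

/-- `t` occurs exactly once in `s`: there is exactly one decomposition `s = x ++ t ++ y`. -/
def UniqueIn (t s : List α) : Prop :=
  ∃! p : List α × List α, p.1 ++ t ++ p.2 = s

/-- The nodes of eertrees: `odd` is the root of the palindromes of odd length and represents the
empty string of length `-1`; `pal t` represents the palindrome `t`, and `pal []` is the root of
the palindromes of even length. -/
inductive Node (α : Type*) where
  | odd : Node α
  | pal (t : List α) : Node α

/-- The length of the palindrome that a node represents. -/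
def Node.len : Node α → ℤ
  | .odd => -1
  | .pal t => t.length

/-- The node of `c str(v) c`, where `c str(odd) c = c`. -/
def Node.extend (c : α) : Node α → Node α
  | .odd => .pal [c]
  | .pal t => .pal (c :: t ++ [c])

/-- The suffix link: the node of the longest proper palindromic suffix, with
`link even = link odd = odd`. The longest proper palindromic suffix of `a :: t` is the longest
palindromic suffix of `t`. -/
def Node.link : Node α → Node α
  | .odd => .odd
  | .pal [] => .odd
  | .pal (_ :: t) => .pal (sufpal t)

/-- An eertree is a tuple `(V, even, odd, next, link)`; `next v c = none` means that `v` has no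
outgoing edge labelled `c`. -/
structure Eertree (α : Type*) where
  V : Set (Node α)
  even : Node α
  odd : Node α
  next : Node α → α → Option (Node α)
  link : Node α → Node α

/-- The nodes of the (minimal) eertree of `s`: the two roots and one node for every nonempty
palindromic substring of `s`. -/
def nodes (s : List α) : Set (Node α) :=
  {v | v = .odd ∨ ∃ t : List α, t.Palindrome ∧ t <:+: s ∧ v = .pal t}

open Classical in
/-- The (minimal) eertree of the string `s`. -/
noncomputable def eertree (s : List α) : Eertree α where
  V := nodes s
  even := .pal []
  odd := .odd
  next v c := if v.extend c ∈ nodes s then some (v.extend c) else none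
  link := Node.link

/-- The number of distinct palindromic substrings of `s`, the empty one included. -/
noncomputable def numPal (s : List α) : ℕ :=
  {t : List α | t.Palindrome ∧ t <:+: s}.ncard

end Eer

/-! ## The word RAM

All data are `w`-bit words, that is, natural numbers below `2 ^ w`. The memory is an array of
`2 ^ w` words; a program also uses the finitely many registers that it mentions. The arithmetic
operations are addition and subtraction modulo `2 ^ w`. -/

namespace WordRAM

/-- Comparisons of two registers. -/
inductive Test where
  | lt (a b : ℕ)
  | eq (a b : ℕ)

/-- Programs; `r`, `a`, `b` are names of registers. -/
inductive Prog where
  | skip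
  /-- `r ← k` -/
  | const (r k : ℕ)
  /-- `r ← a` -/
  | move (r a : ℕ)
  /-- `r ← a + b` -/
  | add (r a b : ℕ)
  /-- `r ← a - b` -/
  | sub (r a b : ℕ)
  /-- `r ← A[a]` -/
  | load (r a : ℕ)
  /-- `A[a] ← b` -/
  | store (a b : ℕ)
  | seq (p q : Prog)
  | ite (b : Test) (p q : Prog)
  | loop (b : Test) (p : Prog)

/-- A state of the machine. Besides the contents of the registers and of the memory it records
the space in use: the least `m` such that all the cells accessed so far have an address below `m`. -/
structure State where
  reg : ℕ → ℕ
  mem : ℕ → ℕ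
  space : ℕ

/-- The initial state: everything is zero, no memory is in use. -/
def State.initial : State := ⟨fun _ => 0, fun _ => 0, 0⟩

/-- Write `x` to the register `r`. -/
def State.set (st : State) (r x : ℕ) : State :=
  { st with reg := Function.update st.reg r x }

/-- Record an access to the memory cell with address `a`. -/
def State.touch (st : State) (a : ℕ) : State :=
  { st with space := max st.space (a + 1) }

/-- Write `x` to the memory cell with address `a`. -/
def State.write (st : State) (a x : ℕ) : State :=
  { st.touch a with mem := Function.update st.mem a x }

/-- Whether a comparison is true in a state. -/
def Test.Holds (st : State) : Test → Prop
  | .lt a b => st.reg a < st.reg b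
  | .eq a b => st.reg a = st.reg b

/-- `Exec w p st t st'`: on the word RAM with word length `w`, the program `p`, started in the
state `st`, halts in the state `st'` after `t` steps. Every instruction and every evaluation of a
comparison is one step. -/
inductive Exec (w : ℕ) : Prog → State → ℕ → State → Prop
  | skip (st : State) : Exec w .skip st 1 st
  | const (r k : ℕ) (st : State) : Exec w (.const r k) st 1 (st.set r (k % 2 ^ w))
  | move (r a : ℕ) (st : State) : Exec w (.move r a) st 1 (st.set r (st.reg a))
  | add (r a b : ℕ) (st : State) :
      Exec w (.add r a b) st 1 (st.set r ((st.reg a + st.reg b) % 2 ^ w))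
  | sub (r a b : ℕ) (st : State) :
      Exec w (.sub r a b) st 1 (st.set r ((st.reg a + 2 ^ w - st.reg b) % 2 ^ w))
  | load (r a : ℕ) (st : State) :
      Exec w (.load r a) st 1 ((st.touch (st.reg a)).set r (st.mem (st.reg a)))
  | store (a b : ℕ) (st : State) :
      Exec w (.store a b) st 1 (st.write (st.reg a) (st.reg b))
  | seq {p q : Prog} {st₁ st₂ st₃ : State} {t u : ℕ} :
      Exec w p st₁ t st₂ → Exec w q st₂ u st₃ → Exec w (.seq p q) st₁ (t + u) st₃
  | ite_true {b : Test} {p q : Prog} {st₁ st₂ : State} {t : ℕ} :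
      b.Holds st₁ → Exec w p st₁ t st₂ → Exec w (.ite b p q) st₁ (1 + t) st₂
  | ite_false {b : Test} {p q : Prog} {st₁ st₂ : State} {t : ℕ} :
      ¬ b.Holds st₁ → Exec w q st₁ t st₂ → Exec w (.ite b p q) st₁ (1 + t) st₂
  | loop_true {b : Test} {p : Prog} {st₁ st₂ st₃ : State} {t u : ℕ} :
      b.Holds st₁ → Exec w p st₁ t st₂ → Exec w (.loop b p) st₂ u st₃ →
      Exec w (.loop b p) st₁ (1 + t + u) st₃
  | loop_false {b : Test} {p : Prog} {st : State} :
      ¬ b.Holds st → Exec w (.loop b p) st 1 st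

/-- The calling convention: the arguments of an operation are passed in the registers 0, 1, 2
(and its result is returned in the register 0). -/
def State.call (st : State) (x y z : ℕ) : State :=
  ((st.set 0 x).set 1 y).set 2 z

end WordRAM

/-! ## Persistent double-ended eertrees

The alphabet of size `σ` is `Fin σ`, its letters are passed to programs as numbers below `σ`. -/

namespace Eer

open WordRAM

/-- The operations that modify the string. -/
inductive Update (σ : ℕ) where
  | pushBack (c : Fin σ)
  | pushFront (c : Fin σ)
  | popBack
  | popFront

/-- Pop operations require a nonempty string. -/
def Update.Valid {σ : ℕ} (s : List (Fin σ)) : Update σ → Prop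
  | .pushBack _ => True
  | .pushFront _ => True
  | .popBack => s ≠ []
  | .popFront => s ≠ []

/-- The string after an update. -/
def Update.apply {σ : ℕ} (s : List (Fin σ)) : Update σ → List (Fin σ)
  | .pushBack c => s ++ [c]
  | .pushFront c => c :: s
  | .popBack => s.dropLast
  | .popFront => s.tail

/-- The argument of an update that is passed to its program. -/
def Update.arg {σ : ℕ} : Update σ → ℕ
  | .pushBack c => c
  | .pushFront c => c
  | .popBack => 0
  | .popFront => 0

/-- The cost of an update of a string of length `n`: `1 + log n + log σ` for pushes, `1 + log n`
for pops (`Nat.log 2` is the binary logarithm rounded down, with `log 0 = 0`). -/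
def Update.bound {σ : ℕ} (n : ℕ) : Update σ → ℕ
  | .pushBack _ => 1 + Nat.log 2 n + Nat.log 2 σ
  | .pushFront _ => 1 + Nat.log 2 n + Nat.log 2 σ
  | .popBack => 1 + Nat.log 2 n
  | .popFront => 1 + Nat.log 2 n

/-- The operations that access a version: its string (`length`, `charAt`), its eertree (`even`,
`odd`, `next`, `link`, `len`), the number of distinct palindromic substrings, and the longest
palindromic prefix and suffix (their nodes, and whether they are unique in the string). -/
inductive Query (σ : ℕ) where
  | length
  | charAt (i : ℕ)
  | even
  | odd
  | next (v : Node (Fin σ)) (c : Fin σ)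
  | link (v : Node (Fin σ))
  | len (v : Node (Fin σ))
  | numPal
  | prePal
  | prePalUnique
  | sufPal
  | sufPalUnique

/-- The queries that may be made to a version with string `s`: positions lie in the string, nodes
lie in its eertree, and the string is nonempty when its longest palindromic prefix or suffix is
asked for. -/
def Query.Valid {σ : ℕ} (s : List (Fin σ)) : Query σ → Prop
  | .charAt i => i < s.length
  | .next v _ => v ∈ (eertree s).V
  | .link v => v ∈ (eertree s).V
  | .len v => v ∈ (eertree s).V
  | .prePal => s ≠ []
  | .prePalUnique => s ≠ []
  | .sufPal => s ≠ []
  | .sufPalUnique => s ≠ []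
  | _ => True

/-- The first argument of a query, where `label v` is the word (pointer) that stands for `v`. -/
def Query.arg₁ {σ : ℕ} (label : Node (Fin σ) → ℕ) : Query σ → ℕ
  | .charAt i => i
  | .next v _ => label v
  | .link v => label v
  | .len v => label v
  | _ => 0

/-- The second argument of a query. -/
def Query.arg₂ {σ : ℕ} : Query σ → ℕ
  | .next _ c => c
  | _ => 0

open Classical in
/-- The word that answers a query to a version with string `s` and node pointers `label`, on a
machine with word length `w`. Positions are counted from 0, the null pointer is 0, integers are
reduced modulo `2 ^ w` (so that `-1` becomes `2 ^ w - 1`), true and false are 1 and 0. -/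
noncomputable def Query.answer {σ : ℕ} (w : ℕ) (s : List (Fin σ)) (label : Node (Fin σ) → ℕ) :
    Query σ → ℕ
  | .length => s.length
  | .charAt i => (s[i]?).elim 0 (fun c => (c : ℕ))
  | .even => label (eertree s).even
  | .odd => label (eertree s).odd
  | .next v c => ((eertree s).next v c).elim 0 label
  | .link v => label ((eertree s).link v)
  | .len v => (v.len % 2 ^ w).toNat
  | .numPal => Eer.numPal s
  | .prePal => label (.pal (prepal s))
  | .prePalUnique => if UniqueIn (prepal s) s then 1 else 0
  | .sufPal => label (.pal (sufpal s))
  | .sufPalUnique => if UniqueIn (sufpal s) s then 1 else 0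

/-- An implementation: a program for the initialization and one for every operation. -/
structure Implementation where
  init : Prog
  pushBack : Prog
  pushFront : Prog
  popBack : Prog
  popFront : Prog
  length : Prog
  charAt : Prog
  even : Prog
  odd : Prog
  next : Prog
  link : Prog
  len : Prog
  numPal : Prog
  prePal : Prog
  prePalUnique : Prog
  sufPal : Prog
  sufPalUnique : Prog

/-- The program for an update. -/
def Implementation.update (I : Implementation) {σ : ℕ} : Update σ → Prog
  | .pushBack _ => I.pushBack
  | .pushFront _ => I.pushFront
  | .popBack => I.popBack
  | .popFront => I.popFront

/-- The program for a query. -/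
def Implementation.query (I : Implementation) {σ : ℕ} : Query σ → Prog
  | .length => I.length
  | .charAt _ => I.charAt
  | .even => I.even
  | .odd => I.odd
  | .next _ _ => I.next
  | .link _ => I.link
  | .len _ => I.len
  | .numPal => I.numPal
  | .prePal => I.prePal
  | .prePalUnique => I.prePalUnique
  | .sufPal => I.sufPal
  | .sufPalUnique => I.sufPalUnique

/-- A version of the data structure: its string, the word (handle) by which it is referred to, and
the words (pointers) that stand for the nodes of its eertree. -/
structure Version (σ : ℕ) where
  str : List (Fin σ)
  handle : ℕ
  label : Node (Fin σ) → ℕ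

/-- The nodes of the eertree have distinct non-null pointers. -/
def Version.WellLabelled {σ : ℕ} (v : Version σ) : Prop :=
  Set.InjOn v.label (eertree v.str).V ∧ ∀ x ∈ (eertree v.str).V, v.label x ≠ 0

/-- `Serves I C w m st vs`: in the machine state `st`, in which the versions `vs` (in the order of
their creation) have been created, the implementation `I` correctly executes, within the time and
space bounds with constant `C`, any next `m` operations, each of them chosen after the previous
one has been executed and applied to any of the versions that exist by then. An update creates a
new version and leaves all the old ones available; a query returns the correct answer. -/
def Serves {σ : ℕ} (I : Implementation) (C w : ℕ) : ℕ → State → List (Version σ) → Prop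
  | 0, _, _ => True
  | m + 1, st, vs => ∀ v ∈ vs,
      (∀ u : Update σ, u.Valid v.str → ∃ (t : ℕ) (st' : State) (v' : Version σ),
        Exec w (I.update u) (st.call v.handle u.arg 0) t st' ∧
        t ≤ C * u.bound v.str.length ∧
        st'.space ≤ st.space + C * u.bound v.str.length ∧
        v'.str = u.apply v.str ∧ v'.handle = st'.reg 0 ∧ v'.WellLabelled ∧
        Serves I C w m st' (vs ++ [v'])) ∧
      (∀ q : Query σ, q.Valid v.str → ∃ (t : ℕ) (st' : State),
        Exec w (I.query q) (st.call v.handle (q.arg₁ v.label) q.arg₂) t st' ∧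
        t ≤ C * (1 + Nat.log 2 v.str.length + Nat.log 2 σ) ∧
        st'.space ≤ st.space + C * (1 + Nat.log 2 v.str.length + Nat.log 2 σ) ∧
        st'.reg 0 = q.answer w v.str v.label ∧
        Serves I C w m st' vs)

/-- `I` implements fully persistent double-ended eertrees over the alphabet of size `σ` on the word
RAM with word length `w`, for up to `m` operations: from the all-zero machine state the
initialization, which is given `σ`, creates a version of the empty string, and after that `I`
serves any `m` operations. -/
def Implements (I : Implementation) (C σ w m : ℕ) : Prop :=
  ∃ (t : ℕ) (st : State) (v : Version σ),
    Exec w I.init (State.initial.call σ 0 0) t st ∧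
    t ≤ C * (1 + Nat.log 2 σ) ∧
    st.space ≤ C * (1 + Nat.log 2 σ) ∧
    v.str = [] ∧ v.handle = st.reg 0 ∧ v.WellLabelled ∧
    Serves I C w m st [v]

end Eer

/-! # Persistent double-ended eertrees

**Surfaces.** Call an occurrence `[i, j)` of a nonempty palindrome in `s` a *surface* if no longer
palindrome starts at `i` or ends at `j` (`Surf`). At most one surface starts, and at most one ends,
at each position, so that a string of length `n` has at most `n` surfaces, and the longest
palindromic prefix and suffix are the surfaces at its two ends. When a letter is appended, let `i₀`
be the start of the new longest palindromic suffix. The latter becomes a surface, the surface that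
starts at `i₀` is lost if there is one, and nothing else changes (`surf_concat_iff`). When the
letter is removed again, the only occurrence that can become a surface is the longest proper
palindromic prefix of the removed surface, which has the node of its suffix link (`surf_start_iff`).
Both facts rest on the periodicity of palindromes with a common start (`exists_sym_right`,
`exists_sym_left`).

**The eertree.** The longest palindromic suffix of `s ++ [c]` is `c u c`, where `u` is the longest
palindromic suffix of `s` if this is preceded by `c`, and otherwise the longest shorter one that is.
The latter is stored as the *direct link* of the longest palindromic suffix and `c`
(`extend_sufpal_concat`); the direct link of the parent of a new node also leads to its suffix link
(`link_extend_pal`). The direct links of a new node are those of its suffix link with one change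
(`direct_pal`), so that a single change of a persistent map creates them: no amortization takes
place. Finally, the *count* of a node is the number of its surfaces plus the number of nodes whose
suffix link it is (`cnt`). A nonempty palindrome occurs in `s` if and only if its count is positive
(`cnt_pos_iff`), which decides whether a node disappears with a letter; the longest palindromic
suffix is unique if and only if its count is 1 (`uniqueIn_sufpal`). One operation changes only a few
counts (`cnt_concat`).

**Persistence.** The letters, the surfaces (by first and by last positions), the edges, and the
counts are five maps, and the direct links of every node are a map. Maps are search trees balanced
by height and changed by copying the search path (`sets_set`, `runs_getP`, `runs_setP`). Thus memory
cells in use are never overwritten, so that all the versions and all the records of nodes remain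
valid. A version is a header with pointers to its five maps, the positions of its two ends, and two
numbers (`VerAt`). Positions are words modulo `2 ^ w`, and there are two variants of each update
program, for the two directions in which a string can be read. Reversing a string preserves its
palindromes, so that an operation at the front is one at the back of the reversed string
(`VerAt.mirror`).

Every operation consists of a constant number of accesses to maps with `O(n)` keys (`within_pushP`,
`within_popP`, `within_query`), and therefore takes time and space `O(1 + log n)`, whatever `σ` is:
the edges of all the nodes are kept in one map. The invariant that all the versions are present in
memory is preserved by every operation (`Inv.serves`).
-/

/-! ### Symmetric intervals of a sequence -/

namespace Eer

/-- The interval `[i, j)` of the sequence `f` reads the same in both directions. -/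
def Sym {β : Type*} (f : ℕ → β) (i j : ℕ) : Prop :=
  ∀ k, i ≤ k → k < j → f k = f (i + j - 1 - k)

theorem Sym.concentric {β : Type*} {f : ℕ → β} {a b i j : ℕ} (h : Sym f a b) (hi : a ≤ i)
    (_ : j ≤ b) (e : i + j = a + b) : Sym f i j := by
  intro k h1 h2
  rw [h k (by omega) (by omega), e]

/-- A palindromic prefix `[a, e)` of a palindrome `[a, b)` makes `b - e` a period. -/
theorem Sym.period {β : Type*} {f : ℕ → β} {a e b : ℕ} (h : Sym f a e) (h' : Sym f a b)
    (hb : e ≤ b) {y : ℕ} (h1 : a ≤ y) (h2 : y < e) : f y = f (y + (b - e)) := by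
  rw [h y h1 h2, h' (a + e - 1 - y) (by omega) (by omega)]
  congr 1; omega

/-- Two palindromes `[a, e)` and `[a, b)` with a common start, `e < b`: from every `i ∈ [a, e]`
starts a palindrome that ends in `(e, b]`. If `i` lies in the first half of `[a, b)`, far enough
from its centre, the part of `[a, b)` that is concentric with it does; otherwise `a` can be moved
to the right by the period `b - e`. -/
theorem exists_sym_right {β : Type*} {f : ℕ → β} {e b i : ℕ} (hie : i ≤ e) (hb : e < b) :
    ∀ {a : ℕ}, a ≤ i → Sym f a e → Sym f a b → ∃ j, e < j ∧ j ≤ b ∧ Sym f i j := by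
  suffices H : ∀ (d a : ℕ), i - a = d → a ≤ i → Sym f a e → Sym f a b →
      ∃ j, e < j ∧ j ≤ b ∧ Sym f i j from fun {a} => H _ a rfl
  intro d
  induction d using Nat.strong_induction_on with
  | _ d ih =>
    intro a hd hai h h'
    by_cases hc : i - a < b - e
    · exact ⟨a + b - i, by omega, by omega, h'.concentric hai (by omega) (by omega)⟩
    · refine ih (i - (a + (b - e))) (by omega) (a + (b - e)) rfl (by omega) ?_ ?_
      · intro k h1 h2
        rw [h k (by omega) h2, h.period h' hb.le (by omega) (by omega)]
        congr 1; omega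
      · intro k h1 h2
        rw [h' k (by omega) h2, h (a + b - 1 - k) (by omega) (by omega)]
        rw [h' (a + e - 1 - (a + b - 1 - k)) (by omega) (by omega)]
        congr 1; omega

/-- The mirror image of `exists_sym_right`. -/
theorem exists_sym_left {β : Type*} {f : ℕ → β} {e b i : ℕ} (hie : e ≤ i) (hb : b < e) :
    ∀ {a : ℕ}, i ≤ a → Sym f e a → Sym f b a → ∃ j, b ≤ j ∧ j < e ∧ Sym f j i := by
  suffices H : ∀ (d a : ℕ), a - i = d → i ≤ a → Sym f e a → Sym f b a →
      ∃ j, b ≤ j ∧ j < e ∧ Sym f j i from fun {a} => H _ a rfl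
  intro d
  induction d using Nat.strong_induction_on with
  | _ d ih =>
    intro a hd hai h h'
    by_cases hc : a - i < e - b
    · exact ⟨b + a - i, by omega, by omega, h'.concentric (by omega) hai (by omega)⟩
    · have per : ∀ y, e ≤ y → y < a → f y = f (y - (e - b)) := by
        intro y h1 h2
        rw [h y h1 h2, h' (e + a - 1 - y) (by omega) (by omega)]
        congr 1; omega
      refine ih (a - (e - b) - i) (by omega) (a - (e - b)) rfl (by omega) ?_ ?_
      · intro k h1 h2
        rw [h k (by omega) (by omega), per _ (by omega) (by omega)]
        congr 1; omega
      · intro k h1 h2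
        rw [h' k (by omega) (by omega), h (b + a - 1 - k) (by omega) (by omega)]
        rw [h' (e + a - 1 - (b + a - 1 - k)) (by omega) (by omega)]
        congr 1; omega

/-! ### Palindromic substrings -/

variable {α : Type*}

/-- The substring `s[i, j)`. -/
def sub (s : List α) (i j : ℕ) : List α := (s.drop i).take (j - i)

theorem length_sub {s : List α} {i j : ℕ} (hj : j ≤ s.length) : (sub s i j).length = j - i := by
  simp [sub]; omega

theorem sub_infix (s : List α) (i j : ℕ) : sub s i j <:+: s :=
  (List.take_prefix _ _).isInfix.trans (List.drop_suffix _ _).isInfix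

theorem getElem?_sub {s : List α} {i j k : ℕ} (h : k < j - i) : (sub s i j)[k]? = s[i + k]? := by
  simp [sub, h]

theorem sub_append {s t : List α} {i j : ℕ} (hij : i ≤ j) (hj : j ≤ s.length) :
    sub (s ++ t) i j = sub s i j := by
  simp only [sub, List.drop_append_of_le_length (hij.trans hj)]
  rw [List.take_append_of_le_length]; simp; omega

theorem sub_length (s : List α) (i : ℕ) : sub s i s.length = s.drop i := by
  simp [sub]

theorem drop_sub {s : List α} {i j k : ℕ} : (sub s i j).drop k = sub s (i + k) j := by
  simp only [sub, List.drop_take, List.drop_drop]; congr 1; omega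

theorem take_sub {s : List α} {i j k : ℕ} (h : k ≤ j - i) :
    (sub s i j).take k = sub s i (i + k) := by
  simp only [sub, List.take_take]; congr 1; omega

theorem sub_reverse {s : List α} {i j : ℕ} (hij : i ≤ j) (hj : j ≤ s.length) :
    sub s.reverse (s.length - j) (s.length - i) = (sub s i j).reverse := by
  apply List.ext_getElem?
  intro k
  by_cases hk : k < j - i
  · rw [getElem?_sub (by omega), List.getElem?_reverse (by omega), List.getElem?_reverse
      (by rw [length_sub hj]; exact hk), length_sub hj, getElem?_sub (by omega)]
    congr 1; omega
  · rw [List.getElem?_eq_none, List.getElem?_eq_none]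
    · rw [List.length_reverse, length_sub hj]; omega
    · simp only [sub, List.length_take, List.length_drop, List.length_reverse]; omega

theorem exists_sub_of_infix {t s : List α} (h : t <:+: s) :
    ∃ i j, i ≤ j ∧ j ≤ s.length ∧ t = sub s i j := by
  obtain ⟨x, y, rfl⟩ := h
  refine ⟨x.length, x.length + t.length, by omega, by simp, ?_⟩
  simp [sub]

/-- `s[i, j)` is a palindrome. -/
def Pal (s : List α) (i j : ℕ) : Prop := Sym (fun k => s[k]?) i j

theorem palindrome_sub {s : List α} {i j : ℕ} (hij : i ≤ j) (hj : j ≤ s.length) :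
    (sub s i j).Palindrome ↔ Pal s i j := by
  rw [List.Palindrome.iff_reverse_eq]
  have hl := length_sub (s := s) (i := i) hj
  constructor
  · intro h k h1 h2
    have e : (sub s i j).reverse[k - i]? = (sub s i j)[k - i]? := by rw [h]
    rw [List.getElem?_reverse (by omega), getElem?_sub (by omega), getElem?_sub (by omega)] at e
    simp only
    rw [show i + (k - i) = k by omega] at e
    rw [← e]; congr 1; omega
  · intro h
    apply List.ext_getElem?
    intro k
    by_cases hk : k < j - i
    · rw [List.getElem?_reverse (by omega), getElem?_sub (by omega), getElem?_sub (by omega)]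
      refine Eq.trans ?_ (h (i + k) (by omega) (by omega)).symm
      simp only
      congr 1; omega
    · rw [List.getElem?_eq_none, List.getElem?_eq_none]
      · omega
      · simp; omega

theorem pal_append {s t : List α} {i j : ℕ} (hj : j ≤ s.length) : Pal (s ++ t) i j ↔ Pal s i j := by
  constructor
  · intro h k h1 h2
    have := h k h1 h2
    simp only at this ⊢
    rwa [List.getElem?_append_left (by omega), List.getElem?_append_left (by omega)] at this
  · intro h k h1 h2
    have := h k h1 h2
    simp only at this ⊢
    rwa [List.getElem?_append_left (by omega), List.getElem?_append_left (by omega)]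

theorem pal_reverse {s : List α} {i j : ℕ} (hij : i ≤ j) (hj : j ≤ s.length) :
    Pal s.reverse (s.length - j) (s.length - i) ↔ Pal s i j := by
  rw [← palindrome_sub hij hj, ← palindrome_sub (by omega) (by simp), sub_reverse hij hj,
    List.Palindrome.iff_reverse_eq, List.Palindrome.iff_reverse_eq, List.reverse_reverse]
  exact eq_comm

theorem Palindrome.suffix_iff_prefix {t u : List α} (ht : t.Palindrome) (hu : u.Palindrome) :
    u <:+ t ↔ u <+: t := by
  rw [← List.reverse_prefix, ht.reverse_eq, hu.reverse_eq]

/-- The node `v` with `t = c str(v) c`, for a nonempty palindrome `t`. -/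
def core : List α → Node α
  | [] => .odd
  | [_] => .odd
  | _ :: t => .pal t.dropLast

theorem core_extend (c : α) (v : Node α) : ∃ t, v.extend c = .pal t ∧ core t = v := by
  cases v with
  | odd => exact ⟨[c], rfl, rfl⟩
  | pal t =>
    refine ⟨c :: t ++ [c], rfl, ?_⟩
    cases t with
    | nil => rfl
    | cons a t => exact congrArg Node.pal List.dropLast_concat

theorem extend_core {t : List α} (h : t.Palindrome) {c : α} (hc : [c] <:+ t) :
    (core t).extend c = .pal t := by
  cases h with
  | nil => simp at hc
  | singleton x =>
    have := hc.eq_of_length rfl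
    injection this with h
    subst h; rfl
  | cons_concat x h =>
    rename_i l
    have : c = x := by
      have : [c] <:+ (x :: l) ++ [x] := by simpa using hc
      rw [List.suffix_concat_iff] at this
      rcases this with h | ⟨t, h, h'⟩
      · simp at h
      · have := congrArg List.getLast? h; simp at this; exact this
    subst this
    cases l with
    | nil => rfl
    | cons a l =>
      exact congrArg (fun z => Node.pal (c :: z ++ [c])) List.dropLast_concat

theorem Node.extend_injective {c c' : α} {v v' : Node α} (h : v.extend c = v'.extend c') :
    v = v' ∧ c = c' := by
  obtain ⟨t, h1, h2⟩ := core_extend c v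
  obtain ⟨t', h1', h2'⟩ := core_extend c' v'
  have : t = t' := by rw [h, h1'] at h1; injection h1 with h1; exact h1.symm
  refine ⟨by rw [← h2, ← h2', this], ?_⟩
  subst this
  have e : t.head? = some c := by
    cases v <;> (injection h1 with h1; subst h1; rfl)
  have e' : t.head? = some c' := by
    cases v' <;> (injection h1' with h1; subst h1; rfl)
  rw [e] at e'; injection e'

section sufpal

variable [DecidableEq α]

theorem sufpal_suffix (s : List α) : sufpal s <:+ s := List.drop_suffix _ _

theorem sufpal_palindrome (s : List α) : (sufpal s).Palindrome :=
  Nat.findGreatest_spec (P := fun l => (s.drop (s.length - l)).Palindrome) (Nat.zero_le s.length)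
    (by simpa using List.Palindrome.nil)

theorem length_le_sufpal {s u : List α} (hu : u.Palindrome) (h : u <:+ s) :
    u.length ≤ (sufpal s).length := by
  have h1 : (s.drop (s.length - u.length)).Palindrome := by
    rwa [← List.suffix_iff_eq_drop.1 h]
  have := Nat.le_findGreatest (P := fun l => (s.drop (s.length - l)).Palindrome) h.length_le h1
  have h2 := Nat.findGreatest_le (P := fun l => (s.drop (s.length - l)).Palindrome) s.length
  simp only [sufpal, List.length_drop]
  omega

theorem suffix_sufpal {s u : List α} (hu : u.Palindrome) (h : u <:+ s) : u <:+ sufpal s :=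
  List.suffix_of_suffix_length_le h (sufpal_suffix s) (length_le_sufpal hu h)

theorem sufpal_eq {s u : List α} (hu : u.Palindrome) (h : u <:+ s)
    (hm : ∀ t : List α, t.Palindrome → t <:+ s → t.length ≤ u.length) : sufpal s = u :=
  ((suffix_sufpal hu h).eq_of_length
    (le_antisymm (length_le_sufpal hu h) (hm _ (sufpal_palindrome s) (sufpal_suffix s)))).symm

theorem prepal_eq_sufpal_reverse (s : List α) : prepal s = sufpal s.reverse := by
  have e : ∀ l, (s.take l).Palindrome ↔
      (s.reverse.drop (s.reverse.length - l)).Palindrome := by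
    intro l
    rw [List.drop_reverse, List.length_reverse]
    rw [List.Palindrome.iff_reverse_eq, List.Palindrome.iff_reverse_eq, List.reverse_reverse]
    by_cases h : l ≤ s.length
    · rw [show s.length - (s.length - l) = l by omega]; exact eq_comm
    · rw [show s.length - (s.length - l) = s.length by omega, List.take_of_length_le (by omega),
        List.take_length]; exact eq_comm
  have h1 : (prepal s).Palindrome :=
    Nat.findGreatest_spec (P := fun l => (s.take l).Palindrome) (Nat.zero_le s.length)
      (by simpa using List.Palindrome.nil)
  have h2 : prepal s = (sufpal s.reverse).reverse := by
    have hle := Nat.findGreatest_le (P := fun l => (s.take l).Palindrome) s.length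
    simp only [prepal, sufpal]
    simp only [e]
    simp only [e] at hle
    rw [List.length_reverse, List.drop_reverse, List.reverse_reverse] at *
    congr 1; omega
  rw [← h1.reverse_eq, h2, List.reverse_reverse]

theorem sufpal_ne_nil {s : List α} (h : s ≠ []) : sufpal s ≠ [] := by
  obtain ⟨t, c, rfl⟩ := List.eq_nil_or_concat' s |>.resolve_left h
  have := length_le_sufpal (List.Palindrome.singleton c) (List.suffix_append t [c])
  intro e
  simp [e] at this

/-- The longest palindromic suffix of `s ++ [c]` in terms of the palindromic suffixes of `s`: if
`u` is preceded by `c` in `s` and no longer palindrome is, it is `c u c`. -/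
theorem sufpal_concat_of_suffix {s u : List α} {c : α} (hu : u.Palindrome) (h : c :: u <:+ s)
    (hm : ∀ t : List α, t.Palindrome → c :: t <:+ s → t.length ≤ u.length) :
    sufpal (s ++ [c]) = c :: u ++ [c] := by
  have hp : (c :: u ++ [c]).Palindrome := List.Palindrome.cons_concat c hu
  refine sufpal_eq hp (List.suffix_concat_iff.2 (Or.inr ⟨c :: u, rfl, h⟩)) ?_
  intro t ht hts
  rcases List.suffix_concat_iff.1 hts with rfl | ⟨t', rfl, h'⟩
  · simp
  · cases ht' : t' with
    | nil => simp
    | cons a t'' =>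
      subst ht'
      have e := ht.reverse_eq
      simp only [List.cons_append, List.reverse_cons, List.reverse_append, List.reverse_nil,
        List.nil_append] at e
      injection e with e1 e2
      subst e1
      have e3 : t''.reverse = t'' := by
        have := congrArg List.dropLast e2; simpa using this
      have := hm t'' (List.Palindrome.of_reverse_eq e3) h'
      simp; omega

/-- The palindromic suffixes of `s` that are preceded by `c` decide what the longest palindromic
suffix of `s ++ [c]` is. -/
theorem sufpal_concat_congr {s t : List α} {c : α} (hts : t <:+ s)
    (h : ∀ u : List α, u.Palindrome → c :: u <:+ s → c :: u <:+ t) :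
    sufpal (s ++ [c]) = sufpal (t ++ [c]) := by
  have key : sufpal (s ++ [c]) <:+ t ++ [c] := by
    have hp := sufpal_palindrome (s ++ [c])
    rcases List.suffix_concat_iff.1 (sufpal_suffix (s ++ [c])) with e | ⟨l, e, h'⟩
    · exact absurd e (sufpal_ne_nil (by simp))
    · rw [e] at hp ⊢
      refine List.suffix_concat_iff.2 (Or.inr ⟨l, rfl, ?_⟩)
      have e := hp.reverse_eq
      cases l with
      | nil => simp
      | cons a l =>
        simp only [List.cons_append, List.reverse_cons, List.reverse_append, List.reverse_nil,
          List.nil_append] at e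
        injection e with e1 e2
        subst e1
        have e3 : l.reverse = l := by
          have := congrArg List.dropLast e2; simpa using this
        exact h l (List.Palindrome.of_reverse_eq e3) h'
  obtain ⟨x, hx⟩ := hts
  refine (sufpal_eq (sufpal_palindrome _) key fun u hu hus => length_le_sufpal hu ?_).symm
  exact hus.trans ⟨x, by rw [← hx, List.append_assoc]⟩

end sufpal

end Eer

namespace Eer

/-! ### The nodes of the eertree -/

section nodes

variable {α : Type*}

theorem odd_mem_nodes (s : List α) : Node.odd ∈ nodes s := Or.inl rfl

theorem cons_suffix_iff {s u : List α} {c : α} (h : u <:+ s) :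
    c :: u <:+ s ↔ u.length < s.length ∧ s[s.length - 1 - u.length]? = some c := by
  obtain ⟨x, rfl⟩ := h
  induction x using List.reverseRecOn with
  | nil =>
    constructor
    · intro h; have := h.length_le; simp at this
    · intro h; simp at h
  | append_singleton x a _ =>
    have : (x ++ [a] ++ u).length - 1 - u.length = x.length := by simp
    rw [this]
    simp only [List.append_assoc, List.singleton_append]
    rw [List.getElem?_append_right le_rfl]
    simp only [Nat.sub_self, List.getElem?_cons_zero, Option.some.injEq, List.length_append,
      List.length_cons]
    constructor
    · intro h
      have h1 : c :: u <:+ a :: u := List.suffix_of_suffix_length_le h ⟨x, rfl⟩ (by simp)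
      have := h1.eq_of_length (by simp)
      injection this with h1
      exact ⟨by omega, h1.symm⟩
    · rintro ⟨_, rfl⟩
      exact ⟨x, rfl⟩

variable [DecidableEq α]

/-- The palindromic substrings of `s`, as a finite set. -/
def pals (s : List α) : Finset (List α) :=
  (s.tails.flatMap List.inits).toFinset.filter List.Palindrome

theorem mem_pals {s t : List α} : t ∈ pals s ↔ t.Palindrome ∧ t <:+: s := by
  simp only [pals, Finset.mem_filter, List.mem_toFinset, List.mem_flatMap, List.mem_tails,
    List.mem_inits, List.infix_iff_prefix_suffix, and_comm]

theorem nil_mem_pals (s : List α) : [] ∈ pals s := mem_pals.2 ⟨.nil, List.nil_infix⟩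

theorem numPal_eq (s : List α) : numPal s = (pals s).card := by
  rw [numPal, ← Set.ncard_coe_finset]
  congr 1; ext t; simp [mem_pals]

theorem pal_mem_nodes {s t : List α} : Node.pal t ∈ nodes s ↔ t ∈ pals s := by
  simp [nodes, mem_pals]

theorem pals_reverse (s : List α) : pals s.reverse = pals s := by
  ext t
  simp only [mem_pals]
  refine and_congr_right fun h => ?_
  rw [← List.reverse_infix, List.reverse_reverse, h.reverse_eq]

theorem nodes_reverse (s : List α) : nodes s.reverse = nodes s := by
  ext v
  cases v with
  | odd => simp [odd_mem_nodes]
  | pal t => rw [pal_mem_nodes, pal_mem_nodes, pals_reverse]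

theorem infix_mem_pals {s t u : List α} (hu : u.Palindrome) (h : u <:+: t) (ht : t ∈ pals s) :
    u ∈ pals s := mem_pals.2 ⟨hu, h.trans (mem_pals.1 ht).2⟩

theorem sufpal_mem_pals (s : List α) : sufpal s ∈ pals s :=
  mem_pals.2 ⟨sufpal_palindrome s, (sufpal_suffix s).isInfix⟩

/-- A palindromic suffix of `s ++ [c]` other than the longest one is a prefix of the longest one,
hence it occurs in `s`. -/
theorem mem_pals_of_suffix {s u : List α} {c : α} (hu : u.Palindrome) (h : u <:+ s ++ [c])
    (hne : u ≠ sufpal (s ++ [c])) : u ∈ pals s := by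
  have h1 := suffix_sufpal hu h
  have h2 := (Palindrome.suffix_iff_prefix (sufpal_palindrome (s ++ [c])) hu).1 h1
  refine mem_pals.2 ⟨hu, ?_⟩
  rcases List.suffix_concat_iff.1 (sufpal_suffix (s ++ [c])) with e | ⟨l, e, h'⟩
  · exact absurd e (sufpal_ne_nil (by simp))
  · rw [e] at h2 hne
    rcases List.prefix_concat_iff.1 h2 with e | h2
    · exact absurd e hne
    · exact h2.isInfix.trans h'.isInfix

theorem pals_concat (s : List α) (c : α) :
    pals (s ++ [c]) = insert (sufpal (s ++ [c])) (pals s) := by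
  ext t
  rw [Finset.mem_insert]
  constructor
  · intro h
    obtain ⟨h1, h2⟩ := mem_pals.1 h
    by_cases e : t = sufpal (s ++ [c])
    · exact Or.inl e
    · rcases List.infix_concat_iff.1 h2 with h3 | h3
      · exact Or.inr (mem_pals_of_suffix h1 h3 e)
      · exact Or.inr (mem_pals.2 ⟨h1, h3⟩)
  · rintro (rfl | h)
    · exact sufpal_mem_pals _
    · exact mem_pals.2 ⟨(mem_pals.1 h).1, (mem_pals.1 h).2.trans (List.prefix_append _ _).isInfix⟩

theorem pals_subset_concat (s : List α) (c : α) : pals s ⊆ pals (s ++ [c]) := by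
  rw [pals_concat]; exact Finset.subset_insert _ _

theorem nodes_subset_concat (s : List α) (c : α) : nodes s ⊆ nodes (s ++ [c]) := by
  intro v h
  cases v with
  | odd => exact odd_mem_nodes _
  | pal t => exact pal_mem_nodes.2 (pals_subset_concat s c (pal_mem_nodes.1 h))

theorem card_pals_le (s : List α) : (pals s).card ≤ s.length + 1 := by
  induction s using List.reverseRecOn with
  | nil =>
    have : pals ([] : List α) ⊆ {[]} := fun t h => by
      have := (mem_pals.1 h).2
      simpa using this
    simpa using Finset.card_le_card this
  | append_singleton s c ih =>
    rw [pals_concat]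
    refine (Finset.card_insert_le _ _).trans ?_
    simp; omega

/-- The parent of a node in the eertree is a node. -/
theorem core_mem_nodes {s t : List α} (h : t ∈ pals s) : core t ∈ nodes s := by
  obtain ⟨h1, h2⟩ := mem_pals.1 h
  cases h1 with
  | nil => exact odd_mem_nodes _
  | singleton x => exact odd_mem_nodes _
  | cons_concat x h1 =>
    rename_i l
    have : core (x :: (l ++ [x])) = .pal l := by
      cases l with
      | nil => rfl
      | cons a l => exact congrArg Node.pal List.dropLast_concat
    rw [this, pal_mem_nodes]
    exact mem_pals.2 ⟨h1, List.IsInfix.trans (l₂ := x :: (l ++ [x])) ⟨[x], [x], by simp⟩ h2⟩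

theorem mem_nodes_of_extend {s : List α} {v : Node α} {c : α} (h : v.extend c ∈ nodes s) :
    v ∈ nodes s := by
  obtain ⟨t, h1, rfl⟩ := core_extend c v
  rw [h1, pal_mem_nodes] at h
  exact core_mem_nodes h

theorem link_eq {t : List α} (h : t ≠ []) : Node.link (.pal t) = .pal (sufpal t.tail) := by
  cases t with
  | nil => exact absurd rfl h
  | cons a t => rfl

theorem link_mem_nodes {s : List α} {v : Node α} (h : v ∈ nodes s) : v.link ∈ nodes s := by
  match v, h with
  | .odd, _ => exact odd_mem_nodes _
  | .pal [], _ => exact odd_mem_nodes _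
  | .pal (a :: t), h =>
    rw [link_eq (by simp), pal_mem_nodes]
    exact infix_mem_pals (sufpal_palindrome _)
      ((sufpal_suffix _).isInfix.trans (List.suffix_cons a t).isInfix) (pal_mem_nodes.1 h)

theorem length_sufpal_tail_lt {t : List α} (h : t ≠ []) : (sufpal t.tail).length < t.length := by
  have := (sufpal_suffix t.tail).length_le
  have := List.length_pos_iff.2 h
  simp at *; omega

/-! ### Direct links -/

/-- The direct links. `direct v c` is the node of the longest proper palindromic suffix of `str(v)`
that is preceded by `c` in `str(v)`, and `odd` if there is none. In other words, the longest
palindromic suffix of `str(v) c` is `c direct(v, c) c`. -/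
def direct : Node α → α → Node α
  | .odd, _ => .odd
  | .pal t, c => core (sufpal (t ++ [c]))

theorem extend_direct (t : List α) (c : α) :
    (direct (.pal t) c).extend c = .pal (sufpal (t ++ [c])) :=
  extend_core (sufpal_palindrome _)
    (suffix_sufpal (List.Palindrome.singleton c) (List.suffix_append t [c]))

theorem direct_mem_nodes {s : List α} {v : Node α} (h : v ∈ nodes s) (c : α) :
    direct v c ∈ nodes s := by
  cases v with
  | odd => exact h
  | pal t =>
    cases hd : direct (.pal t) c with
    | odd => exact odd_mem_nodes _
    | pal u =>
      have h1 := extend_direct t c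
      rw [hd] at h1
      injection h1 with h1
      have h2 := sufpal_suffix (t ++ [c])
      have h3 := sufpal_palindrome (t ++ [c])
      rw [← h1] at h2 h3
      rcases List.suffix_concat_iff.1 h2 with e | ⟨l, e, h'⟩
      · simp at e
      · have : l = c :: u := (List.append_cancel_right e).symm
        subst this
        have h4 : u.Palindrome := by
          have := core_extend c (.pal u)
          have e := h3.reverse_eq
          simp only [List.cons_append, List.reverse_cons, List.reverse_append, List.reverse_nil,
            List.nil_append] at e
          injection e with _ e
          exact .of_reverse_eq (List.append_cancel_right e)
        exact pal_mem_nodes.2 (infix_mem_pals h4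
          ((List.suffix_cons c u).trans h').isInfix (pal_mem_nodes.1 h))

/-- The suffix link of a child `c v c` of `v` is the child, with the same label, of the direct link
of `v`. -/
theorem link_extend_pal (t : List α) (c : α) :
    Node.link ((Node.pal t).extend c) = (direct (.pal t) c).extend c :=
  (extend_direct t c).symm

/-- Palindromes that are preceded by a letter in a palindrome `t` are suffixes of `link t`, so the
direct links of `t` are those of `link t`, except for the letter that precedes `link t`. -/
theorem direct_pal {t u : List α} {c₀ : α} (ht : t.Palindrome) (hu : sufpal t.tail = u)
    (hc : c₀ :: u <:+ t) (c : α) :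
    direct (.pal t) c = if c = c₀ then .pal u else direct (.pal u) c := by
  have hup : u.Palindrome := hu ▸ sufpal_palindrome _
  have hle : ∀ w : List α, w.Palindrome → c :: w <:+ t → w <:+ u := by
    intro w hw h
    rw [← hu]
    refine suffix_sufpal hw ?_
    obtain ⟨x, rfl⟩ := h
    cases x with
    | nil => exact List.suffix_refl _
    | cons a x => exact ⟨x ++ [c], by simp⟩
  split_ifs with e
  · subst e
    have h := sufpal_concat_of_suffix hup hc fun w hw h => (hle w hw h).length_le
    have h1 := extend_direct t c
    rw [h] at h1
    exact (Node.extend_injective (v' := .pal u) h1).1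
  · have : sufpal (t ++ [c]) = sufpal (u ++ [c]) := by
      refine sufpal_concat_congr ((List.suffix_cons _ _).trans hc) fun w hw h => ?_
      have h1 := hle w hw h
      by_cases hwu : w = u
      · subst hwu
        have := List.suffix_of_suffix_length_le h hc (by simp)
        have := this.eq_of_length (by simp)
        injection this with h1
        exact absurd h1 e
      · refine List.suffix_of_suffix_length_le h ((List.suffix_cons _ _).trans hc) ?_
        have : w.length ≠ u.length := fun e => hwu (h1.eq_of_length e)
        have := h1.length_le
        simp; omega
    simp [direct, this]

/-- The longest palindromic suffix of `s ++ [c]` is `c v c`, where `v` is the longest palindromic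
suffix of `s` if that one is preceded by `c`, and its direct link otherwise. -/
theorem extend_sufpal_concat (s : List α) (c : α) [Decidable (c :: sufpal s <:+ s)] :
    (if c :: sufpal s <:+ s then Node.pal (sufpal s) else direct (.pal (sufpal s)) c).extend c =
      .pal (sufpal (s ++ [c])) := by
  split_ifs with h
  · rw [sufpal_concat_of_suffix (sufpal_palindrome s) h]
    · rfl
    · exact fun t ht h => length_le_sufpal ht ((List.suffix_cons _ _).trans h)
  · rw [extend_direct, sufpal_concat_congr (sufpal_suffix s)]
    intro u hu hs
    have h1 := suffix_sufpal hu ((List.suffix_cons _ _).trans hs)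
    refine List.suffix_of_suffix_length_le hs (sufpal_suffix s) ?_
    have : u.length ≠ (sufpal s).length := fun e => h (h1.eq_of_length e ▸ hs)
    have := h1.length_le
    simp; omega

end nodes

/-! ### Surfaces -/

section surfaces

variable {α : Type*}

/-- The surfaces of `s` are the occurrences `s[i, j)` of nonempty palindromes such that no longer
palindrome starts at `i` or ends at `j`. -/
structure Surf (s : List α) (i j : ℕ) : Prop where
  lt : i < j
  le : j ≤ s.length
  pal : Pal s i j
  right : ∀ j', j < j' → j' ≤ s.length → ¬ Pal s i j'
  left : ∀ i', i' < i → ¬ Pal s i' j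

theorem Surf.eq_right {s : List α} {i j j' : ℕ} (h : Surf s i j) (h' : Surf s i j') : j = j' := by
  rcases lt_trichotomy j j' with e | e | e
  · exact absurd h'.pal (h.right _ e h'.le)
  · exact e
  · exact absurd h.pal (h'.right _ e h.le)

theorem Surf.eq_left {s : List α} {i i' j : ℕ} (h : Surf s i j) (h' : Surf s i' j) : i = i' := by
  rcases lt_trichotomy i i' with e | e | e
  · exact absurd h.pal (h'.left _ e)
  · exact e
  · exact absurd h'.pal (h.left _ e)

theorem Surf.reverse {s : List α} {i j : ℕ} (h : Surf s i j) :
    Surf s.reverse (s.length - j) (s.length - i) := by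
  have h1 := h.lt
  have h2 := h.le
  refine ⟨by omega, by simp, (pal_reverse h1.le h2).2 h.pal, fun j' h3 h4 h5 => ?_,
    fun i' h3 h5 => ?_⟩
  · rw [List.length_reverse] at h4
    have := (pal_reverse (s := s) (i := s.length - j') (j := j) (by omega) h2)
    rw [show s.length - (s.length - j') = j' by omega] at this
    exact h.left _ (by omega) (this.1 h5)
  · have := (pal_reverse (s := s) (i := i) (j := s.length - i') (by omega) (by omega))
    rw [show s.length - (s.length - i') = i' by omega] at this
    exact h.right _ (by omega) (by omega) (this.1 h5)

theorem pal_suffix_iff {s : List α} {i : ℕ} (hi : i ≤ s.length) :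
    Pal s i s.length ↔ (s.drop i).Palindrome := by
  rw [← palindrome_sub hi le_rfl, sub_length]

variable [DecidableEq α]

theorem sub_sufpal (s : List α) :
    sub s (s.length - (sufpal s).length) s.length = sufpal s := by
  rw [sub_length, ← List.suffix_iff_eq_drop.1 (sufpal_suffix s)]

theorem pal_sufpal (s : List α) : Pal s (s.length - (sufpal s).length) s.length := by
  rw [← palindrome_sub (by omega) le_rfl, sub_sufpal]; exact sufpal_palindrome s

theorem not_pal_of_lt_sufpal {s : List α} {i : ℕ} (h : i < s.length - (sufpal s).length) :
    ¬ Pal s i s.length := by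
  intro h'
  rw [pal_suffix_iff (by omega)] at h'
  have := length_le_sufpal h' (List.drop_suffix _ _)
  simp at this; omega

/-- The longest palindromic suffix is the only surface that ends at the end of the string. -/
theorem surf_length_iff {s : List α} (hs : s ≠ []) {i : ℕ} :
    Surf s i s.length ↔ i = s.length - (sufpal s).length := by
  have h1 := List.length_pos_iff.2 (sufpal_ne_nil hs)
  have h2 := (sufpal_suffix s).length_le
  have h : Surf s (s.length - (sufpal s).length) s.length :=
    ⟨by omega, le_rfl, pal_sufpal s, fun j' _ _ => by omega, fun i' h => not_pal_of_lt_sufpal h⟩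
  exact ⟨fun h' => h'.eq_left h, fun e => e ▸ h⟩

/-- Appending a letter destroys only the surface that starts where the new longest palindromic
suffix starts. -/
theorem surf_concat_iff {s : List α} {c : α} {i j : ℕ} (hj : j ≤ s.length) :
    Surf (s ++ [c]) i j ↔ Surf s i j ∧ i ≠ (s ++ [c]).length - (sufpal (s ++ [c])).length := by
  have hl : (s ++ [c]).length = s.length + 1 := by simp
  constructor
  · intro h
    refine ⟨⟨h.lt, hj, (pal_append hj).1 h.pal, fun j' h1 h2 h3 =>
      h.right j' h1 (by omega) ((pal_append h2).2 h3),
      fun i' h1 h2 => h.left i' h1 ((pal_append hj).2 h2)⟩, ?_⟩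
    rintro rfl
    exact h.right _ (by omega) le_rfl (pal_sufpal _)
  · rintro ⟨h, hi⟩
    have hij := h.lt
    refine ⟨h.lt, by omega, (pal_append hj).2 h.pal, fun j' h1 h2 h3 => ?_,
      fun i' h1 h2 => h.left i' h1 ((pal_append hj).1 h2)⟩
    by_cases e : j' ≤ s.length
    · exact h.right j' h1 e ((pal_append e).1 h3)
    · obtain rfl : j' = (s ++ [c]).length := by omega
      have h4 : ¬ i < (s ++ [c]).length - (sufpal (s ++ [c])).length :=
        fun h4 => not_pal_of_lt_sufpal h4 h3
      -- Two palindromic suffixes start at or before `i`: a palindrome longer than `s[i, j)` ends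
      -- at `j`.
      obtain ⟨i', _, h6, h7⟩ := exists_sym_left (i := j) (a := (s ++ [c]).length) hij.le
        (lt_of_le_of_ne (not_lt.1 h4) (Ne.symm hi)) (by omega) h3 (pal_sufpal (s ++ [c]))
      exact h.left i' h6 ((pal_append hj).1 h7)

end surfaces

end Eer

namespace Eer

/-! ### Removing a letter from a string -/

section pop

variable {α : Type*} [DecidableEq α]

theorem take_palindrome_le {t : List α} (ht : t.Palindrome) {k : ℕ} (hk : k < t.length)
    (h : (t.take k).Palindrome) : k ≤ (sufpal t.tail).length := by
  have h1 := (Palindrome.suffix_iff_prefix ht h).2 (List.take_prefix k t)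
  have h2 : t.take k <:+ t.tail := by
    refine List.suffix_of_suffix_length_le h1 (List.tail_suffix t) ?_
    simp; omega
  have := length_le_sufpal h h2
  simp at this; omega

theorem take_link {t : List α} (ht : t.Palindrome) :
    t.take (sufpal t.tail).length = sufpal t.tail := by
  have h : sufpal t.tail <:+ t := (sufpal_suffix _).trans (List.tail_suffix t)
  have := (Palindrome.suffix_iff_prefix ht (sufpal_palindrome _)).1 h
  exact (List.prefix_iff_eq_take.1 this).symm

/-- The surface that appears when the last letter is removed. Let `i` be the start of the longest
palindromic suffix `v` of `s ++ [c]`. The only palindrome that can become a surface is the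
occurrence of `link v` at `i`, and it does unless a surface of `s ++ [c]` ends where it ends. -/
theorem surf_start_iff {s : List α} {c : α} {i j : ℕ} {v u : List α} (hv : sufpal (s ++ [c]) = v)
    (hu : sufpal v.tail = u) (hi : i = (s ++ [c]).length - v.length) :
    Surf s i j ↔ j = i + u.length ∧ u ≠ [] ∧ ∀ a, ¬ Surf (s ++ [c]) a (i + u.length) := by
  have hl : (s ++ [c]).length = s.length + 1 := by simp
  have hvp : v.Palindrome := hv ▸ sufpal_palindrome _
  have hv0 : v ≠ [] := hv ▸ sufpal_ne_nil (by simp)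
  have hvl : v.length ≤ s.length + 1 := by rw [← hl, ← hv]; exact (sufpal_suffix _).length_le
  have hul : u.length < v.length := hu ▸ length_sufpal_tail_lt hv0
  have hsub : sub (s ++ [c]) i (s ++ [c]).length = v := by rw [hi, ← hv, sub_sufpal]
  have hsub' : ∀ k, i + k ≤ s.length → sub s i (i + k) = v.take k := by
    intro k hk
    rw [← hsub, take_sub (by omega), sub_append (by omega) hk]
  have hpu : Pal s i (i + u.length) := by
    rw [← palindrome_sub (by omega) (by omega), hsub' _ (by omega), ← hu, take_link hvp]
    exact sufpal_palindrome _
  have hmax : ∀ j', i ≤ j' → j' ≤ s.length → Pal s i j' → j' ≤ i + u.length := by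
    intro j' h1 h2 h3
    rw [← palindrome_sub h1 h2, show j' = i + (j' - i) by omega, hsub' _ (by omega)] at h3
    have := take_palindrome_le hvp (by omega) h3
    rw [hu] at this; omega
  constructor
  · intro h
    have hij := h.lt
    have hj := h.le
    have e : j = i + u.length := by
      refine le_antisymm (hmax j hij.le hj h.pal) (not_lt.1 fun h1 => ?_)
      exact h.right _ h1 (by omega) hpu
    refine ⟨e, fun e0 => by simp [e0] at e; omega, fun a ha => ?_⟩
    rw [← e] at ha
    obtain ⟨h1, h2⟩ := (surf_concat_iff hj).1 ha
    exact h2 ((h1.eq_left h).trans (by rw [hi, hv]))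
  · rintro ⟨rfl, hu0, hno⟩
    have := List.length_pos_iff.2 hu0
    refine ⟨by omega, by omega, hpu, fun j' h1 h2 h3 => ?_, ?_⟩
    · have := hmax j' (by omega) h2 h3; omega
    · intro a₀ ha₀ hp₀
      -- Let `a` be the first position from which a palindrome ends where `link v` ends. As it is
      -- not a surface, a longer palindrome starts at `a`, and so does one at `i`.
      classical
      let P : ℕ → Prop := fun a => Pal s a (i + u.length)
      have hP : ∃ a, P a := ⟨a₀, hp₀⟩
      have ha := Nat.find_spec hP
      have hai : Nat.find hP < i := lt_of_le_of_lt (Nat.find_min' hP hp₀) ha₀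
      refine hno (Nat.find hP) ⟨by omega, by omega, (pal_append (by omega)).2 ha, ?_, ?_⟩
      · intro b h1 h2 h3
        by_cases e : b ≤ s.length
        · obtain ⟨j', h4, h5, h6⟩ := exists_sym_right (i := i) (by omega) h1 hai.le
            ((pal_append (by omega)).2 ha) h3
          have := hmax j' (by omega) (by omega) ((pal_append (by omega)).1 h6)
          omega
        · obtain rfl : b = (s ++ [c]).length := by omega
          exact not_pal_of_lt_sufpal (by rw [hv, ← hi]; exact hai) h3
      · intro a' h1 h2
        exact Nat.find_min hP h1 ((pal_append (by omega)).1 h2)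

end pop

/-! ### Counting surfaces and suffix links -/

section count

variable {α : Type*}

open Classical in
/-- The surfaces of `s`, as a finite set. -/
noncomputable def surfs (s : List α) : Finset (ℕ × ℕ) :=
  (Finset.range (s.length + 1) ×ˢ Finset.range (s.length + 1)).filter fun p => Surf s p.1 p.2

theorem mem_surfs {s : List α} {p : ℕ × ℕ} : p ∈ surfs s ↔ Surf s p.1 p.2 := by
  simp only [surfs, Finset.mem_filter, Finset.mem_product, Finset.mem_range, and_iff_right_iff_imp]
  intro h
  have := h.lt
  have := h.le
  omega

theorem surfs_nil : surfs ([] : List α) = ∅ := by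
  ext p
  simp only [mem_surfs, Finset.notMem_empty, iff_false]
  intro h
  have := h.lt
  have := h.le
  simp at this; omega

theorem uniqueIn_reverse {s t : List α} (h : UniqueIn t s) (ht : t.Palindrome) :
    UniqueIn t s.reverse := by
  obtain ⟨⟨x, y⟩, h1, h2⟩ := h
  simp only at h1
  refine ⟨(y.reverse, x.reverse), ?_, ?_⟩
  · simp only [← h1, List.reverse_append, ht.reverse_eq, List.append_assoc]
  · rintro ⟨x', y'⟩ h3
    have h4 : (x' ++ t ++ y').reverse = s := by rw [h3, List.reverse_reverse]
    have := h2 (y'.reverse, x'.reverse) (by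
      simp only [← h4, List.reverse_append, ht.reverse_eq, List.append_assoc])
    simp only [Prod.mk.injEq] at this
    simp [← this.1, ← this.2]

variable [DecidableEq α]

open Classical in
/-- The number of surfaces of `s` that are occurrences of `v`, plus the number of nodes of the
eertree of `s` with suffix link `v`. -/
noncomputable def cnt (s : List α) (v : Node α) : ℕ :=
  ((surfs s).filter fun p => Node.pal (sub s p.1 p.2) = v).card +
    ((pals s).filter fun t => t ≠ [] ∧ Node.link (.pal t) = v).card

theorem mem_pals_of_surf {s : List α} {i j : ℕ} (h : Surf s i j) : sub s i j ∈ pals s :=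
  mem_pals.2 ⟨(palindrome_sub h.lt.le h.le).2 h.pal, sub_infix _ _ _⟩

/-- A palindrome `t` that is a proper suffix of a palindromic substring `w` of `s` is the suffix
link of a node of `s`. -/
theorem exists_link_eq {s t : List α} (ht : t.Palindrome) :
    ∀ {w : List α}, w ∈ pals s → t <:+ w → t ≠ w →
      ∃ w' ∈ pals s, w' ≠ [] ∧ Node.link (.pal w') = .pal t := by
  suffices H : ∀ (d : ℕ) (w : List α), w.length = d → w ∈ pals s → t <:+ w → t ≠ w →
      ∃ w' ∈ pals s, w' ≠ [] ∧ Node.link (.pal w') = .pal t from fun {w} => H _ w rfl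
  intro d
  induction d using Nat.strong_induction_on with
  | _ d ih =>
    rintro w rfl hw h hne
    have hw0 : w ≠ [] := by rintro rfl; exact hne (List.suffix_nil.1 h)
    have h1 : t <:+ w.tail := by
      refine List.suffix_of_suffix_length_le h (List.tail_suffix w) ?_
      have := h.length_le
      have : t.length ≠ w.length := fun e => hne (h.eq_of_length e)
      simp; omega
    have h2 := suffix_sufpal ht h1
    by_cases e : t = sufpal w.tail
    · exact ⟨w, hw, hw0, by rw [link_eq hw0, e]⟩
    · exact ih _ (length_sufpal_tail_lt hw0) _ rfl (infix_mem_pals (sufpal_palindrome _)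
        ((sufpal_suffix _).trans (List.tail_suffix w)).isInfix hw) h2 e

/-- A nonempty palindrome occurs in `s` if and only if one of its occurrences is a surface or it is
a suffix link: if an occurrence is not a surface, the palindrome is a proper prefix or suffix of
another one. -/
theorem cnt_pos_iff {s t : List α} (ht : t.Palindrome) (h0 : t ≠ []) :
    0 < cnt s (.pal t) ↔ t ∈ pals s := by
  classical
  constructor
  · intro h
    rcases Nat.add_pos_iff_pos_or_pos.1 h with h | h
    · obtain ⟨p, hp⟩ := Finset.card_pos.1 h
      obtain ⟨h1, h2⟩ := Finset.mem_filter.1 hp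
      injection h2 with h2
      exact h2 ▸ mem_pals_of_surf (mem_surfs.1 h1)
    · obtain ⟨w, hw⟩ := Finset.card_pos.1 h
      obtain ⟨h1, h2, h3⟩ := Finset.mem_filter.1 hw
      have := link_mem_nodes (pal_mem_nodes.2 h1)
      rw [h3] at this
      exact pal_mem_nodes.1 this
  · intro h
    obtain ⟨i, j, hij, hj, rfl⟩ := exists_sub_of_infix (mem_pals.1 h).2
    have hlt : i < j := by
      refine lt_of_le_of_ne hij ?_
      rintro rfl; simp [sub] at h0
    have link : ∀ w : List α, w ∈ pals s → sub s i j <:+ w → sub s i j ≠ w →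
        0 < cnt s (.pal (sub s i j)) := by
      intro w h1 h2 h3
      obtain ⟨w', h4, h5, h6⟩ := exists_link_eq ht h1 h2 h3
      exact Nat.add_pos_right _ (Finset.card_pos.2 ⟨w', Finset.mem_filter.2 ⟨h4, h5, h6⟩⟩)
    by_cases hs : Surf s i j
    · refine Nat.add_pos_left (Finset.card_pos.2 ⟨(i, j), ?_⟩) _
      exact Finset.mem_filter.2 ⟨mem_surfs.2 hs, rfl⟩
    · have hp := (palindrome_sub hij hj).1 ht
      by_cases h1 : ∃ j', j < j' ∧ j' ≤ s.length ∧ Pal s i j'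
      · obtain ⟨j', h2, h3, h4⟩ := h1
        have hw := (palindrome_sub (by omega) h3).2 h4
        refine link _ (mem_pals.2 ⟨hw, sub_infix s i j'⟩) ?_ ?_
        · rw [Palindrome.suffix_iff_prefix hw ht, show j = i + (j - i) by omega,
            ← take_sub (j := j') (by omega)]
          exact List.take_prefix _ _
        · intro e
          have := congrArg List.length e
          rw [length_sub hj, length_sub h3] at this
          omega
      · by_cases h2 : ∃ i', i' < i ∧ Pal s i' j
        · obtain ⟨i', h2, h3⟩ := h2
          refine link _ (mem_pals.2 ⟨(palindrome_sub (by omega) hj).2 h3, sub_infix s i' j⟩) ?_ ?_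
          · rw [show i = i' + (i - i') by omega, ← drop_sub]
            exact List.drop_suffix _ _
          · intro e
            have := congrArg List.length e
            rw [length_sub hj, length_sub hj] at this
            omega
        · push Not at h1 h2
          exact absurd ⟨hlt, hj, hp, h1, h2⟩ hs

theorem surfs_concat (s : List α) (c : α) :
    surfs (s ++ [c]) =
      insert ((s ++ [c]).length - (sufpal (s ++ [c])).length, (s ++ [c]).length)
        ((surfs s).filter fun p => p.1 ≠ (s ++ [c]).length - (sufpal (s ++ [c])).length) := by
  have hl : (s ++ [c]).length = s.length + 1 := by simp
  ext ⟨i, j⟩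
  simp only [Finset.mem_insert, Finset.mem_filter, mem_surfs, Prod.mk.injEq]
  by_cases hj : j ≤ s.length
  · rw [surf_concat_iff hj]
    constructor
    · exact Or.inr
    · rintro (⟨_, h⟩ | h)
      · omega
      · exact h
  · constructor
    · intro h
      have := h.le
      obtain rfl : j = (s ++ [c]).length := by omega
      exact Or.inl ⟨(surf_length_iff (by simp)).1 h, rfl⟩
    · rintro (⟨h1, h2⟩ | ⟨h1, _⟩)
      · subst h2; exact (surf_length_iff (by simp)).2 h1
      · exact absurd h1.le hj

open Classical in
/-- How the counters change when a letter is appended: the new longest palindromic suffix is a new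
surface and possibly a new node, and the surface that starts where it starts disappears. -/
theorem cnt_concat (s : List α) (c : α) {v : List α} (hv : sufpal (s ++ [c]) = v) {i : ℕ}
    (hi : i = (s ++ [c]).length - v.length) (y : Node α) :
    cnt (s ++ [c]) y + (if ∃ j, Surf s i j ∧ .pal (sub s i j) = y then 1 else 0) =
      cnt s y + (if y = .pal v then 1 else 0) +
        (if v ∉ pals s ∧ Node.link (.pal v) = y then 1 else 0) := by
  have hl : (s ++ [c]).length = s.length + 1 := by simp
  have h1 : ((pals (s ++ [c])).filter fun t => t ≠ [] ∧ Node.link (.pal t) = y).card =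
      ((pals s).filter fun t => t ≠ [] ∧ Node.link (.pal t) = y).card +
        (if v ∉ pals s ∧ Node.link (.pal v) = y then 1 else 0) := by
    have hv0 : v ≠ [] := hv ▸ sufpal_ne_nil (by simp)
    rw [pals_concat, hv]
    by_cases h : v ∈ pals s
    · rw [Finset.insert_eq_of_mem h]; simp [h]
    · rw [Finset.filter_insert]
      by_cases h' : Node.link (.pal v) = y
      · rw [if_pos ⟨hv0, h'⟩, Finset.card_insert_of_notMem (by simp [h]), if_pos ⟨h, h'⟩]
      · rw [if_neg (by tauto), if_neg (by tauto), Nat.add_zero]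
  have h2 : ((surfs (s ++ [c])).filter fun p => Node.pal (sub (s ++ [c]) p.1 p.2) = y).card =
      ((surfs s).filter fun p => p.1 ≠ i ∧ Node.pal (sub s p.1 p.2) = y).card +
        (if y = .pal v then 1 else 0) := by
    have e : ((surfs s).filter fun p => p.1 ≠ i ∧ Node.pal (sub (s ++ [c]) p.1 p.2) = y) =
        (surfs s).filter fun p => p.1 ≠ i ∧ Node.pal (sub s p.1 p.2) = y := by
      refine Finset.filter_congr fun p hp => ?_
      have := mem_surfs.1 hp
      rw [sub_append this.lt.le this.le]
    have e2 : sub (s ++ [c]) i (s ++ [c]).length = v := by rw [hi, ← hv, sub_sufpal]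
    rw [surfs_concat, hv, ← hi, Finset.filter_insert, Finset.filter_filter]
    simp only [e2]
    rw [e]
    by_cases h : Node.pal v = y
    · rw [if_pos h, if_pos h.symm, Finset.card_insert_of_notMem]
      simp
    · rw [if_neg h, if_neg (Ne.symm h), Nat.add_zero]
  have h3 : ((surfs s).filter fun p => Node.pal (sub s p.1 p.2) = y).card =
      ((surfs s).filter fun p => p.1 ≠ i ∧ Node.pal (sub s p.1 p.2) = y).card +
        (if ∃ j, Surf s i j ∧ .pal (sub s i j) = y then 1 else 0) := by
    rw [← Finset.card_filter_add_card_filter_not (s := (surfs s).filter _) (fun p => p.1 ≠ i),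
      Finset.filter_filter, Finset.filter_filter]
    congr 1
    · congr 1; ext p; simp only [Finset.mem_filter]; tauto
    · split_ifs with h
      · obtain ⟨j, hj, hy⟩ := h
        rw [Finset.card_eq_one]
        refine ⟨(i, j), ?_⟩
        ext ⟨i', j'⟩
        simp only [Finset.mem_filter, mem_surfs, Finset.mem_singleton, Prod.mk.injEq, not_not]
        constructor
        · rintro ⟨h1, h2, rfl⟩; exact ⟨rfl, h1.eq_right hj⟩
        · rintro ⟨rfl, rfl⟩; exact ⟨hj, hy, rfl⟩
      · rw [Finset.card_eq_zero, Finset.filter_eq_empty_iff]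
        rintro ⟨i', j'⟩ hp ⟨h1, h2⟩
        simp only [not_not] at h2
        subst h2
        exact h ⟨j', mem_surfs.1 hp, h1⟩
  simp only [cnt]
  omega

theorem cnt_reverse (s : List α) (v : Node α) : cnt s.reverse v = cnt s v := by
  classical
  simp only [cnt, pals_reverse]
  congr 1
  have key : ∀ (s : List α) (p : ℕ × ℕ),
      p ∈ (surfs s).filter (fun p => Node.pal (sub s p.1 p.2) = v) →
      (s.length - p.2, s.length - p.1) ∈
        (surfs s.reverse).filter (fun p => Node.pal (sub s.reverse p.1 p.2) = v) := by
    intro s p hp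
    obtain ⟨h1, h2⟩ := Finset.mem_filter.1 hp
    have h := mem_surfs.1 h1
    refine Finset.mem_filter.2 ⟨mem_surfs.2 h.reverse, ?_⟩
    rw [sub_reverse h.lt.le h.le, ((palindrome_sub h.lt.le h.le).2 h.pal).reverse_eq, h2]
  refine Finset.card_bij' (fun p _ => (s.length - p.2, s.length - p.1))
    (fun p _ => (s.length - p.2, s.length - p.1)) ?_ ?_ ?_ ?_
  · intro p hp
    have := key s.reverse p hp
    rwa [List.reverse_reverse, List.length_reverse] at this
  · intro p hp
    exact key s p hp
  · intro p hp
    have h := mem_surfs.1 (Finset.mem_filter.1 hp).1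
    have h1 := h.lt
    have h2 := h.le
    rw [List.length_reverse] at h2
    ext <;> simp only <;> omega
  · intro p hp
    have h := mem_surfs.1 (Finset.mem_filter.1 hp).1
    have h1 := h.lt
    have h2 := h.le
    ext <;> simp only <;> omega

/-- The longest palindromic suffix occurs only once if and only if removing the last letter
destroys it. -/
theorem uniqueIn_sufpal_iff (s : List α) (c : α) :
    UniqueIn (sufpal (s ++ [c])) (s ++ [c]) ↔ sufpal (s ++ [c]) ∉ pals s := by
  obtain ⟨x₀, hx₀⟩ := sufpal_suffix (s ++ [c])
  have hp := sufpal_palindrome (s ++ [c])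
  generalize sufpal (s ++ [c]) = v at *
  constructor
  · rintro ⟨p, _, hu⟩ h
    obtain ⟨x, y, e⟩ := (mem_pals.1 h).2
    have h1 := hu (x, y ++ [c]) (by simp [← e])
    have h2 := hu (x₀, []) (by simpa using hx₀)
    have h3 := congrArg Prod.snd (h1.trans h2.symm)
    simp at h3
  · intro h
    refine ⟨(x₀, []), by simpa using hx₀, ?_⟩
    rintro ⟨x, y⟩ hxy
    simp only at hxy
    rcases List.eq_nil_or_concat' y with rfl | ⟨y, d, rfl⟩
    · rw [List.append_nil, ← hx₀] at hxy
      rw [List.append_cancel_right hxy]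
    · refine absurd (mem_pals.2 ⟨hp, x, y, ?_⟩) h
      rw [← List.append_assoc] at hxy
      exact (List.append_inj' hxy rfl).1

theorem uniqueIn_sufpal {s : List α} (hs : s ≠ []) :
    UniqueIn (sufpal s) s ↔ cnt s (.pal (sufpal s)) = 1 := by
  classical
  obtain ⟨s, c, rfl⟩ := (List.eq_nil_or_concat' s).resolve_left hs
  rw [uniqueIn_sufpal_iff, ← cnt_pos_iff (sufpal_palindrome _) (sufpal_ne_nil hs)]
  have h := cnt_concat s c rfl rfl (.pal (sufpal (s ++ [c])))
  have hl : (s ++ [c]).length = s.length + 1 := by simp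
  have hv0 := sufpal_ne_nil hs
  rw [if_neg, if_pos rfl, if_neg] at h
  · omega
  · rintro ⟨_, h1⟩
    rw [link_eq hv0] at h1
    injection h1 with h1
    have := length_sufpal_tail_lt hv0
    rw [h1] at this
    exact lt_irrefl _ this
  · rintro ⟨j, h1, h2⟩
    injection h2 with h2
    have := congrArg List.length h2
    have := List.length_pos_iff.2 hv0
    have := h1.le
    have h3 := (sufpal_suffix (s ++ [c])).length_le
    rw [length_sub h1.le] at *
    omega

theorem uniqueIn_prepal {s : List α} (hs : s ≠ []) :
    UniqueIn (prepal s) s ↔ cnt s (.pal (prepal s)) = 1 := by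
  rw [prepal_eq_sufpal_reverse, ← cnt_reverse, ← uniqueIn_sufpal (by simpa using hs)]
  constructor
  · intro h; exact uniqueIn_reverse h (sufpal_palindrome _)
  · intro h
    have := uniqueIn_reverse h (sufpal_palindrome _)
    rwa [List.reverse_reverse] at this

end count

end Eer

/-! ### Search trees balanced by height -/

namespace Eer

/-- Search trees with values in the leaves; an inner node stores its height and a router, which
separates the keys on its left from the keys on its right. -/
inductive Tree (K : Type*) where
  | nil : Tree K
  | leaf (k : K) (v : ℕ) : Tree K
  | node (h : ℕ) (l : Tree K) (k : K) (r : Tree K) : Tree K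

namespace Tree

variable {K : Type*}

/-- The height, as stored in the root. -/
def height : Tree K → ℕ
  | nil => 0
  | leaf _ _ => 1
  | node h _ _ _ => h

theorem height_nil : (nil : Tree K).height = 0 := rfl

theorem height_leaf (k : K) (v : ℕ) : (leaf k v).height = 1 := rfl

theorem height_node (h : ℕ) (l : Tree K) (k : K) (r : Tree K) : (node h l k r).height = h := rfl

/-- A node with the correct height. -/
def mk (l : Tree K) (k : K) (r : Tree K) : Tree K := node (max l.height r.height + 1) l k r

/-- `mk` or its mirror image. -/
def mkDir (d : Bool) (a : Tree K) (k : K) (b : Tree K) : Tree K := if d then mk a k b else mk b k a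

/-- The left child (`true`) or the right child (`false`) of an inner node. -/
def child (d : Bool) : Tree K → Tree K
  | node _ l _ r => if d then l else r
  | t => t

/-- The single or double rotation that joins `a` and `b` when `a` is higher by 2; `a` is on the
left if `d = true` and on the right if `d = false`. -/
def rot (d : Bool) (a : Tree K) (k : K) (b : Tree K) : Tree K :=
  match a with
  | node h l k₁ r =>
    let o := (node h l k₁ r).child d
    let i := (node h l k₁ r).child !d
    if o.height < i.height then
      match i with
      | node h' l' k₂ r' =>
        mkDir d (mkDir d o k₁ ((node h' l' k₂ r').child d)) k₂
          (mkDir d ((node h' l' k₂ r').child !d) k b)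
      | _ => nil
    else mkDir d o k₁ (mkDir d i k b)
  | _ => nil

/-- The balanced tree with the keys of `l` and `r`, whose heights differ by at most 2. -/
def bal (l : Tree K) (k : K) (r : Tree K) : Tree K :=
  if l.height = 0 then r
  else if r.height = 0 then l
  else if r.height + 1 < l.height then rot true l k r
  else if l.height + 1 < r.height then rot false r k l
  else mk l k r

/-- The tree that maps `k` to `v`, where the value 0 means that the key is absent. -/
def single (k : K) (v : ℕ) : Tree K := if v = 0 then nil else leaf k v

variable [LinearOrder K]

/-- The value of a key; keys that are absent have the value 0. -/
def get : Tree K → K → ℕ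
  | nil, _ => 0
  | leaf k' v, k => if k = k' then v else 0
  | node _ l k' r, k => if k < k' then l.get k else r.get k

/-- The keys of the leaves; routers do not count. -/
def keys : Tree K → Finset K
  | nil => ∅
  | leaf k _ => {k}
  | node _ l _ r => l.keys ∪ r.keys

/-- The subtree of `t` on the side of `k` is replaced by `new`. -/
def graft (k : K) (t new : Tree K) : Tree K :=
  match t with
  | nil => new
  | leaf k' v => if k = k' then new else if k < k' then bal new k' (leaf k' v)
      else bal (leaf k' v) k new
  | node _ l k' r => if k < k' then bal new k' r else bal l k' new

/-- Set the value of `k` to `v`; this deletes the key if `v = 0`. -/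
def set : Tree K → K → ℕ → Tree K
  | nil, k, v => single k v
  | leaf k' v', k, v => graft k (leaf k' v') (single k v)
  | node h l k' r, k, v =>
    graft k (node h l k' r) (if k < k' then l.set k v else r.set k v)

/-- The inner nodes on the search path of `k`, the deepest one first. -/
def path : Tree K → K → List (Tree K)
  | node h l k' r, k => (if k < k' then l.path k else r.path k) ++ [node h l k' r]
  | _, _ => []

/-- The leaf (or the empty tree) at the end of the search path of `k`. -/
def bottom : Tree K → K → Tree K
  | node _ l k' r, k => if k < k' then l.bottom k else r.bottom k
  | t, _ => t

/-- The recursion as the two loops of a program: walk down to the bottom, then graft along the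
search path upwards. -/
theorem set_eq_foldl (t : Tree K) (k : K) (v : ℕ) :
    t.set k v = (t.path k).foldl (fun new f => graft k f new)
      (graft k (t.bottom k) (single k v)) := by
  induction t with
  | nil => rfl
  | leaf k' v' => rfl
  | node h l k' r ihl ihr =>
    simp only [set, path, bottom, List.foldl_append, List.foldl_cons, List.foldl_nil]
    split_ifs <;> simp [ihl, ihr]

/-- Nonempty balanced search trees with nonzero values. -/
def Good : Tree K → Prop
  | nil => False
  | leaf _ v => v ≠ 0
  | node h l k r => l.Good ∧ r.Good ∧ h = max l.height r.height + 1 ∧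
      l.height ≤ r.height + 1 ∧ r.height ≤ l.height + 1 ∧
      (∀ x ∈ l.keys, x < k) ∧ ∀ x ∈ r.keys, k ≤ x

theorem Good.height_pos {t : Tree K} (h : t.Good) : 0 < t.height := by
  cases t with
  | nil => exact h.elim
  | leaf k v => exact Nat.one_pos
  | node h' l k r => simp only [Good] at h; simp only [height_node]; omega

theorem Good.exists_mem {t : Tree K} (h : t.Good) : ∃ x, x ∈ t.keys := by
  induction t with
  | nil => exact h.elim
  | leaf k v => exact ⟨k, by simp [keys]⟩
  | node h' l k r ihl _ =>
    obtain ⟨x, hx⟩ := ihl h.1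
    exact ⟨x, by simp [keys, hx]⟩

theorem Good.get_ne_zero_iff {t : Tree K} (h : t.Good) (x : K) : t.get x ≠ 0 ↔ x ∈ t.keys := by
  induction t with
  | nil => exact h.elim
  | leaf k v => simp only [Good] at h; simp [get, keys, h]
  | node h' l k r ihl ihr =>
    obtain ⟨h1, h2, -, -, -, h3, h4⟩ := h
    simp only [get, keys, Finset.mem_union]
    split_ifs with hx
    · rw [ihl h1]
      exact ⟨Or.inl, fun h => h.resolve_right fun h' => absurd (h4 x h') (not_le.2 hx)⟩
    · rw [ihr h2]
      exact ⟨Or.inr, fun h => h.resolve_left fun h' => hx (h3 x h')⟩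

/-- The height of a balanced tree is at most logarithmic in the number of its keys. -/
theorem Good.two_pow_height_le {t : Tree K} (h : t.Good) : 2 ^ t.height ≤ 2 * t.keys.card ^ 2 := by
  induction t with
  | nil => exact h.elim
  | leaf k v => simp [height, keys]
  | node h' l k r ihl ihr =>
    obtain ⟨h1, h2, h3, h4, h5, h6, h7⟩ := h
    have hd : Disjoint l.keys r.keys := Finset.disjoint_left.2 fun x hx hx' =>
      absurd (h6 x hx) (not_lt.2 (h7 x hx'))
    have := h1.height_pos
    have := h2.height_pos
    simp only [height, keys, Finset.card_union_of_disjoint hd]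
    have e : 2 ^ h' = 4 * 2 ^ (h' - 2) := by
      rw [show h' = (h' - 2) + 2 by omega, pow_add]; simp; ring
    have e1 : 2 ^ (h' - 2) ≤ 2 * l.keys.card ^ 2 :=
      (Nat.pow_le_pow_right (by norm_num) (by omega)).trans (ihl h1)
    have e2 : 2 ^ (h' - 2) ≤ 2 * r.keys.card ^ 2 :=
      (Nat.pow_le_pow_right (by norm_num) (by omega)).trans (ihr h2)
    rw [e]
    rcases le_total l.keys.card r.keys.card with hle | hle <;> nlinarith

theorem Good.height_le {t : Tree K} (h : t.Good) {N : ℕ} (hN : t.keys.card ≤ N) :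
    t.height ≤ 2 * Nat.log 2 N + 2 := by
  have h1 := h.two_pow_height_le
  have h2 : N < 2 ^ (Nat.log 2 N + 1) := Nat.lt_pow_succ_log_self (by norm_num) N
  have h3 : 2 ^ t.height < 2 ^ (2 * Nat.log 2 N + 3) := by
    calc 2 ^ t.height ≤ 2 * t.keys.card ^ 2 := h1
      _ < 2 * (2 ^ (Nat.log 2 N + 1)) ^ 2 := by
        have := Nat.pow_lt_pow_left (lt_of_le_of_lt hN h2) (two_ne_zero)
        omega
      _ = 2 ^ (2 * Nat.log 2 N + 3) := by ring
  have := (Nat.pow_lt_pow_iff_right (by norm_num)).1 h3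
  omega

/-- A tree is either empty or good. -/
def Ok (t : Tree K) : Prop := t = nil ∨ t.Good

theorem Ok.good {t : Tree K} (h : t.Ok) (h0 : t.height ≠ 0) : t.Good := by
  rcases h with rfl | h
  · exact absurd rfl h0
  · exact h

theorem Ok.eq_nil {t : Tree K} (h : t.Ok) (h0 : t.height = 0) : t = nil := by
  rcases h with h | h
  · exact h
  · exact absurd h0 h.height_pos.ne'

theorem Ok.get_ne_zero_iff {t : Tree K} (h : t.Ok) (x : K) : t.get x ≠ 0 ↔ x ∈ t.keys := by
  rcases h with rfl | h
  · simp [get, keys]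
  · exact h.get_ne_zero_iff x

/-- What joining `l` and `r` at the router `k` has to achieve. -/
structure Joins (l : Tree K) (k : K) (r t : Tree K) : Prop where
  good : t.Good
  keys : t.keys = l.keys ∪ r.keys
  get : ∀ x, t.get x = if x < k then l.get x else r.get x
  le_height : max l.height r.height ≤ t.height
  height_le : t.height ≤ max l.height r.height + 1

theorem joins_mk {l r : Tree K} {k : K} (hl : l.Good) (hr : r.Good)
    (h1 : l.height ≤ r.height + 1) (h2 : r.height ≤ l.height + 1)
    (h3 : ∀ x ∈ l.keys, x < k) (h4 : ∀ x ∈ r.keys, k ≤ x) : Joins l k r (mk l k r) :=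
  ⟨⟨hl, hr, rfl, h1, h2, h3, h4⟩, rfl, fun _ => rfl, Nat.le_succ _, le_rfl⟩

theorem joins_rot_true {l r : Tree K} {k : K} (hl : l.Good) (hr : r.Good)
    (h1 : l.height = r.height + 2)
    (h3 : ∀ x ∈ l.keys, x < k) (h4 : ∀ x ∈ r.keys, k ≤ x) : Joins l k r (rot true l k r) := by
  have hr0 := hr.height_pos
  cases l with
  | nil => exact hl.elim
  | leaf _ _ => simp [height] at h1
  | node h a k₁ b =>
    obtain ⟨ha, hb, e, h5, h6, h7, h8⟩ := hl
    simp only [height_node] at h1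
    simp only [keys, Finset.mem_union] at h3
    obtain ⟨y, hy⟩ := hb.exists_mem
    have hk : k₁ < k := lt_of_le_of_lt (h8 y hy) (h3 y (Or.inr hy))
    simp only [rot, child, mkDir, Bool.not_true, if_true, Bool.false_eq_true, if_false]
    split_ifs with hc
    · cases b with
      | nil => exact hb.elim
      | leaf _ _ => have := ha.height_pos; simp [height] at *; omega
      | node h' c k₂ d =>
        obtain ⟨hc', hd, e', h9, h10, h11, h12⟩ := hb
        simp only [keys, Finset.mem_union] at h8 h3
        obtain ⟨z, hz⟩ := hc'.exists_mem
        obtain ⟨z', hz'⟩ := hd.exists_mem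
        have hk1 : k₁ < k₂ := lt_of_le_of_lt (h8 z (Or.inl hz)) (h11 z hz)
        have hk2 : k₂ < k := lt_of_le_of_lt (h12 z' hz') (h3 z' (by tauto))
        simp only [height_node] at *
        have j1 := joins_mk ha hc' (k := k₁) (by omega) (by omega) h7 fun x hx => h8 x (Or.inl hx)
        have j2 := joins_mk hd hr (k := k) (by omega) (by omega) (fun x hx => h3 x (by tauto)) h4
        have j3 := joins_mk j1.good j2.good (k := k₂) (by simp only [mk, height_node]; omega)
          (by simp only [mk, height_node]; omega) (by
            intro x hx
            rw [j1.keys, Finset.mem_union] at hx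
            exact hx.elim (fun hx => (h7 x hx).trans hk1) (h11 x)) (by
            intro x hx
            rw [j2.keys, Finset.mem_union] at hx
            exact hx.elim (h12 x) fun hx => hk2.le.trans (h4 x hx))
        refine ⟨j3.good, ?_, fun x => ?_, ?_, ?_⟩
        · rw [j3.keys, j1.keys, j2.keys]; simp only [keys, Finset.union_assoc]
        · rw [j3.get, j1.get, j2.get]; simp only [get]
          split_ifs <;> first | rfl | (exfalso; order)
        · simp only [mk, height_node]; omega
        · simp only [mk, height_node]; omega
    · have j2 := joins_mk hb hr (k := k) (by omega) (by omega) (fun x hx => h3 x (by tauto)) h4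
      have j3 := joins_mk ha j2.good (k := k₁) (by simp only [mk, height_node]; omega)
        (by simp only [mk, height_node]; omega) h7 (by
          intro x hx
          rw [j2.keys, Finset.mem_union] at hx
          exact hx.elim (h8 x) fun hx => hk.le.trans (h4 x hx))
      refine ⟨j3.good, ?_, fun x => ?_, ?_, ?_⟩
      · rw [j3.keys, j2.keys]; simp only [keys, Finset.union_assoc]
      · rw [j3.get, j2.get]; simp only [get]
        split_ifs <;> first | rfl | (exfalso; order)
      · simp only [mk, height_node]; omega
      · simp only [mk, height_node]; omega

theorem joins_rot_false {l r : Tree K} {k : K} (hl : l.Good) (hr : r.Good)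
    (h1 : r.height = l.height + 2)
    (h3 : ∀ x ∈ l.keys, x < k) (h4 : ∀ x ∈ r.keys, k ≤ x) : Joins l k r (rot false r k l) := by
  have hl0 := hl.height_pos
  cases r with
  | nil => exact hr.elim
  | leaf _ _ => simp [height] at h1
  | node h a k₁ b =>
    obtain ⟨ha, hb, e, h5, h6, h7, h8⟩ := hr
    simp only [height_node] at h1
    simp only [keys, Finset.mem_union] at h4
    obtain ⟨y, hy⟩ := ha.exists_mem
    have hk : k < k₁ := lt_of_le_of_lt (h4 y (Or.inl hy)) (h7 y hy)
    simp only [rot, child, mkDir, Bool.not_false, if_true, Bool.false_eq_true, if_false]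
    split_ifs with hc
    · cases a with
      | nil => exact ha.elim
      | leaf _ _ => have := hb.height_pos; simp [height] at *; omega
      | node h' c k₂ d =>
        obtain ⟨hc', hd, e', h9, h10, h11, h12⟩ := ha
        simp only [keys, Finset.mem_union] at h7 h4
        obtain ⟨z, hz⟩ := hc'.exists_mem
        obtain ⟨z', hz'⟩ := hd.exists_mem
        have hk1 : k < k₂ := lt_of_le_of_lt (h4 z (by tauto)) (h11 z hz)
        have hk2 : k₂ < k₁ := lt_of_le_of_lt (h12 z' hz') (h7 z' (by tauto))
        simp only [height_node] at *
        have j1 := joins_mk hl hc' (k := k) (by omega) (by omega) h3 fun x hx => h4 x (by tauto)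
        have j2 := joins_mk hd hb (k := k₁) (by omega) (by omega) (fun x hx => h7 x (by tauto)) h8
        have j3 := joins_mk j1.good j2.good (k := k₂) (by simp only [mk, height_node]; omega)
          (by simp only [mk, height_node]; omega) (by
            intro x hx
            rw [j1.keys, Finset.mem_union] at hx
            exact hx.elim (fun hx => (h3 x hx).trans hk1) (h11 x)) (by
            intro x hx
            rw [j2.keys, Finset.mem_union] at hx
            exact hx.elim (h12 x) fun hx => hk2.le.trans (h8 x hx))
        refine ⟨j3.good, ?_, fun x => ?_, ?_, ?_⟩
        · rw [j3.keys, j1.keys, j2.keys]; simp only [keys, Finset.union_assoc]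
        · rw [j3.get, j1.get, j2.get]; simp only [get]
          split_ifs <;> first | rfl | (exfalso; order)
        · simp only [mk, height_node]; omega
        · simp only [mk, height_node]; omega
    · have j2 := joins_mk hl ha (k := k) (by omega) (by omega) h3 (fun x hx => h4 x (by tauto))
      have j3 := joins_mk j2.good hb (k := k₁) (by simp only [mk, height_node]; omega)
        (by simp only [mk, height_node]; omega) (by
          intro x hx
          rw [j2.keys, Finset.mem_union] at hx
          exact hx.elim (fun hx => (h3 x hx).trans hk) (h7 x)) h8
      refine ⟨j3.good, ?_, fun x => ?_, ?_, ?_⟩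
      · rw [j3.keys, j2.keys]; simp only [keys, Finset.union_assoc]
      · rw [j3.get, j2.get]; simp only [get]
        split_ifs <;> first | rfl | (exfalso; order)
      · simp only [mk, height_node]; omega
      · simp only [mk, height_node]; omega

/-- What replacing the subtree `old` by `new` has to achieve when the value of `k` is set to `v`. -/
structure Sets (old : Tree K) (k : K) (v : ℕ) (new : Tree K) : Prop where
  ok : new.Ok
  keys : ∀ x ∈ new.keys, x = k ∨ x ∈ old.keys
  get : ∀ x, new.get x = if x = k then v else old.get x
  height_le : new.height ≤ old.height + 1
  le_height : old.height ≤ new.height + 1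

/-- The properties of `bal` for trees that are not both empty. -/
theorem joins_bal {l r : Tree K} {k : K} (hl : l.Ok) (hr : r.Ok) (h0 : l.Good ∨ r.Good)
    (h1 : l.height ≤ r.height + 2) (h2 : r.height ≤ l.height + 2)
    (h3 : ∀ x ∈ l.keys, x < k) (h4 : ∀ x ∈ r.keys, k ≤ x) :
    Joins l k r (bal l k r) ∧ (l.height ≠ 0 → r.height ≠ 0 → l.height ≤ r.height + 1 →
      r.height ≤ l.height + 1 → (bal l k r).height = max l.height r.height + 1) ∧
      (l.height = 0 ∨ r.height = 0 → (bal l k r).height = max l.height r.height) := by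
  unfold bal
  split_ifs with c1 c2 c3 c4
  · have hrg : r.Good := h0.resolve_left fun h => h.height_pos.ne' c1
    obtain rfl := hl.eq_nil c1
    refine ⟨⟨hrg, by simp [keys], fun x => ?_, by simp [height], by simp [height]⟩,
      fun h => absurd c1 h, by simp [height]⟩
    split_ifs with hx
    · by_contra h
      exact absurd (h4 x ((hrg.get_ne_zero_iff x).1 h)) (not_le.2 hx)
    · rfl
  · have hlg := hl.good c1
    obtain rfl := hr.eq_nil c2
    refine ⟨⟨hlg, by simp [keys], fun x => ?_, by simp [height], by simp [height]⟩,
      fun _ h => absurd c2 h, by simp [height]⟩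
    split_ifs with hx
    · rfl
    · by_contra h
      exact hx (h3 x ((hlg.get_ne_zero_iff x).1 h))
  · exact ⟨joins_rot_true (hl.good c1) (hr.good c2) (by omega) h3 h4, by omega, by omega⟩
  · exact ⟨joins_rot_false (hl.good c1) (hr.good c2) (by omega) h3 h4, by omega, by omega⟩
  · exact ⟨joins_mk (hl.good c1) (hr.good c2) (by omega) (by omega) h3 h4,
      fun _ _ _ _ => rfl, by omega⟩

theorem sets_single (k : K) (v : ℕ) : Sets nil k v (single k v) := by
  unfold single
  split_ifs with h
  · exact ⟨Or.inl rfl, by simp [keys], fun x => by simp [get, h], by simp [height],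
      by simp [height]⟩
  · exact ⟨Or.inr h, by simp [keys], fun x => by simp [get], by simp [height],
      by simp [height]⟩

theorem sets_graft_leaf {k k' : K} {v v' : ℕ} (hv' : v' ≠ 0) :
    Sets (leaf k' v') k v (graft k (leaf k' v') (single k v)) := by
  have hs := sets_single k v
  have hg : (leaf k' v').Good := hv'
  have hh := hs.height_le
  simp only [height_nil] at hh
  simp only [graft]
  split_ifs with c1 c2
  · subst c1
    refine ⟨hs.ok, fun x hx => (hs.keys x hx).imp_right fun h => by simp [keys] at h,
      fun x => ?_,
      by simp only [height_leaf]; omega,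
      by simp only [height_leaf]; omega⟩
    rw [hs.get]; simp only [get]; split_ifs <;> rfl
  · have hk : ∀ x ∈ (single k v).keys, x = k := fun x hx =>
      (hs.keys x hx).resolve_right (by simp [keys])
    obtain ⟨j, -, j'⟩ := joins_bal hs.ok (Or.inr hg) (Or.inr hg) (k := k')
      (by simp only [height_leaf]; omega)
      (by simp only [height_leaf]; omega)
      (fun x hx => by rw [hk x hx]; exact c2) (fun x hx => by simp [keys] at hx; rw [hx])
    have := j.le_height
    have := j.height_le
    simp only [height_leaf] at *
    refine ⟨Or.inr j.good, fun x hx => ?_, fun x => ?_,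
      by simp only [height_leaf]; omega,
      by simp only [height_leaf]; omega⟩
    · rw [j.keys, Finset.mem_union] at hx
      exact hx.imp_left (hk x)
    · rw [j.get, hs.get]; simp only [get]
      split_ifs <;> first | rfl | (exfalso; order)
  · have hk : ∀ x ∈ (single k v).keys, x = k := fun x hx =>
      (hs.keys x hx).resolve_right (by simp [keys])
    obtain ⟨j, -, j'⟩ := joins_bal (Or.inr hg) hs.ok (Or.inl hg) (k := k)
      (by simp only [height_leaf]; omega)
      (by simp only [height_leaf]; omega)
      (fun x hx => by simp [keys] at hx; rw [hx]; order) (fun x hx => by rw [hk x hx])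
    have := j.le_height
    have := j.height_le
    simp only [height_leaf] at *
    refine ⟨Or.inr j.good, fun x hx => ?_, fun x => ?_,
      by simp only [height_leaf]; omega,
      by simp only [height_leaf]; omega⟩
    · rw [j.keys, Finset.mem_union] at hx
      exact hx.symm.imp_left (hk x)
    · rw [j.get, hs.get]; simp only [get]
      split_ifs <;> first | rfl | (exfalso; order)

/-- `Tree.set` preserves balance and changes the value of one key only. A change of a subtree
changes its height by at most 1, so that one application of `bal` at each node of the search path
restores the balance. -/
theorem sets_set {t : Tree K} (ht : t.Ok) (k : K) (v : ℕ) : Sets t k v (t.set k v) := by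
  rcases ht with rfl | ht
  · exact sets_single k v
  induction t with
  | nil => exact ht.elim
  | leaf k' v' => exact sets_graft_leaf ht
  | node h l k' r ihl ihr =>
    obtain ⟨hl, hr, e, h1, h2, h3, h4⟩ := ht
    simp only [set, graft]
    have := hl.height_pos
    have := hr.height_pos
    split_ifs with c
    · have hs := ihl hl
      have := hs.height_le
      have := hs.le_height
      obtain ⟨j, j', j''⟩ := joins_bal hs.ok (Or.inr hr) (Or.inr hr) (k := k')
        (by omega) (by omega)
        (fun x hx => (hs.keys x hx).elim (fun e => e ▸ c) (h3 x)) h4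
      have := j.le_height
      have := j.height_le
      refine ⟨Or.inr j.good, fun x hx => ?_, fun x => ?_,
        by simp only [height_node]; omega,
        by simp only [height_node]; omega⟩
      · rw [j.keys, Finset.mem_union] at hx
        simp only [keys, Finset.mem_union]
        rcases hx with hx | hx
        · exact (hs.keys x hx).imp_right Or.inl
        · exact Or.inr (Or.inr hx)
      · rw [j.get, hs.get]; simp only [get]
        split_ifs <;> first | rfl | (exfalso; order)
    · have hs := ihr hr
      have := hs.height_le
      have := hs.le_height
      obtain ⟨j, j', j''⟩ := joins_bal (Or.inr hl) hs.ok (Or.inl hl) (k := k')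
        (by omega) (by omega) h3
        (fun x hx => (hs.keys x hx).elim (fun e => by rw [e]; order) (h4 x))
      have := j.le_height
      have := j.height_le
      refine ⟨Or.inr j.good, fun x hx => ?_, fun x => ?_,
        by simp only [height_node]; omega,
        by simp only [height_node]; omega⟩
      · rw [j.keys, Finset.mem_union] at hx
        simp only [keys, Finset.mem_union]
        rcases hx with hx | hx
        · exact Or.inr (Or.inl hx)
        · exact (hs.keys x hx).imp_right Or.inr
      · rw [j.get, hs.get]; simp only [get]
        split_ifs <;> first | rfl | (exfalso; order)

end Tree

end Eer

/-! ### Reasoning about programs -/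

namespace WordRAM

/-- The program `p`, started in `st`, halts, and its running time and its final state satisfy
`Q`. -/
def Runs (w : ℕ) (p : Prog) (st : State) (Q : ℕ → State → Prop) : Prop :=
  ∃ t st', Exec w p st t st' ∧ Q t st'

variable {w : ℕ} {p q : Prog} {st : State} {Q R : ℕ → State → Prop}

theorem Runs.mono (h : Runs w p st Q) (hQ : ∀ t st', Q t st' → R t st') : Runs w p st R := by
  obtain ⟨t, st', h1, h2⟩ := h
  exact ⟨t, st', h1, hQ _ _ h2⟩

theorem Runs.seq (h : Runs w p st fun t st' => Runs w q st' fun u st'' => Q (t + u) st'') :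
    Runs w (.seq p q) st Q := by
  obtain ⟨t, st', h1, u, st'', h2, h3⟩ := h
  exact ⟨_, _, .seq h1 h2, h3⟩

theorem Runs.ite {b : Test} (h1 : b.Holds st → Runs w p st fun t st' => Q (1 + t) st')
    (h2 : ¬ b.Holds st → Runs w q st fun t st' => Q (1 + t) st') : Runs w (.ite b p q) st Q := by
  by_cases h : b.Holds st
  · obtain ⟨t, st', h3, h4⟩ := h1 h
    exact ⟨_, _, .ite_true h h3, h4⟩
  · obtain ⟨t, st', h3, h4⟩ := h2 h
    exact ⟨_, _, .ite_false h h3, h4⟩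

theorem Runs.loop_done {b : Test} (h : ¬ b.Holds st) (hQ : Q 1 st) : Runs w (.loop b p) st Q :=
  ⟨_, _, .loop_false h, hQ⟩

theorem Runs.loop_step {b : Test} (h : b.Holds st)
    (hp : Runs w p st fun t st' => Runs w (.loop b p) st' fun u st'' => Q (1 + t + u) st'') :
    Runs w (.loop b p) st Q := by
  obtain ⟨t, st', h1, u, st'', h2, h3⟩ := hp
  exact ⟨_, _, .loop_true h h1 h2, h3⟩

/-- The programs in the list are executed one after the other. -/
def seqs : List Prog → Prog
  | [] => .skip
  | [p] => p
  | p :: ps => .seq p (seqs ps)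

/-- Programs without loops. -/
def Prog.Straight : Prog → Prop
  | .seq p q => p.Straight ∧ q.Straight
  | .ite _ p q => p.Straight ∧ q.Straight
  | .loop _ _ => False
  | _ => True

open Classical in
/-- The final state of a program without loops. -/
noncomputable def Prog.eval (w : ℕ) : Prog → State → State
  | .skip, st => st
  | .const r k, st => st.set r (k % 2 ^ w)
  | .move r a, st => st.set r (st.reg a)
  | .add r a b, st => st.set r ((st.reg a + st.reg b) % 2 ^ w)
  | .sub r a b, st => st.set r ((st.reg a + 2 ^ w - st.reg b) % 2 ^ w)
  | .load r a, st => (st.touch (st.reg a)).set r (st.mem (st.reg a))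
  | .store a b, st => st.write (st.reg a) (st.reg b)
  | .seq p q, st => q.eval w (p.eval w st)
  | .ite b p q, st => if b.Holds st then p.eval w st else q.eval w st
  | .loop _ _, st => st

/-- A bound for the running time of a program without loops. -/
def Prog.cost : Prog → ℕ
  | .seq p q => p.cost + q.cost
  | .ite _ p q => 1 + max p.cost q.cost
  | _ => 1

theorem Runs.straight {c : ℕ} (hp : p.Straight) (hc : p.cost ≤ c)
    (h : ∀ t ≤ c, Q t (p.eval w st)) : Runs w p st Q := by
  suffices H : ∃ t ≤ p.cost, Exec w p st t (p.eval w st) by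
    obtain ⟨t, ht, h'⟩ := H
    exact ⟨t, _, h', h t (ht.trans hc)⟩
  clear h hc
  induction p generalizing st with
  | skip => exact ⟨_, le_rfl, .skip _⟩
  | const r k => exact ⟨_, le_rfl, .const ..⟩
  | move r a => exact ⟨_, le_rfl, .move ..⟩
  | add r a b => exact ⟨_, le_rfl, .add ..⟩
  | sub r a b => exact ⟨_, le_rfl, .sub ..⟩
  | load r a => exact ⟨_, le_rfl, .load ..⟩
  | store a b => exact ⟨_, le_rfl, .store ..⟩
  | seq p q ihp ihq =>
    obtain ⟨t, h1, h2⟩ := ihp hp.1 (st := st)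
    obtain ⟨u, h3, h4⟩ := ihq hp.2 (st := p.eval w st)
    exact ⟨_, Nat.add_le_add h1 h3, .seq h2 h4⟩
  | ite b p q ihp ihq =>
    by_cases hb : b.Holds st
    · obtain ⟨t, h1, h2⟩ := ihp hp.1 (st := st)
      refine ⟨1 + t, by simp only [Prog.cost]; omega, ?_⟩
      simp only [Prog.eval, if_pos hb]
      exact .ite_true hb h2
    · obtain ⟨t, h1, h2⟩ := ihq hp.2 (st := st)
      refine ⟨1 + t, by simp only [Prog.cost]; omega, ?_⟩
      simp only [Prog.eval, if_neg hb]
      exact .ite_false hb h2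
  | loop b p => exact hp.elim

theorem set_reg (st : State) (r x r' : ℕ) :
    (st.set r x).reg r' = if r' = r then x else st.reg r' := by
  simp [State.set, Function.update_apply]

theorem set_mem (st : State) (r x : ℕ) : (st.set r x).mem = st.mem := rfl

theorem set_space (st : State) (r x : ℕ) : (st.set r x).space = st.space := rfl

theorem touch_reg (st : State) (a : ℕ) : (st.touch a).reg = st.reg := rfl

theorem touch_mem (st : State) (a : ℕ) : (st.touch a).mem = st.mem := rfl

theorem touch_space (st : State) (a : ℕ) : (st.touch a).space = max st.space (a + 1) := rfl

theorem write_reg (st : State) (a x : ℕ) : (st.write a x).reg = st.reg := rfl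

theorem write_mem (st : State) (a x b : ℕ) :
    (st.write a x).mem b = if b = a then x else st.mem b := by
  simp [State.write, State.touch, Function.update_apply]

theorem write_space (st : State) (a x : ℕ) : (st.write a x).space = max st.space (a + 1) := rfl

/-- The heap is the part of the memory below the free pointer in register 3. It is never
overwritten: from `st` to `st'` it has only been extended, and only the heap has been accessed. -/
structure Ext (st st' : State) : Prop where
  fp : st.reg 3 ≤ st'.reg 3
  mem : ∀ a < st.reg 3, st'.mem a = st.mem a
  space : st'.space ≤ max st.space (st'.reg 3)

theorem Ext.refl (st : State) : Ext st st := ⟨le_rfl, fun _ _ => rfl, le_max_left _ _⟩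

theorem Ext.trans {st₁ st₂ st₃ : State} (h : Ext st₁ st₂) (h' : Ext st₂ st₃) : Ext st₁ st₃ :=
  ⟨h.fp.trans h'.fp, fun a ha => (h'.mem a (ha.trans_le h.fp)).trans (h.mem a ha), by
    have := h.space
    have := h'.space
    have := h'.fp
    omega⟩

/-! Programs that load and store records. Register 3 holds the first free address, register 20 the
number 1, and register 44 is used for addresses. -/

/-- Load consecutive cells, from the address in register 44 on, into the given registers. -/
def loadLoop : List ℕ → Prog
  | [] => .skip
  | o :: os => .seq (.load o 44) (.seq (.add 44 44 20) (loadLoop os))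

/-- Load the consecutive fields of the record with address `a` into the registers `os`. -/
def loads (a : ℕ) (os : List ℕ) : Prog := .seq (.move 44 a) (loadLoop os)

/-- The registers after the contents of the cells from `a` on have been loaded into `os`. -/
def assign (M : ℕ → ℕ) : ℕ → List ℕ → (ℕ → ℕ) → ℕ → ℕ
  | _, [], f => f
  | a, o :: os, f => assign M (a + 1) os (Function.update f o (M a))

theorem assign_congr {M : ℕ → ℕ} {x : ℕ} {f g : ℕ → ℕ} (h : f x = g x) (a : ℕ) (os : List ℕ) :
    assign M a os f x = assign M a os g x := by
  induction os generalizing a f g with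
  | nil => exact h
  | cons o os ih => exact ih (by simp [Function.update_apply, h]) _

theorem runs_loadLoop {os : List ℕ} (h20 : st.reg 20 = 1) (ho : ∀ o ∈ os, o ≠ 20 ∧ o ≠ 44)
    (hw : st.reg 44 + os.length < 2 ^ w) :
    Runs w (loadLoop os) st fun t st' => t ≤ 2 * os.length + 1 ∧ st'.mem = st.mem ∧
      st'.space ≤ max st.space (st.reg 44 + os.length) ∧
      ∀ x ≠ 44, st'.reg x = assign st.mem (st.reg 44) os st.reg x := by
  induction os generalizing st with
  | nil => exact ⟨_, _, .skip _, by simp, rfl, le_max_left _ _, fun _ _ => rfl⟩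
  | cons o os ih =>
    obtain ⟨h1, h2⟩ := ho o (by simp)
    simp only [List.length_cons] at hw
    refine Runs.seq ⟨_, _, .load .., Runs.seq ⟨_, _, .add .., ?_⟩⟩
    have e : (((st.touch (st.reg 44)).set o (st.mem (st.reg 44))).reg 44 +
        ((st.touch (st.reg 44)).set o (st.mem (st.reg 44))).reg 20) % 2 ^ w = st.reg 44 + 1 := by
      rw [set_reg, set_reg, if_neg h2.symm, if_neg h1.symm, touch_reg, h20]
      exact Nat.mod_eq_of_lt (by omega)
    rw [e]
    refine (ih ?_ (fun o' ho' => ho o' (by simp [ho'])) ?_).mono ?_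
    · simp [set_reg, touch_reg, h1.symm, h20]
    · simp only [set_reg, if_true]; omega
    · rintro t st' ⟨h3, h4, h5, h6⟩
      refine ⟨by simp only [List.length_cons]; omega, by rw [h4]; rfl, ?_, fun x hx => ?_⟩
      · simp only [set_reg, set_space, touch_space, if_true, List.length_cons] at h5 ⊢; omega
      · rw [h6 x hx]
        simp only [set_reg, if_true, assign]
        refine assign_congr ?_ _ _
        simp [set_reg, hx, touch_reg, Function.update_apply]

theorem runs_loads {a : ℕ} {os : List ℕ} (h20 : st.reg 20 = 1)
    (hw : st.reg a + os.length ≤ st.reg 3) (hf : st.reg 3 < 2 ^ w)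
    (ho : ∀ o ∈ os, o ≠ 20 ∧ o ≠ 44) :
    Runs w (loads a os) st fun t st' => t ≤ 2 * os.length + 2 ∧ st'.mem = st.mem ∧
      st'.space ≤ max st.space (st.reg 3) ∧
      ∀ x ≠ 44, st'.reg x = assign st.mem (st.reg a) os st.reg x := by
  refine Runs.seq ⟨_, _, .move .., ?_⟩
  refine (runs_loadLoop (by simp [set_reg, h20]) ho (by simp [set_reg]; omega)).mono ?_
  rintro t st' ⟨h3, h4, h5, h6⟩
  simp only [set_reg, set_mem, set_space, if_true] at *
  refine ⟨by omega, h4, by omega, fun x hx => ?_⟩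
  rw [h6 x hx]
  exact assign_congr (by simp [set_reg, hx]) _ _

/-- Store the given registers in consecutive cells, from the address in register 44 on. -/
def storeLoop : List ℕ → Prog
  | [] => .skip
  | r :: rs => .seq (.store 44 r) (.seq (.add 44 44 20) (storeLoop rs))

/-- Allocate a new record, store the registers `rs` in it, and set `out` to its address. -/
def alloc (out : ℕ) (rs : List ℕ) : Prog :=
  .seq (.move 44 3) (.seq (storeLoop rs) (.seq (.move out 3) (.move 3 44)))

theorem runs_storeLoop {rs : List ℕ} (h20 : st.reg 20 = 1) (hr : ∀ r ∈ rs, r ≠ 44)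
    (hw : st.reg 44 + rs.length < 2 ^ w) :
    Runs w (storeLoop rs) st fun t st' => t ≤ 2 * rs.length + 1 ∧
      st'.reg 44 = st.reg 44 + rs.length ∧ (∀ x ≠ 44, st'.reg x = st.reg x) ∧
      (∀ a < st.reg 44, st'.mem a = st.mem a) ∧
      (∀ (i : ℕ) (h : i < rs.length), st'.mem (st.reg 44 + i) = st.reg rs[i]) ∧
      st'.space ≤ max st.space (st.reg 44 + rs.length) ∧
      st.space ≤ st'.space ∧ (rs ≠ [] → st.reg 44 + rs.length ≤ st'.space) := by
  induction rs generalizing st with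
  | nil =>
    exact ⟨_, _, .skip _, by simp, rfl, fun _ _ => rfl, fun _ _ => rfl, by simp, le_max_left _ _,
      le_rfl, by simp⟩
  | cons r rs ih =>
    simp only [List.length_cons] at hw
    refine Runs.seq ⟨_, _, .store .., Runs.seq ⟨_, _, .add .., ?_⟩⟩
    have e : ((st.write (st.reg 44) (st.reg r)).reg 44 +
        (st.write (st.reg 44) (st.reg r)).reg 20) % 2 ^ w = st.reg 44 + 1 := by
      rw [write_reg, h20]
      exact Nat.mod_eq_of_lt (by omega)
    rw [e]
    refine (ih ?_ (fun o' ho' => hr o' (by simp [ho'])) ?_).mono ?_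
    · simp [set_reg, write_reg, h20]
    · simp only [set_reg, if_true]; omega
    · rintro t st' ⟨h3, h4, h5, h6, h7, h8, h9, h10⟩
      simp only [set_reg, set_mem, set_space, if_true, List.length_cons, write_space] at *
      refine ⟨by omega, by omega, fun x hx => ?_, fun a ha => ?_, fun i hi => ?_, by omega,
        by omega, fun _ => ?_⟩
      · rw [h5 x hx, if_neg hx, write_reg]
      · rw [h6 a (by omega), write_mem, if_neg (by omega)]
      · cases i with
        | zero =>
          rw [Nat.add_zero, h6 _ (by omega), write_mem, if_pos rfl]; rfl
        | succ i =>
          rw [show st.reg 44 + (i + 1) = st.reg 44 + 1 + i by omega, h7 i (by omega),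
            if_neg (hr _ (List.mem_cons_of_mem _ (List.getElem_mem _))), write_reg]
          rfl
      · cases rs with
        | nil => simp; omega
        | cons r' rs => have := h10 (by simp); simp only [List.length_cons] at *; omega

theorem runs_alloc {out : ℕ} {rs : List ℕ} (h20 : st.reg 20 = 1)
    (hw : st.reg 3 + rs.length < 2 ^ w) (hr : ∀ r ∈ rs, r ≠ 44) (ho : out ≠ 3 ∧ out ≠ 44) :
    Runs w (alloc out rs) st fun t st' => t ≤ 2 * rs.length + 4 ∧ Ext st st' ∧
      st'.reg 3 = st.reg 3 + rs.length ∧ st'.reg out = st.reg 3 ∧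
      (∀ x, x ≠ 3 → x ≠ 44 → x ≠ out → st'.reg x = st.reg x) ∧
      (∀ (i : ℕ) (h : i < rs.length), st'.mem (st.reg 3 + i) = st.reg rs[i]) ∧
      (rs ≠ [] → st'.reg 3 ≤ st'.space) := by
  refine Runs.seq ⟨_, _, .move .., Runs.seq ?_⟩
  refine (runs_storeLoop (by simp [set_reg, h20]) hr (by simp [set_reg]; omega)).mono ?_
  rintro t st' ⟨h3, h4, h5, h6, h7, h8, h9, h10⟩
  refine Runs.seq ⟨_, _, .move .., _, _, .move .., ?_⟩
  simp only [set_reg, set_mem, set_space, if_true, if_neg (Ne.symm ho.2), if_neg ho.1] at *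
  have e3 : st'.reg 3 = st.reg 3 := by rw [h5 3 (by norm_num)]; simp
  refine ⟨by omega, ⟨by simp [set_reg]; omega, h6, by simp [set_reg, set_space]; omega⟩, h4, e3,
    fun x hx1 hx2 hx3 => ?_, fun i hi => ?_, fun h => by rw [h4]; exact h10 h⟩
  · rw [if_neg hx1, if_neg hx3, h5 x hx2, if_neg hx2]
  · rw [h7 i hi, if_neg (hr _ (List.getElem_mem _))]

end WordRAM

/-! ### Search trees in memory -/

namespace Eer

open WordRAM

/-- Keys are pairs of words, ordered lexicographically. -/
abbrev Key := ℕ ×ₗ ℕ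

/-- The tree `t` is stored in the memory `M` below the address `fp`, with its root at `p`. The
empty tree is stored at the address 0. The cell 3 takes the place of the value of a leaf there. All
records have 5 fields; the last one of a leaf is not used. -/
def TreeAt (M : ℕ → ℕ) (fp : ℕ) : Tree Key → ℕ → Prop
  | .nil, p => p = 0 ∧ 5 ≤ fp ∧ M 0 = 0 ∧ M 3 = 0
  | .leaf k v, p => 0 < p ∧ p + 5 ≤ fp ∧ M p = 1 ∧ M (p + 1) = (ofLex k).1 ∧
      M (p + 2) = (ofLex k).2 ∧ M (p + 3) = v
  | .node h l k r, p => 0 < p ∧ p + 5 ≤ fp ∧ M p = h ∧ M (p + 1) = (ofLex k).1 ∧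
      M (p + 2) = (ofLex k).2 ∧ TreeAt M fp l (M (p + 3)) ∧ TreeAt M fp r (M (p + 4))

theorem TreeAt.mono {M M' : ℕ → ℕ} {fp fp' : ℕ} (hM : ∀ a < fp, M' a = M a) (hf : fp ≤ fp')
    {t : Tree Key} {p : ℕ} (h : TreeAt M fp t p) : TreeAt M' fp' t p := by
  induction t generalizing p with
  | nil =>
    obtain ⟨h1, h2, h3, h4⟩ := h
    exact ⟨h1, by omega, by rw [hM _ (by omega), h3], by rw [hM _ (by omega), h4]⟩
  | leaf k v =>
    obtain ⟨h0, h1, h2, h3, h4, h5⟩ := h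
    exact ⟨h0, by omega, by rw [hM _ (by omega), h2], by rw [hM _ (by omega), h3],
      by rw [hM _ (by omega), h4], by rw [hM _ (by omega), h5]⟩
  | node h' l k r ihl ihr =>
    obtain ⟨h0, h1, h2, h3, h4, h5, h6⟩ := h
    exact ⟨h0, by omega, by rw [hM _ (by omega), h2], by rw [hM _ (by omega), h3],
      by rw [hM _ (by omega), h4], by rw [hM _ (by omega)]; exact ihl h5,
      by rw [hM _ (by omega)]; exact ihr h6⟩

theorem TreeAt.ext {st st' : State} (h : Ext st st') {t : Tree Key} {p : ℕ}
    (ht : TreeAt st.mem (st.reg 3) t p) : TreeAt st'.mem (st'.reg 3) t p :=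
  ht.mono h.mem h.fp

theorem TreeAt.height {M : ℕ → ℕ} {fp : ℕ} {t : Tree Key} {p : ℕ} (h : TreeAt M fp t p) :
    M p = t.height := by
  cases t with
  | nil => obtain ⟨rfl, -, h, -⟩ := h; exact h
  | leaf k v => exact h.2.2.1
  | node h' l k r => exact h.2.2.1

theorem TreeAt.add_five_le {M : ℕ → ℕ} {fp : ℕ} {t : Tree Key} {p : ℕ} (h : TreeAt M fp t p) :
    p + 5 ≤ fp := by
  cases t with
  | nil => obtain ⟨rfl, h, -⟩ := h; omega
  | leaf k v => exact h.2.1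
  | node h' l k r => have := h.2.1; omega

/-! Registers 10 to 44 are the workspace of the programs for trees. -/

/-- `out ← ` a new node with the subtrees in `l` and `r` and the router in `k₁`, `k₂`. -/
def mkP (out l k₁ k₂ r : ℕ) : Prog := .seq
  (seqs [.load 42 l, .load 43 r, .ite (.lt 42 43) (.move 42 43) .skip, .add 42 42 20])
  (alloc out [42, k₁, k₂, l, r])

theorem runs_mkP {w : ℕ} {out l k₁ k₂ r : ℕ} {st : State} {tl tr : Tree Key} {k : Key}
    (hl : TreeAt st.mem (st.reg 3) tl (st.reg l)) (hr : TreeAt st.mem (st.reg 3) tr (st.reg r))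
    (hk : k = toLex (st.reg k₁, st.reg k₂))
    (h20 : st.reg 20 = 1) (hw : st.reg 3 + 5 < 2 ^ w)
    (hw1 : tl.height + 1 < 2 ^ w) (hw2 : tr.height + 1 < 2 ^ w)
    (hregs : ∀ x ∈ [l, k₁, k₂, r], x ≠ 3 ∧ x ≠ 42 ∧ x ≠ 43 ∧ x ≠ 44) (ho : out ≠ 3 ∧ out ≠ 44) :
    Runs w (mkP out l k₁ k₂ r) st fun t st' => t ≤ 19 ∧ Ext st st' ∧
      st'.reg 3 = st.reg 3 + 5 ∧
      TreeAt st'.mem (st'.reg 3) (tl.mk k tr) (st'.reg out) ∧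
      ∀ x, x ≠ 3 → x ≠ 42 → x ≠ 43 → x ≠ 44 → x ≠ out → st'.reg x = st.reg x := by
  have h1 := hl.height
  have h2 := hr.height
  have h3 := hl.add_five_le
  have h4 := hr.add_five_le
  simp only [List.mem_cons, List.not_mem_nil, or_false, forall_eq_or_imp, forall_eq] at hregs
  obtain ⟨hl', hk1, hk2, hr'⟩ := hregs
  have B : Runs w (seqs [.load 42 l, .load 43 r, .ite (.lt 42 43) (.move 42 43) .skip,
      .add 42 42 20]) st fun t st' => t ≤ 5 ∧ st'.mem = st.mem ∧
      st'.space ≤ max st.space (st.reg 3) ∧ st'.reg 42 = max tl.height tr.height + 1 ∧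
      ∀ x, x ≠ 42 → x ≠ 43 → st'.reg x = st.reg x := by
    refine Runs.straight (c := 5) (by simp [seqs, Prog.Straight])
      (by simp [seqs, Prog.cost]) fun t ht => ?_
    by_cases hc : tl.height < tr.height
    · have hm : max tl.height tr.height = tr.height := by omega
      simp +contextual (disch := omega) [seqs, Prog.eval, Test.Holds, set_reg, set_mem, touch_reg,
        touch_mem, h1, h2, h20, hr', hc, Nat.mod_eq_of_lt, ht, set_space, touch_space]
      omega
    · have hm : max tl.height tr.height = tl.height := by omega
      simp +contextual (disch := omega) [seqs, Prog.eval, Test.Holds, set_reg, set_mem, touch_reg,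
        touch_mem, h1, h2, h20, hr', hc, Nat.mod_eq_of_lt, ht, set_space, touch_space]
      omega
  obtain ⟨t, st₁, hB, b1, b2, b3, b4, b5⟩ := B
  have e3 : st₁.reg 3 = st.reg 3 := b5 3 (by norm_num) (by norm_num)
  refine Runs.seq ⟨t, st₁, hB, ?_⟩
  refine (runs_alloc (st := st₁) (rs := [42, k₁, k₂, l, r])
    (by rw [b5 20 (by norm_num) (by norm_num), h20])
    (by simp only [List.length_cons, List.length_nil]; omega)
    (by simp [hl', hk1, hk2, hr']) ho).mono ?_
  rintro u st₂ ⟨a1, a2, a3, a4, a5, a6, -⟩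
  simp only [List.length_cons, List.length_nil] at a1 a3 a6
  have hE : Ext st st₂ := Ext.trans ⟨e3.ge, fun a _ => by rw [b2], by omega⟩ a2
  refine ⟨by omega, hE, by omega, ?_, fun x h1 h2 h3 h4 h5 => ?_⟩
  · rw [a4, e3]
    have f0 := a6 0 (by norm_num)
    have f1 := a6 1 (by norm_num)
    have f2 := a6 2 (by norm_num)
    have f3 := a6 3 (by norm_num)
    have f4 := a6 4 (by norm_num)
    simp only [List.getElem_cons_zero, List.getElem_cons_succ, e3, b4,
      b5 _ hl'.2.1 hl'.2.2.1, b5 _ hr'.2.1 hr'.2.2.1, b5 _ hk1.2.1 hk1.2.2.1,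
      b5 _ hk2.2.1 hk2.2.2.1, Nat.add_zero] at f0 f1 f2 f3 f4
    subst hk
    exact ⟨by omega, by omega, f0, f1, f2, f3 ▸ hl.ext hE, f4 ▸ hr.ext hE⟩
  · rw [a5 x h1 h4 h5, b5 x h2 h3]

end Eer

namespace Eer

open WordRAM _root_.Eer.Tree

/-! ### Programs for balanced trees -/

/-- `mkP` or its mirror image. -/
def mkDirP (d : Bool) (out a k₁ k₂ b : ℕ) : Prog :=
  if d then mkP out a k₁ k₂ b else mkP out b k₁ k₂ a

variable {w : ℕ} {st : State} {k k' : Key}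

theorem runs_mkDirP {d : Bool} {out a k₁ k₂ b : ℕ} {ta tb : Tree Key}
    (ha : TreeAt st.mem (st.reg 3) ta (st.reg a)) (hb : TreeAt st.mem (st.reg 3) tb (st.reg b))
    (hk : k = toLex (st.reg k₁, st.reg k₂))
    (h20 : st.reg 20 = 1) (hw : st.reg 3 + 5 < 2 ^ w)
    (hw1 : ta.height + 1 < 2 ^ w) (hw2 : tb.height + 1 < 2 ^ w)
    (hregs : ∀ x ∈ [a, k₁, k₂, b], x ≠ 3 ∧ x ≠ 42 ∧ x ≠ 43 ∧ x ≠ 44) (ho : out ≠ 3 ∧ out ≠ 44) :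
    Runs w (mkDirP d out a k₁ k₂ b) st fun t st' => t ≤ 19 ∧ Ext st st' ∧
      st'.reg 3 = st.reg 3 + 5 ∧
      TreeAt st'.mem (st'.reg 3) (mkDir d ta k tb) (st'.reg out) ∧
      ∀ x, x ≠ 3 → x ≠ 42 → x ≠ 43 → x ≠ 44 → x ≠ out → st'.reg x = st.reg x := by
  cases d with
  | true => exact runs_mkP ha hb hk h20 hw hw1 hw2 hregs ho
  | false =>
    refine runs_mkP hb ha hk h20 hw hw2 hw1 (fun x hx => hregs x ?_) ho
    simp only [List.mem_cons, List.not_mem_nil, or_false] at hx ⊢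
    tauto

/-- The program for `Tree.rot d`: the arguments are in the registers 25 (the higher tree), 26 and
27 (the router), and 28, the result is in register 10. -/
def rotP (d : Bool) : Prog :=
  .seq (loads 25 [31, 34, 35, 32, 33])
  (.seq (seqs [.load 36 (if d then 32 else 33), .load 37 (if d then 33 else 32)])
  (.ite (.lt 36 37)
    (.seq (loads (if d then 33 else 32) [31, 38, 39, 36, 37])
    (.seq (mkDirP d 40 (if d then 32 else 33) 34 35 (if d then 36 else 37))
    (.seq (mkDirP d 41 (if d then 37 else 36) 26 27 28) (mkDirP d 10 40 38 39 41))))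
    (.seq (mkDirP d 41 (if d then 33 else 32) 26 27 28)
      (mkDirP d 10 (if d then 32 else 33) 34 35 41))))

/-- What the program that joins two trees achieves: register 10 points to the new tree `t`, and
only the registers above 22 and the registers 3, 10 have changed. -/
structure JoinPost (st : State) (t : Tree Key) (c : ℕ) (n : ℕ) (st' : State) : Prop where
  time : n ≤ c
  ext : Ext st st'
  fp : st'.reg 3 ≤ st.reg 3 + 15
  tree : TreeAt st'.mem (st'.reg 3) t (st'.reg 10)
  frame : ∀ x, x ≠ 3 → x ≠ 10 → x < 23 ∨ x = 24 ∨ 45 ≤ x → st'.reg x = st.reg x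

theorem runs_rotP {d : Bool} {ta tb : Tree Key}
    (ha : TreeAt st.mem (st.reg 3) ta (st.reg 25)) (hb : TreeAt st.mem (st.reg 3) tb (st.reg 28))
    (hk : k = toLex (st.reg 26, st.reg 27)) (h20 : st.reg 20 = 1) (hw : st.reg 3 + 15 < 2 ^ w)
    (hga : ta.Good) (hw1 : ta.height + 4 < 2 ^ w) (hw2 : tb.height + 4 < 2 ^ w)
    (hg : (rot d ta k tb).Good) :
    Runs w (rotP d) st (JoinPost st (rot d ta k tb) 90) := by
  cases ta with
  | nil => exact hg.elim
  | leaf _ _ => exact hg.elim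
  | node h l k₁ r =>
    obtain ⟨a1, a2, a3, a4, a5, a6, a7⟩ := ha
    obtain ⟨gl, gr, e, -, -, -, -⟩ := hga
    simp only [height_node] at hw1
    have hk1 : k₁ = toLex (st.mem (st.reg 25 + 1), st.mem (st.reg 25 + 2)) := by
      rw [a4, a5]; rfl
    refine Runs.seq ((runs_loads h20 (by simpa using a2) (by omega) (by decide)).mono ?_)
    rintro t₁ s₁ ⟨h1, h2, h3, h4⟩
    simp only [List.length_cons, List.length_nil] at h1
    have r3 : s₁.reg 3 = st.reg 3 := h4 3 (by norm_num)
    have r20 : s₁.reg 20 = 1 := by rw [h4 20 (by norm_num)]; exact h20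
    have r34 : s₁.reg 34 = st.mem (st.reg 25 + 1) := h4 34 (by norm_num)
    have r35 : s₁.reg 35 = st.mem (st.reg 25 + 2) := h4 35 (by norm_num)
    have r32 : s₁.reg 32 = st.mem (st.reg 25 + 3) := h4 32 (by norm_num)
    have r33 : s₁.reg 33 = st.mem (st.reg 25 + 4) := h4 33 (by norm_num)
    have r26 : s₁.reg 26 = st.reg 26 := h4 26 (by norm_num)
    have r27 : s₁.reg 27 = st.reg 27 := h4 27 (by norm_num)
    have r28 : s₁.reg 28 = st.reg 28 := h4 28 (by norm_num)
    have fr : ∀ x, x < 23 ∨ x = 24 ∨ 45 ≤ x → s₁.reg x = st.reg x := by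
      intro x hx
      rw [h4 x (by omega)]
      simp only [assign, Function.update_apply]
      repeat rw [if_neg (by omega)]
    have E1 : Ext st s₁ := ⟨r3.ge, fun a _ => by rw [h2], by omega⟩
    clear h4
    rw [← r32, ← h2, ← r3] at a6
    rw [← r33, ← h2, ← r3] at a7
    rw [← r28, ← h2, ← r3] at hb
    rw [← r34, ← r35] at hk1
    rw [← r26, ← r27] at hk
    -- The outer and the inner child of the higher tree.
    generalize ho : (node h l k₁ r).child d = o at *
    generalize hi : (node h l k₁ r).child (!d) = i at *
    have hot : TreeAt s₁.mem (s₁.reg 3) o (s₁.reg (if d then 32 else 33)) := by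
      cases d <;> (subst ho; assumption)
    have hit : TreeAt s₁.mem (s₁.reg 3) i (s₁.reg (if d then 33 else 32)) := by
      cases d <;> (subst hi; assumption)
    have hoh : o.height + 1 ≤ h := by cases d <;> subst ho <;> simp [child] <;> omega
    have hih : i.height + 1 ≤ h := by cases d <;> subst hi <;> simp [child] <;> omega
    have hgi : i.Good := by cases d <;> subst hi <;> assumption
    have hd : ∀ x ∈ [if d then 32 else 33, if d then 33 else 32], x = 32 ∨ x = 33 := by
      cases d <;> decide
    generalize hro : (if d then 32 else 33 : ℕ) = ro at *
    generalize hri : (if d then 33 else 32 : ℕ) = ri at *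
    simp only [List.mem_cons, List.not_mem_nil, or_false, forall_eq_or_imp, forall_eq] at hd
    have B : Runs w (seqs [.load 36 ro, .load 37 ri]) s₁ fun t s => t ≤ 2 ∧ s.mem = s₁.mem ∧
        s.space ≤ max s₁.space (s₁.reg 3) ∧ s.reg 36 = o.height ∧ s.reg 37 = i.height ∧
        ∀ x, x ≠ 36 → x ≠ 37 → s.reg x = s₁.reg x := by
      have := hot.height
      have := hit.height
      have := hot.add_five_le
      have := hit.add_five_le
      refine Runs.straight (c := 2) (by simp [seqs, Prog.Straight])
        (by simp [seqs, Prog.cost]) fun t ht => ?_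
      have : ri ≠ 36 := by omega
      simp +contextual [seqs, Prog.eval, set_reg, set_mem, touch_reg, touch_mem, set_space,
        touch_space, *]
      omega
    refine Runs.seq (B.mono ?_)
    rintro t₂ s₂ ⟨h5, h6, h7, h8, h9, h10⟩
    have q : ∀ x, x ≠ 36 → x ≠ 37 → s₂.reg x = s₁.reg x := h10
    have r3' : s₂.reg 3 = s₁.reg 3 := q 3 (by norm_num) (by norm_num)
    have E2 : Ext st s₂ := E1.trans ⟨r3'.ge, fun a _ => by rw [h6], by omega⟩
    rw [← h6, ← r3', ← q ro (by omega) (by omega)] at hot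
    rw [← h6, ← r3', ← q ri (by omega) (by omega)] at hit
    rw [← h6, ← r3', ← q 28 (by omega) (by omega)] at hb
    rw [← q 34 (by omega) (by omega), ← q 35 (by omega) (by omega)] at hk1
    rw [← q 26 (by omega) (by omega), ← q 27 (by omega) (by omega)] at hk
    rw [← q 20 (by omega) (by omega)] at r20
    have fr2 : ∀ x, x < 23 ∨ x = 24 ∨ 45 ≤ x → s₂.reg x = st.reg x := fun x hx => by
      rw [q x (by omega) (by omega), fr x hx]
    have hs3 : s₂.reg 3 = st.reg 3 := by omega
    clear q h10 B
    refine Runs.ite ?_ ?_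
    · intro hc
      simp only [Test.Holds, h8, h9] at hc
      simp only [rot, ho, hi, if_pos hc] at hg ⊢
      cases i with
      | nil => exact hg.elim
      | leaf _ _ => exact hg.elim
      | node h' c k₂ e =>
        obtain ⟨c1, c2, c3, c4, c5, c6, c7⟩ := hit
        obtain ⟨gc, ge, e', -, -, -, -⟩ := hgi
        have hk2 : k₂ = toLex (s₂.mem (s₂.reg ri + 1), s₂.mem (s₂.reg ri + 2)) := by
          rw [c4, c5]; rfl
        refine Runs.seq ((runs_loads r20 (by simpa using c2) (by omega) (by decide)).mono ?_)
        rintro t₃ s₃ ⟨i1, i2, i3, i4⟩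
        simp only [List.length_cons, List.length_nil] at i1
        have u3 : s₃.reg 3 = s₂.reg 3 := i4 3 (by norm_num)
        have u38 : s₃.reg 38 = s₂.mem (s₂.reg ri + 1) := i4 38 (by norm_num)
        have u39 : s₃.reg 39 = s₂.mem (s₂.reg ri + 2) := i4 39 (by norm_num)
        have u36 : s₃.reg 36 = s₂.mem (s₂.reg ri + 3) := i4 36 (by norm_num)
        have u37 : s₃.reg 37 = s₂.mem (s₂.reg ri + 4) := i4 37 (by norm_num)
        have q : ∀ x, x < 31 ∨ (32 ≤ x ∧ x ≤ 35) ∨ 45 ≤ x → s₃.reg x = s₂.reg x := by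
          intro x hx
          rw [i4 x (by omega)]
          simp only [assign, Function.update_apply]
          repeat rw [if_neg (by omega)]
        clear i4
        have E3 : Ext st s₃ := E2.trans ⟨u3.ge, fun a _ => by rw [i2], by omega⟩
        rw [← i2, ← u3, ← q ro (by omega)] at hot
        rw [← i2, ← u3, ← q 28 (by omega)] at hb
        rw [← q 34 (by omega), ← q 35 (by omega)] at hk1
        rw [← q 26 (by omega), ← q 27 (by omega)] at hk
        rw [← q 20 (by omega)] at r20
        rw [← u38, ← u39] at hk2
        rw [← u36, ← i2, ← u3] at c6
        rw [← u37, ← i2, ← u3] at c7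
        have fr3 : ∀ x, x < 23 ∨ x = 24 ∨ 45 ≤ x → s₃.reg x = st.reg x := fun x hx => by
          rw [q x (by omega), fr2 x hx]
        generalize ho' : (node h' c k₂ e).child d = io at *
        generalize hi' : (node h' c k₂ e).child (!d) = ii at *
        simp only [height_node] at hih
        have hiot : TreeAt s₃.mem (s₃.reg 3) io (s₃.reg (if d then 36 else 37)) := by
          cases d <;> (subst ho'; assumption)
        have hiit : TreeAt s₃.mem (s₃.reg 3) ii (s₃.reg (if d then 37 else 36)) := by
          cases d <;> (subst hi'; assumption)
        have hioh : io.height + 1 ≤ h' := by cases d <;> subst ho' <;> simp [child] <;> omega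
        have hiih : ii.height + 1 ≤ h' := by cases d <;> subst hi' <;> simp [child] <;> omega
        have hd' : ∀ x ∈ [if d then 36 else 37, if d then 37 else 36], x = 36 ∨ x = 37 := by
          cases d <;> decide
        generalize hro : (if d then 36 else 37 : ℕ) = rio at *
        generalize hri : (if d then 37 else 36 : ℕ) = rii at *
        simp only [List.mem_cons, List.not_mem_nil, or_false, forall_eq_or_imp, forall_eq] at hd'
        refine Runs.seq ((runs_mkDirP (d := d) hot hiot hk1 r20 (by omega) (by omega) (by omega)
          (by simp; omega) (by omega)).mono ?_)
        rintro t₄ s₄ ⟨j1, j2, j3, j4, j5⟩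
        have q' : ∀ x, x < 40 → x ≠ 3 → s₄.reg x = s₃.reg x := fun x h h' =>
          j5 x (by omega) (by omega) (by omega) (by omega) (by omega)
        have q'' : ∀ x, x < 23 ∨ x = 24 ∨ 45 ≤ x → x ≠ 3 → s₄.reg x = st.reg x :=
          fun x hx h => by rw [j5 x (by omega) (by omega) (by omega) (by omega) (by omega),
            fr3 x hx]
        clear j5
        have hiit' := hiit.ext j2
        have hb' := hb.ext j2
        rw [← q' rii (by omega) (by omega)] at hiit'
        rw [← q' 28 (by omega) (by omega)] at hb'
        rw [← q' 26 (by omega) (by omega), ← q' 27 (by omega) (by omega)] at hk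
        rw [← q' 38 (by omega) (by omega), ← q' 39 (by omega) (by omega)] at hk2
        rw [← q' 20 (by omega) (by omega)] at r20
        refine Runs.seq ((runs_mkDirP (d := d) hiit' hb' hk r20 (by omega) (by omega) (by omega)
          (by simp; omega) (by omega)).mono ?_)
        rintro t₅ s₅ ⟨l1, l2, l3, l4, l5⟩
        have m4 := j4.ext l2
        rw [← l5 40 (by omega) (by omega) (by omega) (by omega) (by omega)] at m4
        rw [← l5 20 (by omega) (by omega) (by omega) (by omega) (by omega)] at r20
        rw [← l5 38 (by omega) (by omega) (by omega) (by omega) (by omega),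
          ← l5 39 (by omega) (by omega) (by omega) (by omega) (by omega)] at hk2
        have hh1 : (mkDir d o k₁ io).height ≤ h + 1 := by
          cases d <;> simp [mkDir, mk, height_node] <;> omega
        have hh2 : (mkDir d ii k tb).height ≤ max h tb.height + 1 := by
          cases d <;> simp [mkDir, mk, height_node] <;> omega
        refine (runs_mkDirP (d := d) m4 l4 hk2 r20 (by omega) (by omega) (by omega)
          (by decide) (by omega)).mono ?_
        rintro t₆ s₆ ⟨n1, n2, n3, n4, n5⟩
        refine ⟨by omega, (E3.trans j2).trans (l2.trans n2), by omega,
          by simpa only [ho', hi'] using n4, fun x h1 h2 h3 => ?_⟩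
        rw [n5 x (by omega) (by omega) (by omega) (by omega) (by omega),
          l5 x (by omega) (by omega) (by omega) (by omega) (by omega), q'' x h3 h1]
    · intro hc
      simp only [Test.Holds, h8, h9] at hc
      simp only [rot, ho, hi, if_neg hc] at hg ⊢
      refine Runs.seq ((runs_mkDirP (d := d) hit hb hk r20 (by omega) (by omega) (by omega)
          (by simp; omega) (by omega)).mono ?_)
      rintro t₅ s₅ ⟨l1, l2, l3, l4, l5⟩
      have m4 := hot.ext l2
      rw [← l5 ro (by omega) (by omega) (by omega) (by omega) (by omega)] at m4
      rw [← l5 20 (by omega) (by omega) (by omega) (by omega) (by omega)] at r20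
      rw [← l5 34 (by omega) (by omega) (by omega) (by omega) (by omega),
          ← l5 35 (by omega) (by omega) (by omega) (by omega) (by omega)] at hk1
      have hh2 : (mkDir d i k tb).height ≤ max h tb.height + 1 := by
        cases d <;> simp [mkDir, mk, height_node] <;> omega
      refine (runs_mkDirP (d := d) m4 l4 hk1 r20 (by omega) (by omega) (by omega)
          (by simp; omega) (by omega)).mono ?_
      rintro t₆ s₆ ⟨n1, n2, n3, n4, n5⟩
      refine ⟨by omega, E2.trans (l2.trans n2), by omega, n4, fun x h1 h2 h3 => ?_⟩
      rw [n5 x (by omega) (by omega) (by omega) (by omega) (by omega),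
        l5 x (by omega) (by omega) (by omega) (by omega) (by omega), fr2 x h3]

end Eer

namespace Eer

open WordRAM _root_.Eer.Tree

variable {w : ℕ} {st : State} {k k' : Key}

/-- The program for `Tree.bal`: the arguments are in the registers 25 (the left tree), 26 and 27
(the router), and 28 (the right tree), the result is in register 10. -/
def balP : Prog :=
  .seq (seqs [.load 29 25, .load 30 28, .const 23 0, .add 31 30 20, .add 32 29 20])
  (.ite (.eq 29 23) (.move 10 28)
  (.ite (.eq 30 23) (.move 10 25)
  (.ite (.lt 31 29) (rotP true)
  (.ite (.lt 32 30)
    (.seq (seqs [.move 31 25, .move 25 28, .move 28 31]) (rotP false))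
    (mkP 10 25 26 27 28)))))

theorem runs_balP {tl tr : Tree Key}
    (hl : TreeAt st.mem (st.reg 3) tl (st.reg 25)) (hr : TreeAt st.mem (st.reg 3) tr (st.reg 28))
    (hk : k = toLex (st.reg 26, st.reg 27)) (h20 : st.reg 20 = 1) (hw : st.reg 3 + 15 < 2 ^ w)
    (ol : tl.Ok) (or : tr.Ok) (hw1 : tl.height + 4 < 2 ^ w) (hw2 : tr.height + 4 < 2 ^ w)
    (hg : (bal tl k tr).Good) :
    Runs w balP st (JoinPost st (bal tl k tr) 110) := by
  have l1 := hl.height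
  have l2 := hr.height
  have l3 := hl.add_five_le
  have l4 := hr.add_five_le
  have B : Runs w (seqs [.load 29 25, .load 30 28, .const 23 0, .add 31 30 20, .add 32 29 20]) st
      fun t s => t ≤ 5 ∧ s.mem = st.mem ∧ s.space ≤ max st.space (st.reg 3) ∧
        (s.reg 29 = tl.height ∧ s.reg 30 = tr.height ∧ s.reg 23 = 0 ∧ s.reg 31 = tr.height + 1 ∧
        s.reg 32 = tl.height + 1) ∧
        ∀ x, x < 23 ∨ (24 ≤ x ∧ x ≤ 28) ∨ 45 ≤ x → s.reg x = st.reg x := by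
    refine Runs.straight (c := 5) (by simp [seqs, Prog.Straight])
      (by simp [seqs, Prog.cost]) fun t ht => ⟨ht, ?_, ?_, ?_, fun x hx => ?_⟩
    · simp [seqs, Prog.eval, set_mem, touch_mem]
    · simp [seqs, Prog.eval, set_space, touch_space, set_reg, touch_reg]
      omega
    · simp (disch := omega) [seqs, Prog.eval, set_reg, set_mem, touch_reg, touch_mem, l1, l2, h20,
        Nat.mod_eq_of_lt]
    · simp only [seqs, Prog.eval, set_reg, touch_reg]
      repeat rw [if_neg (by omega)]
  refine Runs.seq (B.mono ?_)
  rintro t₁ s₁ ⟨h1, h2, h3, ⟨v29, v30, v23, v31, v32⟩, fr⟩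
  have r3 := fr 3 (by norm_num)
  have E1 : Ext st s₁ := ⟨r3.ge, fun a _ => by rw [h2], by omega⟩
  rw [← fr 25 (by norm_num), ← h2, ← r3] at hl
  rw [← fr 28 (by norm_num), ← h2, ← r3] at hr
  rw [← fr 26 (by norm_num), ← fr 27 (by norm_num)] at hk
  rw [← fr 20 (by norm_num)] at h20
  have mv : ∀ r (t : Tree Key), TreeAt s₁.mem (s₁.reg 3) t (s₁.reg r) →
      Runs w (.move 10 r) s₁ (fun n s => n ≤ 1 ∧ JoinPost st t 110 (t₁ + n + 10) s) := by
    intro r t h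
    refine ⟨_, _, .move .., le_rfl, by omega, E1.trans ⟨le_rfl, fun _ _ => rfl, le_max_left _ _⟩,
      ?_, ?_, fun x h1 h2 h3 => ?_⟩
    · simp only [set_reg]; norm_num; omega
    · simpa [set_reg, set_mem] using h
    · simp only [set_reg, if_neg h2]; exact fr x (by omega)
  unfold bal at hg ⊢
  refine Runs.ite ?_ ?_
  · intro c
    simp only [Test.Holds, v29, v23] at c
    rw [if_pos c]
    exact (mv 28 tr hr).mono fun n s h => ⟨by omega, h.2.ext, h.2.fp, h.2.tree, h.2.frame⟩
  intro c1
  simp only [Test.Holds, v29, v23] at c1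
  rw [if_neg c1] at hg ⊢
  refine Runs.ite ?_ ?_
  · intro c
    simp only [Test.Holds, v30, v23] at c
    rw [if_pos c]
    exact (mv 25 tl hl).mono fun n s h => ⟨by omega, h.2.ext, h.2.fp, h.2.tree, h.2.frame⟩
  intro c2
  simp only [Test.Holds, v30, v23] at c2
  rw [if_neg c2] at hg ⊢
  have post : ∀ {s s' : State} {t : Tree Key} {n e : ℕ}, Ext s₁ s → s.reg 3 = s₁.reg 3 →
      (∀ x, x < 23 ∨ x = 24 ∨ 45 ≤ x → s.reg x = s₁.reg x) → JoinPost s t 90 n s' → e ≤ 18 →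
      JoinPost st t 110 (e + n) s' := by
    intro s s' t n e hE h3 hs h he
    refine ⟨by have := h.time; omega, E1.trans (hE.trans h.ext), by have := h.fp; omega,
      h.tree, fun x x1 x2 x3 => ?_⟩
    rw [h.frame x x1 x2 x3, hs x x3, fr x (by omega)]
  refine Runs.ite ?_ ?_
  · intro c
    simp only [Test.Holds, v31, v29] at c
    rw [if_pos c] at hg ⊢
    refine (runs_rotP hl hr hk h20 (by omega) (ol.good c1) (by omega) (by omega) hg).mono ?_
    intro n s h
    have := post (e := t₁ + 3) (Ext.refl _) rfl (fun _ _ => rfl) h (by omega)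
    exact ⟨by have := this.time; omega, this.ext, this.fp, this.tree, this.frame⟩
  intro c3
  simp only [Test.Holds, v31, v29] at c3
  rw [if_neg c3] at hg ⊢
  refine Runs.ite ?_ ?_
  · intro c
    simp only [Test.Holds, v32, v30] at c
    rw [if_pos c] at hg ⊢
    have B : Runs w (seqs [.move 31 25, .move 25 28, .move 28 31]) s₁
        fun t s => t ≤ 3 ∧ s.mem = s₁.mem ∧ s.space = s₁.space ∧
          s.reg 25 = s₁.reg 28 ∧ s.reg 28 = s₁.reg 25 ∧
          ∀ x, x ≠ 25 → x ≠ 28 → x ≠ 31 → s.reg x = s₁.reg x := by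
      refine Runs.straight (c := 3) (by simp [seqs, Prog.Straight])
        (by simp [seqs, Prog.cost]) fun t ht => ?_
      simp +contextual [seqs, Prog.eval, set_reg, set_mem, set_space, ht]
    refine Runs.seq (B.mono ?_)
    rintro t₂ s₂ ⟨i1, i2, i3, i4, i5, i6⟩
    have e3 := i6 3 (by norm_num) (by norm_num) (by norm_num)
    rw [← i2, ← e3, ← i4] at hr
    rw [← i2, ← e3, ← i5] at hl
    rw [← i6 26 (by norm_num) (by norm_num) (by norm_num),
      ← i6 27 (by norm_num) (by norm_num) (by norm_num)] at hk
    rw [← i6 20 (by norm_num) (by norm_num) (by norm_num)] at h20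
    refine (runs_rotP hr hl hk h20 (by omega) (or.good c2) (by omega) (by omega) hg).mono ?_
    intro n s h
    have := post (e := t₁ + t₂ + 4) ⟨e3.ge, fun _ _ => by rw [i2], by omega⟩ e3
      (fun x hx => i6 x (by omega) (by omega) (by omega)) h (by omega)
    exact ⟨by have := this.time; omega, this.ext, this.fp, this.tree, this.frame⟩
  intro c4
  simp only [Test.Holds, v32, v30] at c4
  rw [if_neg c4] at hg ⊢
  refine (runs_mkP hl hr hk h20 (by omega) (by omega) (by omega) (by decide) (by decide)).mono ?_
  rintro n s ⟨i1, i2, i3, i4, i5⟩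
  refine ⟨by omega, E1.trans i2, by omega, i4, fun x x1 x2 x3 => ?_⟩
  rw [i5 x x1 (by omega) (by omega) (by omega) x2, fr x (by omega)]

/-! ### Looking up and changing keys of trees -/

/-- Branch on whether the key in the registers 11 and 12 is less than the router in 16 and 17. -/
def ifLess (p q : Prog) : Prog :=
  .ite (.lt 11 16) p (.ite (.eq 11 16) (.ite (.lt 12 17) p q) q)

/-- The time that the comparison takes depends on its outcome, but it is at most 3. -/
theorem runs_ifLess {p q : Prog} {Q : ℕ → State → Prop}
    (hk : k = toLex (st.reg 11, st.reg 12)) (hk' : k' = toLex (st.reg 16, st.reg 17))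
    (hp : k < k' → Runs w p st fun t s => ∀ e ≤ 3, Q (e + t) s)
    (hq : ¬ k < k' → Runs w q st fun t s => ∀ e ≤ 3, Q (e + t) s) :
    Runs w (ifLess p q) st Q := by
  subst hk hk'
  simp only [Prod.Lex.toLex_lt_toLex] at hp hq
  refine Runs.ite (fun c => ?_) fun c => Runs.ite (fun c1 => Runs.ite (fun c2 => ?_) fun c2 => ?_)
    fun c1 => ?_ <;> simp only [Test.Holds] at *
  · exact (hp (Or.inl c)).mono fun t s h => h 1 (by omega)
  · refine (hp (Or.inr ⟨c1, c2⟩)).mono fun t s h => ?_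
    rw [← Nat.add_assoc, ← Nat.add_assoc]; exact h 3 (by omega)
  · refine (hq (by omega)).mono fun t s h => ?_
    rw [← Nat.add_assoc, ← Nat.add_assoc]; exact h 3 (by omega)
  · refine (hq (by omega)).mono fun t s h => ?_
    rw [← Nat.add_assoc]; exact h 2 (by omega)

/-- The fields of the root of a tree, loaded into the registers 14, 16, 17, 18, 19. -/
structure Loaded (M : ℕ → ℕ) (fp : ℕ) (t : Tree Key) (s : State) : Prop where
  height : s.reg 14 = t.height
  leaf : ∀ k v, t = .leaf k v → k = toLex (s.reg 16, s.reg 17) ∧ s.reg 18 = v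
  nil : t = .nil → s.reg 18 = 0
  node : ∀ h l k r, t = .node h l k r → k = toLex (s.reg 16, s.reg 17) ∧
    TreeAt M fp l (s.reg 18) ∧ TreeAt M fp r (s.reg 19)

theorem runs_loadTree {a : ℕ} {t : Tree Key} (ht : TreeAt st.mem (st.reg 3) t (st.reg a))
    (h20 : st.reg 20 = 1) (hf : st.reg 3 < 2 ^ w) :
    Runs w (loads a [14, 16, 17, 18, 19]) st fun n s => n ≤ 12 ∧ s.mem = st.mem ∧
      s.space ≤ max st.space (st.reg 3) ∧ Loaded st.mem (st.reg 3) t s ∧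
      ∀ x, x ∉ [14, 16, 17, 18, 19, 44] → s.reg x = st.reg x := by
  refine (runs_loads h20 (by simpa using ht.add_five_le) hf (by decide)).mono ?_
  rintro n s ⟨h1, h2, h3, h4⟩
  have r14 : s.reg 14 = st.mem (st.reg a) := h4 14 (by norm_num)
  have r16 : s.reg 16 = st.mem (st.reg a + 1) := h4 16 (by norm_num)
  have r17 : s.reg 17 = st.mem (st.reg a + 2) := h4 17 (by norm_num)
  have r18 : s.reg 18 = st.mem (st.reg a + 3) := h4 18 (by norm_num)
  have r19 : s.reg 19 = st.mem (st.reg a + 4) := h4 19 (by norm_num)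
  refine ⟨by simpa using h1, h2, h3, ⟨r14.trans ht.height, ?_, ?_, ?_⟩, fun x hx => ?_⟩
  · rintro k v rfl
    obtain ⟨-, -, -, f1, f2, f3⟩ := ht
    rw [r16, r17, r18, f1, f2]
    exact ⟨rfl, f3⟩
  · rintro rfl
    obtain ⟨f0, -, -, f3⟩ := ht
    rw [r18, f0]; exact f3
  · rintro h l k r rfl
    obtain ⟨-, -, -, f1, f2, f3, f4⟩ := ht
    rw [r16, r17, r18, r19, f1, f2]
    exact ⟨rfl, f3, f4⟩
  · simp only [List.mem_cons, List.not_mem_nil, or_false, not_or] at hx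
    rw [h4 x (by omega)]
    simp only [assign, Function.update_apply]
    repeat rw [if_neg (by omega)]

/-- Look up the key in the registers 11 and 12 in the tree in register 10; the value is returned
in register 13. -/
def getP : Prog :=
  .seq (.const 20 1) (.seq (loads 10 [14, 16, 17, 18, 19])
  (.seq (.loop (.lt 20 14)
    (.seq (ifLess (.move 10 18) (.move 10 19)) (loads 10 [14, 16, 17, 18, 19])))
  (.ite (.eq 11 16) (.ite (.eq 12 17) (.move 13 18) (.const 13 0)) (.const 13 0))))

end Eer

namespace Eer

open WordRAM _root_.Eer.Tree

variable {w : ℕ} {st : State} {k k' : Key}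

theorem runs_moveFollow {t l r : Tree Key} {h : ℕ} {a : ℕ} {s : State} {M : ℕ → ℕ} {fp : ℕ}
    (hL : Loaded M fp t s) (e : t = .node h l k' r) (hk : k = toLex (s.reg 11, s.reg 12)) :
    Runs w (ifLess (.move a 18) (.move a 19)) s fun n s' => n ≤ 4 ∧ s'.mem = s.mem ∧
      s'.space = s.space ∧ TreeAt M fp (if k < k' then l else r) (s'.reg a) ∧
      ∀ x ≠ a, s'.reg x = s.reg x := by
  obtain ⟨h1, h2, h3⟩ := hL.node _ _ _ _ e
  refine runs_ifLess hk h1 (fun c => ?_) fun c => ?_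
  · refine ⟨_, _, .move .., fun e he => ⟨by omega, rfl, rfl, ?_, fun x hx => ?_⟩⟩
    · simpa [c, set_reg] using h2
    · simp [set_reg, hx]
  · refine ⟨_, _, .move .., fun e he => ⟨by omega, rfl, rfl, ?_, fun x hx => ?_⟩⟩
    · simpa [c, set_reg] using h3
    · simp [set_reg, hx]

theorem runs_getLoop {s : State} (h20 : s.reg 20 = 1) (hf : s.reg 3 < 2 ^ w)
    (hk : k = toLex (s.reg 11, s.reg 12)) {t : Tree Key} (ht : t.Good)
    (hL : Loaded s.mem (s.reg 3) t s) :
    Runs w (.loop (.lt 20 14)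
        (.seq (ifLess (.move 10 18) (.move 10 19)) (loads 10 [14, 16, 17, 18, 19]))) s
      fun n s' => n ≤ 20 * t.height ∧ s'.mem = s.mem ∧ s'.space ≤ max s.space (s.reg 3) ∧
        Loaded s.mem (s.reg 3) (t.bottom k) s' ∧
        ∀ x, x ∉ [10, 14, 16, 17, 18, 19, 44] → s'.reg x = s.reg x := by
  induction t generalizing s with
  | nil => exact ht.elim
  | leaf k' v =>
    refine Runs.loop_done ?_ ⟨by simp [height], rfl, le_max_left _ _, hL, fun _ _ => rfl⟩
    simp [Test.Holds, h20, hL.height, height]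
  | node h l k' r ihl ihr =>
    obtain ⟨gl, gr, e, -⟩ := ht
    have := gl.height_pos
    have := gr.height_pos
    refine Runs.loop_step ?_ (Runs.seq ((runs_moveFollow hL rfl hk).mono ?_))
    · simp only [Test.Holds, h20, hL.height, height_node]; omega
    rintro n₁ s₁ ⟨a1, a2, a3, a4, a5⟩
    have e3 := a5 3 (by norm_num)
    rw [← a2, ← e3] at a4
    refine (runs_loadTree a4 (by rw [a5 20 (by norm_num), h20]) (by omega)).mono ?_
    rintro n₂ s₂ ⟨b1, b2, b3, b4, b5⟩
    have e3' : s₂.reg 3 = s.reg 3 := by rw [b5 3 (by decide), e3]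
    have em : s₂.mem = s.mem := b2.trans a2
    have hk' : k = toLex (s₂.reg 11, s₂.reg 12) := by
      rw [b5 11 (by decide), b5 12 (by decide), a5 11 (by norm_num), a5 12 (by norm_num), hk]
    rw [a2, e3, ← em, ← e3'] at b4
    have h20' : s₂.reg 20 = 1 := by rw [b5 20 (by decide), a5 20 (by norm_num), h20]
    have fr : ∀ x, x ∉ [10, 14, 16, 17, 18, 19, 44] → s₂.reg x = s.reg x := by
      intro x hx
      rw [b5 x (fun h => hx (List.mem_cons_of_mem _ h)), a5 x (fun h => hx (by simp [h]))]
    simp only [bottom, height_node]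
    split_ifs at b4 ⊢ with c
    · refine (ihl h20' (by omega) hk' gl b4).mono ?_
      rintro n₃ s₃ ⟨c1, c2, c3, c4, c5⟩
      rw [em, e3'] at c4
      exact ⟨by omega, c2.trans em, by omega, c4, fun x hx => (c5 x hx).trans (fr x hx)⟩
    · refine (ihr h20' (by omega) hk' gr b4).mono ?_
      rintro n₃ s₃ ⟨c1, c2, c3, c4, c5⟩
      rw [em, e3'] at c4
      exact ⟨by omega, c2.trans em, by omega, c4, fun x hx => (c5 x hx).trans (fr x hx)⟩

theorem Tree.get_eq_bottom (t : Tree Key) (k : Key) : t.get k = (t.bottom k).get k := by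
  induction t with
  | nil => rfl
  | leaf k' v => rfl
  | node h l k' r ihl ihr =>
    simp only [Tree.get, bottom]; split_ifs <;> assumption

theorem Tree.bottom_cases (t : Tree Key) (k : Key) :
    t.bottom k = .nil ∨ ∃ k' v, t.bottom k = .leaf k' v := by
  induction t with
  | nil => exact Or.inl rfl
  | leaf k' v => exact Or.inr ⟨k', v, rfl⟩
  | node h l k' r ihl ihr => simp only [bottom]; split_ifs <;> assumption

theorem Tree.Good.bottom {t : Tree Key} (h : t.Good) (k : Key) : (t.bottom k).Good := by
  induction t with
  | nil => exact h
  | leaf k' v => exact h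
  | node h' l k' r ihl ihr =>
    simp only [Tree.bottom]; split_ifs
    · exact ihl h.1
    · exact ihr h.2.1

theorem runs_getP {t : Tree Key} (ht : TreeAt st.mem (st.reg 3) t (st.reg 10)) (ho : t.Ok)
    (hf : st.reg 3 < 2 ^ w) (hk : k = toLex (st.reg 11, st.reg 12)) :
    Runs w getP st fun n s => n ≤ 20 * t.height + 20 ∧ s.mem = st.mem ∧
      s.space ≤ max st.space (st.reg 3) ∧ s.reg 13 = t.get k ∧
      ∀ x, x < 10 ∨ 45 ≤ x → s.reg x = st.reg x := by
  have h5 := ht.add_five_le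
  refine Runs.seq ⟨_, _, .const .., Runs.seq ?_⟩
  have m1 : 1 % 2 ^ w = 1 := Nat.mod_eq_of_lt (by omega)
  rw [m1]
  refine (runs_loadTree (t := t) (a := 10) (st := st.set 20 1)
    (by simpa [set_reg, set_mem] using ht)
    (by simp [set_reg]) (by simpa [set_reg] using hf)).mono ?_
  rintro n₁ s₁ ⟨a1, a2, a3, a4, a5⟩
  simp only [set_mem, set_space, set_reg] at a2 a3 a4 a5
  norm_num at a3 a4
  have fr1 : ∀ x, x < 10 ∨ x = 11 ∨ x = 12 ∨ 45 ≤ x → s₁.reg x = st.reg x := by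
    intro x hx
    rw [a5 x (by simp; omega), if_neg (by omega)]
  have h20 : s₁.reg 20 = 1 := by rw [a5 20 (by decide)]; norm_num
  have e3 := fr1 3 (by norm_num)
  have hk1 : k = toLex (s₁.reg 11, s₁.reg 12) := by
    rw [fr1 11 (by norm_num), fr1 12 (by norm_num), hk]
  have L : Runs w (.loop (.lt 20 14)
        (.seq (ifLess (.move 10 18) (.move 10 19)) (loads 10 [14, 16, 17, 18, 19]))) s₁
      fun n s' => n ≤ 20 * t.height + 1 ∧ s'.mem = s₁.mem ∧ s'.space ≤ max s₁.space (s₁.reg 3) ∧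
        Loaded s₁.mem (s₁.reg 3) (t.bottom k) s' ∧
        ∀ x, x ∉ [10, 14, 16, 17, 18, 19, 44] → s'.reg x = s₁.reg x := by
    rw [← a2, ← e3] at a4
    rcases ho with rfl | ho
    · refine Runs.loop_done ?_ ⟨by omega, rfl, le_max_left _ _, a4, fun _ _ => rfl⟩
      simp [Test.Holds, h20, a4.height, height]
    · refine (runs_getLoop h20 (by omega) hk1 ho a4).mono ?_
      rintro n s ⟨b1, b2⟩
      exact ⟨by omega, b2⟩
  refine Runs.seq (L.mono ?_)
  rintro n₂ s₂ ⟨b1, b2, b3, b4, b5⟩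
  have fr2 : ∀ x, x < 10 ∨ x = 11 ∨ x = 12 ∨ 45 ≤ x → s₂.reg x = st.reg x := by
    intro x hx
    rw [b5 x (by simp; omega), fr1 x hx]
  have hk2 : k = toLex (s₂.reg 11, s₂.reg 12) := by
    rw [fr2 11 (by norm_num), fr2 12 (by norm_num), hk]
  refine Runs.straight (c := 3) (by simp [Prog.Straight]) (by simp [Prog.cost]) fun n hn => ?_
  rw [get_eq_bottom]
  have fin : ∀ x, x < 10 ∨ 45 ≤ x → ((Prog.ite (.eq 11 16) (.ite (.eq 12 17) (.move 13 18)
      (.const 13 0)) (.const 13 0)).eval w s₂).reg x = st.reg x := by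
    intro x hx
    simp only [Prog.eval]
    split_ifs <;> simp only [set_reg] <;> rw [if_neg (by omega)] <;> exact fr2 x (by omega)
  refine ⟨by omega, ?_, ?_, ?_, fin⟩
  · simp only [Prog.eval]; split_ifs <;> simp [set_mem, b2, a2]
  · simp only [Prog.eval]; split_ifs <;> simp only [set_space] <;> omega
  · simp only [Prog.eval, Test.Holds]
    rcases Tree.bottom_cases t k with e | ⟨k', v, e⟩
    · have := b4.nil e
      rw [e]
      split_ifs <;> simp [set_reg, Tree.get, this]
    · obtain ⟨f1, f2⟩ := b4.leaf _ _ e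
      rw [e, f1, hk2]
      simp only [Tree.get, EmbeddingLike.apply_eq_iff_eq, Prod.mk.injEq]
      by_cases c1 : s₂.reg 11 = s₂.reg 16 <;> by_cases c2 : s₂.reg 12 = s₂.reg 17 <;>
        simp [c1, c2, set_reg, f2]

/-- Pointers to the trees `fs`, the last one first, are stored in the memory from `base` on. -/
def StackAt (M : ℕ → ℕ) (fp base : ℕ) : List (Tree Key) → Prop
  | [] => True
  | f :: fs => TreeAt M fp f (M (base + fs.length)) ∧ StackAt M fp base fs

theorem StackAt.mono {M M' : ℕ → ℕ} {fp fp' base : ℕ} (hM : ∀ a < fp, M' a = M a) (hf : fp ≤ fp')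
    {fs : List (Tree Key)} (hb : base + fs.length ≤ fp) (h : StackAt M fp base fs) :
    StackAt M' fp' base fs := by
  induction fs with
  | nil => trivial
  | cons f fs ih =>
    simp only [List.length_cons] at hb
    refine ⟨?_, ih (by omega) h.2⟩
    rw [hM _ (by omega)]
    exact h.1.mono hM hf

/-- The first loop of `setP`: walk down the search path and push the inner nodes on a stack. -/
def descend : Prog := .loop (.lt 20 14)
  (.seq (seqs [.store 3 10, .add 3 3 20])
    (.seq (ifLess (.move 10 18) (.move 10 19)) (loads 10 [14, 16, 17, 18, 19])))

/-- The stack grows by the inner nodes of the search path, and its length stays below the height of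
the tree. -/
theorem runs_descend {s : State} (h20 : s.reg 20 = 1)
    (hk : k = toLex (s.reg 11, s.reg 12)) {t : Tree Key} (ht : t.Good)
    (hf : s.reg 3 + t.height < 2 ^ w) {fs : List (Tree Key)} {base : ℕ}
    (hb : s.reg 3 = base + fs.length) (hS : StackAt s.mem (s.reg 3) base fs)
    (hT : TreeAt s.mem (s.reg 3) t (s.reg 10)) (hL : Loaded s.mem (s.reg 3) t s) :
    Runs w descend s fun n s' => n ≤ 20 * t.height ∧ Ext s s' ∧
        s'.reg 3 = base + (t.path k ++ fs).length ∧ s'.reg 3 + 1 ≤ s.reg 3 + t.height ∧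
        StackAt s'.mem (s'.reg 3) base (t.path k ++ fs) ∧
        TreeAt s'.mem (s'.reg 3) (t.bottom k) (s'.reg 10) ∧
        Loaded s'.mem (s'.reg 3) (t.bottom k) s' ∧
        ∀ x, x ∉ [3, 10, 14, 16, 17, 18, 19, 44] → s'.reg x = s.reg x := by
  induction t generalizing s fs with
  | nil => exact ht.elim
  | leaf k' v =>
    refine Runs.loop_done ?_ ⟨by simp [height], Ext.refl _, hb, by simp [height_leaf], hS, hT, hL,
      fun _ _ => rfl⟩
    simp [Test.Holds, h20, hL.height, height]
  | node h l k' r ihl ihr =>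
    obtain ⟨gl, gr, e, -⟩ := ht
    have := gl.height_pos
    have := gr.height_pos
    simp only [height_node] at hf
    refine Runs.loop_step ?_ (Runs.seq ?_)
    · simp only [Test.Holds, h20, hL.height, height_node]; omega
    have B : Runs w (seqs [.store 3 10, .add 3 3 20]) s fun n s₁ => n ≤ 2 ∧ Ext s s₁ ∧
        s₁.reg 3 = s.reg 3 + 1 ∧ s₁.mem (s.reg 3) = s.reg 10 ∧
        ∀ x ≠ 3, s₁.reg x = s.reg x := by
      refine Runs.straight (c := 2) (by simp [seqs, Prog.Straight]) (by simp [seqs, Prog.cost])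
        fun n hn => ?_
      have e : (s.reg 3 + s.reg 20) % 2 ^ w = s.reg 3 + 1 := by
        rw [h20, Nat.mod_eq_of_lt (by omega)]
      refine ⟨hn, ⟨?_, ?_, ?_⟩, ?_, ?_, ?_⟩
      · simp [seqs, Prog.eval, set_reg, write_reg, e]
      · intro a ha
        simp only [seqs, Prog.eval, set_mem, write_mem]
        rw [if_neg (by omega)]
      · simp [seqs, Prog.eval, set_reg, write_reg, e, set_space, write_space]
      · simp [seqs, Prog.eval, set_reg, write_reg, e]
      · simp [seqs, Prog.eval, set_mem, write_mem]
      · intro x hx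
        simp [seqs, Prog.eval, set_reg, write_reg, hx]
    refine B.mono ?_
    rintro n₀ s₀ ⟨d1, d2, d3, d4, d5⟩
    have hL0 : Loaded s₀.mem (s₀.reg 3) (.node h l k' r) s₀ := by
      refine ⟨by rw [d5 14 (by norm_num), hL.height], by simp, by simp, ?_⟩
      intro h' l' k'' r' e'
      obtain ⟨x1, x2, x3⟩ := hL.node _ _ _ _ e'
      rw [d5 16 (by norm_num), d5 17 (by norm_num), d5 18 (by norm_num), d5 19 (by norm_num)]
      exact ⟨x1, x2.ext d2, x3.ext d2⟩
    have hS0 : StackAt s₀.mem (s₀.reg 3) base (.node h l k' r :: fs) := by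
      refine ⟨?_, hS.mono d2.mem d2.fp hb.ge⟩
      rw [← hb, d4]
      exact hT.ext d2
    rw [← d5 11 (by norm_num), ← d5 12 (by norm_num)] at hk
    refine Runs.seq ((runs_moveFollow hL0 rfl hk).mono ?_)
    rintro n₁ s₁ ⟨a1, a2, a3, a4, a5⟩
    have e3 := a5 3 (by norm_num)
    rw [← a2, ← e3] at a4
    refine (runs_loadTree a4 (by rw [a5 20 (by norm_num), d5 20 (by norm_num), h20])
      (by omega)).mono ?_
    rintro n₂ s₂ ⟨b1, b2, b3, b4, b5⟩
    have e3' : s₂.reg 3 = s₀.reg 3 := by rw [b5 3 (by decide), e3]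
    have em : s₂.mem = s₀.mem := b2.trans a2
    have hk' : k = toLex (s₂.reg 11, s₂.reg 12) := by
      rw [b5 11 (by decide), b5 12 (by decide), a5 11 (by norm_num), a5 12 (by norm_num), hk]
    rw [a2, e3, ← em, ← e3'] at b4
    rw [← b5 10 (by decide), a2, e3, ← em, ← e3'] at a4
    rw [← em, ← e3'] at hS0
    have h20' : s₂.reg 20 = 1 := by
      rw [b5 20 (by decide), a5 20 (by norm_num), d5 20 (by norm_num), h20]
    have fr : ∀ x, x ∉ [3, 10, 14, 16, 17, 18, 19, 44] → s₂.reg x = s.reg x := by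
      intro x hx
      rw [b5 x (fun h => hx (List.mem_cons_of_mem _ (List.mem_cons_of_mem _ h))),
        a5 x (fun h => hx (by simp [h])), d5 x (fun h => hx (by simp [h]))]
    have E2 : Ext s s₂ :=
      d2.trans ⟨e3'.ge, fun a _ => by rw [em], by omega⟩
    have hlen : ∀ fs' : List (Tree Key), fs' ++ .node h l k' r :: fs =
        (fs' ++ [.node h l k' r]) ++ fs := by simp
    simp only [bottom, height_node, path]
    split_ifs at b4 a4 ⊢ with c
    · refine (ihl h20' hk' gl (by omega) (fs := .node h l k' r :: fs)
        (by simp only [List.length_cons]; omega) hS0 a4 b4).mono ?_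
      rintro n₃ s₃ ⟨c1, c2, c3, c4, c5, c6, c7, c8⟩
      rw [hlen] at c3 c5
      exact ⟨by omega, E2.trans c2, c3, by omega, c5, c6, c7,
        fun x hx => (c8 x hx).trans (fr x hx)⟩
    · refine (ihr h20' hk' gr (by omega) (fs := .node h l k' r :: fs)
        (by simp only [List.length_cons]; omega) hS0 a4 b4).mono ?_
      rintro n₃ s₃ ⟨c1, c2, c3, c4, c5, c6, c7, c8⟩
      rw [hlen] at c3 c5
      exact ⟨by omega, E2.trans c2, c3, by omega, c5, c6, c7,
        fun x hx => (c8 x hx).trans (fr x hx)⟩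

end Eer

namespace Eer

open WordRAM _root_.Eer.Tree

variable {w : ℕ} {st : State} {k k' : Key}

/-- The new subtree `new` can be grafted onto the inner node `f`. -/
structure Graftable (H : ℕ) (k : Key) (f new : Tree Key) : Prop where
  node : ∃ h l k' r, f = .node h l k' r
  good : f.Good
  ok : new.Ok
  height : f.height ≤ H
  height_new : new.height ≤ H
  good_graft : (graft k f new).Good

/-- `new` can be grafted onto the first node, the result can be grafted onto the second one, and so
on. -/
def Rebuildable (H : ℕ) (k : Key) : List (Tree Key) → Tree Key → Prop
  | [], _ => True
  | f :: fs, new => Graftable H k f new ∧ Rebuildable H k fs (graft k f new)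

theorem rebuildable_append {H : ℕ} {fs : List (Tree Key)} {f new : Tree Key}
    (h : Rebuildable H k fs new) (hf : Graftable H k f (fs.foldl (fun n f => graft k f n) new)) :
    Rebuildable H k (fs ++ [f]) new := by
  induction fs generalizing new with
  | nil => exact ⟨hf, trivial⟩
  | cons g fs ih => exact ⟨h.1, ih h.2 hf⟩

/-- The changed leaf can be grafted all the way up the search path. -/
theorem rebuildable_path {t : Tree Key} (ht : t.Good) (v : ℕ) {H : ℕ} (hH : t.height ≤ H) :
    Rebuildable H k (t.path k) (graft k (t.bottom k) (single k v)) := by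
  induction t with
  | nil => exact ht.elim
  | leaf k' v' => trivial
  | node h l k' r ihl ihr =>
    have hs := sets_set (Or.inr ht) k v
    have ht' := ht
    obtain ⟨gl, gr, e, h1, h2, h3, h4⟩ := ht
    have := gl.height_pos
    have := gr.height_pos
    simp only [height_node] at hH
    have hg : (Tree.set (node h l k' r) k v).Good := by
      refine hs.ok.good fun h0 => ?_
      have := hs.le_height
      simp only [height_node] at this
      omega
    simp only [Tree.set] at hg
    simp only [path, bottom]
    split_ifs at hg ⊢ with c
    · refine rebuildable_append (ihl gl (by omega)) ?_
      rw [← set_eq_foldl]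
      have := sets_set (Or.inr gl) k v
      have := this.height_le
      exact ⟨⟨h, l, k', r, rfl⟩, ht', (sets_set (Or.inr gl) k v).ok, hH, by omega, hg⟩
    · refine rebuildable_append (ihr gr (by omega)) ?_
      rw [← set_eq_foldl]
      have := (sets_set (Or.inr gr) k v).height_le
      exact ⟨⟨h, l, k', r, rfl⟩, ht', (sets_set (Or.inr gr) k v).ok, hH, by omega, hg⟩

/-- The second loop of `setP`: walk up the search path and rebuild the tree. -/
def ascend : Prog := .loop (.lt 21 24)
  (.seq (seqs [.sub 24 24 20, .load 22 24])
  (.seq (loads 22 [14, 16, 17, 18, 19])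
  (.seq (ifLess (seqs [.move 25 10, .move 26 16, .move 27 17, .move 28 19])
      (seqs [.move 25 18, .move 26 16, .move 27 17, .move 28 10])) balP)))

theorem runs_ascend {H : ℕ} (hH : H + 4 < 2 ^ w) {fs : List (Tree Key)} {new : Tree Key} {s : State}
    (h20 : s.reg 20 = 1) (hk : k = toLex (s.reg 11, s.reg 12))
    (hf : s.reg 3 + 15 * fs.length < 2 ^ w) (h24 : s.reg 24 = s.reg 21 + fs.length)
    (hb : s.reg 21 + fs.length ≤ s.reg 3) (hS : StackAt s.mem (s.reg 3) (s.reg 21) fs)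
    (hT : TreeAt s.mem (s.reg 3) new (s.reg 10)) (hR : Rebuildable H k fs new) :
    Runs w ascend s fun n s' => n ≤ 140 * fs.length + 1 ∧ Ext s s' ∧
      s'.reg 3 ≤ s.reg 3 + 15 * fs.length ∧
      TreeAt s'.mem (s'.reg 3) (fs.foldl (fun n f => graft k f n) new) (s'.reg 10) ∧
      ∀ x, x ≠ 3 → x < 10 ∨ 45 ≤ x → s'.reg x = s.reg x := by
  induction fs generalizing s new with
  | nil =>
    refine Runs.loop_done ?_ ⟨by simp, Ext.refl _, by simp, hT, fun _ _ _ => rfl⟩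
    simp [Test.Holds, h24]
  | cons f fs ih =>
    simp only [List.length_cons] at hf h24 hb
    obtain ⟨hG, hR⟩ := hR
    obtain ⟨hS1, hS⟩ := hS
    refine Runs.loop_step (by simp only [Test.Holds]; omega) (Runs.seq ?_)
    have B : Runs w (seqs [.sub 24 24 20, .load 22 24]) s fun n s₁ => n ≤ 2 ∧ s₁.mem = s.mem ∧
        s₁.space ≤ max s.space (s.reg 3) ∧ s₁.reg 24 = s.reg 21 + fs.length ∧
        s₁.reg 22 = s.mem (s.reg 21 + fs.length) ∧ ∀ x, x ≠ 22 → x ≠ 24 → s₁.reg x = s.reg x := by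
      refine Runs.straight (c := 2) (by simp [seqs, Prog.Straight]) (by simp [seqs, Prog.cost])
        fun n hn => ?_
      have e : (s.reg 24 + 2 ^ w - s.reg 20) % 2 ^ w = s.reg 21 + fs.length := by
        rw [h20, h24, show s.reg 21 + (fs.length + 1) + 2 ^ w - 1 = s.reg 21 + fs.length + 2 ^ w by
          omega, Nat.add_mod_right, Nat.mod_eq_of_lt (by omega)]
      refine ⟨hn, rfl, ?_, ?_, ?_, fun x h1 h2 => ?_⟩
      · simp only [seqs, Prog.eval, set_space, touch_space, set_reg, if_true, e]; omega
      · simp [seqs, Prog.eval, set_reg, touch_reg, e]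
      · simp [seqs, Prog.eval, set_reg, set_mem, e]
      · simp [seqs, Prog.eval, set_reg, touch_reg, h1, h2]
    refine B.mono ?_
    rintro n₁ s₁ ⟨a1, a2, a3, a4, a5, a6⟩
    have e3 := a6 3 (by norm_num) (by norm_num)
    rw [← a5, ← a2, ← e3] at hS1
    refine Runs.seq ((runs_loadTree hS1 (by rw [a6 20 (by norm_num) (by norm_num), h20])
      (by omega)).mono ?_)
    rintro n₂ s₂ ⟨b1, b2, b3, b4, b5⟩
    have e3' : s₂.reg 3 = s.reg 3 := by rw [b5 3 (by decide), e3]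
    have em : s₂.mem = s.mem := b2.trans a2
    have fr2 : ∀ x, x ∉ [14, 16, 17, 18, 19, 22, 24, 44] → s₂.reg x = s.reg x := by
      intro x hx
      simp only [List.mem_cons, List.not_mem_nil, or_false, not_or] at hx
      rw [b5 x (by simp; omega), a6 x (by omega) (by omega)]
    have E2 : Ext s s₂ := ⟨e3'.ge, fun a _ => by rw [em], by omega⟩
    rw [a2, e3, ← em, ← e3'] at b4
    rw [← em, ← e3', ← fr2 10 (by decide)] at hT
    have hk' : k = toLex (s₂.reg 11, s₂.reg 12) := by
      rw [fr2 11 (by decide), fr2 12 (by decide), hk]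
    obtain ⟨⟨h, l, k', r, rfl⟩, hG1, hG2, hG3, hG4, hG5⟩ := hG
    obtain ⟨c1, c2, c3⟩ := b4.node _ _ _ _ rfl
    obtain ⟨gl, gr, e, -⟩ := hG1
    simp only [height_node] at hG3
    -- After the branch the arguments of `balP` are in place.
    have C : Runs w (ifLess (seqs [.move 25 10, .move 26 16, .move 27 17, .move 28 19])
        (seqs [.move 25 18, .move 26 16, .move 27 17, .move 28 10])) s₂ fun n s₃ => n ≤ 7 ∧
        s₃.mem = s₂.mem ∧ s₃.space = s₂.space ∧ (∃ tl tr, TreeAt s₃.mem (s₃.reg 3) tl (s₃.reg 25) ∧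
          TreeAt s₃.mem (s₃.reg 3) tr (s₃.reg 28) ∧ tl.Ok ∧ tr.Ok ∧ tl.height ≤ H ∧
          tr.height ≤ H ∧ bal tl k' tr = graft k (node h l k' r) new) ∧
        k' = toLex (s₃.reg 26, s₃.reg 27) ∧
        ∀ x, x < 25 ∨ 28 < x → s₃.reg x = s₂.reg x := by
      refine runs_ifLess hk' c1 (fun c => ?_) fun c => ?_
      all_goals
        refine Runs.straight (c := 4) (by simp [seqs, Prog.Straight]) (by simp [seqs, Prog.cost])
          fun n hn e' he => ⟨by omega, rfl, rfl, ?_, ?_, fun x hx => ?_⟩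
      · refine ⟨new, r, ?_, ?_, hG2, Or.inr gr, hG4, by omega, by simp [graft, c]⟩
        · simpa [seqs, Prog.eval, set_reg, set_mem] using hT
        · simpa [seqs, Prog.eval, set_reg, set_mem] using c3
      · simpa [seqs, Prog.eval, set_reg, set_mem] using c1
      · simp only [seqs, Prog.eval, set_reg]
        repeat rw [if_neg (by omega)]
      · refine ⟨l, new, ?_, ?_, Or.inr gl, hG2, by omega, hG4, by simp [graft, c]⟩
        · simpa [seqs, Prog.eval, set_reg, set_mem] using c2
        · simpa [seqs, Prog.eval, set_reg, set_mem] using hT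
      · simpa [seqs, Prog.eval, set_reg, set_mem] using c1
      · simp only [seqs, Prog.eval, set_reg]
        repeat rw [if_neg (by omega)]
    refine Runs.seq (C.mono ?_)
    rintro n₃ s₃ ⟨d1, d2, d3, ⟨tl, tr, d4, d5, d6, d7, d8, d9, d10⟩, d11, d12⟩
    have e3'' : s₃.reg 3 = s.reg 3 := by rw [d12 3 (by norm_num), e3']
    rw [← d10] at hG5 hR
    refine (runs_balP d4 d5 d11 (by rw [d12 20 (by norm_num), fr2 20 (by decide), h20])
      (by omega) d6 d7 (by omega) (by omega) hG5).mono ?_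
    intro n₄ s₄ J
    have E3 : Ext s s₃ := E2.trans ⟨by omega, fun a _ => by rw [d2], by omega⟩
    have E4 := E3.trans J.ext
    have fr4 : ∀ x, x ≠ 3 → x < 10 ∨ x = 11 ∨ x = 12 ∨ x = 20 ∨ x = 21 ∨ 45 ≤ x →
        s₄.reg x = s.reg x := by
      intro x h3 hx
      rw [J.frame x h3 (by omega) (by omega), d12 x (by omega), fr2 x (by simp; omega)]
    have e24 : s₄.reg 24 = s.reg 21 + fs.length := by
      rw [J.frame 24 (by omega) (by omega) (by omega), d12 24 (by omega), b5 24 (by decide), a4]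
    have e21 := fr4 21 (by norm_num) (by norm_num)
    have hfp := J.fp
    have ht := J.time
    have := E4.fp
    refine (ih (by rw [fr4 20 (by norm_num) (by norm_num), h20]) (by
      rw [fr4 11 (by norm_num) (by norm_num), fr4 12 (by norm_num) (by norm_num), hk])
      (by omega) (by omega) (by omega) ?_ J.tree hR).mono ?_
    · rw [e21]
      exact hS.mono E4.mem E4.fp (by omega)
    · rintro n₅ s₅ ⟨f1, f2, f3, f4, f5⟩
      refine ⟨by simp only [List.length_cons]; omega, E4.trans f2, by
        simp only [List.length_cons]; omega, ?_, fun x h1 h2 => ?_⟩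
      · rw [List.foldl_cons, ← d10]; exact f4
      · rw [f5 x h1 h2, fr4 x h1 (by omega)]

/-- The middle part of `setP`: the leaf or the empty tree in register 22, whose fields have been
loaded, is replaced; register 10 holds the new leaf or 0. -/
def graftLeaf : Prog :=
  .ite (.eq 14 15) .skip
  (.ite (.eq 11 16) (.ite (.eq 12 17) .skip graftLeaf') graftLeaf')
where
  /-- The new leaf is joined with a leaf that has a different key. -/
  graftLeaf' : Prog := .seq (ifLess (seqs [.move 25 10, .move 26 16, .move 27 17, .move 28 22])
    (seqs [.move 25 22, .move 26 11, .move 27 12, .move 28 10])) balP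

theorem runs_graftLeaf {t : Tree Key} {v : ℕ} (h20 : st.reg 20 = 1) (hw : st.reg 3 + 15 < 2 ^ w)
    (h15 : st.reg 15 = 0) (hk : k = toLex (st.reg 11, st.reg 12)) (ht : t.Ok)
    (htb : t = .nil ∨ ∃ k' v, t = .leaf k' v) (hL : Loaded st.mem (st.reg 3) t st)
    (hT : TreeAt st.mem (st.reg 3) t (st.reg 22))
    (hN : TreeAt st.mem (st.reg 3) (single k v) (st.reg 10)) :
    Runs w graftLeaf st (JoinPost st (graft k t (single k v)) 130) := by
  have hw5 : 6 ≤ 2 ^ w := by have := hT.add_five_le; omega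
  have hsh : (single k v).height ≤ 1 := by unfold single; split_ifs <;> simp [height]
  have hsk : Runs w .skip st (fun n s => n ≤ 1 ∧ s = st) := ⟨_, _, .skip _, le_rfl, rfl⟩
  have post : ∀ n ≤ 130, JoinPost st (single k v) 130 n st := fun n hn =>
    ⟨hn, Ext.refl _, by omega, hN, fun _ _ _ _ => rfl⟩
  rcases htb with rfl | ⟨k', v', rfl⟩
  · refine Runs.ite (fun _ => hsk.mono ?_) fun c => absurd ?_ c
    · rintro n s ⟨hn, rfl⟩
      exact post _ (by omega)
    · simp [Test.Holds, h15, hL.height, height]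
  obtain ⟨hk', -⟩ := hL.leaf _ _ rfl
  have hgl : (Tree.leaf k' v').Good := ht.good (by simp [height])
  have hs0 := sets_graft_leaf (k := k) (k' := k') (v := v) (v' := v') hgl
  refine Runs.ite (fun c => absurd c ?_) fun _ => ?_
  · simp [Test.Holds, h15, hL.height, height]
  have main : k ≠ k' → Runs w graftLeaf.graftLeaf' st
      fun n s => ∀ e ≤ 3, JoinPost st (graft k (.leaf k' v') (single k v)) 130 (e + n) s := by
    intro hne
    have C : Runs w (ifLess (seqs [.move 25 10, .move 26 16, .move 27 17, .move 28 22])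
        (seqs [.move 25 22, .move 26 11, .move 27 12, .move 28 10])) st fun n s₃ => n ≤ 7 ∧
        s₃.mem = st.mem ∧ s₃.space = st.space ∧
        (∃ tl k₁ tr, TreeAt s₃.mem (s₃.reg 3) tl (s₃.reg 25) ∧
          TreeAt s₃.mem (s₃.reg 3) tr (s₃.reg 28) ∧ tl.Ok ∧ tr.Ok ∧ tl.height ≤ 1 ∧
          tr.height ≤ 1 ∧ bal tl k₁ tr = graft k (.leaf k' v') (single k v) ∧
        k₁ = toLex (s₃.reg 26, s₃.reg 27)) ∧
        ∀ x, x < 25 ∨ 28 < x → s₃.reg x = st.reg x := by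
      refine runs_ifLess hk hk' (fun c => ?_) fun c => ?_
      all_goals
        refine Runs.straight (c := 4) (by simp [seqs, Prog.Straight]) (by simp [seqs, Prog.cost])
          fun n hn e' he => ⟨by omega, rfl, rfl, ?_, fun x hx => ?_⟩
      · refine ⟨single k v, k', .leaf k' v', ?_, ?_, (sets_single k v).ok, Or.inr hgl, hsh,
          by simp [height], by simp [graft, c, hne], ?_⟩
        · simpa [seqs, Prog.eval, set_reg, set_mem] using hN
        · simpa [seqs, Prog.eval, set_reg, set_mem] using hT
        · simpa [seqs, Prog.eval, set_reg, set_mem] using hk'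
      · simp only [seqs, Prog.eval, set_reg]
        repeat rw [if_neg (by omega)]
      · refine ⟨.leaf k' v', k, single k v, ?_, ?_, Or.inr hgl, (sets_single k v).ok,
          by simp [height], hsh, by simp [graft, c, hne], ?_⟩
        · simpa [seqs, Prog.eval, set_reg, set_mem] using hT
        · simpa [seqs, Prog.eval, set_reg, set_mem] using hN
        · simpa [seqs, Prog.eval, set_reg, set_mem] using hk
      · simp only [seqs, Prog.eval, set_reg]
        repeat rw [if_neg (by omega)]
    refine Runs.seq (C.mono ?_)
    rintro n₃ s₃ ⟨d1, d2, d3, ⟨tl, k₁, tr, d4, d5, d6, d7, d8, d9, d10, d11⟩, d12⟩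
    have e3 : s₃.reg 3 = st.reg 3 := d12 3 (by norm_num)
    refine (runs_balP d4 d5 d11 (by rw [d12 20 (by norm_num), h20])
      (by omega) d6 d7 (by omega) (by omega) ?_).mono ?_
    · rw [d10]
      have : k ∈ (graft k (.leaf k' v') (single k v)).keys ∨
          k' ∈ (graft k (.leaf k' v') (single k v)).keys := by
        right
        rw [← hs0.ok.get_ne_zero_iff, hs0.get, if_neg hne.symm]
        simp only [Tree.get, if_true]
        exact hgl
      refine hs0.ok.resolve_left fun h0 => ?_
      rw [h0] at this
      simp [Tree.keys] at this
    · intro n s J e he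
      have hJ := J.time
      have := J.fp
      rw [d10] at J
      refine ⟨by omega, Ext.trans ⟨e3.ge, fun a _ => by rw [d2], by omega⟩ J.ext, by omega, J.tree,
        fun x h1 h2 h3 => ?_⟩
      rw [J.frame x h1 h2 h3, d12 x (by omega)]
  refine Runs.ite (fun c1 => Runs.ite (fun c2 => ?_) fun c2 => ?_) fun c1 => ?_ <;>
    simp only [Test.Holds] at *
  · refine hsk.mono ?_
    rintro n s ⟨hn, rfl⟩
    have : k = k' := by rw [hk, hk', c1, c2]
    simp only [graft, if_pos this]
    exact post _ (by omega)
  · refine (main ?_).mono fun n s h => ?_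
    · rw [hk, hk']
      intro h
      simp only [EmbeddingLike.apply_eq_iff_eq, Prod.mk.injEq] at h
      exact c2 h.2
    · rw [← Nat.add_assoc, ← Nat.add_assoc]; exact h _ (by omega)
  · refine (main ?_).mono fun n s h => ?_
    · rw [hk, hk']
      intro h
      simp only [EmbeddingLike.apply_eq_iff_eq, Prod.mk.injEq] at h
      exact c1 h.1
    · rw [← Nat.add_assoc]; exact h _ (by omega)

end Eer

namespace Eer

open WordRAM _root_.Eer.Tree

variable {w : ℕ} {st : State} {k k' : Key}

/-- Set the value of the key in the registers 11 and 12 in the tree in register 10 to the value in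
register 13; the new tree is returned in register 10. -/
def setP : Prog :=
  .seq (seqs [.const 20 1, .move 21 3])
  (.seq (loads 10 [14, 16, 17, 18, 19])
  (.seq descend
  (.seq (seqs [.move 24 3, .move 22 10, .const 10 0, .const 15 0])
  (.seq (.ite (.eq 13 15) .skip (alloc 10 [20, 11, 12, 13, 13]))
  (.seq graftLeaf ascend)))))

/-- A key is changed in logarithmic time and space, and the old tree remains intact: only cells from
the first free address on are written. -/
theorem runs_setP {t : Tree Key} {v : ℕ} (ht : TreeAt st.mem (st.reg 3) t (st.reg 10)) (ho : t.Ok)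
    (h0 : TreeAt st.mem (st.reg 3) .nil 0) (hf : st.reg 3 + 16 * t.height + 30 < 2 ^ w)
    (hk : k = toLex (st.reg 11, st.reg 12))
    (hv : v = st.reg 13) :
    Runs w setP st fun n s => n ≤ 160 * t.height + 200 ∧ Ext st s ∧
      s.reg 3 ≤ st.reg 3 + 16 * t.height + 20 ∧
      TreeAt s.mem (s.reg 3) (t.set k v) (s.reg 10) ∧
      ∀ x, x ≠ 3 → x < 10 ∨ 45 ≤ x → s.reg x = st.reg x := by
  have h5 := ht.add_five_le
  have m1 : 1 % 2 ^ w = 1 := Nat.mod_eq_of_lt (by omega)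
  have B : Runs w (seqs [.const 20 1, .move 21 3]) st fun n s => n ≤ 2 ∧ s.mem = st.mem ∧
      s.space = st.space ∧ s.reg 20 = 1 ∧ s.reg 21 = st.reg 3 ∧
      ∀ x, x ≠ 20 → x ≠ 21 → s.reg x = st.reg x := by
    refine Runs.straight (c := 2) (by simp [seqs, Prog.Straight]) (by simp [seqs, Prog.cost])
      fun n hn => ?_
    simp +contextual [seqs, Prog.eval, set_reg, set_mem, set_space, hn, m1]
  refine Runs.seq (B.mono ?_)
  rintro n₀ s₀ ⟨a1, a2, a3, a4, a5, a6⟩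
  have e3 := a6 3 (by norm_num) (by norm_num)
  rw [← a2, ← e3, ← a6 10 (by norm_num) (by norm_num)] at ht
  refine Runs.seq ((runs_loadTree ht a4 (by omega)).mono ?_)
  rintro n₁ s₁ ⟨b1, b2, b3, b4, b5⟩
  have e3' : s₁.reg 3 = st.reg 3 := by rw [b5 3 (by decide), e3]
  rw [b5 3 (by decide) |>.symm, b5 10 (by decide) |>.symm, ← b2] at ht
  rw [b5 3 (by decide) |>.symm, ← b2] at b4
  have fr1 : ∀ x, x ∉ [14, 16, 17, 18, 19, 20, 21, 44] → s₁.reg x = st.reg x := by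
    intro x hx
    simp only [List.mem_cons, List.not_mem_nil, or_false, not_or] at hx
    rw [b5 x (by simp; omega), a6 x (by omega) (by omega)]
  have E1 : Ext st s₁ := ⟨e3'.ge, fun a _ => by rw [b2, a2], by omega⟩
  have h20 : s₁.reg 20 = 1 := by rw [b5 20 (by decide), a4]
  have h21 : s₁.reg 21 = st.reg 3 := by rw [b5 21 (by decide), a5]
  have hk1 : k = toLex (s₁.reg 11, s₁.reg 12) := by
    rw [fr1 11 (by decide), fr1 12 (by decide), hk]
  have D : Runs w descend s₁ fun n s' => n ≤ 20 * t.height + 1 ∧ Ext s₁ s' ∧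
        s'.reg 3 = st.reg 3 + (t.path k).length ∧ (t.path k).length ≤ t.height ∧
        StackAt s'.mem (s'.reg 3) (st.reg 3) (t.path k) ∧
        TreeAt s'.mem (s'.reg 3) (t.bottom k) (s'.reg 10) ∧
        Loaded s'.mem (s'.reg 3) (t.bottom k) s' ∧
        ∀ x, x ∉ [3, 10, 14, 16, 17, 18, 19, 44] → s'.reg x = s₁.reg x := by
    rcases ho with rfl | hg
    · refine Runs.loop_done ?_ ⟨by omega, Ext.refl _, by simp [path, e3'], by simp [path], trivial,
        ht, b4, fun _ _ => rfl⟩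
      simp [Test.Holds, h20, b4.height, height]
    · refine (runs_descend h20 hk1 hg (by omega) (fs := []) (base := st.reg 3)
        (by simp [e3']) trivial ht b4).mono ?_
      rintro n s ⟨c1, c2, c3, c4, c5, c6, c7, c8⟩
      rw [List.append_nil] at c3 c5
      exact ⟨by omega, c2, c3, by omega, c5, c6, c7, c8⟩
  refine Runs.seq (D.mono ?_)
  rintro n₂ s₂ ⟨c1, c2, c3, c4, c5, c6, c7, c8⟩
  have fr2 : ∀ x, x ∉ [3, 10, 14, 16, 17, 18, 19, 20, 21, 44] → s₂.reg x = st.reg x := by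
    intro x hx
    simp only [List.mem_cons, List.not_mem_nil, or_false, not_or] at hx
    rw [c8 x (by simp; omega), fr1 x (by simp; omega)]
  have C : Runs w (seqs [.move 24 3, .move 22 10, .const 10 0, .const 15 0]) s₂ fun n s => n ≤ 4 ∧
      s.mem = s₂.mem ∧ s.space = s₂.space ∧ s.reg 24 = s₂.reg 3 ∧ s.reg 22 = s₂.reg 10 ∧
      s.reg 10 = 0 ∧ s.reg 15 = 0 ∧
      ∀ x, x ∉ [10, 15, 22, 24] → s.reg x = s₂.reg x := by
    refine Runs.straight (c := 4) (by simp [seqs, Prog.Straight]) (by simp [seqs, Prog.cost])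
      fun n hn => ?_
    simp +contextual [seqs, Prog.eval, set_reg, set_mem, set_space, hn]
  refine Runs.seq (C.mono ?_)
  rintro n₃ s₃ ⟨d1, d2, d3, d4, d5, d6, d7, d8⟩
  have e33 : s₃.reg 3 = s₂.reg 3 := d8 3 (by decide)
  have E3 : Ext st s₃ := (E1.trans c2).trans ⟨e33.ge, fun a _ => by rw [d2], by omega⟩
  have h20' : s₃.reg 20 = 1 := by rw [d8 20 (by decide), c8 20 (by decide), h20]
  have h13 : s₃.reg 13 = v := by rw [d8 13 (by decide), fr2 13 (by decide), hv]
  rw [← d2, ← e33] at c5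
  rw [← d2, ← e33, ← d5] at c6
  have c7' : Loaded s₃.mem (s₃.reg 3) (t.bottom k) s₃ := by
    rw [d2, e33]
    exact ⟨by rw [d8 14 (by decide)]; exact c7.height,
      by rw [d8 16 (by decide), d8 17 (by decide), d8 18 (by decide)]; exact c7.leaf,
      by rw [d8 18 (by decide)]; exact c7.nil,
      by rw [d8 16 (by decide), d8 17 (by decide), d8 18 (by decide), d8 19 (by decide)]
         exact c7.node⟩
  -- The new leaf. If it is empty, the null pointer represents the empty tree.
  have A : Runs w (.ite (.eq 13 15) .skip (alloc 10 [20, 11, 12, 13, 13])) s₃ fun n s => n ≤ 15 ∧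
      Ext s₃ s ∧ s.reg 3 ≤ s₃.reg 3 + 5 ∧
      TreeAt s.mem (s.reg 3) (single k v) (s.reg 10) ∧
      ∀ x, x ∉ [3, 10, 44] → s.reg x = s₃.reg x := by
    refine Runs.ite (fun c => ?_) fun c => ?_
    · simp only [Test.Holds, h13, d7] at c
      refine ⟨_, _, .skip _, by omega, Ext.refl _, by omega, ?_, fun _ _ => rfl⟩
      rw [single, if_pos c, d6]
      exact h0.ext E3
    · simp only [Test.Holds, h13, d7] at c
      refine (runs_alloc h20' (by simp; omega) (by decide) (by decide)).mono ?_
      rintro n s ⟨f1, f2, f3, f4, f5, f6, -⟩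
      simp only [List.length_cons, List.length_nil] at f1 f3 f6
      refine ⟨by omega, f2, by omega, ?_, fun x hx => ?_⟩
      · rw [f4]
        have g0 := f6 0 (by norm_num)
        have g1 := f6 1 (by norm_num)
        have g2 := f6 2 (by norm_num)
        have g3 := f6 3 (by norm_num)
        simp only [List.getElem_cons_zero, List.getElem_cons_succ, Nat.add_zero] at g0 g1 g2 g3
        simp only [single, if_neg c]
        have hkk : k = toLex (s₃.reg 11, s₃.reg 12) := by
          rw [d8 11 (by decide), d8 12 (by decide), fr2 11 (by decide), fr2 12 (by decide), hk]
        rw [hkk]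
        exact ⟨by omega, by omega, g0.trans h20', g1, g2, g3.trans h13⟩
      · simp only [List.mem_cons, List.not_mem_nil, or_false, not_or] at hx
        exact f5 x hx.1 hx.2.2 hx.2.1
  refine Runs.seq (A.mono ?_)
  rintro n₄ s₄ ⟨f1, f2, f3, f4, f6⟩
  have E4 := E3.trans f2
  have fr4 : ∀ x, x < 3 ∨ (4 ≤ x ∧ x < 10) ∨ x = 11 ∨ x = 12 ∨ 45 ≤ x → s₄.reg x = st.reg x := by
    intro x hx
    rw [f6 x (by simp; omega), d8 x (by simp; omega), fr2 x (by simp; omega)]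
  have hk4 : k = toLex (s₄.reg 11, s₄.reg 12) := by
    rw [fr4 11 (by norm_num), fr4 12 (by norm_num), hk]
  have h20'' : s₄.reg 20 = 1 := by rw [f6 20 (by decide), h20']
  have hfp4 := f2.fp
  have e10 : s₄.reg 22 = s₃.reg 22 := f6 22 (by decide)
  rw [← e10] at c6
  have L4 : Loaded s₄.mem (s₄.reg 3) (t.bottom k) s₄ := by
    refine ⟨by rw [f6 14 (by decide)]; exact c7'.height, ?_, ?_, ?_⟩
    · rw [f6 16 (by decide), f6 17 (by decide), f6 18 (by decide)]; exact c7'.leaf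
    · rw [f6 18 (by decide)]; exact c7'.nil
    · intro h l k' r e
      rw [f6 16 (by decide), f6 17 (by decide), f6 18 (by decide), f6 19 (by decide)]
      obtain ⟨x1, x2, x3⟩ := c7'.node h l k' r e
      exact ⟨x1, x2.ext f2, x3.ext f2⟩
  have hbok : (t.bottom k).Ok := by
    rcases ho with rfl | hg
    · exact Or.inl rfl
    · exact Or.inr (hg.bottom k)
  refine Runs.seq ((runs_graftLeaf h20'' (by omega) (by rw [f6 15 (by decide), d7]) hk4 hbok
    (Tree.bottom_cases t k) L4 (c6.ext f2) f4).mono ?_)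
  intro n₅ s₅ J
  have hJ := J.time
  have hJf := J.fp
  have E5 := E4.trans J.ext
  have hfp5 := J.ext.fp
  have fr5 : ∀ x, x < 3 ∨ (4 ≤ x ∧ x < 10) ∨ x = 11 ∨ x = 12 ∨ 45 ≤ x → s₅.reg x = st.reg x := by
    intro x hx
    rw [J.frame x (by omega) (by omega) (by omega), fr4 x hx]
  have e21 : s₅.reg 21 = st.reg 3 := by
    rw [J.frame 21 (by decide) (by decide) (by decide), f6 21 (by decide), d8 21 (by decide),
      c8 21 (by decide), h21]
  have e24 : s₅.reg 24 = st.reg 3 + (t.path k).length := by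
    rw [J.frame 24 (by decide) (by decide) (by decide), f6 24 (by decide), d4, c3]
  have hR : Rebuildable t.height k (t.path k) (graft k (t.bottom k) (single k v)) := by
    rcases ho with rfl | hg
    · trivial
    · exact rebuildable_path hg v le_rfl
  refine (runs_ascend (H := t.height) (by omega) (fs := t.path k)
    (by rw [J.frame 20 (by decide) (by decide) (by decide), h20''])
    (by rw [fr5 11 (by norm_num), fr5 12 (by norm_num), hk]) (by omega) (by omega) (by omega)
    ?_ J.tree hR).mono ?_
  · rw [e21]
    exact (c5.mono f2.mem f2.fp (by omega)).mono J.ext.mem J.ext.fp (by omega)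
  · rintro n₆ s₆ ⟨g1, g2, g3, g4, g5⟩
    refine ⟨by omega, E5.trans g2, by omega, ?_, fun x h3 hx => ?_⟩
    · rw [set_eq_foldl]; exact g4
    · rw [g5 x h3 hx, fr5 x (by omega)]

end Eer

namespace Eer

open WordRAM _root_.Eer.Tree

variable {w : ℕ} {st : State}

/-- The integer `z` modulo `2 ^ w`, as a word. -/
def word (w : ℕ) (z : ℤ) : ℕ := (z % 2 ^ w).toNat

theorem word_lt (w : ℕ) (z : ℤ) : word w z < 2 ^ w := by
  have : (0 : ℤ) < 2 ^ w := by positivity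
  have h1 := Int.emod_nonneg z this.ne'
  have h2 := Int.emod_lt_of_pos z this
  unfold word
  zify
  omega

theorem natCast_word (w : ℕ) (z : ℤ) : (word w z : ℤ) = z % 2 ^ w :=
  Int.toNat_of_nonneg (Int.emod_nonneg _ (by positivity))

theorem word_natCast {n : ℕ} (h : n < 2 ^ w) : word w n = n := by
  zify
  rw [natCast_word, Int.emod_eq_of_lt (by positivity) (by exact_mod_cast h)]

theorem word_add (x y : ℤ) : (word w x + word w y) % 2 ^ w = word w (x + y) := by
  zify
  rw [natCast_word, natCast_word, natCast_word, ← Int.add_emod]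

theorem word_sub (x y : ℤ) : (word w x + 2 ^ w - word w y) % 2 ^ w = word w (x - y) := by
  have := word_lt w y
  zify [(by omega : word w y ≤ word w x + 2 ^ w)]
  rw [natCast_word, natCast_word, natCast_word, Int.sub_emod, Int.add_emod_right, Int.emod_emod,
    Int.emod_emod, ← Int.sub_emod]

theorem word_inj {x y : ℤ} (h : word w x = word w y) (h1 : x - y < 2 ^ w) (h2 : y - x < 2 ^ w) :
    x = y := by
  zify at h
  rw [natCast_word, natCast_word] at h
  have h3 : (2 ^ w : ℤ) ∣ x - y :=
    Int.dvd_of_emod_eq_zero (Int.emod_eq_emod_iff_emod_sub_eq_zero.1 h)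
  have := Int.eq_zero_of_abs_lt_dvd h3 (by rw [abs_lt]; omega)
  omega

/-! ### Maps in memory -/

/-- `f` with the value at `a`, `b` changed to `v`. -/
def fset (f : ℕ → ℕ → ℕ) (a b v : ℕ) : ℕ → ℕ → ℕ :=
  fun a' b' => if a' = a ∧ b' = b then v else f a' b'

/-- `f` has at most `N` nonzero values. -/
def Supp (f : ℕ → ℕ → ℕ) (N : ℕ) : Prop :=
  ∃ S : Finset (ℕ × ℕ), S.card ≤ N ∧ ∀ a b, f a b ≠ 0 → (a, b) ∈ S

/-- `p` points to a search tree for the map `f`; keys that are absent have the value 0. -/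
def MapAt (M : ℕ → ℕ) (fp : ℕ) (f : ℕ → ℕ → ℕ) (p : ℕ) : Prop :=
  ∃ t : Tree Key, t.Ok ∧ TreeAt M fp t p ∧ ∀ a b, f a b = t.get (toLex (a, b))

theorem MapAt.mono {M M' : ℕ → ℕ} {fp fp' : ℕ} (hM : ∀ a < fp, M' a = M a) (hf : fp ≤ fp')
    {f : ℕ → ℕ → ℕ} {p : ℕ} (h : MapAt M fp f p) : MapAt M' fp' f p := by
  obtain ⟨t, h1, h2, h3⟩ := h
  exact ⟨t, h1, h2.mono hM hf, h3⟩

theorem Supp.fset {f : ℕ → ℕ → ℕ} {N : ℕ} (h : Supp f N) (a b v : ℕ) :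
    Supp (fset f a b v) (N + 1) := by
  classical
  obtain ⟨S, h1, h2⟩ := h
  refine ⟨insert (a, b) S, (Finset.card_insert_le _ _).trans (by omega), fun a' b' h' => ?_⟩
  unfold Eer.fset at h'
  split_ifs at h' with c
  · simp [c]
  · exact Finset.mem_insert_of_mem (h2 _ _ h')

theorem Supp.mono {f : ℕ → ℕ → ℕ} {N N' : ℕ} (h : Supp f N) (hN : N ≤ N') : Supp f N' := by
  obtain ⟨S, h1, h2⟩ := h
  exact ⟨S, h1.trans hN, h2⟩

/-- A bound on the height of trees with at most `N` leaves. -/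
def hgt (N : ℕ) : ℕ := 2 * Nat.log 2 N + 2

theorem height_le_hgt {t : Tree Key} (ho : t.Ok) {f : ℕ → ℕ → ℕ}
    (hf : ∀ a b, f a b = t.get (toLex (a, b))) {N : ℕ} (h : Supp f N) : t.height ≤ hgt N := by
  rcases ho with rfl | hg
  · simp [height]
  · obtain ⟨S, h1, h2⟩ := h
    refine hg.height_le (le_trans ?_ h1)
    refine Finset.card_le_card_of_injOn ofLex (fun x hx => ?_) (fun _ _ _ _ h => ofLex_inj.1 h)
    exact h2 _ _ (by rw [hf]; exact (hg.get_ne_zero_iff _).2 hx)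

theorem mapAt_zero {M : ℕ → ℕ} {fp : ℕ} (h : TreeAt M fp .nil 0) : MapAt M fp (fun _ _ => 0) 0 :=
  ⟨.nil, Or.inl rfl, h, fun _ _ => rfl⟩

/-- `out ← ` the value of the map in register `i` at the key in the registers `k₁` and `k₂`. -/
def getM (out i k₁ k₂ : ℕ) : Prog :=
  .seq (seqs [.move 10 i, .move 11 k₁, .move 12 k₂]) (.seq getP (.move out 13))

/-- Change the map in register `i` at the key in the registers `k₁` and `k₂` to the value in
register `v`. -/
def setM (i k₁ k₂ v : ℕ) : Prog :=
  .seq (seqs [.move 10 i, .move 11 k₁, .move 12 k₂, .move 13 v]) (.seq setP (.move i 10))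

/-- `out ← ` the cell `k` of the record in register `a`. -/
def loadM (out a k : ℕ) : Prog := seqs [.const 45 k, .add 45 45 a, .load out 45]

/-- Looking up a key of a map takes logarithmic time, and nothing is written to the memory. -/
theorem runs_getM {out i k₁ k₂ N : ℕ} {f : ℕ → ℕ → ℕ} (hf : MapAt st.mem (st.reg 3) f (st.reg i))
    (hN : Supp f N) (hw : st.reg 3 < 2 ^ w) (h1 : 45 ≤ k₁) (h2 : 45 ≤ k₂) (ho : 45 ≤ out) :
    Runs w (getM out i k₁ k₂) st fun n s => n ≤ 20 * hgt N + 24 ∧ s.mem = st.mem ∧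
      s.space ≤ max st.space (st.reg 3) ∧ s.reg out = f (st.reg k₁) (st.reg k₂) ∧
      ∀ x, x = 3 ∨ 45 ≤ x → x ≠ out → s.reg x = st.reg x := by
  obtain ⟨t, t1, t2, t3⟩ := hf
  have hh := height_le_hgt t1 t3 hN
  have n1 : k₁ ≠ 10 := by omega
  have n2 : k₂ ≠ 10 ∧ k₂ ≠ 11 := by omega
  have B : Runs w (seqs [.move 10 i, .move 11 k₁, .move 12 k₂]) st fun n s => n ≤ 3 ∧
      s.mem = st.mem ∧ s.space = st.space ∧ s.reg 10 = st.reg i ∧ s.reg 11 = st.reg k₁ ∧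
      s.reg 12 = st.reg k₂ ∧ ∀ x, x ≠ 10 → x ≠ 11 → x ≠ 12 → s.reg x = st.reg x := by
    refine Runs.straight (c := 3) (by simp [seqs, Prog.Straight]) (by simp [seqs, Prog.cost])
      fun n hn => ⟨hn, rfl, rfl, ?_, ?_, ?_, fun x x1 x2 x3 => ?_⟩
    · simp [seqs, Prog.eval, set_reg]
    · simp [seqs, Prog.eval, set_reg, n1]
    · simp [seqs, Prog.eval, set_reg, n2]
    · simp [seqs, Prog.eval, set_reg, x1, x2, x3]
  refine Runs.seq (B.mono ?_)
  rintro n s ⟨b1, b2, b3, b4, b5, b6, b7⟩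
  have e3 := b7 3 (by norm_num) (by norm_num) (by norm_num)
  refine Runs.seq ((runs_getP (t := t) (by rw [b2, b4, e3]; exact t2) t1 (by omega) rfl).mono ?_)
  rintro n' s' ⟨c1, c2, c3, c4, c5⟩
  refine ⟨_, _, .move .., by omega, by simp [set_mem, c2, b2], by simp [set_space]; omega, ?_,
    fun x hx hxo => ?_⟩
  · simp only [set_reg, if_true]
    rw [c4, b5, b6, t3]
  · rw [set_reg, if_neg hxo, c5 x (by omega), b7 x (by omega) (by omega) (by omega)]

/-- Changing a key of a map takes logarithmic time and space, and leaves the old map in the memory.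
-/
theorem runs_setM {i k₁ k₂ v N : ℕ} {f : ℕ → ℕ → ℕ} (hf : MapAt st.mem (st.reg 3) f (st.reg i))
    (hN : Supp f N) (h0 : TreeAt st.mem (st.reg 3) .nil 0) (hw : st.reg 3 + 16 * hgt N + 30 < 2 ^ w)
    (h1 : 45 ≤ k₁) (h2 : 45 ≤ k₂) (hv : 45 ≤ v) (hi : 45 ≤ i) :
    Runs w (setM i k₁ k₂ v) st fun n s => n ≤ 160 * hgt N + 205 ∧ Ext st s ∧
      s.reg 3 ≤ st.reg 3 + 16 * hgt N + 20 ∧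
      MapAt s.mem (s.reg 3) (fset f (st.reg k₁) (st.reg k₂) (st.reg v)) (s.reg i) ∧
      ∀ x, 45 ≤ x → x ≠ i → s.reg x = st.reg x := by
  obtain ⟨t, t1, t2, t3⟩ := hf
  have hh := height_le_hgt t1 t3 hN
  have n1 : k₁ ≠ 10 := by omega
  have n2 : k₂ ≠ 10 ∧ k₂ ≠ 11 := by omega
  have n3 : v ≠ 10 ∧ v ≠ 11 ∧ v ≠ 12 := by omega
  have B : Runs w (seqs [.move 10 i, .move 11 k₁, .move 12 k₂, .move 13 v]) st fun n s => n ≤ 4 ∧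
      s.mem = st.mem ∧ s.space = st.space ∧ s.reg 10 = st.reg i ∧ s.reg 11 = st.reg k₁ ∧
      s.reg 12 = st.reg k₂ ∧ s.reg 13 = st.reg v ∧
      ∀ x, x ≠ 10 → x ≠ 11 → x ≠ 12 → x ≠ 13 → s.reg x = st.reg x := by
    refine Runs.straight (c := 4) (by simp [seqs, Prog.Straight]) (by simp [seqs, Prog.cost])
      fun n hn => ⟨hn, rfl, rfl, ?_, ?_, ?_, ?_, fun x x1 x2 x3 x4 => ?_⟩
    · simp [seqs, Prog.eval, set_reg]
    · simp [seqs, Prog.eval, set_reg, n1]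
    · simp [seqs, Prog.eval, set_reg, n2]
    · simp [seqs, Prog.eval, set_reg, n3]
    · simp [seqs, Prog.eval, set_reg, x1, x2, x3, x4]
  refine Runs.seq (B.mono ?_)
  rintro n s ⟨b1, b2, b3, b4, b5, b6, b6', b7⟩
  have e3 := b7 3 (by norm_num) (by norm_num) (by norm_num) (by norm_num)
  refine Runs.seq ((runs_setP (t := t) (by rw [b2, b4, e3]; exact t2) t1
    (by rw [b2, e3]; exact h0) (by omega) rfl rfl).mono ?_)
  rintro n' s' ⟨c1, c2, c3, c4, c5⟩
  have hfp := c2.fp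
  have hE : Ext st s' := Ext.trans ⟨e3.ge, fun a _ => by rw [b2], by omega⟩ c2
  refine ⟨_, _, .move .., by omega, ⟨?_, hE.mem, ?_⟩, ?_, ⟨_,
    (sets_set t1 (toLex (s.reg 11, s.reg 12)) (s.reg 13)).ok, ?_, fun a b => ?_⟩,
    fun x hx hxo => ?_⟩
  · rw [set_reg, if_neg (by omega)]; exact hE.fp
  · rw [set_reg, if_neg (by omega), set_space]; exact hE.space
  · rw [set_reg, if_neg (by omega)]; omega
  · simp only [set_reg, if_true, set_mem]
    rw [if_neg (by omega)]
    exact c4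
  · rw [(sets_set t1 _ _).get, b5, b6, b6', ← t3, fset]
    simp [Prod.ext_iff]
  · rw [set_reg, if_neg hxo, c5 x (by omega) (by omega), b7 x (by omega) (by omega) (by omega)
      (by omega)]

theorem runs_loadM {out a k : ℕ} (hw : st.reg 3 < 2 ^ w) (ha : st.reg a + k < st.reg 3)
    (ha' : 46 ≤ a) :
    Runs w (loadM out a k) st fun n s => n ≤ 3 ∧ s.mem = st.mem ∧
      s.space ≤ max st.space (st.reg 3) ∧ s.reg out = st.mem (st.reg a + k) ∧
      ∀ x, x ≠ 45 → x ≠ out → s.reg x = st.reg x := by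
  refine Runs.straight (c := 3) (by simp [loadM, seqs, Prog.Straight])
    (by simp [loadM, seqs, Prog.cost]) fun n hn => ?_
  have e : (k % 2 ^ w + st.reg a) % 2 ^ w = st.reg a + k := by
    rw [Nat.mod_add_mod, Nat.mod_eq_of_lt (by omega), Nat.add_comm]
  have ha2 : a ≠ 45 := by omega
  refine ⟨hn, rfl, ?_, ?_, fun x x1 x2 => ?_⟩
  · simp only [loadM, seqs, Prog.eval, set_space, touch_space, set_reg, if_true, if_neg ha2, e]
    omega
  · simp [loadM, seqs, Prog.eval, set_reg, ha2, e, set_mem]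
  · simp [loadM, seqs, Prog.eval, set_reg, x1, x2, touch_reg]

end Eer

namespace Eer

open WordRAM _root_.Eer.Tree

variable {w N lim j : ℕ} {st₀ s : State} {R : ℕ → ℕ} {F : ℕ → ℕ → ℕ → ℕ} {p q : Prog}
  {P Q : State → Prop}

/-! ### Programs on maps -/

/-- The function `R` with the value at `r` changed to `v`. -/
def upd {β : Type} (R : ℕ → β) (r : ℕ) (v : β) : ℕ → β := fun x => bif x.beq r then v else R x

theorem upd_apply {β : Type} (R : ℕ → β) (r : ℕ) (v : β) (x : ℕ) :
    upd R r v x = if x = r then v else R x := by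
  unfold upd
  by_cases h : x = r
  · simp [h]
  · rw [if_neg h, Bool.eq_false_iff.2 fun h' => h (Nat.eq_of_beq_eq_true h'), cond_false]

/-- A bound for the time that a single step of a program on maps takes, if the maps have at most `N`
nonzero values; the most expensive step is the change of a key, see `runs_setM`. -/
def unitTime (N : ℕ) : ℕ := 160 * hgt N + 210

/-- A bound for the space that a single step of a program on maps takes, the stack of its search
path included. -/
def unitSpace (N : ℕ) : ℕ := 16 * hgt N + 30

/-- The program `p` leads from the state `s` to a state with `Q` in `j` units of time. -/
def Within (w N j : ℕ) (p : Prog) (s : State) (Q : State → Prop) : Prop :=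
  Runs w p s fun n s' => n ≤ j * unitTime N ∧ Q s'

/-- The state `s`, which has been reached from `st₀`, seen on the level of maps: the registers from
56 on contain the words `R`, and the registers from 50 to 55 contain pointers to the maps `F`. The
memory below `lim` suffices for `j` more steps, and since a step adds at most one key to a map, the
maps will have at most `N` nonzero values by then. -/
structure HS (w N lim : ℕ) (st₀ : State) (j : ℕ) (s : State) (R : ℕ → ℕ) (F : ℕ → ℕ → ℕ → ℕ) :
    Prop where
  lt : lim < 2 ^ w
  ext : Ext st₀ s
  reg : ∀ x, 56 ≤ x → s.reg x = R x
  map : ∀ i, 50 ≤ i → i < 56 → MapAt s.mem (s.reg 3) (F i) (s.reg i)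
  supp : ∀ i, 50 ≤ i → i < 56 → ∃ n, Supp (F i) n ∧ n + j ≤ N
  null : TreeAt s.mem (s.reg 3) .nil 0
  fp : s.reg 3 + j * unitSpace N ≤ lim

theorem Within.seq {k : ℕ} (h : Within w N k p s P) (hq : ∀ s', P s' → Within w N j q s' Q) :
    Within w N (j + k) (.seq p q) s Q := by
  refine Runs.seq (Runs.mono h ?_)
  rintro n s' ⟨h1, h2⟩
  refine Runs.mono (hq s' h2) ?_
  rintro n' s'' ⟨h3, h4⟩
  exact ⟨by rw [Nat.add_mul]; omega, h4⟩

theorem Within.step (h : Within w N 1 p s P) (hq : ∀ s', P s' → Within w N j q s' Q) :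
    Within w N (j + 1) (.seq p q) s Q :=
  Within.seq h hq

theorem Within.mono {k : ℕ} (h : Within w N k p s P) (hk : k ≤ j) (hQ : ∀ s', P s' → Q s') :
    Within w N j p s Q := by
  refine Runs.mono h ?_
  rintro n s' ⟨h1, h2⟩
  exact ⟨h1.trans (Nat.mul_le_mul_right _ hk), hQ _ h2⟩

theorem Within.ite {b : Test} (h1 : b.Holds s → Within w N j p s Q)
    (h2 : ¬ b.Holds s → Within w N j q s Q) : Within w N (j + 1) (.ite b p q) s Q := by
  have hU : 1 ≤ unitTime N := by unfold unitTime; omega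
  refine Runs.ite (fun h => Runs.mono (h1 h) ?_) fun h => Runs.mono (h2 h) ?_ <;>
  · rintro n s' ⟨h3, h4⟩
    exact ⟨by rw [Nat.add_mul]; omega, h4⟩

theorem Within.of_runs {c : ℕ} (hc : c ≤ 210) (h : Runs w p s fun n s' => n ≤ c ∧ P s') :
    Within w N 1 p s P := by
  refine h.mono fun n s' h' => ⟨?_, h'.2⟩
  have := h'.1
  unfold unitTime
  omega

theorem Within.skip (h : Q s) : Within w N 1 .skip s Q :=
  Within.of_runs (c := 1) (by norm_num) ⟨_, _, .skip _, le_rfl, h⟩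

namespace HS

theorem mono {k : ℕ} (h : HS w N lim st₀ j s R F) (hk : k ≤ j) : HS w N lim st₀ k s R F := by
  refine ⟨h.lt, h.ext, h.reg, h.map, fun i h1 h2 => ?_, h.null, ?_⟩
  · obtain ⟨n, h3, h4⟩ := h.supp i h1 h2
    exact ⟨n, h3, by omega⟩
  · have := Nat.mul_le_mul_right (unitSpace N) hk
    have := h.fp
    omega

theorem fp_add (h : HS w N lim st₀ (j + 1) s R F) :
    s.reg 3 + j * unitSpace N + unitSpace N ≤ lim := by
  have := h.fp
  rw [Nat.add_mul] at this
  omega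

theorem fp_lt (h : HS w N lim st₀ j s R F) : s.reg 3 < 2 ^ w := by
  have := h.fp
  have := h.lt
  omega

/-- A step that changes only the registers below 50 and a register `r` from 56 on. -/
theorem of_reg {s' : State} {r v : ℕ} (h : HS w N lim st₀ (j + 1) s R F) (h1 : s'.mem = s.mem)
    (h2 : s'.space ≤ max s.space (s.reg 3)) (h3 : s'.reg r = v)
    (h4 : ∀ x, x = 3 ∨ 50 ≤ x → x ≠ r → s'.reg x = s.reg x) (hr : 56 ≤ r) :
    HS w N lim st₀ j s' (upd R r v) F := by
  have e3 := h4 3 (by omega) (by omega)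
  have := h.ext.fp
  have := h.ext.space
  refine ⟨h.lt, ⟨by omega, fun a ha => by rw [h1, h.ext.mem a ha], by omega⟩, fun x hx => ?_,
    fun i hi hi' => ?_, (h.mono (Nat.le_succ j)).supp, ?_, ?_⟩
  · rw [upd_apply]
    split_ifs with c
    · rw [c, h3]
    · rw [h4 x (by omega) c, h.reg x hx]
  · rw [h1, e3, h4 i (by omega) (by omega)]
    exact h.map i hi hi'
  · rw [h1, e3]
    exact h.null
  · rw [e3]
    exact (h.mono (Nat.le_succ j)).fp

theorem const {r k : ℕ} (h : HS w N lim st₀ (j + 1) s R F) (hr : 56 ≤ r) (hk : k < 2 ^ w) :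
    Within w N 1 (.const r k) s fun s' => HS w N lim st₀ j s' (upd R r k) F := by
  refine Within.of_runs (c := 1) (by norm_num) ⟨_, _, .const .., le_rfl, ?_⟩
  exact h.of_reg rfl (le_max_left _ _) (by simp [set_reg, Nat.mod_eq_of_lt hk])
    (fun x _ hx => by simp [set_reg, hx]) hr

theorem move {r a : ℕ} (h : HS w N lim st₀ (j + 1) s R F) (hr : 56 ≤ r) (ha : 56 ≤ a) :
    Within w N 1 (.move r a) s fun s' => HS w N lim st₀ j s' (upd R r (R a)) F := by
  refine Within.of_runs (c := 1) (by norm_num) ⟨_, _, .move .., le_rfl, ?_⟩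
  exact h.of_reg rfl (le_max_left _ _) (by simp [set_reg, h.reg a ha])
    (fun x _ hx => by simp [set_reg, hx]) hr

theorem add {r a b : ℕ} {x y : ℤ} (h : HS w N lim st₀ (j + 1) s R F) (hr : 56 ≤ r) (ha : 56 ≤ a)
    (hb : 56 ≤ b) (e₁ : R a = word w x) (e₂ : R b = word w y) :
    Within w N 1 (.add r a b) s fun s' => HS w N lim st₀ j s' (upd R r (word w (x + y))) F := by
  refine Within.of_runs (c := 1) (by norm_num) ⟨_, _, .add .., le_rfl, ?_⟩
  refine h.of_reg rfl (le_max_left _ _) ?_ (fun x _ hx => by simp [set_reg, hx]) hr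
  simp [set_reg, h.reg a ha, h.reg b hb, e₁, e₂, word_add]

theorem sub {r a b : ℕ} {x y : ℤ} (h : HS w N lim st₀ (j + 1) s R F) (hr : 56 ≤ r) (ha : 56 ≤ a)
    (hb : 56 ≤ b) (e₁ : R a = word w x) (e₂ : R b = word w y) :
    Within w N 1 (.sub r a b) s fun s' => HS w N lim st₀ j s' (upd R r (word w (x - y))) F := by
  refine Within.of_runs (c := 1) (by norm_num) ⟨_, _, .sub .., le_rfl, ?_⟩
  refine h.of_reg rfl (le_max_left _ _) ?_ (fun x _ hx => by simp [set_reg, hx]) hr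
  simp [set_reg, h.reg a ha, h.reg b hb, e₁, e₂, word_sub]

theorem getM {out i k₁ k₂ y : ℕ} (h : HS w N lim st₀ (j + 1) s R F) (ho : 56 ≤ out)
    (hi : 50 ≤ i ∧ i < 56) (h1 : 56 ≤ k₁) (h2 : 56 ≤ k₂) (e : F i (R k₁) (R k₂) = y) :
    Within w N 1 (getM out i k₁ k₂) s fun s' => HS w N lim st₀ j s' (upd R out y) F := by
  obtain ⟨n, hs1, hs2⟩ := h.supp i hi.1 hi.2
  refine Runs.mono (runs_getM (h.map i hi.1 hi.2) (hs1.mono (by omega : n ≤ N)) h.fp_lt (by omega)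
    (by omega) (by omega)) ?_
  rintro n s' ⟨c1, c2, c3, c4, c5⟩
  refine ⟨by unfold unitTime; omega, h.of_reg c2 c3 ?_ (fun x hx => c5 x (by omega)) ho⟩
  rw [c4, h.reg _ h1, h.reg _ h2, e]

theorem setM {i k₁ k₂ v : ℕ} (h : HS w N lim st₀ (j + 1) s R F)
    (hi : 50 ≤ i ∧ i < 56) (h1 : 56 ≤ k₁) (h2 : 56 ≤ k₂) (h3 : 56 ≤ v) :
    Within w N 1 (setM i k₁ k₂ v) s fun s' =>
      HS w N lim st₀ j s' R (upd F i (fset (F i) (R k₁) (R k₂) (R v))) := by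
  obtain ⟨n, hs1, hs2⟩ := h.supp i hi.1 hi.2
  have hfp := h.fp_add
  have hlim := h.lt
  have := h.ext.fp
  refine Runs.mono (runs_setM (h.map i hi.1 hi.2) (hs1.mono (by omega : n ≤ N)) h.null
    (by unfold unitSpace at hfp; omega) (by omega : 45 ≤ k₁) (by omega : 45 ≤ k₂)
    (by omega : 45 ≤ v) (by omega)) ?_
  rintro n' s' ⟨c1, c2, c3, c4, c5⟩
  refine ⟨by unfold unitTime; omega, h.lt, h.ext.trans c2, fun x hx => ?_, fun x hx hx' => ?_,
    fun x hx hx' => ?_, h.null.ext c2, by unfold unitSpace at *; omega⟩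
  · rw [c5 x (by omega) (by omega), h.reg x hx]
  · rw [upd_apply]
    split_ifs with c
    · rw [c, ← h.reg _ h1, ← h.reg _ h2, ← h.reg _ h3]
      exact c4
    · rw [c5 x (by omega) c]
      exact (h.map x hx hx').mono c2.mem c2.fp
  · rw [upd_apply]
    split_ifs with c
    · exact ⟨n + 1, hs1.fset _ _ _, by omega⟩
    · exact (h.mono (Nat.le_succ j)).supp x hx hx'

theorem loadM {out a k y : ℕ} (h : HS w N lim st₀ (j + 1) s R F) (ho : 56 ≤ out) (ha : 56 ≤ a)
    (hk : R a + k < st₀.reg 3) (e : st₀.mem (R a + k) = y) :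
    Within w N 1 (loadM out a k) s fun s' => HS w N lim st₀ j s' (upd R out y) F := by
  have hfp := h.ext.fp
  refine Within.of_runs (c := 3) (by norm_num) ((runs_loadM (out := out) h.fp_lt
    (by rw [h.reg a ha]; omega) (by omega)).mono ?_)
  rintro n s' ⟨c1, c2, c3, c4, c5⟩
  refine ⟨c1, h.of_reg c2 c3 ?_ (fun x hx => c5 x (by omega)) ho⟩
  rw [c4, h.reg a ha, h.ext.mem _ hk, e]

theorem loadMap {a k n : ℕ} {f : ℕ → ℕ → ℕ} (h : HS w N lim st₀ (j + 1) s R F) (ha : 56 ≤ a)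
    (hk : R a + k < st₀.reg 3) (hf : MapAt st₀.mem (st₀.reg 3) f (st₀.mem (R a + k)))
    (hs : Supp f n) (hn : n + j ≤ N) :
    Within w N 1 (Eer.loadM 55 a k) s fun s' => HS w N lim st₀ j s' R (upd F 55 f) := by
  have hfp := h.ext.fp
  have hsp := h.ext.space
  refine Within.of_runs (c := 3) (by norm_num) ((runs_loadM (out := 55) h.fp_lt
    (by rw [h.reg a ha]; omega) (by omega)).mono ?_)
  rintro n s' ⟨c1, c2, c3, c4, c5⟩
  have e3 := c5 3 (by norm_num) (by norm_num)
  refine ⟨c1, h.lt, ⟨by omega, fun a ha => by rw [c2, h.ext.mem a ha], by omega⟩,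
    fun x hx => ?_, fun i hi hi' => ?_, fun i hi hi' => ?_, ?_, ?_⟩
  · rw [c5 x (by omega) (by omega), h.reg x hx]
  · rw [upd_apply, c2, e3]
    split_ifs with c
    · rw [c, c4, h.reg a ha, h.ext.mem _ hk]
      exact hf.mono h.ext.mem h.ext.fp
    · rw [c5 i (by omega) c]
      exact h.map i hi hi'
  · rw [upd_apply]
    split_ifs with c
    · exact ⟨_, hs, hn⟩
    · exact (h.mono (Nat.le_succ j)).supp i hi hi'
  · rw [c2, e3]
    exact h.null
  · rw [e3]
    exact (h.mono (Nat.le_succ j)).fp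

/-- After the allocation of a record the new state takes the place of the initial state. -/
theorem alloc {out : ℕ} {rs : List ℕ} (h : HS w N lim st₀ (j + 1) s R F) (ho : 56 ≤ out)
    (hr : ∀ r ∈ rs, 50 ≤ r) (hl : rs.length ≤ 10) :
    Within w N 1 (.seq (.const 20 1) (alloc out rs)) s fun s' => Ext s s' ∧
      HS w N lim s' j s' (upd R out (s.reg 3)) F ∧ s'.reg 3 = s.reg 3 + rs.length ∧
      (∀ x, 50 ≤ x → x ≠ out → s'.reg x = s.reg x) ∧
      (∀ (i : ℕ) (h : i < rs.length), s'.mem (s.reg 3 + i) = s.reg rs[i]) ∧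
      (rs ≠ [] → s'.reg 3 ≤ s'.space) := by
  have hfp := h.fp_add
  have hlim := h.lt
  unfold unitSpace at hfp
  have m1 : 1 % 2 ^ w = 1 := Nat.mod_eq_of_lt (by omega)
  refine Within.of_runs (c := 25) (by norm_num) (Runs.seq ⟨_, _, .const .., ?_⟩)
  rw [m1]
  refine (runs_alloc (st := s.set 20 1) (by simp [set_reg]) (by simp [set_reg]; omega)
    (fun r hr' => by have := hr r hr'; omega) (by omega)).mono ?_
  rintro n s' ⟨c1, c2, c3, c4, c5, c6, c7⟩
  have hE : Ext s s' := ⟨by simpa [set_reg] using c2.fp,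
    fun a ha => by simpa [set_mem] using c2.mem a (by simpa [set_reg] using ha),
    by simpa [set_space] using c2.space⟩
  have fr : ∀ x, 50 ≤ x → x ≠ out → s'.reg x = s.reg x := fun x hx hx' => by
    rw [c5 x (by omega) (by omega) hx', set_reg, if_neg (by omega)]
  simp only [set_reg, if_neg (by norm_num : ¬ 3 = 20)] at c3 c4 c6
  refine ⟨by omega, hE, ⟨h.lt, Ext.refl _, fun x hx => ?_, fun i hi hi' => ?_,
    (h.mono (Nat.le_succ j)).supp, h.null.ext hE, by unfold unitSpace; omega⟩, c3, fr, ?_, c7⟩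
  · rw [upd_apply]
    split_ifs with c
    · rw [c, c4]
    · rw [fr x (by omega) c, h.reg x hx]
  · rw [fr i hi (by omega)]
    exact (h.map i hi hi').mono hE.mem hE.fp
  · intro i hi
    rw [c6 i hi, if_neg]
    have := hr _ (List.getElem_mem hi)
    omega

end HS

end Eer

namespace Eer

/-! ### Tables that represent a string -/

/-- `f` is the map whose nonzero values are described by the relation `rel` between keys and
values; absent keys have the value 0. -/
structure Tab (f : ℕ → ℕ → ℕ) (rel : ℕ → ℕ → ℕ → Prop) : Prop where
  val : ∀ {x y v}, rel x y v → f x y = v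
  supp : ∀ {x y}, f x y ≠ 0 → rel x y (f x y)

theorem Tab.eq_zero {f : ℕ → ℕ → ℕ} {rel : ℕ → ℕ → ℕ → Prop} (h : Tab f rel) {x y : ℕ}
    (h' : ∀ v, ¬ rel x y v) : f x y = 0 :=
  of_not_not fun h0 => h' _ (h.supp h0)

theorem Tab.set {f : ℕ → ℕ → ℕ} {rel rel' : ℕ → ℕ → ℕ → Prop} (h : Tab f rel) {a b v : ℕ}
    (h1 : ∀ x y u, rel' x y u → ((x = a ∧ y = b) ∧ u = v) ∨ (¬ (x = a ∧ y = b) ∧ rel x y u))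
    (h2 : v ≠ 0 → rel' a b v) (h3 : ∀ x y u, rel x y u → ¬ (x = a ∧ y = b) → rel' x y u) :
    Tab (fset f a b v) rel' := by
  constructor
  · intro x y u hu
    unfold fset
    rcases h1 x y u hu with ⟨c, e⟩ | ⟨c, e⟩
    · rw [if_pos c, e]
    · rw [if_neg c, h.val e]
  · intro x y hu
    unfold fset at hu ⊢
    split_ifs at hu ⊢ with c
    · rw [c.1, c.2]; exact h2 hu
    · exact h3 _ _ _ (h.supp hu) c

theorem Tab.congr {f : ℕ → ℕ → ℕ} {rel rel' : ℕ → ℕ → ℕ → Prop} (h : Tab f rel)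
    (h' : ∀ x y u, rel' x y u ↔ rel x y u) : Tab f rel' := by
  have : rel' = rel := by ext; exact h' _ _ _
  rwa [this]

theorem Tab.toSupp {ι : Type*} {f : ℕ → ℕ → ℕ} {rel : ℕ → ℕ → ℕ → Prop} (h : Tab f rel)
    (S : Finset ι) (g : ι → ℕ × ℕ) (hS : ∀ x y v, rel x y v → v ≠ 0 → ∃ i ∈ S, g i = (x, y)) :
    Supp f S.card := by
  classical
  refine ⟨S.image g, Finset.card_image_le, fun a b h0 => ?_⟩
  obtain ⟨i, hi, e⟩ := hS _ _ _ (h.supp h0) h0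
  rw [← e]
  exact Finset.mem_image_of_mem _ hi

variable {σ : ℕ} {s : List (Fin σ)} {c : Fin σ} {P P' : ℕ → ℕ} {lab lab' : Node (Fin σ) → ℕ}
  {f f₁ f₂ : ℕ → ℕ → ℕ} {v : List (Fin σ)} {i₀ : ℕ}

/-- The letters of `s`, increased by 1; `P k` is the key of the position `k`. -/
def ChTab (P : ℕ → ℕ) (s : List (Fin σ)) (f : ℕ → ℕ → ℕ) : Prop :=
  Tab f fun x y v => y = 0 ∧ ∃ (k : ℕ) (c : Fin σ), s[k]? = some c ∧ x = P k ∧ v = c + 1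

/-- The nodes of the surfaces of `s`, accessed by their first positions. -/
def PreTab (P : ℕ → ℕ) (lab : Node (Fin σ) → ℕ) (s : List (Fin σ)) (f : ℕ → ℕ → ℕ) : Prop :=
  Tab f fun x y v => y = 0 ∧ ∃ i j, Surf s i j ∧ x = P i ∧ v = lab (.pal (sub s i j))

/-- The nodes of the surfaces of `s`, accessed by their last positions. -/
def SufTab (P : ℕ → ℕ) (lab : Node (Fin σ) → ℕ) (s : List (Fin σ)) (f : ℕ → ℕ → ℕ) : Prop :=
  Tab f fun x y v => y = 0 ∧ ∃ i j, Surf s i j ∧ x = P (j - 1) ∧ v = lab (.pal (sub s i j))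

/-- The edges of the eertree of `s`. -/
def EdTab (lab : Node (Fin σ) → ℕ) (s : List (Fin σ)) (f : ℕ → ℕ → ℕ) : Prop :=
  Tab f fun x y v => ∃ (u : Node (Fin σ)) (c : Fin σ), u.extend c ∈ nodes s ∧ x = lab u ∧
    y = c + 1 ∧ v = lab (u.extend c)

/-- The values of `g` at the nodes in `D`. -/
def CnTab (lab : Node (Fin σ) → ℕ) (D : Set (Node (Fin σ))) (g : Node (Fin σ) → ℕ)
    (f : ℕ → ℕ → ℕ) : Prop :=
  Tab f fun x y v => y = 0 ∧ ∃ u ∈ D, x = lab u ∧ v = g u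

/-- `P` is injective on the positions up to `n`. -/
def InjTo (P : ℕ → ℕ) (n : ℕ) : Prop := ∀ i ≤ n, ∀ j ≤ n, P i = P j → i = j

theorem surf_mem_nodes {i j : ℕ} (h : Surf s i j) : Node.pal (sub s i j) ∈ nodes s :=
  pal_mem_nodes.2 (mem_pals_of_surf h)

theorem ChTab.concat (h : ChTab P s f) (hP : InjTo P s.length) :
    ChTab P (s ++ [c]) (fset f (P s.length) 0 (c + 1)) := by
  refine Tab.set h ?_ ?_ ?_
  · rintro x y u ⟨rfl, k, c', h1, rfl, rfl⟩
    by_cases hk : k < s.length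
    · rw [List.getElem?_append_left hk] at h1
      refine Or.inr ⟨fun e => ?_, rfl, k, c', h1, rfl, rfl⟩
      have := hP _ hk.le _ le_rfl e.1
      omega
    · have := (List.getElem?_eq_some_iff.1 h1).1
      simp only [List.length_append, List.length_singleton] at this
      obtain rfl : k = s.length := by omega
      simp at h1
      simp [h1]
  · intro _
    exact ⟨rfl, s.length, c, by simp, rfl, rfl⟩
  · rintro x y u ⟨rfl, k, c', h1, rfl, rfl⟩ -
    refine ⟨rfl, k, c', ?_, rfl, rfl⟩
    rw [List.getElem?_append_left (List.getElem?_eq_some_iff.1 h1).1, h1]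

theorem ChTab.of_concat (h : ChTab P (s ++ [c]) f) (hP : InjTo P s.length) :
    ChTab P s (fset f (P s.length) 0 0) := by
  refine Tab.set h ?_ (fun h => absurd rfl h) ?_
  · rintro x y u ⟨rfl, k, c', h1, rfl, rfl⟩
    have hk := (List.getElem?_eq_some_iff.1 h1).1
    refine Or.inr ⟨fun e => ?_, rfl, k, c', ?_, rfl, rfl⟩
    · have := hP _ hk.le _ le_rfl e.1
      omega
    · rw [List.getElem?_append_left hk, h1]
  · rintro x y u ⟨rfl, k, c', h1, rfl, rfl⟩ hne
    refine ⟨rfl, k, c', ?_, rfl, rfl⟩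
    have := (List.getElem?_eq_some_iff.1 h1).1
    simp only [List.length_append, List.length_singleton] at this
    have hk : k ≠ s.length := fun e => hne ⟨by rw [e], rfl⟩
    rwa [List.getElem?_append_left (by omega)] at h1

theorem surf_concat_cases (hv : sufpal (s ++ [c]) = v) (hi : i₀ = (s ++ [c]).length - v.length)
    {i j : ℕ} : Surf (s ++ [c]) i j ↔ (i = i₀ ∧ j = s.length + 1) ∨ (Surf s i j ∧ i ≠ i₀) := by
  have hl : (s ++ [c]).length = s.length + 1 := by simp
  constructor
  · intro h
    have := h.le
    by_cases hj : j ≤ s.length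
    · rw [surf_concat_iff hj, hv, ← hi] at h
      exact Or.inr h
    · obtain rfl : j = (s ++ [c]).length := by omega
      rw [surf_length_iff (by simp), hv, ← hi] at h
      exact Or.inl ⟨h, hl⟩
  · rintro (⟨rfl, rfl⟩ | ⟨h1, h2⟩)
    · rw [← hl, surf_length_iff (by simp), hv, ← hi]
    · rw [surf_concat_iff h1.le, hv, ← hi]
      exact ⟨h1, h2⟩

theorem sub_concat_last (hv : sufpal (s ++ [c]) = v) (hi : i₀ = (s ++ [c]).length - v.length) :
    sub (s ++ [c]) i₀ (s.length + 1) = v := by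
  have hl : (s ++ [c]).length = s.length + 1 := by simp
  rw [← hl, hi, ← hv, sub_sufpal]

theorem sub_concat_surf {i j : ℕ} (h : Surf s i j) : sub (s ++ [c]) i j = sub s i j :=
  sub_append h.lt.le h.le

theorem lt_of_sufpal_concat (hv : sufpal (s ++ [c]) = v)
    (hi : i₀ = (s ++ [c]).length - v.length) : i₀ ≤ s.length := by
  have := List.length_pos_iff.2 (hv ▸ sufpal_ne_nil (by simp) : v ≠ [])
  simp at hi
  omega

/-- By `surf_concat_iff` the surface that starts at `i₀` is replaced by the new longest palindromic
suffix `v`. -/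
theorem PreTab.concat (hv : sufpal (s ++ [c]) = v)
    (hi : i₀ = (s ++ [c]).length - v.length) (h : PreTab P lab s f) (hP : InjTo P s.length)
    (hlab : ∀ u ∈ nodes s, lab' u = lab u) :
    PreTab P lab' (s ++ [c]) (fset f (P i₀) 0 (lab' (.pal v))) := by
  have hi0 := lt_of_sufpal_concat hv hi
  have hs := sub_concat_last hv hi
  refine Tab.set h ?_ ?_ ?_
  · rintro x y u ⟨rfl, i, j, h1, rfl, rfl⟩
    rcases (surf_concat_cases hv hi).1 h1 with ⟨rfl, rfl⟩ | ⟨h1, h2⟩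
    · exact Or.inl ⟨⟨rfl, rfl⟩, by rw [hs]⟩
    · refine Or.inr ⟨fun e => h2 (hP _ (h1.lt.le.trans h1.le) _ hi0 e.1), rfl, i, j, h1, rfl, ?_⟩
      rw [sub_concat_surf h1, hlab _ (surf_mem_nodes h1)]
  · intro _
    exact ⟨rfl, i₀, s.length + 1, (surf_concat_cases hv hi).2 (Or.inl ⟨rfl, rfl⟩), rfl, by rw [hs]⟩
  · rintro x y u ⟨rfl, i, j, h1, rfl, rfl⟩ hne
    refine ⟨rfl, i, j, (surf_concat_cases hv hi).2 (Or.inr ⟨h1, fun e => hne ⟨by rw [e], rfl⟩⟩),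
      rfl, ?_⟩
    rw [sub_concat_surf h1, hlab _ (surf_mem_nodes h1)]

/-- The same change as in `PreTab.concat`; here the surface that starts at `i₀`, if there is one, is
deleted under its last position. -/
theorem SufTab.concat (hv : sufpal (s ++ [c]) = v)
    (hi : i₀ = (s ++ [c]).length - v.length) (h : SufTab P lab s f) (hP : InjTo P s.length)
    (hlab : ∀ u ∈ nodes s, lab' u = lab u)
    (hf : (∃ j, Surf s i₀ j ∧ f₁ = fset f (P (j - 1)) 0 0) ∨ ((∀ j, ¬ Surf s i₀ j) ∧ f₁ = f)) :
    SufTab P lab' (s ++ [c]) (fset f₁ (P s.length) 0 (lab' (.pal v))) := by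
  have hs := sub_concat_last hv hi
  have h' : Tab f₁ fun x y v =>
      y = 0 ∧ ∃ i j, (Surf s i j ∧ i ≠ i₀) ∧ x = P (j - 1) ∧ v = lab (.pal (sub s i j)) := by
    rcases hf with ⟨j₀, hj, rfl⟩ | ⟨hn, rfl⟩
    · refine Tab.set h ?_ (fun h => absurd rfl h) ?_
      · rintro x y u ⟨rfl, i, j, ⟨h1, h2⟩, rfl, rfl⟩
        refine Or.inr ⟨fun e => h2 ?_, rfl, i, j, h1, rfl, rfl⟩
        have l1 := h1.le
        have l2 := hj.le
        have l3 := h1.lt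
        have l4 := hj.lt
        have := hP _ (by omega) _ (by omega) e.1
        obtain rfl : j = j₀ := by omega
        exact h1.eq_left hj
      · rintro x y u ⟨rfl, i, j, h1, rfl, rfl⟩ hne
        refine ⟨rfl, i, j, ⟨h1, ?_⟩, rfl, rfl⟩
        rintro rfl
        exact hne ⟨by rw [h1.eq_right hj], rfl⟩
    · refine Tab.congr h fun x y u => and_congr_right fun _ => ?_
      constructor
      · rintro ⟨i, j, h1, h2⟩
        exact ⟨i, j, h1.1, h2⟩
      · rintro ⟨i, j, h1, h2⟩
        refine ⟨i, j, ⟨h1, ?_⟩, h2⟩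
        rintro rfl
        exact hn _ h1
  refine Tab.set h' ?_ ?_ ?_
  · rintro x y u ⟨rfl, i, j, h1, rfl, rfl⟩
    rcases (surf_concat_cases hv hi).1 h1 with ⟨rfl, rfl⟩ | ⟨h1, h2⟩
    · exact Or.inl ⟨⟨rfl, rfl⟩, by rw [hs]⟩
    · refine Or.inr ⟨fun e => ?_, rfl, i, j, ⟨h1, h2⟩, rfl, ?_⟩
      · have l1 := h1.le
        have l3 := h1.lt
        have := hP _ (by omega) _ le_rfl e.1
        omega
      · rw [sub_concat_surf h1, hlab _ (surf_mem_nodes h1)]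
  · intro _
    exact ⟨rfl, i₀, s.length + 1, (surf_concat_cases hv hi).2 (Or.inl ⟨rfl, rfl⟩), rfl, by rw [hs]⟩
  · rintro x y u ⟨rfl, i, j, ⟨h1, h2⟩, rfl, rfl⟩ hne
    refine ⟨rfl, i, j, (surf_concat_cases hv hi).2 (Or.inr ⟨h1, h2⟩), rfl, ?_⟩
    rw [sub_concat_surf h1, hlab _ (surf_mem_nodes h1)]

/-- The inverse of `PreTab.concat`: the surface of the removed longest palindromic suffix gives way
to the surface of `s` that starts at the same position, if there is one. -/
theorem PreTab.of_concat (hv : sufpal (s ++ [c]) = v)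
    (hi : i₀ = (s ++ [c]).length - v.length) (h : PreTab P lab (s ++ [c]) f)
    (hP : InjTo P s.length) {x : ℕ}
    (hx : (∃ j, Surf s i₀ j ∧ x = lab (.pal (sub s i₀ j))) ∨ ((∀ j, ¬ Surf s i₀ j) ∧ x = 0)) :
    PreTab P lab s (fset f (P i₀) 0 x) := by
  have hi0 := lt_of_sufpal_concat hv hi
  refine Tab.set h ?_ ?_ ?_
  · rintro x y u ⟨rfl, i, j, h1, rfl, rfl⟩
    by_cases e : i = i₀
    · subst e
      rcases hx with ⟨j', h2, rfl⟩ | ⟨h2, -⟩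
      · exact Or.inl ⟨⟨rfl, rfl⟩, by rw [h1.eq_right h2]⟩
      · exact absurd h1 (h2 j)
    · refine Or.inr ⟨fun e' => e (hP _ (h1.lt.le.trans h1.le) _ hi0 e'.1), rfl, i, j,
        (surf_concat_cases hv hi).2 (Or.inr ⟨h1, e⟩), rfl, ?_⟩
      rw [sub_concat_surf h1]
  · intro h0
    rcases hx with ⟨j', h2, rfl⟩ | ⟨-, h2⟩
    · exact ⟨rfl, i₀, j', h2, rfl, rfl⟩
    · exact absurd h2 h0
  · rintro x y u ⟨rfl, i, j, h1, rfl, rfl⟩ hne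
    rcases (surf_concat_cases hv hi).1 h1 with ⟨rfl, rfl⟩ | ⟨h1, h2⟩
    · exact absurd ⟨rfl, rfl⟩ hne
    · exact ⟨rfl, i, j, h1, rfl, by rw [sub_concat_surf h1]⟩

/-- The inverse of `SufTab.concat`. -/
theorem SufTab.of_concat (hv : sufpal (s ++ [c]) = v)
    (hi : i₀ = (s ++ [c]).length - v.length) (h : SufTab P lab (s ++ [c]) f) (hP : InjTo P s.length)
    (hf : (∃ j, Surf s i₀ j ∧
        f₁ = fset (fset f (P s.length) 0 0) (P (j - 1)) 0 (lab (.pal (sub s i₀ j)))) ∨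
      ((∀ j, ¬ Surf s i₀ j) ∧ f₁ = fset f (P s.length) 0 0)) :
    SufTab P lab s f₁ := by
  have h' : Tab (fset f (P s.length) 0 0) fun x y v =>
      y = 0 ∧ ∃ i j, (Surf s i j ∧ i ≠ i₀) ∧ x = P (j - 1) ∧ v = lab (.pal (sub s i j)) := by
    refine Tab.set h ?_ (fun h => absurd rfl h) ?_
    · rintro x y u ⟨rfl, i, j, ⟨h1, h2⟩, rfl, rfl⟩
      refine Or.inr ⟨fun e => ?_, rfl, i, j, (surf_concat_cases hv hi).2 (Or.inr ⟨h1, h2⟩), rfl, ?_⟩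
      · have l1 := h1.le
        have l3 := h1.lt
        have := hP _ (by omega) _ le_rfl e.1
        omega
      · rw [sub_concat_surf h1]
    · rintro x y u ⟨rfl, i, j, h1, rfl, rfl⟩ hne
      rcases (surf_concat_cases hv hi).1 h1 with ⟨rfl, rfl⟩ | ⟨h1, h2⟩
      · exact absurd ⟨rfl, rfl⟩ hne
      · exact ⟨rfl, i, j, ⟨h1, h2⟩, rfl, by rw [sub_concat_surf h1]⟩
  rcases hf with ⟨j₀, hj, rfl⟩ | ⟨hn, rfl⟩
  · refine Tab.set h' ?_ (fun _ => ⟨rfl, i₀, j₀, hj, rfl, rfl⟩) ?_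
    · rintro x y u ⟨rfl, i, j, h1, rfl, rfl⟩
      by_cases e : i = i₀
      · subst e
        rw [h1.eq_right hj]
        exact Or.inl ⟨⟨rfl, rfl⟩, rfl⟩
      · refine Or.inr ⟨fun e' => e ?_, rfl, i, j, ⟨h1, e⟩, rfl, rfl⟩
        have l1 := h1.le
        have l2 := hj.le
        have l3 := h1.lt
        have l4 := hj.lt
        have := hP _ (by omega) _ (by omega) e'.1
        obtain rfl : j = j₀ := by omega
        exact h1.eq_left hj
    · rintro x y u ⟨rfl, i, j, ⟨h1, -⟩, rfl, rfl⟩ -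
      exact ⟨rfl, i, j, h1, rfl, rfl⟩
  · refine Tab.congr h' fun x y u => and_congr_right fun _ => ?_
    constructor
    · rintro ⟨i, j, h1, h2⟩
      refine ⟨i, j, ⟨h1, ?_⟩, h2⟩
      rintro rfl
      exact hn _ h1
    · rintro ⟨i, j, h1, h2⟩
      exact ⟨i, j, h1.1, h2⟩

theorem nodes_concat (hv : sufpal (s ++ [c]) = v) (u : Node (Fin σ)) :
    u ∈ nodes (s ++ [c]) ↔ u ∈ nodes s ∨ u = .pal v := by
  cases u with
  | odd => simp [odd_mem_nodes]
  | pal t => simp [pal_mem_nodes, pals_concat, hv, or_comm]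

theorem nodes_concat_old (hv : sufpal (s ++ [c]) = v) (h : v ∈ pals s) :
    nodes (s ++ [c]) = nodes s := by
  ext u
  rw [nodes_concat hv, or_iff_left_iff_imp]
  rintro rfl
  exact pal_mem_nodes.2 h

theorem EdTab.concat (h : EdTab lab s f) (hv : sufpal (s ++ [c]) = v) (hn : v ∉ pals s)
    {p : Node (Fin σ)} (hp : p.extend c = .pal v) (hpn : p ∈ nodes s)
    (hinj : Set.InjOn lab (nodes s)) (hlab : ∀ u ∈ nodes s, lab' u = lab u) :
    EdTab lab' (s ++ [c]) (fset f (lab p) (c + 1) (lab' (.pal v))) := by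
  refine Tab.set h ?_ ?_ ?_
  · rintro x y u ⟨a, b, h1, rfl, rfl, rfl⟩
    rcases (nodes_concat hv _).1 h1 with h2 | h2
    · have ha := mem_nodes_of_extend h2
      rw [hlab _ ha, hlab _ h2]
      refine Or.inr ⟨?_, a, b, h2, rfl, rfl, rfl⟩
      rintro ⟨e1, e2⟩
      obtain rfl := hinj ha hpn e1
      obtain rfl : b = c := by ext; omega
      rw [hp, pal_mem_nodes] at h2
      exact hn h2
    · obtain ⟨rfl, rfl⟩ := Node.extend_injective (h2.trans hp.symm)
      rw [h2, hlab _ hpn]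
      exact Or.inl ⟨⟨rfl, rfl⟩, rfl⟩
  · intro _
    exact ⟨p, c, by rw [hp, nodes_concat hv]; exact Or.inr rfl, (hlab _ hpn).symm, rfl, by rw [hp]⟩
  · rintro x y u ⟨a, b, h1, rfl, rfl, rfl⟩ -
    exact ⟨a, b, nodes_subset_concat _ _ h1, (hlab _ (mem_nodes_of_extend h1)).symm, rfl,
      (hlab _ h1).symm⟩

theorem EdTab.of_concat (h : EdTab lab (s ++ [c]) f) (hv : sufpal (s ++ [c]) = v)
    (hn : v ∉ pals s) {p : Node (Fin σ)} (hp : p.extend c = .pal v)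
    (hinj : Set.InjOn lab (nodes (s ++ [c]))) :
    EdTab lab s (fset f (lab p) (c + 1) 0) := by
  have hpn : p ∈ nodes (s ++ [c]) := mem_nodes_of_extend (c := c) (by
    rw [hp, nodes_concat hv]; exact Or.inr rfl)
  refine Tab.set h ?_ (fun h => absurd rfl h) ?_
  · rintro x y u ⟨a, b, h1, rfl, rfl, rfl⟩
    have h1' := nodes_subset_concat s c h1
    refine Or.inr ⟨?_, a, b, h1', rfl, rfl, rfl⟩
    rintro ⟨e1, e2⟩
    obtain rfl := hinj (mem_nodes_of_extend h1') hpn e1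
    obtain rfl : b = c := by ext; omega
    rw [hp, pal_mem_nodes] at h1
    exact hn h1
  · rintro x y u ⟨a, b, h1, rfl, rfl, rfl⟩ hne
    rcases (nodes_concat hv _).1 h1 with h1 | h1
    · exact ⟨a, b, h1, rfl, rfl, rfl⟩
    · obtain ⟨rfl, rfl⟩ := Node.extend_injective (h1.trans hp.symm)
      exact absurd ⟨rfl, rfl⟩ hne

open Classical in
theorem CnTab.set {D : Set (Node (Fin σ))} {g : Node (Fin σ) → ℕ} (h : CnTab lab D g f)
    (hinj : Set.InjOn lab D) {u : Node (Fin σ)} (hu : u ∈ D) (z : ℕ) :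
    CnTab lab D (fun t => if t = u then z else g t) (fset f (lab u) 0 z) := by
  refine Tab.set h ?_ ?_ ?_
  · rintro x y z' ⟨rfl, t, ht, rfl, rfl⟩
    by_cases e : t = u
    · exact Or.inl ⟨⟨by rw [e], rfl⟩, if_pos e⟩
    · exact Or.inr ⟨fun e' => e (hinj ht hu e'.1), rfl, t, ht, rfl, if_neg e⟩
  · intro _
    exact ⟨rfl, u, hu, rfl, (if_pos rfl).symm⟩
  · rintro x y z' ⟨rfl, t, ht, rfl, rfl⟩ hne
    exact ⟨rfl, t, ht, rfl, (if_neg fun e => hne ⟨by rw [e], rfl⟩).symm⟩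

theorem CnTab.congr {D : Set (Node (Fin σ))} {g g' : Node (Fin σ) → ℕ} (h : CnTab lab D g f)
    (hg : ∀ u ∈ D, g' u = g u) : CnTab lab D g' f := by
  refine Tab.congr h fun x y z => and_congr_right fun _ => ?_
  constructor <;>
  · rintro ⟨u, hu, h1, h2⟩
    exact ⟨u, hu, h1, by rw [h2, hg u hu]⟩

theorem CnTab.apply {D : Set (Node (Fin σ))} {g : Node (Fin σ) → ℕ} (h : CnTab lab D g f)
    {u : Node (Fin σ)} (hu : u ∈ D) : f (lab u) 0 = g u :=
  h.val ⟨rfl, u, hu, rfl, rfl⟩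

/-- Nodes with the value 0 may be added or removed. -/
theorem CnTab.change {D D' : Set (Node (Fin σ))} {g : Node (Fin σ) → ℕ} (h : CnTab lab D g f)
    (hlab : ∀ u ∈ D, u ∈ D' → lab' u = lab u) (h1 : ∀ u ∈ D', u ∉ D → g u = 0 ∧ f (lab' u) 0 = 0)
    (h2 : ∀ u ∈ D, u ∉ D' → g u = 0) : CnTab lab' D' g f := by
  constructor
  · rintro x y z ⟨rfl, u, hu, rfl, rfl⟩
    by_cases hD : u ∈ D
    · rw [hlab u hD hu]
      exact h.apply hD
    · rw [(h1 u hu hD).1, (h1 u hu hD).2]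
  · intro x y h0
    obtain ⟨rfl, u, hu, h3, h4⟩ := h.supp h0
    by_cases hD : u ∈ D'
    · exact ⟨rfl, u, hD, by rw [h3, hlab u hu hD], h4⟩
    · rw [h2 u hu hD] at h4
      exact absurd h4 h0

theorem cnt_eq_zero {t : List (Fin σ)} (ht : t.Palindrome) (h0 : t ≠ []) (h : t ∉ pals s) :
    cnt s (.pal t) = 0 := by
  rw [← cnt_pos_iff ht h0] at h
  omega

/-! ### Tables of the mirror image of a string -/

theorem ChTab.reverse (h : ChTab P s f) (hP : ∀ k < s.length, P' k = P (s.length - 1 - k)) :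
    ChTab P' s.reverse f := by
  refine Tab.congr h fun x y z => and_congr_right fun _ => ?_
  constructor
  · rintro ⟨k, c, h1, h2, h3⟩
    have hk := (List.getElem?_eq_some_iff.1 h1).1
    rw [List.length_reverse] at hk
    rw [List.getElem?_reverse hk] at h1
    exact ⟨_, c, h1, by rw [h2, hP k hk], h3⟩
  · rintro ⟨k, c, h1, h2, h3⟩
    have hk := (List.getElem?_eq_some_iff.1 h1).1
    refine ⟨s.length - 1 - k, c, ?_, ?_, h3⟩
    · rw [List.getElem?_reverse (by omega), ← h1]
      congr 1
      omega
    · rw [h2, hP _ (by omega)]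
      congr 1
      omega

theorem Surf.of_reverse {i j : ℕ} (h : Surf s.reverse i j) :
    Surf s (s.length - j) (s.length - i) := by
  have := h.reverse
  rwa [List.reverse_reverse, List.length_reverse] at this

theorem sub_reverse_surf {i j : ℕ} (h : Surf s i j) :
    sub s.reverse (s.length - j) (s.length - i) = sub s i j := by
  rw [sub_reverse h.lt.le h.le, ((palindrome_sub h.lt.le h.le).2 h.pal).reverse_eq]

theorem sub_of_reverse_surf {i j : ℕ} (h : Surf s.reverse i j) :
    sub s (s.length - j) (s.length - i) = sub s.reverse i j := by
  have := sub_reverse_surf h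
  rwa [List.reverse_reverse, List.length_reverse] at this

theorem PreTab.reverse (h : PreTab P lab s f) (hP : ∀ k < s.length, P' k = P (s.length - 1 - k)) :
    SufTab P' lab s.reverse f := by
  refine Tab.congr h fun x y z => and_congr_right fun _ => ?_
  constructor
  · rintro ⟨i, j, h1, h2, h3⟩
    have l1 := h1.lt
    have l2 := h1.le
    rw [List.length_reverse] at l2
    refine ⟨_, _, h1.of_reverse, ?_, by rw [h3, sub_of_reverse_surf h1]⟩
    rw [h2, hP _ (by omega)]
    congr 1
    omega
  · rintro ⟨i, j, h1, h2, h3⟩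
    have l1 := h1.lt
    have l2 := h1.le
    refine ⟨_, _, h1.reverse, ?_, by rw [h3, sub_reverse_surf h1]⟩
    rw [h2, hP _ (by omega)]
    congr 1
    omega

theorem SufTab.reverse (h : SufTab P lab s f) (hP : ∀ k < s.length, P' k = P (s.length - 1 - k)) :
    PreTab P' lab s.reverse f := by
  refine Tab.congr h fun x y z => and_congr_right fun _ => ?_
  constructor
  · rintro ⟨i, j, h1, h2, h3⟩
    have l1 := h1.lt
    have l2 := h1.le
    rw [List.length_reverse] at l2
    refine ⟨_, _, h1.of_reverse, ?_, by rw [h3, sub_of_reverse_surf h1]⟩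
    rw [h2, hP _ (by omega)]
    congr 1
    omega
  · rintro ⟨i, j, h1, h2, h3⟩
    have l1 := h1.lt
    have l2 := h1.le
    refine ⟨_, _, h1.reverse, ?_, by rw [h3, sub_reverse_surf h1]⟩
    rw [h2, hP _ (by omega)]
    congr 1
    omega

/-! ### Sizes of the tables -/

theorem ChTab.toSupp (h : ChTab P s f) : Supp f s.length := by
  have := Tab.toSupp h (Finset.range s.length) (fun k => (P k, 0)) (by
    rintro x y z ⟨rfl, k, c, h1, rfl, rfl⟩ -
    exact ⟨k, Finset.mem_range.2 (List.getElem?_eq_some_iff.1 h1).1, rfl⟩)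
  rwa [Finset.card_range] at this

theorem PreTab.toSupp (h : PreTab P lab s f) : Supp f s.length := by
  have := Tab.toSupp h (Finset.range s.length) (fun k => (P k, 0)) (by
    rintro x y z ⟨rfl, i, j, h1, rfl, rfl⟩ -
    exact ⟨i, Finset.mem_range.2 (h1.lt.trans_le h1.le), rfl⟩)
  rwa [Finset.card_range] at this

theorem SufTab.toSupp (h : SufTab P lab s f) : Supp f s.length := by
  have := Tab.toSupp h (Finset.range s.length) (fun k => (P k, 0)) (by
    rintro x y z ⟨rfl, i, j, h1, rfl, rfl⟩ -
    have l1 := h1.lt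
    have l2 := h1.le
    exact ⟨j - 1, Finset.mem_range.2 (by omega), rfl⟩)
  rwa [Finset.card_range] at this

theorem EdTab.toSupp (h : EdTab lab s f) : Supp f (s.length + 1) := by
  classical
  -- An edge is determined by its target, and by its last letter, which is the letter of the edge.
  have := Tab.toSupp h (pals s)
    (fun t => (lab (core t), (t.getLast?.elim 0 fun c => (c : ℕ) + 1))) (by
    rintro x y z ⟨u, c, h1, rfl, rfl, rfl⟩ -
    obtain ⟨t, h2, rfl⟩ := core_extend c u
    rw [h2, pal_mem_nodes] at h1
    refine ⟨t, h1, ?_⟩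
    have : t.getLast? = some c := by
      generalize core t = u at h2
      cases u with
      | odd => simp only [Node.extend, Node.pal.injEq] at h2; subst h2; rfl
      | pal r => simp only [Node.extend, Node.pal.injEq] at h2; subst h2; exact List.getLast?_concat
    rw [this]
    rfl)
  exact this.mono (card_pals_le s)

theorem CnTab.toSupp {g : Node (Fin σ) → ℕ} (h : CnTab lab (nodes s) g f) :
    Supp f (s.length + 2) := by
  classical
  have := Tab.toSupp h (insert Node.odd ((pals s).image Node.pal)) (fun u => (lab u, 0)) (by
    rintro x y z ⟨rfl, u, hu, rfl, rfl⟩ -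
    refine ⟨u, ?_, rfl⟩
    cases u with
    | odd => simp
    | pal t => simpa [pal_mem_nodes] using hu)
  refine this.mono ((Finset.card_insert_le _ _).trans ?_)
  have := Finset.card_image_le (s := pals s) (f := Node.pal)
  have := card_pals_le s
  omega

/-- At most one surface starts at each position, and at most `s.length + 1` nodes have a suffix link
to `u`. -/
theorem cnt_le (s : List (Fin σ)) (u : Node (Fin σ)) : cnt s u ≤ 2 * s.length + 1 := by
  classical
  have h1 : (surfs s).card ≤ s.length := by
    rw [← Finset.card_range s.length]
    refine Finset.card_le_card_of_injOn Prod.fst (fun p hp => ?_) fun p hp q hq e => ?_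
    · have := mem_surfs.1 hp
      exact Finset.mem_coe.2 (Finset.mem_range.2 (this.lt.trans_le this.le))
    · have h1 := mem_surfs.1 hp
      have h2 := mem_surfs.1 hq
      rw [← e] at h2
      exact Prod.ext e (h1.eq_right h2)
  have h2 := card_pals_le s
  unfold cnt
  refine (Nat.add_le_add (Finset.card_filter_le _ _) (Finset.card_filter_le _ _)).trans ?_
  omega

end Eer

namespace Eer

open WordRAM _root_.Eer.Tree

variable {w σ : ℕ} {s : List (Fin σ)} {c : Fin σ} {lab : Node (Fin σ) → ℕ} {d : Bool} {o : ℤ}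
  {M M' : ℕ → ℕ} {fp fp' : ℕ} {ch pre suf ed cn : ℕ → ℕ → ℕ} {h : ℕ}

/-! ### Versions in memory -/

/-- The direction in which the string is read: forwards for `true`, backwards for `false`. -/
def dir (d : Bool) : ℤ := if d then 1 else -1

theorem dir_not (d : Bool) : dir (!d) = - dir d := by cases d <;> simp [dir]

theorem word_dir_inj {x y : ℤ} (h : word w (o + dir d * x) = word w (o + dir d * y))
    (h1 : x - y < 2 ^ w) (h2 : y - x < 2 ^ w) : x = y := by
  cases d <;> simp only [dir] at h
  · have := word_inj h (by simp; omega) (by simp; omega)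
    simp at this
    omega
  · have := word_inj h (by simp; omega) (by simp; omega)
    simp at this
    omega

/-- The key of the position `k`, if the key of the position 0 is `o`. -/
def posn (w : ℕ) (d : Bool) (o : ℤ) (k : ℕ) : ℕ := word w (o + dir d * k)

theorem injTo_posn {n : ℕ} (hn : n < 2 ^ w) : InjTo (posn w d o) n := by
  intro i hi j hj h
  have : (n : ℤ) < 2 ^ w := by exact_mod_cast hn
  have := word_dir_inj h (by omega) (by omega)
  omega

/-- The direct links of the node `v`; those to `odd` are omitted. -/
def DTab (lab : Node (Fin σ) → ℕ) (v : Node (Fin σ)) (f : ℕ → ℕ → ℕ) : Prop :=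
  Tab f fun x y z => y = 0 ∧ ∃ c : Fin σ, direct v c ≠ .odd ∧ x = c + 1 ∧ z = lab (direct v c)

/-- The record of the node `v`: its length, its suffix link, its direct links, and the node of the
palindrome without its first and last letters. -/
structure RecAt (w : ℕ) (M : ℕ → ℕ) (fp : ℕ) (lab : Node (Fin σ) → ℕ) (v : Node (Fin σ)) :
    Prop where
  lt : lab v + 4 ≤ fp
  len : M (lab v) = word w v.len
  link : M (lab v + 1) = lab v.link
  direct : ∃ f, DTab lab v f ∧ Supp f v.len.toNat ∧ MapAt M fp f (M (lab v + 2))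
  core : ∀ t, v = .pal t → M (lab v + 3) = lab (core t)

theorem RecAt.mono {v : Node (Fin σ)} (hM : ∀ a < fp, M' a = M a) (hf : fp ≤ fp')
    (h : RecAt w M fp lab v) : RecAt w M' fp' lab v := by
  have := h.lt
  refine ⟨by omega, ?_, ?_, ?_, fun t ht => ?_⟩
  · rw [hM _ (by omega), h.len]
  · rw [hM _ (by omega), h.link]
  · obtain ⟨f, h1, h2, h3⟩ := h.direct
    exact ⟨f, h1, h2, by rw [hM _ (by omega)]; exact h3.mono hM hf⟩
  · rw [hM _ (by omega), h.core t ht]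

/-- The pointers to the nodes of the eertree of `s`. The two roots have fixed addresses: their
records are shared by all the versions. -/
structure Labels (lab : Node (Fin σ) → ℕ) (s : List (Fin σ)) : Prop where
  inj : Set.InjOn lab (nodes s)
  ne : ∀ v ∈ nodes s, lab v ≠ 0
  odd : lab .odd = 5
  even : lab (.pal []) = 9

/-- The tables and the records of nodes represent the string `s`, read in the direction `d`; `o` is
the position of the first letter, and positions are words, so that the string may grow at both ends.
The bound on the length makes the positions of letters distinct words, and lets the counts, which
are at most `2 * s.length + 1`, fit into a word. -/
structure Enc (w : ℕ) (M : ℕ → ℕ) (fp : ℕ) (d : Bool) (o : ℤ) (s : List (Fin σ))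
    (lab : Node (Fin σ) → ℕ) (ch pre suf ed cn : ℕ → ℕ → ℕ) : Prop where
  length : 3 * s.length + 10 < 2 ^ w
  ch : ChTab (posn w d o) s ch
  pre : PreTab (posn w d o) lab s pre
  suf : SufTab (posn w d o) lab s suf
  ed : EdTab lab s ed
  cn : CnTab lab (nodes s) (cnt s) cn
  labels : Labels lab s
  recs : ∀ v ∈ nodes s, RecAt w M fp lab v

/-- The record `h` with 9 fields is the header of a version with string `s`: the five tables, the
first and the last position, the length, and the number of palindromic substrings. For `d = false`
it is seen as the header of a version with the reversed string, where the tables of surfaces and the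
ends are exchanged. The last position of the empty string is the one before its first position. -/
structure VerAt (w : ℕ) (M : ℕ → ℕ) (fp : ℕ) (d : Bool) (h : ℕ) (s : List (Fin σ))
    (lab : Node (Fin σ) → ℕ) (o : ℤ) (ch pre suf ed cn : ℕ → ℕ → ℕ) : Prop where
  lt : h + 9 ≤ fp
  enc : Enc w M fp d o s lab ch pre suf ed cn
  ch : MapAt M fp ch (M h)
  pre : MapAt M fp pre (M (h + bif d then 1 else 2))
  suf : MapAt M fp suf (M (h + bif d then 2 else 1))
  ed : MapAt M fp ed (M (h + 3))
  cn : MapAt M fp cn (M (h + 4))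
  fst : M (h + bif d then 5 else 6) = word w o
  lst : M (h + bif d then 6 else 5) = word w (o + dir d * (s.length - 1))
  len : M (h + 7) = s.length
  num : M (h + 8) = (pals s).card

theorem Enc.mono (hM : ∀ a < fp, M' a = M a) (hf : fp ≤ fp')
    (h : Enc w M fp d o s lab ch pre suf ed cn) : Enc w M' fp' d o s lab ch pre suf ed cn :=
  { h with recs := fun v hv => (h.recs v hv).mono hM hf }

theorem VerAt.mono (hM : ∀ a < fp, M' a = M a) (hf : fp ≤ fp')
    (H : VerAt w M fp d h s lab o ch pre suf ed cn) :
    VerAt w M' fp' d h s lab o ch pre suf ed cn := by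
  have h1 := H.lt
  have e : ∀ k < 9, M' (h + k) = M (h + k) := fun k hk => hM _ (by omega)
  have b1 : (bif d then 1 else 2) < 9 := by cases d <;> simp
  have b2 : (bif d then 2 else 1) < 9 := by cases d <;> simp
  have b3 : (bif d then 5 else 6) < 9 := by cases d <;> simp
  have b4 : (bif d then 6 else 5) < 9 := by cases d <;> simp
  refine ⟨by omega, H.enc.mono hM hf, ?_, ?_, ?_, ?_, ?_, ?_, ?_, ?_, ?_⟩
  · rw [hM _ (by omega)]; exact H.ch.mono hM hf
  · rw [e _ b1]; exact H.pre.mono hM hf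
  · rw [e _ b2]; exact H.suf.mono hM hf
  · rw [e _ (by norm_num)]; exact H.ed.mono hM hf
  · rw [e _ (by norm_num)]; exact H.cn.mono hM hf
  · rw [e _ b3, H.fst]
  · rw [e _ b4, H.lst]
  · rw [e _ (by norm_num), H.len]
  · rw [e _ (by norm_num), H.num]

theorem posn_mirror {k : ℕ} (hk : k < s.length) :
    posn w (!d) (o + dir d * (s.length - 1)) k = posn w d o (s.length - 1 - k) := by
  unfold posn
  congr 1
  rw [dir_not]
  push_cast [(by omega : k ≤ s.length - 1), (by omega : 1 ≤ s.length)]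
  ring

/-- A representation of `s` is also one of the reversed string, read in the other direction from the
other end: the eertrees and the counts are the same, and surfaces go to surfaces. -/
theorem Enc.mirror (h : Enc w M fp d o s lab ch pre suf ed cn) :
    Enc w M fp (!d) (o + dir d * (s.length - 1)) s.reverse lab ch suf pre ed cn := by
  have hn := nodes_reverse s
  have hc : cnt s.reverse = cnt s := funext fun v => cnt_reverse s v
  have hP : ∀ k < s.length, posn w (!d) (o + dir d * (s.length - 1)) k =
      posn w d o (s.length - 1 - k) := fun k hk => posn_mirror hk
  refine ⟨by simpa using h.length, h.ch.reverse hP, h.suf.reverse hP, h.pre.reverse hP, ?_, ?_, ?_,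
    ?_⟩
  · have := h.ed
    unfold EdTab at this ⊢
    rwa [hn]
  · rw [hn, hc]; exact h.cn
  · have := h.labels
    exact ⟨by rw [hn]; exact this.inj, by rw [hn]; exact this.ne, this.odd, this.even⟩
  · rw [hn]; exact h.recs

/-- The header of a version is also the header of the mirrored version, which turns operations at
the back into operations at the front. -/
theorem VerAt.mirror (H : VerAt w M fp d h s lab o ch pre suf ed cn) :
    VerAt w M fp (!d) h s.reverse lab (o + dir d * (s.length - 1)) ch suf pre ed cn := by
  refine ⟨H.lt, H.enc.mirror, H.ch, ?_, ?_, H.ed, H.cn, ?_, ?_, by simpa using H.len, ?_⟩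
  · have := H.suf
    cases d <;> exact this
  · have := H.pre
    cases d <;> exact this
  · have := H.lst
    cases d <;> exact this
  · have h1 := H.fst
    rw [dir_not, List.length_reverse, neg_mul, add_neg_cancel_right]
    cases d <;> exact h1
  · rw [H.num, pals_reverse]

/-- The letter in front of a suffix. -/
theorem ChTab.suffix {f : ℕ → ℕ → ℕ} (H : ChTab (posn w d o) s f) (hn : s.length < 2 ^ w)
    {u : List (Fin σ)} (hu : u <:+ s) :
    f (word w (o + dir d * (s.length - 1 - u.length))) 0 = c + 1 ↔ c :: u <:+ s := by
  have hl := hu.length_le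
  have hw : (s.length : ℤ) < 2 ^ w := by exact_mod_cast hn
  rw [cons_suffix_iff hu]
  constructor
  · intro h0
    obtain ⟨-, k, c', h1, h2, h3⟩ := H.supp (h0.trans_ne (Nat.succ_ne_zero _))
    have hk := (List.getElem?_eq_some_iff.1 h1).1
    have := word_dir_inj h2 (by omega) (by omega)
    rw [h0] at h3
    obtain rfl : c' = c := by ext; omega
    refine ⟨by omega, ?_⟩
    rw [← h1]
    congr 1
    omega
  · rintro ⟨h1, h2⟩
    refine H.val ⟨rfl, _, c, h2, ?_, rfl⟩
    unfold posn
    push_cast [(by omega : 1 ≤ s.length), (by omega : u.length ≤ s.length - 1)]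
    rfl

/-- Direct links that are absent lead to `odd`, which has the address 5. -/
theorem Labels.dtab_apply (H : Labels lab s)
    {u : Node (Fin σ)} (hu : u ∈ nodes s) {f : ℕ → ℕ → ℕ} (hf : DTab lab u f) :
    (if f (c + 1) 0 = 0 then 5 else f (c + 1) 0) = lab (direct u c) := by
  by_cases h : direct u c = .odd
  · rw [hf.eq_zero, if_pos rfl, h, H.odd]
    rintro z ⟨-, c', h1, h2, -⟩
    obtain rfl : c' = c := by ext; omega
    exact h1 h
  · rw [hf.val ⟨rfl, c, h, rfl, rfl⟩, if_neg (H.ne _ (direct_mem_nodes hu c))]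

/-- Pointers to nodes of `s` may be replaced by pointers that agree on these nodes. -/
theorem DTab.relabel {lab' : Node (Fin σ) → ℕ} (hlab : ∀ u ∈ nodes s, lab' u = lab u)
    {u : Node (Fin σ)} (hu : u ∈ nodes s) {f : ℕ → ℕ → ℕ} (hf : DTab lab u f) : DTab lab' u f := by
  refine Tab.congr hf fun x y z => ?_
  simp only [hlab _ (direct_mem_nodes hu _)]

theorem RecAt.relabel {lab' : Node (Fin σ) → ℕ} (hlab : ∀ u ∈ nodes s, lab' u = lab u)
    {u : Node (Fin σ)} (hu : u ∈ nodes s) (h : RecAt w M fp lab u) : RecAt w M fp lab' u := by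
  have e := hlab u hu
  refine ⟨by rw [e]; exact h.lt, by rw [e, h.len], ?_, ?_, fun t ht => ?_⟩
  · rw [e, h.link, hlab _ (link_mem_nodes hu)]
  · obtain ⟨f, h1, h2, h3⟩ := h.direct
    exact ⟨f, h1.relabel hlab hu, h2, by rw [e]; exact h3⟩
  · subst ht
    rw [e, h.core t rfl, hlab _ (core_mem_nodes (pal_mem_nodes.1 hu))]

/-- The direct links of a new node `v` are those of its suffix link `u`, except that the letter `c₀`
in front of the suffix `u` of `v` leads to `u`: they are obtained by one change of a map. -/
theorem DTab.concat {u v : List (Fin σ)} {c₀ : Fin σ} (hv : v.Palindrome) (hu : sufpal v.tail = u)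
    (hc : c₀ :: u <:+ v) {f : ℕ → ℕ → ℕ} (hf : DTab lab (.pal u) f) :
    DTab lab (.pal v) (fset f (c₀ + 1) 0 (lab (.pal u))) := by
  have key := direct_pal hv hu hc
  refine Tab.set hf ?_ ?_ ?_
  · rintro x y z ⟨rfl, c, h1, rfl, rfl⟩
    rw [key] at h1 ⊢
    split_ifs at h1 ⊢ with e
    · exact Or.inl ⟨⟨by rw [e], rfl⟩, rfl⟩
    · refine Or.inr ⟨fun e' => e ?_, rfl, c, h1, rfl, rfl⟩
      ext
      omega
  · intro _
    exact ⟨rfl, c₀, by rw [key, if_pos rfl]; simp, rfl, by rw [key, if_pos rfl]⟩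
  · rintro x y z ⟨rfl, c, h1, rfl, rfl⟩ hne
    have e : c ≠ c₀ := by rintro rfl; exact hne ⟨rfl, rfl⟩
    exact ⟨rfl, c, by rwa [key, if_neg e], rfl, by rw [key, if_neg e]⟩

namespace Enc

/-- The surface that ends at the last position is the longest palindromic suffix. -/
theorem suf_last (H : Enc w M fp d o s lab ch pre suf ed cn) :
    suf (word w (o + dir d * (s.length - 1))) 0 =
      if s = [] then 0 else lab (.pal (sufpal s)) := by
  split_ifs with hs
  · refine H.suf.eq_zero ?_
    rintro v ⟨-, i, j, h1, -⟩
    have := h1.lt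
    have := h1.le
    simp [hs] at this
    omega
  · have := List.length_pos_iff.2 hs
    refine H.suf.val ⟨rfl, _, _, (surf_length_iff hs).2 rfl, ?_, by rw [sub_sufpal]⟩
    unfold posn
    push_cast [(by omega : 1 ≤ s.length)]
    rfl

theorem ed_apply (H : Enc w M fp d o s lab ch pre suf ed cn)
    {u : Node (Fin σ)} (h : u.extend c ∈ nodes s) :
    ed (lab u) (c + 1) = lab (u.extend c) :=
  H.ed.val ⟨u, c, h, rfl, rfl, rfl⟩

theorem ed_eq_zero (H : Enc w M fp d o s lab ch pre suf ed cn)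
    {u : Node (Fin σ)} (hu : u ∈ nodes s) :
    ed (lab u) (c + 1) = 0 ↔ u.extend c ∉ nodes s := by
  constructor
  · intro h0 h
    rw [H.ed_apply h] at h0
    exact H.labels.ne _ h h0
  · intro h
    refine H.ed.eq_zero ?_
    rintro z ⟨u', c', h1, h2, h3, -⟩
    obtain rfl := H.labels.inj hu (mem_nodes_of_extend h1) h2
    obtain rfl : c' = c := by ext; omega
    exact h h1

end Enc

end Eer

namespace Eer

open WordRAM _root_.Eer.Tree

variable {w N lim j σ : ℕ} {st₀ st : State} {R : ℕ → ℕ} {F : ℕ → ℕ → ℕ → ℕ} {p q : Prog}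
  {P Q : State → Prop} {s v : List (Fin σ)} {c : Fin σ} {lab : Node (Fin σ) → ℕ} {d : Bool} {o : ℤ}

/-! ### Adding a letter: the longest palindromic suffix -/

/-- `r ← a + b` or `r ← a - b`. -/
def addD (d : Bool) (r a b : ℕ) : Prog := bif d then .add r a b else .sub r a b

/-- `out ← ` the value of the map in register `i` at the key in the registers `k₁` and `k₂`, or `x`
if that value is 0. The register 62 contains 0. -/
def getD (out i k₁ k₂ x : ℕ) : Prog :=
  seqs [getM out i k₁ k₂, .ite (.eq out 62) (.const out x) .skip]

theorem HS.congr {R' : ℕ → ℕ} {F' : ℕ → ℕ → ℕ → ℕ} (h : HS w N lim st₀ j st R F)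
    (hR : ∀ x, 56 ≤ x → R' x = R x) (hF : ∀ i, 50 ≤ i → i < 56 → F' i = F i) :
    HS w N lim st₀ j st R' F' :=
  { h with
    reg := fun x hx => by rw [h.reg x hx, hR x hx]
    map := fun i h1 h2 => by rw [hF i h1 h2]; exact h.map i h1 h2
    supp := fun i h1 h2 => by rw [hF i h1 h2]; exact h.supp i h1 h2 }

theorem HS.addD {r a b : ℕ} {x y : ℤ} (h : HS w N lim st₀ (j + 1) st R F) (hr : 56 ≤ r)
    (ha : 56 ≤ a) (hb : 56 ≤ b) (e₁ : R a = word w x) (e₂ : R b = word w y) :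
    Within w N 1 (addD d r a b) st fun s' =>
      HS w N lim st₀ j s' (upd R r (word w (x + dir d * y))) F := by
  cases d
  · have := h.sub hr ha hb e₁ e₂
    simpa [Eer.addD, dir, ← sub_eq_add_neg] using this
  · have := h.add hr ha hb e₁ e₂
    simpa [Eer.addD, dir] using this

theorem HS.succ {r a b x : ℕ} (h : HS w N lim st₀ (j + 1) st R F) (hr : 56 ≤ r)
    (ha : 56 ≤ a) (hb : 56 ≤ b) (e₁ : R a = x) (e₂ : R b = 1) (hx : x + 1 < 2 ^ w) :
    Within w N 1 (.add r a b) st fun s' => HS w N lim st₀ j s' (upd R r (x + 1)) F := by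
  have := h.add (x := x) (y := (1 : ℕ)) hr ha hb (by rw [e₁, word_natCast (by omega)])
    (by rw [e₂, word_natCast (by omega)])
  rwa [← Nat.cast_add, word_natCast hx] at this

theorem HS.pred {r a b x : ℕ} (h : HS w N lim st₀ (j + 1) st R F) (hr : 56 ≤ r)
    (ha : 56 ≤ a) (hb : 56 ≤ b) (e₁ : R a = x + 1) (e₂ : R b = 1) (hx : x + 1 < 2 ^ w) :
    Within w N 1 (.sub r a b) st fun s' => HS w N lim st₀ j s' (upd R r x) F := by
  have := h.sub (x := (x + 1 : ℕ)) (y := (1 : ℕ)) hr ha hb (by rw [e₁, word_natCast hx])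
    (by rw [e₂, word_natCast (by omega)])
  rwa [Nat.cast_add, add_sub_cancel_right, word_natCast (by omega)] at this

theorem HS.getD {out i k₁ k₂ x y : ℕ} (h : HS w N lim st₀ (j + 2) st R F) (ho : 56 ≤ out)
    (hi : 50 ≤ i ∧ i < 56) (h1 : 56 ≤ k₁) (h2 : 56 ≤ k₂) (hz : R 62 = 0) (hx : x < 2 ^ w)
    (ho' : out ≠ 62) (e : (if F i (R k₁) (R k₂) = 0 then x else F i (R k₁) (R k₂)) = y) :
    Within w N 3 (getD out i k₁ k₂ x) st fun s' => HS w N lim st₀ j s' (upd R out y) F := by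
  refine Within.step (h.getM ho hi h1 h2 rfl) fun s₁ H => ?_
  have e62 : s₁.reg 62 = 0 := by
    rw [H.reg 62 (by norm_num), upd_apply, if_neg ho'.symm, hz]
  have eo : s₁.reg out = F i (R k₁) (R k₂) := by rw [H.reg out ho, upd_apply, if_pos rfl]
  refine Within.ite (fun t => ?_) fun t => ?_ <;> simp only [Test.Holds, eo, e62] at t
  · refine (H.const (k := x) ho hx).mono le_rfl fun s₂ H₂ => H₂.congr (fun z _ => ?_)
      fun _ _ _ => rfl
    rw [if_pos t] at e
    simp only [upd_apply, e]
    split_ifs <;> rfl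
  · refine Within.skip ((H.mono (Nat.le_succ j)).congr (fun z _ => ?_) fun _ _ _ => rfl)
    rw [if_neg t] at e
    rw [e]

/-- The registers that describe a version. -/
structure Regs (w : ℕ) (d : Bool) (o : ℤ) (s : List (Fin σ)) (R : ℕ → ℕ) : Prop where
  fst : R 57 = word w o
  lst : R 58 = word w (o + dir d * (s.length - 1))
  len : R 59 = s.length
  num : R 60 = (pals s).card
  zero : R 62 = 0
  one : R 63 = 1

/-- Register 67 ← the node `p` such that `c str(p) c` is the longest palindromic suffix after the
letter `c` has been added. -/
def findCore (d : Bool) : Prog := seqs [getD 64 52 58 62 9, loadM 65 64 0, addD (!d) 66 58 65,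
  getM 66 50 66 62, .ite (.eq 66 61) (.move 67 64) (seqs [loadM 55 64 2, getD 67 55 61 62 5])]

/-- One comparison of letters and one direct link suffice, by `extend_sufpal_concat`. -/
theorem within_findCore (H : HS w N lim st₀ (j + 10) st R F)
    (E : Enc w st₀.mem (st₀.reg 3) d o s lab (F 50) (F 51) (F 52) (F 53) (F 54))
    (hR : Regs w d o s R) (h61 : R 61 = c + 1) (hN : s.length + j + 10 ≤ N) {p : Node (Fin σ)}
    (hp : p.extend c = .pal (sufpal (s ++ [c]))) :
    Within w N 11 (findCore d) st fun st' => ∃ R' F', HS w N lim st₀ j st' R' F' ∧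
      (∀ x, x < 64 → R' x = R x) ∧ (∀ i, i < 55 → F' i = F i) ∧ R' 67 = lab p := by
  have hlen := E.length
  have hu : sufpal s ∈ pals s := sufpal_mem_pals s
  have hun := pal_mem_nodes.2 hu
  have rc := E.recs _ hun
  have hlt := rc.lt
  -- No surface ends in the empty string; its longest palindromic suffix is the node `even`.
  have e64 : (if F 52 (R 58) (R 62) = 0 then 9 else F 52 (R 58) (R 62)) =
      lab (.pal (sufpal s)) := by
    rw [hR.lst, hR.zero, E.suf_last]
    by_cases h1 : s = []
    · rw [if_pos h1, if_pos rfl, h1, ← E.labels.even]; rfl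
    · rw [if_neg h1, if_neg (E.labels.ne _ hun)]
  refine Within.seq (k := 3) (H.getD (by norm_num) (by norm_num) (by norm_num) (by norm_num)
    hR.zero (by omega) (by norm_num) e64) fun s₁ H₁ => ?_
  refine Within.step (H₁.loadM (by norm_num) (by norm_num) (k := 0) (y := word w (sufpal s).length)
    (by simp only [upd_apply]; simp; omega) ?_) fun s₂ H₂ => ?_
  · simp only [upd_apply]; simp; exact rc.len
  refine Within.step (H₂.addD (x := o + dir d * (s.length - 1)) (y := (sufpal s).length)
    (by norm_num) (by norm_num) (by norm_num) ?_ ?_) fun s₃ H₃ => ?_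
  · simpa [upd_apply] using hR.lst
  · simp [upd_apply]
  have e66 : o + dir d * (s.length - 1) + dir (!d) * (sufpal s).length =
      o + dir d * (s.length - 1 - (sufpal s).length) := by rw [dir_not]; ring
  rw [e66] at H₃
  refine Within.step (H₃.getM (by norm_num) (by norm_num) (by norm_num) (by norm_num) rfl)
    fun s₄ H₄ => ?_
  simp only [upd_apply, if_true, if_neg (by norm_num : ¬ 62 = 66), if_neg (by norm_num : ¬ 62 = 65),
    if_neg (by norm_num : ¬ 62 = 64), hR.zero] at H₄
  have key := E.ch.suffix (c := c) (by omega) (sufpal_suffix s)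
  have hp' := extend_sufpal_concat s c
  refine Within.ite (fun t => ?_) fun t => ?_ <;>
    simp only [Test.Holds, H₄.reg 66 (by norm_num), H₄.reg 61 (by norm_num), upd_apply] at t <;>
    simp [h61] at t <;> rw [key] at t
  · rw [if_pos t, ← hp] at hp'
    refine (H₄.move (by norm_num) (by norm_num)).mono (by norm_num) fun s₅ H₅ =>
      ⟨_, _, H₅.mono (by omega), fun x hx => ?_, fun _ _ => rfl, ?_⟩
    · simp only [upd_apply]
      repeat rw [if_neg (by omega)]
    · rw [← (Node.extend_injective hp').1]
      simp [upd_apply]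
  · rw [if_neg t, ← hp] at hp'
    obtain ⟨f, hf1, hf2, hf3⟩ := rc.direct
    have hl := (sufpal_suffix s).length_le
    refine Within.step (H₄.loadMap (by norm_num) (k := 2) (f := f)
      (by simp only [upd_apply]; simp; omega) (by simpa [upd_apply] using hf3) hf2
      (by simp [Node.len]; omega)) fun s₅ H₅ => ?_
    refine (H₅.getD (y := lab (direct (.pal (sufpal s)) c)) (by norm_num) (by norm_num)
      (by norm_num)
      (by norm_num) (by simp [upd_apply, hR.zero]) (by omega) (by norm_num) ?_).mono (by norm_num)
      fun s₆ H₆ => ⟨_, _, H₆.mono (by omega), fun x hx => ?_, fun i hi => ?_, ?_⟩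
    · rw [← E.labels.dtab_apply hun hf1]
      simp [upd_apply, hR.zero, h61]
    · simp only [upd_apply]
      repeat rw [if_neg (by omega)]
    · rw [upd_apply, if_neg (by omega)]
    · rw [← (Node.extend_injective hp').1]
      simp [upd_apply]

end Eer

namespace Eer

open WordRAM _root_.Eer.Tree

/-! ### Adding a letter: the new node -/

variable {w N lim j σ : ℕ} {st₀ st : State} {R : ℕ → ℕ} {F : ℕ → ℕ → ℕ → ℕ}
  {s v : List (Fin σ)} {c : Fin σ} {lab lab' : Node (Fin σ) → ℕ} {d : Bool} {o : ℤ}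

open Classical in
/-- The counts of `s` and, if `v` is a new node, its suffix link. -/
noncomputable def cntNew (s v : List (Fin σ)) (y : Node (Fin σ)) : ℕ :=
  cnt s y + if v ∉ pals s ∧ Node.link (.pal v) = y then 1 else 0

/-- The pointers `lab'`, the tables `ed`, `cn` and the records after the node of the longest
palindromic suffix `v` of `s ++ [c]` has been added to the eertree of `s` if necessary. -/
structure Added (w : ℕ) (M : ℕ → ℕ) (fp : ℕ) (s : List (Fin σ)) (c : Fin σ) (v : List (Fin σ))
    (lab lab' : Node (Fin σ) → ℕ) (ed cn : ℕ → ℕ → ℕ) : Prop where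
  eq : ∀ u ∈ nodes s, lab' u = lab u
  labels : Labels lab' (s ++ [c])
  recs : ∀ u ∈ nodes (s ++ [c]), RecAt w M fp lab' u
  ed : EdTab lab' (s ++ [c]) ed
  cn : CnTab lab' (nodes (s ++ [c])) (cntNew s v) cn

/-- Add a node with the parent in register 67, the edge label in 61, and the length in 69. -/
def newNode (d : Bool) : Prog := seqs [loadM 55 67 2, getD 70 55 61 62 5, getD 71 53 70 61 9,
  loadM 72 71 0, addD (!d) 73 58 72, getM 73 50 73 62, loadM 55 71 2, setM 55 73 62 71,
  .seq (.const 20 1) (alloc 68 [69, 71, 55, 67]), setM 53 67 61 68, getM 74 54 71 62,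
  .add 74 74 63, setM 54 71 62 74, .add 60 60 63]

/-- The suffix link of a new node, found by the direct link of its parent. -/
theorem link_eq_direct {ed : ℕ → ℕ → ℕ} (L : Labels lab s) (hed : EdTab lab s ed)
    (hv : sufpal (s ++ [c]) = v) (hn : v ∉ pals s) {p : Node (Fin σ)} (hp : p.extend c = .pal v)
    (hpn : p ∈ nodes s) :
    (if ed (lab (direct p c)) (c + 1) = 0 then 9 else ed (lab (direct p c)) (c + 1)) =
      lab (.pal (sufpal v.tail)) := by
  have hvp : v.Palindrome := hv ▸ sufpal_palindrome _
  have hv0 : v ≠ [] := hv ▸ sufpal_ne_nil (by simp)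
  cases p with
  | odd =>
    simp only [Node.extend, Node.pal.injEq] at hp
    subst hp
    rw [hed.eq_zero, if_pos rfl, ← L.even]
    · rfl
    · rintro z ⟨u', c', h1, h2, h3, -⟩
      have := L.inj (odd_mem_nodes s) (mem_nodes_of_extend h1) h2
      subst this
      obtain rfl : c' = c := by ext; omega
      exact hn (pal_mem_nodes.1 h1)
  | pal t =>
    have h1 : (direct (.pal t) c).extend c = .pal (sufpal v.tail) := by
      rw [← link_extend_pal, hp, link_eq hv0]
    have h2 : Node.pal (sufpal v.tail) ∈ nodes s := by
      refine pal_mem_nodes.2 (mem_pals_of_suffix (c := c) (sufpal_palindrome _) ?_ ?_)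
      · exact (sufpal_suffix _).trans ((List.tail_suffix v).trans (hv ▸ sufpal_suffix _))
      · rw [hv]
        intro e
        have := length_sufpal_tail_lt hv0
        rw [e] at this
        omega
    rw [hed.val ⟨direct (.pal t) c, c, by rw [h1]; exact h2, rfl, rfl, rfl⟩, h1, if_neg (L.ne _ h2)]

/-- The suffix link `u` of the new node is found by `link_eq_direct`, its direct links by
`DTab.concat`. The only count that changes is that of `u`; the surface of the new palindrome is
counted later. -/
theorem within_newNode (H : HS w N lim st₀ (j + 20) st R F)
    (hlen : 3 * s.length + 10 < 2 ^ w) (L : Labels lab s)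
    (recs : ∀ u ∈ nodes s, RecAt w st₀.mem (st₀.reg 3) lab u)
    (hch : ChTab (posn w d o) (s ++ [c]) (F 50)) (hed : EdTab lab s (F 53))
    (hcn : CnTab lab (nodes s) (cnt s) (F 54)) (hv : sufpal (s ++ [c]) = v) (hn : v ∉ pals s)
    (h58 : R 58 = word w (o + dir d * s.length)) (h60 : R 60 = (pals s).card)
    (h61 : R 61 = c + 1) (h62 : R 62 = 0) (h63 : R 63 = 1) {p : Node (Fin σ)}
    (hp : p.extend c = .pal v) (hpn : p ∈ nodes s) (h67 : R 67 = lab p)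
    (h69 : R 69 = word w v.length) (hN : s.length + j + 20 ≤ N) :
    Within w N 18 (newNode d) st fun st' => ∃ st₁ R' F' lab', Ext st₀ st₁ ∧
      HS w N lim st₁ j st' R' F' ∧
      Added w st₁.mem (st₁.reg 3) s c v lab lab' (F' 53) (F' 54) ∧
      R' 68 = lab' (.pal v) ∧ R' 69 = R 69 ∧ R' 60 = (pals (s ++ [c])).card ∧
      (∀ x, x < 64 → x ≠ 60 → R' x = R x) ∧ ∀ i, i < 53 → F' i = F i := by
  have hvp : v.Palindrome := hv ▸ sufpal_palindrome _
  have hv0 : v ≠ [] := hv ▸ sufpal_ne_nil (by simp)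
  have hvs : v <:+ s ++ [c] := hv ▸ sufpal_suffix _
  obtain ⟨u, hu⟩ : ∃ u, sufpal v.tail = u := ⟨_, rfl⟩
  have hul : u.length < v.length := hu ▸ length_sufpal_tail_lt hv0
  have huv : u <:+ v := hu ▸ (sufpal_suffix _).trans (List.tail_suffix v)
  have hus := huv.trans hvs
  have hup : u.Palindrome := hu ▸ sufpal_palindrome _
  have hun : Node.pal u ∈ nodes s := pal_mem_nodes.2 (mem_pals_of_suffix (c := c) hup hus
    (by rw [hv]; rintro rfl; omega))
  -- The letter in front of the suffix `u` of `v`; it exists since `u` is shorter than `v`.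
  obtain ⟨c₀, hc₀⟩ : ∃ c₀, c₀ :: u <:+ v := by
    obtain ⟨x, hx⟩ := huv
    have hx0 : x ≠ [] := by rintro rfl; rw [List.nil_append] at hx; rw [hx] at hul; omega
    obtain ⟨y, a, rfl⟩ := (List.eq_nil_or_concat' x).resolve_left hx0
    exact ⟨a, y, by rw [← hx]; simp⟩
  have hlv : v.length ≤ s.length + 1 := by simpa using hvs.length_le
  have rp := recs p hpn
  have ru := recs _ hun
  have lp := rp.lt
  have lu := ru.lt
  obtain ⟨f₁, hf1, hf2, hf3⟩ := rp.direct
  obtain ⟨f₂, hf4, hf5, hf6⟩ := ru.direct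
  have hplen : p.len.toNat ≤ s.length + 1 := by
    cases p with
    | odd => simp [Node.len]
    | pal t =>
      have := ((mem_pals.1 (pal_mem_nodes.1 hpn)).2).length_le
      simp [Node.len]
      omega
  refine Within.step (H.loadMap (by norm_num) (k := 2) (f := f₁) (by rw [h67]; omega)
      (by rw [h67]; exact hf3) hf2 (by omega)) fun s₁ H₁ => ?_
  refine Within.seq (k := 3) (H₁.getD (y := lab (direct p c)) (by norm_num) (by norm_num)
    (by norm_num) (by norm_num) h62 (by omega) (by norm_num) ?_) fun s₂ H₂ => ?_
  · rw [← L.dtab_apply hpn hf1, h61, h62]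
    simp [upd_apply]
  refine Within.seq (k := 3) (H₂.getD (y := lab (.pal u)) (by norm_num) (by norm_num)
    (by norm_num) (by norm_num) (by simp [upd_apply, h62]) (by omega) (by norm_num) ?_)
    fun s₃ H₃ => ?_
  · rw [← hu, ← link_eq_direct L hed hv hn hp hpn]
    simp [upd_apply, h61]
  refine Within.step (H₃.loadM (by norm_num) (by norm_num) (k := 0) (y := word w u.length)
    (by simp only [upd_apply]; simp; omega) ?_) fun s₄ H₄ => ?_
  · simp only [upd_apply]; simp; exact ru.len
  refine Within.step (H₄.addD (x := o + dir d * s.length) (y := u.length)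
    (by norm_num) (by norm_num) (by norm_num) ?_ ?_) fun s₅ H₅ => ?_
  · simpa [upd_apply] using h58
  · simp [upd_apply]
  have e73 : o + dir d * s.length + dir (!d) * u.length =
      o + dir d * ((s ++ [c]).length - 1 - u.length) := by rw [dir_not]; simp; ring
  rw [e73] at H₅
  have hc1 := (ChTab.suffix hch (by simp; omega) hus).2 (hc₀.trans hvs)
  refine Within.step (H₅.getM (y := c₀ + 1) (by norm_num) (by norm_num) (by norm_num)
    (by norm_num) ?_)
    fun s₆ H₆ => ?_
  · rw [← hc1]
    simp [upd_apply, h62]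
  refine Within.step (H₆.loadMap (by norm_num) (k := 2) (f := f₂)
    (by simp only [upd_apply]; simp; omega) (by simpa [upd_apply] using hf6) hf5
    (by simp [Node.len]; omega)) fun s₇ H₇ => ?_
  refine Within.step (H₇.setM (by norm_num) (by norm_num) (by norm_num) (by norm_num))
    fun s₈ H₈ => ?_
  simp [upd_apply, h62] at H₈
  have f8 := H₈.ext.fp
  have m55 := H₈.map 55 (by norm_num) (by norm_num)
  have r69 := H₈.reg 69 (by norm_num)
  have r71 := H₈.reg 71 (by norm_num)
  have r67 := H₈.reg 67 (by norm_num)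
  simp [upd_apply, h69, h67] at m55 r69 r71 r67
  have X8 := H₈.ext
  refine Within.step (H₈.alloc (out := 68) (rs := [69, 71, 55, 67]) (by norm_num) (by simp)
    (by simp)) fun s₉ hs₉ => ?_
  obtain ⟨X9, H₉, g3, -, gm, -⟩ := hs₉
  classical
  simp only [List.length_cons, List.length_nil] at g3 gm
  have g0 := gm 0 (by norm_num)
  have g1 := gm 1 (by norm_num)
  have g2 := gm 2 (by norm_num)
  have g4 := gm 3 (by norm_num)
  simp only [List.getElem_cons_zero, List.getElem_cons_succ, Nat.add_zero] at g0 g1 g2 g4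
  have EX := X8.trans X9
  have hlt : ∀ u ∈ nodes s, lab u < s₈.reg 3 := fun u hu => by
    have := (recs u hu).lt
    omega
  have hvn : Node.pal v ∉ nodes s := fun h => hn (pal_mem_nodes.1 h)
  obtain ⟨lab', hl1, hl2⟩ : ∃ lab' : Node (Fin σ) → ℕ, (∀ u ∈ nodes s, lab' u = lab u) ∧
      lab' (.pal v) = s₈.reg 3 := by
    refine ⟨Function.update lab (.pal v) (s₈.reg 3), fun u hu => ?_, by simp⟩
    rw [Function.update_of_ne]
    rintro rfl
    exact hvn hu
  have hlab : Labels lab' (s ++ [c]) := by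
    refine ⟨fun x hx y hy e => ?_, fun x hx => ?_, ?_, ?_⟩
    · rcases (nodes_concat hv x).1 hx with hx | rfl <;>
        rcases (nodes_concat hv y).1 hy with hy | rfl
      · rw [hl1 x hx, hl1 y hy] at e
        exact L.inj hx hy e
      · rw [hl1 x hx, hl2] at e
        exact absurd e (hlt x hx).ne
      · rw [hl1 y hy, hl2] at e
        exact absurd e (hlt y hy).ne'
      · rfl
    · rcases (nodes_concat hv x).1 hx with hx | rfl
      · rw [hl1 x hx]
        exact L.ne x hx
      · have := hlt p hpn
        omega
    · rw [hl1 _ (odd_mem_nodes s), L.odd]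
    · rw [hl1 _ (pal_mem_nodes.2 (nil_mem_pals s)), L.even]
  have hlink : Node.link (.pal v) = .pal u := by rw [link_eq hv0, hu]
  have hcore : core v = p := by
    obtain ⟨t, h1, h2⟩ := core_extend c p
    rw [hp, Node.pal.injEq] at h1
    rw [h1, h2]
  have hrec : ∀ u ∈ nodes (s ++ [c]), RecAt w s₉.mem (s₉.reg 3) lab' u := by
    intro x hx
    rcases (nodes_concat hv x).1 hx with hx | rfl
    · exact ((recs x hx).mono EX.mem EX.fp).relabel hl1 hx
    · refine ⟨by rw [hl2]; omega, ?_, ?_, ?_, fun t ht => ?_⟩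
      · rw [hl2, g0, r69]
        rfl
      · rw [hl2, g1, r71, hlink, hl1 _ hun]
      · have := DTab.concat hvp hu hc₀ (hf4.relabel hl1 hun)
        rw [hl1 _ hun] at this
        refine ⟨_, this, (hf5.fset _ _ _).mono ?_, ?_⟩
        · simp only [Node.len, Int.toNat_natCast]
          omega
        · rw [hl2, g2]
          exact m55.mono X9.mem X9.fp
      · obtain rfl : v = t := by simpa using ht
        rw [hl2, g4, r67, hcore, hl1 p hpn]
  refine Within.step (H₉.setM (by norm_num) (by norm_num) (by norm_num) (by norm_num))
    fun s₁₀ H₁₀ => ?_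
  have hcu : F 54 (lab (.pal u)) 0 = cnt s (.pal u) := hcn.apply hun
  refine Within.step (H₁₀.getM (y := cnt s (.pal u)) (by norm_num) (by norm_num) (by norm_num)
    (by norm_num) ?_) fun s₁₁ H₁₁ => ?_
  · rw [← hcu]
    simp [upd_apply, h62]
  have hcl := cnt_le s (.pal u)
  refine Within.step (H₁₁.succ (x := cnt s (.pal u)) (by norm_num) (by norm_num)
    (by norm_num) (by simp [upd_apply]) (by simp [upd_apply, h63]) (by omega)) fun s₁₂ H₁₂ => ?_
  refine Within.step (H₁₂.setM (by norm_num) (by norm_num) (by norm_num) (by norm_num))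
    fun s₁₃ H₁₃ => ?_
  have hcp := card_pals_le s
  refine (H₁₃.succ (x := (pals s).card) (by norm_num) (by norm_num) (by norm_num)
    (by simp [upd_apply, h60]) (by simp [upd_apply, h63]) (by omega)).mono le_rfl
    fun s₁₄ H₁₄ => ?_
  refine ⟨s₉, _, _, lab', EX, H₁₄.mono (by omega), ⟨hl1, hlab, hrec, ?_, ?_⟩, ?_, ?_, ?_,
    fun x hx hx' => ?_, fun i hi => ?_⟩
  · have := hed.concat (lab' := lab') hv hn hp hpn L.inj hl1
    rw [hl2] at this
    simpa [upd_apply, h67, h61] using this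
  · have h1 : CnTab lab' (nodes (s ++ [c])) (cnt s) (F 54) := by
      refine CnTab.change hcn (fun x hx _ => hl1 x hx) (fun x hx hx' => ?_)
        fun x hx hx' => absurd (nodes_subset_concat _ _ hx) hx'
      obtain rfl := ((nodes_concat hv x).1 hx).resolve_left hx'
      refine ⟨cnt_eq_zero hvp hv0 hn, hcn.eq_zero ?_⟩
      rintro z ⟨-, y, hy, h2, -⟩
      rw [hl2] at h2
      exact (hlt y hy).ne' h2
    have h2 := h1.set hlab.inj (nodes_subset_concat _ _ hun) (cnt s (.pal u) + 1)
    rw [hl1 _ hun] at h2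
    have h3 := CnTab.congr (g' := cntNew s v) h2 fun y _ => by
      unfold cntNew
      rw [hlink]
      by_cases e : y = .pal u
      · simp [e, hn]
      · simp [e, Ne.symm e]
    simpa [upd_apply, h62] using h3
  · rw [hl2]
    simp [upd_apply]
  · simp [upd_apply]
  · rw [pals_concat, hv, Finset.card_insert_of_notMem hn]
    simp [upd_apply]
  · simp only [upd_apply]
    repeat rw [if_neg (by omega)]
  · simp only [upd_apply]
    repeat rw [if_neg (by omega)]

end Eer

namespace Eer

open WordRAM _root_.Eer.Tree

variable {w N lim j σ : ℕ} {st₀ st : State} {R : ℕ → ℕ} {F : ℕ → ℕ → ℕ → ℕ}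
  {s v : List (Fin σ)} {c : Fin σ} {lab lab' : Node (Fin σ) → ℕ} {d : Bool} {o : ℤ}

/-! ### Adding a letter: the surfaces -/

/-- Remove the surface that starts at the position in register 75 and whose node is in register 76,
unless this is 0. -/
def dropSurf (d : Bool) : Prog := .ite (.eq 76 62) .skip (seqs [loadM 77 76 0, addD d 77 75 77,
  addD (!d) 77 77 63, setM 52 77 62 62, getM 78 54 76 62, .sub 78 78 63, setM 54 76 62 78])

open Classical in
/-- The counts are described by `g` with the surface that starts at `i₀` added; when it has been
removed, they are `g`. -/
theorem within_dropSurf (H : HS w N lim st₀ (j + 7) st R F)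
    (hlen : 3 * s.length + 10 < 2 ^ w) {i₀ : ℕ} (hi : i₀ < s.length + 1) (L : Labels lab s)
    (hpre : PreTab (posn w d o) lab s (F 51)) {D : Set (Node (Fin σ))} {g : Node (Fin σ) → ℕ}
    (hD : nodes s ⊆ D) (hcn : CnTab lab' D (fun y => g y +
      if ∃ j, Surf s i₀ j ∧ Node.pal (sub s i₀ j) = y then 1 else 0) (F 54))
    (hinj : Set.InjOn lab' D) (hlab : ∀ u ∈ nodes s, lab' u = lab u)
    (hg : ∀ y, g y ≤ 2 * s.length + 3)
    (recs : ∀ u ∈ nodes s, RecAt w st₀.mem (st₀.reg 3) lab' u)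
    (h62 : R 62 = 0) (h63 : R 63 = 1) (h75 : R 75 = posn w d o i₀)
    (h76 : R 76 = F 51 (posn w d o i₀) 0) :
    Within w N 9 (dropSurf d) st fun st' => ∃ R' F', HS w N lim st₀ j st' R' F' ∧
      ((∃ j, Surf s i₀ j ∧ F' 52 = fset (F 52) (posn w d o (j - 1)) 0 0) ∨
        ((∀ j, ¬ Surf s i₀ j) ∧ F' 52 = F 52)) ∧
      CnTab lab' D g (F' 54) ∧ (∀ x, x < 77 → R' x = R x) ∧
      ∀ i, i ≠ 52 → i ≠ 54 → F' i = F i := by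
  have hP : InjTo (posn w d o) s.length := injTo_posn (by omega)
  have w1 : word w 1 = 1 := word_natCast (n := 1) (by omega)
  refine (Within.ite (fun t => ?_) fun t => ?_ : Within w N 8 _ _ _).mono (by norm_num)
    fun _ h => h <;>
    simp only [Test.Holds, H.reg 76 (by norm_num), H.reg 62 (by norm_num), h62] at t
  · have hn : ∀ j, ¬ Surf s i₀ j := fun j hj => by
      rw [h76, hpre.val ⟨rfl, _, _, hj, rfl, rfl⟩] at t
      exact L.ne _ (surf_mem_nodes hj) t
    refine (Within.skip ⟨R, F, H.mono (by omega), Or.inr ⟨hn, rfl⟩, ?_, fun _ _ => rfl,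
      fun _ _ _ => rfl⟩ : Within w N 1 _ _ _).mono (by norm_num) fun _ h => h
    exact CnTab.congr hcn fun y _ => by simp [hn]
  · obtain ⟨-, i, k, hs, h1, h2⟩ := hpre.supp (h76 ▸ t)
    have l1 := hs.lt
    have l2 := hs.le
    obtain rfl : i₀ = i := hP _ (by omega) _ (by omega) h1
    rw [← h76] at h2
    have hy := surf_mem_nodes hs
    have ry := recs _ hy
    have ly := ry.lt
    rw [hlab _ hy, ← h2] at ly
    have lny := ry.len
    rw [hlab _ hy, ← h2] at lny
    refine Within.step (H.loadM (by norm_num) (by norm_num) (k := 0)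
      (y := word w (k - i₀ : ℕ)) (by omega) ?_) fun s₁ H₁ => ?_
    · rw [Nat.add_zero, lny]
      simp [Node.len, length_sub l2]
    refine Within.step (H₁.addD (x := o + dir d * i₀) (y := (k - i₀ : ℕ)) (by norm_num)
      (by norm_num) (by norm_num) (by simpa [upd_apply, posn] using h75) (by simp [upd_apply]))
      fun s₂ H₂ => ?_
    refine Within.step (H₂.addD (d := !d) (y := (1 : ℕ)) (by norm_num) (by norm_num) (by norm_num)
      (upd_apply _ _ _ _) (by simp [upd_apply, h63, w1])) fun s₃ H₃ => ?_
    have e77 : o + dir d * i₀ + dir d * (k - i₀ : ℕ) + dir (!d) * (1 : ℕ) =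
        o + dir d * (k - 1 : ℕ) := by
      rw [dir_not]
      push_cast [l1.le, (by omega : 1 ≤ k)]
      ring
    rw [e77] at H₃
    refine Within.step (H₃.setM (by norm_num) (by norm_num) (by norm_num) (by norm_num))
      fun s₄ H₄ => ?_
    have hgk := hg (.pal (sub s i₀ k))
    have hcy := hcn.apply (hD hy)
    rw [if_pos ⟨k, hs, rfl⟩, hlab _ hy, ← h2] at hcy
    refine Within.step (H₄.getM (y := g (.pal (sub s i₀ k)) + 1) (by norm_num) (by norm_num)
      (by norm_num) (by norm_num) (by rw [← hcy]; simp [upd_apply, h62])) fun s₅ H₅ => ?_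
    refine Within.step (H₅.pred (x := g (.pal (sub s i₀ k))) (by norm_num) (by norm_num)
      (by norm_num) (by simp [upd_apply]) (by simp [upd_apply, h63]) (by omega)) fun s₆ H₆ => ?_
    refine (H₆.setM (by norm_num) (by norm_num) (by norm_num) (by norm_num)).mono le_rfl
      fun s₇ H₇ => ⟨_, _, H₇, Or.inl ⟨k, hs, ?_⟩, ?_, fun x hx => ?_, fun i hi hi' => ?_⟩
    · simp [upd_apply, h62, posn]
    · have h3 := hcn.set hinj (hD hy) (g (.pal (sub s i₀ k)))
      rw [hlab _ hy, ← h2] at h3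
      have h4 := CnTab.congr (g' := g) h3 fun y _ => by
        by_cases e : y = .pal (sub s i₀ k)
        · simp [e]
        · rw [if_neg e, if_neg, Nat.add_zero]
          rintro ⟨k', hk', e'⟩
          rw [hk'.eq_right hs] at e'
          exact e e'.symm
      simpa [upd_apply, h62] using h4
    · simp only [upd_apply]
      repeat rw [if_neg (by omega)]
    · simp only [upd_apply]
      repeat rw [if_neg (by omega)]

/-- Record the new longest palindromic suffix, whose node is in register 68 and whose length is in
register 69. -/
def addLast (d : Bool) : Prog := seqs [getM 74 54 68 62, .add 74 74 63, setM 54 68 62 74,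
  addD (!d) 75 58 69, addD d 75 75 63, getM 76 51 75 62, dropSurf d, setM 51 75 62 68,
  setM 52 58 62 68, .add 59 59 63]

/-- The longest palindromic suffix `v` of `s ++ [c]` is a new surface, which replaces the surface of
`s` that starts at the same position; the counts change as `cnt_concat` says. -/
theorem within_addLast (H : HS w N lim st₀ (j + 20) st R F)
    (hlen : 3 * s.length + 13 < 2 ^ w) (L : Labels lab s)
    (hA : Added w st₀.mem (st₀.reg 3) s c v lab lab' (F 53) (F 54))
    (hch : ChTab (posn w d o) (s ++ [c]) (F 50)) (hpre : PreTab (posn w d o) lab s (F 51))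
    (hsuf : SufTab (posn w d o) lab s (F 52)) (hv : sufpal (s ++ [c]) = v)
    (h57 : R 57 = word w o) (h58 : R 58 = word w (o + dir d * s.length)) (h59 : R 59 = s.length)
    (h60 : R 60 = (pals (s ++ [c])).card) (h62 : R 62 = 0) (h63 : R 63 = 1)
    (h68 : R 68 = lab' (.pal v)) (h69 : R 69 = word w v.length) :
    Within w N 18 (addLast d) st fun st' => ∃ R' F', HS w N lim st₀ j st' R' F' ∧
      Enc w st₀.mem (st₀.reg 3) d o (s ++ [c]) lab' (F' 50) (F' 51) (F' 52) (F' 53) (F' 54) ∧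
      Regs w d o (s ++ [c]) R' := by
  classical
  have hv0 : v ≠ [] := hv ▸ sufpal_ne_nil (by simp)
  have hvl := List.length_pos_iff.2 hv0
  have hvs : v.length ≤ s.length + 1 := by
    simpa [hv] using (sufpal_suffix (s ++ [c])).length_le
  have hP : InjTo (posn w d o) s.length := injTo_posn (by omega)
  have w1 : word w 1 = 1 := word_natCast (n := 1) (by omega)
  obtain ⟨i₀, hi⟩ : ∃ i₀, i₀ = (s ++ [c]).length - v.length := ⟨_, rfl⟩
  have hi' : i₀ = s.length + 1 - v.length := by simpa using hi
  have hvn : Node.pal v ∈ nodes (s ++ [c]) := (nodes_concat hv _).2 (Or.inr rfl)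
  have hcl : cntNew s v (.pal v) ≤ 2 * s.length + 2 := by
    have := cnt_le s (.pal v)
    unfold cntNew
    split_ifs <;> omega
  have hcv := hA.cn.apply hvn
  refine Within.step (H.getM (y := cntNew s v (.pal v)) (by norm_num) (by norm_num) (by norm_num)
    (by norm_num) (by rw [h68, h62, hcv])) fun s₁ H₁ => ?_
  refine Within.step (H₁.succ (x := cntNew s v (.pal v)) (by norm_num) (by norm_num) (by norm_num)
    (by simp [upd_apply]) (by simp [upd_apply, h63]) (by omega)) fun s₂ H₂ => ?_
  refine Within.step (H₂.setM (by norm_num) (by norm_num) (by norm_num) (by norm_num))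
    fun s₃ H₃ => ?_
  refine Within.step (H₃.addD (x := o + dir d * s.length) (y := v.length) (by norm_num)
    (by norm_num) (by norm_num) (by simpa [upd_apply] using h58) (by simpa [upd_apply] using h69))
    fun s₄ H₄ => ?_
  refine Within.step (H₄.addD (d := d) (y := (1 : ℕ)) (by norm_num) (by norm_num) (by norm_num)
    (upd_apply _ _ _ _) (by simp [upd_apply, h63, w1])) fun s₅ H₅ => ?_
  -- The new longest palindromic suffix starts at the position `i₀`.
  have e75 : o + dir d * s.length + dir (!d) * v.length + dir d * (1 : ℕ) = o + dir d * i₀ := by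
    rw [dir_not, hi']
    push_cast [hvs]
    ring
  rw [e75] at H₅
  refine Within.step (H₅.getM (by norm_num) (by norm_num) (by norm_num) (by norm_num) rfl)
    fun s₆ H₆ => ?_
  have hcn : CnTab lab' (nodes (s ++ [c])) (fun y => cnt (s ++ [c]) y +
      if ∃ j, Surf s i₀ j ∧ Node.pal (sub s i₀ j) = y then 1 else 0)
      (fset (F 54) (lab' (.pal v)) 0 (cntNew s v (.pal v) + 1)) := by
    refine CnTab.congr (hA.cn.set hA.labels.inj hvn _) fun y _ => ?_
    have := cnt_concat s c hv hi y
    unfold cntNew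
    by_cases e : y = .pal v
    · subst e
      simp only [if_true] at this ⊢
      omega
    · simp only [if_neg e] at this ⊢
      omega
  refine Within.seq (k := 9) (within_dropSurf (j := j + 7) (s := s) (i₀ := i₀) (lab := lab)
    (lab' := lab') (D := nodes (s ++ [c])) (g := cnt (s ++ [c])) (o := o) (d := d) H₆ (by omega)
    (by omega) L ?_ (nodes_subset_concat s c) ?_ hA.labels.inj hA.eq ?_ ?_ ?_ ?_ ?_ ?_)
    fun s₇ h₇ => ?_
  · simpa [upd_apply] using hpre
  · simpa [upd_apply, h62, h68] using hcn
  · intro y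
    have := cnt_le (s ++ [c]) y
    simp at this
    omega
  · exact fun u hu => hA.recs u (nodes_subset_concat s c hu)
  · simp [upd_apply, h62]
  · simp [upd_apply, h63]
  · simp [upd_apply, posn]
  · simp [upd_apply, posn, h62]
  obtain ⟨R₇, F₇, H₇, hsf, hc7, hR7, hF7⟩ := h₇
  refine Within.step (H₇.setM (by norm_num) (by norm_num) (by norm_num) (by norm_num))
    fun s₈ H₈ => ?_
  refine Within.step (H₈.setM (by norm_num) (by norm_num) (by norm_num) (by norm_num))
    fun s₉ H₉ => ?_
  refine (H₉.succ (x := s.length) (by norm_num) (by norm_num)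
    (by norm_num) ?_ ?_ (by omega)).mono le_rfl fun s₁₀ H₁₀ => ⟨_, _, H₁₀.mono (by omega), ?_, ?_⟩
  · rw [hR7 _ (by norm_num)]; simp [upd_apply, h59]
  · rw [hR7 _ (by norm_num)]; simp [upd_apply, h63]
  · have q1 := hpre.concat hv hi hP hA.eq
    have q2 := fun f₁ hf => hsuf.concat (f₁ := f₁) hv hi hP hA.eq hf
    simp only [upd_apply] at hsf
    refine ⟨by simp; omega, ?_, ?_, ?_, ?_, ?_, hA.labels, hA.recs⟩
    · simp only [upd_apply]
      simp
      rw [hF7 50 (by norm_num) (by norm_num)]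
      simpa [upd_apply] using hch
    · simp only [upd_apply]
      simp
      rw [hF7 51 (by norm_num) (by norm_num), hR7 75 (by norm_num), hR7 62 (by norm_num),
        hR7 68 (by norm_num)]
      simpa [upd_apply, h62, h68, posn] using q1
    · simp only [upd_apply]
      simp
      rw [hR7 58 (by norm_num), hR7 62 (by norm_num), hR7 68 (by norm_num)]
      simpa [upd_apply, h62, h68, h58, posn] using q2 (F₇ 52) (by simpa using hsf)
    · simp only [upd_apply]
      simp
      rw [hF7 53 (by norm_num) (by norm_num)]
      simpa [upd_apply] using hA.ed
    · simpa [upd_apply] using hc7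
  · refine ⟨?_, ?_, ?_, ?_, ?_, ?_⟩ <;> rw [upd_apply]
    · rw [if_neg (by norm_num), hR7 _ (by norm_num)]; simp [upd_apply, h57]
    · rw [if_neg (by norm_num), hR7 _ (by norm_num)]; simp [upd_apply, h58]
    · simp
    · rw [if_neg (by norm_num), hR7 _ (by norm_num)]; simp [upd_apply, h60]
    · rw [if_neg (by norm_num), hR7 _ (by norm_num)]; simp [upd_apply, h62]
    · rw [if_neg (by norm_num), hR7 _ (by norm_num)]; simp [upd_apply, h63]

end Eer

namespace Eer

open WordRAM _root_.Eer.Tree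

variable {w N lim j σ : ℕ} {st₀ st : State} {R : ℕ → ℕ} {F : ℕ → ℕ → ℕ → ℕ}
  {s v : List (Fin σ)} {c : Fin σ} {lab lab' : Node (Fin σ) → ℕ} {d : Bool} {o : ℤ}
  {ch pre suf ed cn : ℕ → ℕ → ℕ}

/-! ### Headers of versions -/

/-- The registers for the fields of a header. For the mirrored version the two tables of surfaces
and the two ends are exchanged. -/
def hdr (d : Bool) : List ℕ :=
  bif d then [50, 51, 52, 53, 54, 57, 58, 59, 60] else [50, 52, 51, 53, 54, 58, 57, 59, 60]

/-- Load the header in register 0, and increase the letter in register 1. -/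
def loadHdr (d : Bool) : Prog := .seq
  (seqs [.const 20 1, .const 55 0, .const 62 0, .const 63 1, .add 61 1 63]) (loads 0 (hdr d))

/-- The maps of a version, by the registers that hold them. -/
def maps (ch pre suf ed cn : ℕ → ℕ → ℕ) : ℕ → ℕ → ℕ → ℕ :=
  upd (upd (upd (upd (upd (fun _ _ _ => 0) 50 ch) 51 pre) 52 suf) 53 ed) 54 cn

/-- Loading the header leads to the level of maps; register 61 receives the key of a letter in the
tables of edges and direct links. -/
theorem within_loadHdr (V : VerAt w st.mem (st.reg 3) d (st.reg 0) s lab o ch pre suf ed cn)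
    (h0 : TreeAt st.mem (st.reg 3) .nil 0) (h1 : st.reg 1 + 1 < 2 ^ w) (hlim : lim < 2 ^ w)
    (hfp : st.reg 3 + j * unitSpace N ≤ lim) (hN : s.length + 2 + j ≤ N) :
    Within w N 1 (loadHdr d) st fun st' => ∃ R, HS w N lim st j st' R (maps ch pre suf ed cn) ∧
      Regs w d o s R ∧ R 61 = st.reg 1 + 1 ∧ ∀ x, 64 ≤ x → R x = st.reg x := by
  have hlt := V.lt
  have m1 : 1 % 2 ^ w = 1 := Nat.mod_eq_of_lt (by omega)
  have B : Runs w (seqs [.const 20 1, .const 55 0, .const 62 0, .const 63 1, .add 61 1 63]) st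
      fun n s => n ≤ 5 ∧ s.mem = st.mem ∧ s.space = st.space ∧ s.reg 20 = 1 ∧ s.reg 55 = 0 ∧
      s.reg 62 = 0 ∧ s.reg 63 = 1 ∧ s.reg 61 = st.reg 1 + 1 ∧ s.reg 0 = st.reg 0 ∧
      s.reg 3 = st.reg 3 ∧ ∀ x, 64 ≤ x → s.reg x = st.reg x := by
    refine Runs.straight (c := 5) (by simp [seqs, Prog.Straight]) (by simp [seqs, Prog.cost])
      fun n hn => ?_
    have B : ∀ x, 64 ≤ x → x ≠ 20 ∧ x ≠ 55 ∧ x ≠ 62 ∧ x ≠ 63 ∧ x ≠ 61 := by omega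
    simp +contextual [seqs, Prog.eval, set_reg, set_mem, set_space, hn, m1, Nat.mod_eq_of_lt h1, B]
  refine Within.of_runs (c := 25) (by norm_num) (Runs.seq (B.mono ?_))
  rintro n s₁ ⟨b1, b2, b3, b4, b5, b6, b7, b8, b9, b10, b11⟩
  have hl : (hdr d).length = 9 := by cases d <;> rfl
  refine (runs_loads b4 (by rw [hl, b9, b10]; exact hlt) (by omega) (fun r hr => by
    cases d <;> simp [hdr] at hr <;> omega)).mono ?_
  rintro n' s₂ ⟨c1, c2, c3, c4⟩
  rw [hl] at c1
  have em : s₂.mem = st.mem := by rw [c2, b2]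
  have e3 : s₂.reg 3 = st.reg 3 := by
    rw [c4 3 (by norm_num)]
    cases d <;> simp [hdr, assign, b10]
  rw [b2, b9] at c4
  have er : ∀ x, x = 55 ∨ x = 61 ∨ x = 62 ∨ x = 63 → s₂.reg x = s₁.reg x := by
    intro x hx
    rw [c4 x (by omega)]
    cases d <;> rcases hx with rfl | rfl | rfl | rfl <;> simp [hdr, assign]
  have supp0 : ∀ f, Supp f (s.length + 2) → ∃ n, Supp f n ∧ n + j ≤ N :=
    fun f hf => ⟨_, hf, by omega⟩
  have E := V.enc
  have emap : ∀ i, 50 ≤ i → i < 56 →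
      MapAt st.mem (st.reg 3) (maps ch pre suf ed cn i) (s₂.reg i) := by
    intro i hi hi'
    obtain rfl | rfl | rfl | rfl | rfl | rfl :
      i = 50 ∨ i = 51 ∨ i = 52 ∨ i = 53 ∨ i = 54 ∨ i = 55 := by omega
    · rw [c4 50 (by norm_num)]
      cases d <;> simpa [hdr, assign, maps, upd_apply] using V.ch
    · rw [c4 51 (by norm_num)]
      cases d <;> simpa [hdr, assign, maps, upd_apply] using V.pre
    · rw [c4 52 (by norm_num)]
      cases d <;> simpa [hdr, assign, maps, upd_apply] using V.suf
    · rw [c4 53 (by norm_num)]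
      cases d <;> simpa [hdr, assign, maps, upd_apply] using V.ed
    · rw [c4 54 (by norm_num)]
      cases d <;> simpa [hdr, assign, maps, upd_apply] using V.cn
    · rw [er 55 (by norm_num), b5]
      exact mapAt_zero h0
  refine ⟨by omega, s₂.reg, ⟨hlim, ⟨e3.ge, fun a _ => by rw [em], by omega⟩, fun _ _ => rfl, ?_, ?_,
    by rw [em, e3]; exact h0, by omega⟩, ⟨?_, ?_, ?_, ?_, ?_, ?_⟩, ?_, fun x hx => ?_⟩
  · rw [em, e3]
    exact emap
  · intro i hi hi'
    obtain rfl | rfl | rfl | rfl | rfl | rfl :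
      i = 50 ∨ i = 51 ∨ i = 52 ∨ i = 53 ∨ i = 54 ∨ i = 55 := by omega
    · exact supp0 _ (E.ch.toSupp.mono (by omega))
    · exact supp0 _ (E.pre.toSupp.mono (by omega))
    · exact supp0 _ (E.suf.toSupp.mono (by omega))
    · exact supp0 _ (E.ed.toSupp.mono (by omega))
    · exact supp0 _ E.cn.toSupp
    · exact ⟨0, ⟨∅, by simp, fun a b h => absurd rfl h⟩, by omega⟩
  · rw [c4 57 (by norm_num)]
    cases d <;> simpa [hdr, assign] using V.fst
  · rw [c4 58 (by norm_num)]
    cases d <;> simpa [hdr, assign] using V.lst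
  · rw [c4 59 (by norm_num)]
    cases d <;> simpa [hdr, assign] using V.len
  · rw [c4 60 (by norm_num)]
    cases d <;> simpa [hdr, assign] using V.num
  · rw [er 62 (by norm_num), b6]
  · rw [er 63 (by norm_num), b7]
  · rw [er 61 (by norm_num), b8]
  · rw [c4 x (by omega), ← b11 x hx]
    have n : x ≠ 50 ∧ x ≠ 51 ∧ x ≠ 52 ∧ x ≠ 53 ∧ x ≠ 54 ∧ x ≠ 57 ∧ x ≠ 58 ∧ x ≠ 59 ∧ x ≠ 60 := by
      omega
    cases d <;> simp [hdr, assign, n]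

/-- Store a new header and return it in register 0. -/
def storeHdr (d : Bool) : Prog := seqs [.seq (.const 20 1) (alloc 79 (hdr d)), .move 0 79]

/-- The outcome of an update that is executed in the state `st`, with the new string `s`. -/
def Updated (w lim : ℕ) (d : Bool) (s : List (Fin σ)) (st st' : State) : Prop :=
  Ext st st' ∧ st'.reg 3 ≤ lim ∧ st'.reg 3 ≤ st'.space ∧ ∃ lab o ch pre suf ed cn,
    VerAt w st'.mem (st'.reg 3) d (st'.reg 0) s lab o ch pre suf ed cn

/-- The maps and registers of the new string become a new version. -/
theorem within_storeHdr (H : HS w N lim st₀ (j + 1) st R F)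
    (E : Enc w st₀.mem (st₀.reg 3) d o s lab (F 50) (F 51) (F 52) (F 53) (F 54))
    (hR : Regs w d o s R) : Within w N 2 (storeHdr d) st fun st' => Updated w lim d s st₀ st' := by
  have hl : (hdr d).length = 9 := by cases d <;> rfl
  have hlim := H.fp
  have hlt := H.lt
  refine Within.step (H.alloc (out := 79) (rs := hdr d) (by norm_num)
    (by cases d <;> simp [hdr]) (by omega)) fun s₁ h₁ => ?_
  obtain ⟨X, H₁, g3, gr, gm, gs⟩ := h₁
  have X' := H.ext.trans X
  have hfp := H₁.fp
  refine Within.of_runs (c := 1) (by norm_num) ⟨_, _, .move .., le_rfl, ?_⟩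
  have e0 : s₁.reg 79 = st.reg 3 := by
    rw [H₁.reg 79 (by norm_num), upd_apply, if_pos rfl]
  have r3 : (s₁.set 0 (s₁.reg 79)).reg 3 = s₁.reg 3 := by simp [set_reg]
  have r0 : (s₁.set 0 (s₁.reg 79)).reg 0 = st.reg 3 := by simp [set_reg, e0]
  have f : ∀ i r, (hdr d)[i]? = some r → s₁.mem (st.reg 3 + i) = st.reg r := by
    intro i r h
    obtain ⟨hi, h'⟩ := List.getElem?_eq_some_iff.1 h
    rw [gm i hi, h']
  have mp : ∀ i, 50 ≤ i → i < 56 → MapAt s₁.mem (s₁.reg 3) (F i) (st.reg i) := fun i hi hi' =>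
    (H.map i hi hi').mono X.mem X.fp
  refine ⟨⟨by rw [r3]; exact X'.fp, fun a ha => by rw [set_mem]; exact X'.mem a ha,
      by rw [r3, set_space]; exact X'.space⟩, by rw [r3]; omega, ?_, lab, o, F 50, F 51, F 52, F 53,
      F 54, ?_⟩
  · rw [r3, set_space]
    exact gs (by intro e; rw [e] at hl; simp at hl)
  · rw [r3, r0, set_mem]
    refine ⟨by omega, E.mono X'.mem X'.fp, ?_, ?_, ?_, ?_, ?_, ?_, ?_, ?_, ?_⟩
    · rw [← Nat.add_zero (st.reg 3), f 0 50 (by cases d <;> rfl)]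
      exact mp 50 (by norm_num) (by norm_num)
    · rw [f _ 51 (by cases d <;> rfl)]
      exact mp 51 (by norm_num) (by norm_num)
    · rw [f _ 52 (by cases d <;> rfl)]
      exact mp 52 (by norm_num) (by norm_num)
    · rw [f _ 53 (by cases d <;> rfl)]
      exact mp 53 (by norm_num) (by norm_num)
    · rw [f _ 54 (by cases d <;> rfl)]
      exact mp 54 (by norm_num) (by norm_num)
    · rw [f _ 57 (by cases d <;> rfl), H.reg 57 (by norm_num), hR.fst]
    · rw [f _ 58 (by cases d <;> rfl), H.reg 58 (by norm_num), hR.lst]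
    · rw [f _ 59 (by cases d <;> rfl), H.reg 59 (by norm_num), hR.len]
    · rw [f _ 60 (by cases d <;> rfl), H.reg 60 (by norm_num), hR.num]

/-! ### The programs that add a letter -/

/-- Add the letter in register 1 to the version in register 0: at the back for `d = true`, at the
front for `d = false`. -/
def pushP (d : Bool) : Prog := seqs [loadHdr d, findCore d, addD d 58 58 63, setM 50 58 62 61,
  getM 68 53 67 61, loadM 69 67 0, .add 69 69 63, .add 69 69 63, .ite (.eq 68 62) (newNode d) .skip,
  addLast d, storeHdr d]

/-- The budget of 57 steps is the sum of the budgets of the parts: 11 for `findCore`, 19 for the new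
node, 18 for `addLast`, 2 for `storeHdr`, and 7 for the other steps. The state has to have resources
for 70 more. -/
theorem within_pushP (V : VerAt w st.mem (st.reg 3) d (st.reg 0) s lab o ch pre suf ed cn)
    (h0 : TreeAt st.mem (st.reg 3) .nil 0) (h1 : st.reg 1 = c) (hlim : lim < 2 ^ w)
    (hlen : 3 * s.length + 13 < 2 ^ w) (hc : (c : ℕ) + 1 < 2 ^ w)
    (hfp : st.reg 3 + 70 * unitSpace N ≤ lim) (hN : s.length + 80 ≤ N) :
    Within w N 57 (pushP d) st fun st' => Updated w lim d (s ++ [c]) st st' := by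
  have E := V.enc
  have L := E.labels
  have w1 : word w 1 = 1 := word_natCast (n := 1) (by omega)
  have hP : InjTo (posn w d o) s.length := injTo_posn (by omega)
  refine Within.step (within_loadHdr (j := 70) V h0 (by rw [h1]; exact hc) hlim hfp (by omega))
    fun s₁ h₁ => ?_
  obtain ⟨R, H, hR, h61, -⟩ := h₁
  rw [h1] at h61
  obtain ⟨v, hv⟩ : ∃ v, sufpal (s ++ [c]) = v := ⟨_, rfl⟩
  have hv0 : v ≠ [] := hv ▸ sufpal_ne_nil (by simp)
  obtain ⟨p, hp⟩ : ∃ p : Node (Fin σ), p.extend c = .pal v :=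
    ⟨core v, extend_core (hv ▸ sufpal_palindrome _)
      (hv ▸ suffix_sufpal (List.Palindrome.singleton c) (List.suffix_append _ _))⟩
  have hpn : p ∈ nodes s := by
    classical
    have hs := pal_mem_nodes.2 (sufpal_mem_pals s)
    have h := extend_sufpal_concat s c
    rw [hv, ← hp] at h
    rw [← (Node.extend_injective h).1]
    split_ifs
    exacts [hs, direct_mem_nodes hs c]
  have hpl : p.len + 1 + 1 = v.length := by
    cases p with
    | odd => simp only [Node.extend, Node.pal.injEq] at hp; subst hp; rfl
    | pal t => simp only [Node.extend, Node.pal.injEq] at hp; subst hp; simp [Node.len]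
  refine Within.seq (k := 11) (within_findCore (j := 60) (d := d) (o := o) (lab := lab) (s := s) H
    E hR h61 (by omega) (by rw [hv]; exact hp)) fun s₂ h₂ => ?_
  obtain ⟨R₂, F₂, H₂, hR2, hF2, h67⟩ := h₂
  refine Within.step (H₂.addD (x := o + dir d * (s.length - 1)) (y := 1) (by norm_num)
    (by norm_num) (by norm_num) (by rw [hR2 _ (by norm_num), hR.lst])
    (by rw [hR2 _ (by norm_num), hR.one, w1])) fun s₃ H₃ => ?_
  rw [show o + dir d * (s.length - 1) + dir d * 1 = o + dir d * s.length by ring] at H₃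
  refine Within.step (H₃.setM (by norm_num) (by norm_num) (by norm_num) (by norm_num))
    fun s₄ H₄ => ?_
  simp only [upd_apply] at H₄
  simp [hR2, hF2, hR.zero, h61] at H₄
  have g50 : ChTab (posn w d o) (s ++ [c]) (fset ch (posn w d o s.length) 0 (c + 1)) :=
    E.ch.concat hP
  -- The edge of `p` with the letter `c` tells whether the new palindrome occurs in `s`.
  have g53 : (if v ∈ pals s then lab (.pal v) else 0) = ed (lab p) (c + 1) := by
    split_ifs with h
    · rw [E.ed_apply (by rw [hp]; exact pal_mem_nodes.2 h), hp]
    · rw [(E.ed_eq_zero hpn).2 (by rw [hp, pal_mem_nodes]; exact h)]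
  refine Within.step (H₄.getM (y := if v ∈ pals s then lab (.pal v) else 0) (by norm_num)
    (by norm_num) (by norm_num) (by norm_num) ?_) fun s₅ H₅ => ?_
  · rw [g53]
    simp [upd_apply, hF2, h67, hR2, h61]
    rfl
  have rp := E.recs p hpn
  have lp := rp.lt
  refine Within.step (H₅.loadM (by norm_num) (by norm_num) (k := 0) (y := word w p.len)
    (by simp only [upd_apply]; simp [h67]; omega) (by simp [upd_apply, h67]; exact rp.len))
    fun s₆ H₆ => ?_
  refine Within.step (H₆.add (x := p.len) (y := 1) (by norm_num) (by norm_num) (by norm_num)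
    (upd_apply _ _ _ _) (by simp [upd_apply, hR2, hR.one, w1])) fun s₇ H₇ => ?_
  refine Within.step (H₇.add (x := p.len + 1) (y := 1) (by norm_num) (by norm_num) (by norm_num)
    (upd_apply _ _ _ _) (by simp [upd_apply, hR2, hR.one, w1])) fun s₈ H₈ => ?_
  rw [hpl] at H₈
  have K : Within w N 19 (.ite (.eq 68 62) (newNode d) .skip) s₈ fun st' => ∃ st₁ R' F' lab',
      Ext st st₁ ∧ HS w N lim st₁ 30 st' R' F' ∧
      Added w st₁.mem (st₁.reg 3) s c v lab lab' (F' 53) (F' 54) ∧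
      R' 68 = lab' (.pal v) ∧ R' 69 = word w v.length ∧ R' 60 = (pals (s ++ [c])).card ∧
      R' 58 = word w (o + dir d * s.length) ∧ (∀ x, x < 64 → x ≠ 58 → x ≠ 60 → R' x = R x) ∧
      F' 50 = fset ch (posn w d o s.length) 0 (c + 1) ∧ F' 51 = pre ∧ F' 52 = suf := by
    refine Within.ite (fun t => ?_) fun t => ?_ <;>
      simp only [Test.Holds, H₈.reg 68 (by norm_num), H₈.reg 62 (by norm_num)] at t <;>
      simp [upd_apply, hR2, hR.zero] at t
    · have hn : v ∉ pals s := fun h => L.ne _ (pal_mem_nodes.2 h) (t h)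
      refine (within_newNode (j := 30) (s := s) (c := c) (v := v) (d := d) (o := o) (lab := lab)
        (p := p) (H₈.mono (by norm_num)) (by omega) L E.recs ?_ ?_ ?_ hv hn ?_ ?_ ?_ ?_ ?_ hp hpn
        ?_ ?_ (by omega)).mono le_rfl ?_
      · simpa [upd_apply, posn, maps] using g50
      · simpa [upd_apply, hF2, maps] using E.ed
      · simpa [upd_apply, hF2, maps] using E.cn
      · simp [upd_apply]
      · simp [upd_apply, hR2, hR.num]
      · simp [upd_apply, hR2, h61]
      · simp [upd_apply, hR2, hR.zero]
      · simp [upd_apply, hR2, hR.one]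
      · simp [upd_apply, h67]
      · simp [upd_apply]
      · rintro st' ⟨st₁, R', F', lab', x1, x2, x3, x4, x5, x6, x7, x8⟩
        refine ⟨st₁, R', F', lab', x1, x2, x3, x4, ?_, x6, ?_, fun x hx h1 h2 => ?_, ?_, ?_, ?_⟩
        · rw [x5]
          simp [upd_apply]
        · rw [x7 58 (by norm_num) (by norm_num)]
          simp [upd_apply]
        · rw [x7 x hx h2, ← hR2 x hx]
          simp only [upd_apply]
          repeat rw [if_neg (by omega)]
        · rw [x8 50 (by norm_num)]
          simp [upd_apply, posn]
          rfl
        · rw [x8 51 (by norm_num)]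
          simp [upd_apply, hF2]
          rfl
        · rw [x8 52 (by norm_num)]
          simp [upd_apply, hF2]
          rfl
    · obtain ⟨hn, t⟩ := t
      have en := nodes_concat_old hv hn
      refine (Within.skip ⟨st, _, _, lab, Ext.refl st, H₈.mono (by norm_num),
        ⟨fun _ _ => rfl, ?_, by rw [en]; exact E.recs, ?_, ?_⟩, ?_, ?_, ?_, ?_,
        fun x hx h1 h2 => ?_, ?_, ?_, ?_⟩ : Within w N 1 _ _ _).mono (by norm_num) fun _ h => h
      · exact ⟨by rw [en]; exact L.inj, by rw [en]; exact L.ne, L.odd, L.even⟩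
      · have := E.ed
        unfold EdTab at this ⊢
        rw [en]
        simpa [upd_apply, hF2, maps] using this
      · have := CnTab.congr (g' := cntNew s v) E.cn fun u _ => by simp [cntNew, hn]
        rw [en]
        simpa [upd_apply, hF2, maps] using this
      · simp [upd_apply, hn]
      · simp [upd_apply]
      · rw [pals_concat, hv, Finset.insert_eq_self.2 hn]
        simp [upd_apply, hR2, hR.num]
      · simp [upd_apply]
      · rw [← hR2 x hx]
        simp only [upd_apply]
        repeat rw [if_neg (by omega)]
      · simp [upd_apply, posn]
        rfl
      · simp [upd_apply, hF2]
        rfl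
      · simp [upd_apply, hF2]
        rfl
  refine Within.seq (k := 19) K fun s₉ h₉ => ?_
  obtain ⟨st₁, R₉, F₉, lab', X, H₉, hA, k68, k69, k60, k58, kR, k50, k51, k52⟩ := h₉
  refine Within.seq (k := 18) (within_addLast (j := 10) (d := d) (o := o) (c := c) H₉ hlen L hA
    (by rw [k50]; exact g50) (by rw [k51]; exact E.pre) (by rw [k52]; exact E.suf) hv
    (by rw [kR _ (by norm_num) (by norm_num) (by norm_num), hR.fst]) k58
    (by rw [kR _ (by norm_num) (by norm_num) (by norm_num), hR.len]) k60
    (by rw [kR _ (by norm_num) (by norm_num) (by norm_num), hR.zero])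
    (by rw [kR _ (by norm_num) (by norm_num) (by norm_num), hR.one]) k68 k69) fun s₁₀ h₁₀ => ?_
  obtain ⟨R', F', H', E', hR'⟩ := h₁₀
  refine (within_storeHdr (j := 9) H' E' hR').mono le_rfl fun st' h => ?_
  exact ⟨X.trans h.1, h.2⟩

end Eer

namespace Eer

open WordRAM _root_.Eer.Tree

variable {w N lim j σ : ℕ} {st₀ st : State} {R : ℕ → ℕ} {F : ℕ → ℕ → ℕ → ℕ}
  {s u v : List (Fin σ)} {c : Fin σ} {lab lab' : Node (Fin σ) → ℕ} {d : Bool} {o : ℤ}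
  {ch pre suf ed cn : ℕ → ℕ → ℕ}

/-! ### The programs that remove a letter -/

/-- The removed last letter was the end of a surface; its suffix link, in register 71, becomes a
surface if no other surface ends at its last position, which is in register 77. The node of the new
surface or 0 is returned in register 76. -/
def linkSurf : Prog := seqs [.move 76 62, .ite (.eq 72 62) .skip (seqs [getM 78 52 77 62,
  .ite (.eq 78 62) (seqs [.move 76 71, setM 52 77 62 71, getM 78 54 71 62, .add 78 78 63,
    setM 54 71 62 78]) .skip])]

open Classical in
/-- By `surf_start_iff` the surface of `s` that starts at `i₀`, if there is one, has the node of the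
suffix link `u` of the removed longest palindromic suffix `v`. It is a surface if and only if `u` is
nonempty and no other surface ends where it does. The counts then are those of `s ++ [c]` with this
surface added. -/
theorem within_linkSurf (H : HS w N lim st₀ (j + 8) st R F)
    (hlen : 3 * s.length + 13 < 2 ^ w) (L : Labels lab (s ++ [c]))
    (hv : sufpal (s ++ [c]) = v) (hu : sufpal v.tail = u) {i₀ : ℕ}
    (hi : i₀ = (s ++ [c]).length - v.length)
    (hsuf : SufTab (posn w d o) lab (s ++ [c]) suf)
    (h52 : F 52 = fset suf (posn w d o s.length) 0 0)
    (hcn : CnTab lab (nodes (s ++ [c])) (cnt (s ++ [c])) (F 54))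
    (h62 : R 62 = 0) (h63 : R 63 = 1) (h71 : R 71 = lab (.pal u)) (h72 : R 72 = u.length)
    (h77 : R 77 = word w (o + dir d * (i₀ + u.length - 1))) :
    Within w N 9 linkSurf st fun st' => ∃ R' F', HS w N lim st₀ j st' R' F' ∧
      ((∃ k, Surf s i₀ k ∧ F' 52 = fset (F 52) (posn w d o (k - 1)) 0 (lab (.pal (sub s i₀ k))) ∧
          R' 76 = lab (.pal (sub s i₀ k))) ∨
        ((∀ k, ¬ Surf s i₀ k) ∧ F' 52 = F 52 ∧ R' 76 = 0)) ∧
      CnTab lab (nodes (s ++ [c])) (fun y => cnt (s ++ [c]) y +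
        if ∃ k, Surf s i₀ k ∧ Node.pal (sub s i₀ k) = y then 1 else 0) (F' 54) ∧
      (∀ x, x < 76 → R' x = R x) ∧ ∀ i, i ≠ 52 → i ≠ 54 → F' i = F i := by
  have hv0 : v ≠ [] := hv ▸ sufpal_ne_nil (by simp)
  have hvp : v.Palindrome := hv ▸ sufpal_palindrome _
  have hvl : v.length ≤ s.length + 1 := by simpa [hv] using (sufpal_suffix (s ++ [c])).length_le
  have hul : u.length < v.length := hu ▸ length_sufpal_tail_lt hv0
  have hi' : i₀ = s.length + 1 - v.length := by simpa using hi
  have hP : InjTo (posn w d o) (s.length + 1) := injTo_posn (by omega)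
  have key := fun k => surf_start_iff (j := k) hv hu hi
  refine Within.step (H.move (r := 76) (a := 62) (by norm_num) (by norm_num)) fun s₁ H₁ => ?_
  -- If no surface of `s` starts at `i₀`, the tables remain as they are.
  have none : (∀ k, ¬ Surf s i₀ k) → ∀ s' R₁, HS w N lim st₀ j s' R₁ F → R₁ 76 = 0 →
      (∀ x, x < 76 → R₁ x = R x) → ∃ R' F', HS w N lim st₀ j s' R' F' ∧
      ((∃ k, Surf s i₀ k ∧ F' 52 = fset (F 52) (posn w d o (k - 1)) 0 (lab (.pal (sub s i₀ k))) ∧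
          R' 76 = lab (.pal (sub s i₀ k))) ∨
        ((∀ k, ¬ Surf s i₀ k) ∧ F' 52 = F 52 ∧ R' 76 = 0)) ∧
      CnTab lab (nodes (s ++ [c])) (fun y => cnt (s ++ [c]) y +
        if ∃ k, Surf s i₀ k ∧ Node.pal (sub s i₀ k) = y then 1 else 0) (F' 54) ∧
      (∀ x, x < 76 → R' x = R x) ∧ ∀ i, i ≠ 52 → i ≠ 54 → F' i = F i := by
    exact fun hn s' R₁ H' h76 hR => ⟨_, _, H', Or.inr ⟨hn, rfl, h76⟩,
      CnTab.congr hcn fun y _ => by simp [hn], hR, fun _ _ _ => rfl⟩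
  refine (Within.ite (fun t => ?_) fun t => ?_ : Within w N 8 _ _ _) <;>
    simp only [Test.Holds, H₁.reg 72 (by norm_num), H₁.reg 62 (by norm_num)] at t <;>
    simp [upd_apply, h72, h62] at t
  · refine (Within.skip (none (fun k hk => ((key k).1 hk).2.1 t) _ _ (H₁.mono (by omega))
      (by simp [upd_apply, h62]) fun x hx => ?_) : Within w N 1 _ _ _).mono (by norm_num)
      fun _ h => h
    rw [upd_apply, if_neg (by omega)]
  have hu1 := List.length_pos_iff.2 t
  have e77 : word w (o + dir d * (i₀ + u.length - 1)) = posn w d o (i₀ + u.length - 1) := by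
    unfold posn
    push_cast [(by omega : 1 ≤ i₀ + u.length)]
    rfl
  rw [e77] at h77
  have g52 : F 52 (R 77) (R 62) = suf (posn w d o (i₀ + u.length - 1)) 0 := by
    rw [h52, h77, h62]
    unfold fset
    rw [if_neg]
    rintro ⟨e, -⟩
    have := hP _ (by omega) _ (by omega) e
    omega
  refine Within.step (H₁.getM (by norm_num) (by norm_num) (by norm_num) (by norm_num) rfl)
    fun s₂ H₂ => ?_
  simp [upd_apply] at H₂
  rw [g52] at H₂
  refine (Within.ite (fun t => ?_) fun t => ?_ : Within w N 6 _ _ _) <;>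
    simp only [Test.Holds, H₂.reg 78 (by norm_num), H₂.reg 62 (by norm_num)] at t <;>
    simp [upd_apply, h62] at t
  · have hs : Surf s i₀ (i₀ + u.length) := by
      refine (key _).2 ⟨rfl, List.length_pos_iff.1 hu1, fun a ha => ?_⟩
      rw [hsuf.val ⟨rfl, _, _, ha, rfl, rfl⟩] at t
      exact L.ne _ (surf_mem_nodes ha) t
    have hsub : sub s i₀ (i₀ + u.length) = u := by
      rw [← sub_concat_surf (c := c) hs, ← take_sub (j := s.length + 1) (by omega),
        sub_concat_last hv hi, ← hu, take_link hvp]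
    have hun : Node.pal u ∈ nodes (s ++ [c]) := by
      rw [← hsub]
      exact nodes_subset_concat _ _ (surf_mem_nodes hs)
    have hcl := cnt_le (s ++ [c]) (.pal u)
    simp only [List.length_append, List.length_singleton] at hcl
    refine Within.step (H₂.move (r := 76) (a := 71) (by norm_num) (by norm_num)) fun s₃ H₃ => ?_
    refine Within.step (H₃.setM (by norm_num) (by norm_num) (by norm_num) (by norm_num))
      fun s₄ H₄ => ?_
    refine Within.step (H₄.getM (y := cnt (s ++ [c]) (.pal u)) (by norm_num) (by norm_num)
      (by norm_num) (by norm_num) (by rw [← hcn.apply hun]; simp [upd_apply, h62, h71]))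
      fun s₅ H₅ => ?_
    refine Within.step (H₅.succ (x := cnt (s ++ [c]) (.pal u)) (by norm_num) (by norm_num)
      (by norm_num) (by simp [upd_apply]) (by simp [upd_apply, h63]) (by omega)) fun s₆ H₆ => ?_
    refine (H₆.setM (by norm_num) (by norm_num) (by norm_num) (by norm_num)).mono le_rfl
      fun s₇ H₇ => ⟨_, _, H₇.mono (by omega), Or.inl ⟨_, hs, ?_, ?_⟩, ?_,
        fun x hx => ?_, fun i hi hi' => ?_⟩
    · rw [hsub]
      simp [upd_apply, h71, h77, h62]
    · rw [hsub]
      simp [upd_apply, h71]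
    · have h1 := CnTab.congr (g' := fun y => cnt (s ++ [c]) y +
        if ∃ k, Surf s i₀ k ∧ Node.pal (sub s i₀ k) = y then 1 else 0)
        (hcn.set L.inj hun (cnt (s ++ [c]) (.pal u) + 1)) fun y _ => by
          by_cases e : y = .pal u
          · rw [if_pos e, if_pos ⟨_, hs, by rw [hsub, e]⟩, e]
          · rw [if_neg e, if_neg, Nat.add_zero]
            rintro ⟨k, hk, e'⟩
            rw [hk.eq_right hs, hsub] at e'
            exact e e'.symm
      simpa [upd_apply, h71, h62] using h1
    · simp only [upd_apply]
      repeat rw [if_neg (by omega)]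
    · simp only [upd_apply]
      repeat rw [if_neg (by omega)]
  · obtain ⟨-, a, b, hab, h1, -⟩ := hsuf.supp t
    have l1 := hab.lt
    have l2 : b ≤ s.length + 1 := by simpa using hab.le
    have hb := hP _ (by omega) _ (by omega) h1
    obtain rfl : b = i₀ + u.length := by omega
    refine (Within.skip (none (fun k hk => ((key k).1 hk).2.2 a hab) _ _ (H₂.mono (by omega))
      (by simp [upd_apply, h62]) fun x hx => ?_) : Within w N 1 _ _ _).mono (by norm_num)
      fun _ h => h
    simp only [upd_apply]
    repeat rw [if_neg (by omega)]

/-- Remove the node of the old longest palindromic suffix, unless its count, in register 74, is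
positive. Its parent, its suffix link and the removed letter are in the registers 67, 71, 61. -/
def dropNode : Prog := .ite (.eq 74 62) (seqs [setM 53 67 61 62, getM 78 54 71 62, .sub 78 78 63,
  setM 54 71 62 78, .sub 60 60 63]) .skip

open Classical in
/-- By `cnt_pos_iff` the palindrome `v` still occurs in `s` if and only if its count is positive. If
it does not, only the edge to `v` and the count of its suffix link have to be changed. -/
theorem within_dropNode (H : HS w N lim st₀ (j + 5) st R F)
    (hlen : 3 * s.length + 13 < 2 ^ w) (L : Labels lab (s ++ [c]))
    (hv : sufpal (s ++ [c]) = v) (hu : sufpal v.tail = u)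
    (hed : EdTab lab (s ++ [c]) (F 53)) (hcn : CnTab lab (nodes (s ++ [c])) (cntNew s v) (F 54))
    (h60 : R 60 = (pals (s ++ [c])).card) (h61 : R 61 = c + 1)
    (h62 : R 62 = 0) (h63 : R 63 = 1) {p : Node (Fin σ)} (hp : p.extend c = .pal v)
    (h67 : R 67 = lab p) (h71 : R 71 = lab (.pal u)) (h74 : R 74 = cnt s (.pal v)) :
    Within w N 6 dropNode st fun st' => ∃ R' F', HS w N lim st₀ j st' R' F' ∧
      EdTab lab s (F' 53) ∧ CnTab lab (nodes s) (cnt s) (F' 54) ∧ R' 60 = (pals s).card ∧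
      (∀ x, x < 64 → x ≠ 60 → R' x = R x) ∧ ∀ i, i < 53 → F' i = F i := by
  have hv0 : v ≠ [] := hv ▸ sufpal_ne_nil (by simp)
  have hvp : v.Palindrome := hv ▸ sufpal_palindrome _
  have hul : u.length < v.length := hu ▸ length_sufpal_tail_lt hv0
  have hlk : Node.link (.pal v) = .pal u := by rw [link_eq hv0, hu]
  refine (Within.ite (fun t => ?_) fun t => ?_ : Within w N 6 _ _ _) <;>
    simp only [Test.Holds, H.reg 74 (by norm_num), H.reg 62 (by norm_num), h74, h62] at t
  · have hn : v ∉ pals s := fun h => by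
      have := (cnt_pos_iff hvp hv0).2 h
      omega
    have hun : Node.pal u ∈ nodes (s ++ [c]) := by
      rw [← hlk]
      exact link_mem_nodes ((nodes_concat hv _).2 (Or.inr rfl))
    have hcl := cnt_le s (.pal u)
    have hcu : F 54 (lab (.pal u)) 0 = cnt s (.pal u) + 1 := by
      rw [hcn.apply hun, cntNew, if_pos ⟨hn, hlk⟩]
    have hcard : (pals (s ++ [c])).card = (pals s).card + 1 := by
      rw [pals_concat, hv, Finset.card_insert_of_notMem hn]
    have hcl' : (pals s).card + 1 < 2 ^ w := by
      have := card_pals_le s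
      omega
    refine Within.step (H.setM (by norm_num) (by norm_num) (by norm_num) (by norm_num))
      fun s₁ H₁ => ?_
    refine Within.step (H₁.getM (y := cnt s (.pal u) + 1) (by norm_num) (by norm_num)
      (by norm_num) (by norm_num) (by rw [← hcu]; simp [upd_apply, h62, h71])) fun s₂ H₂ => ?_
    refine Within.step (H₂.pred (x := cnt s (.pal u)) (by norm_num) (by norm_num)
      (by norm_num) (by simp [upd_apply]) (by simp [upd_apply, h63]) (by omega)) fun s₃ H₃ => ?_
    refine Within.step (H₃.setM (by norm_num) (by norm_num) (by norm_num) (by norm_num))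
      fun s₄ H₄ => ?_
    refine (H₄.pred (x := (pals s).card) (by norm_num) (by norm_num)
      (by norm_num) (by simp [upd_apply, h60, hcard]) (by simp [upd_apply, h63]) hcl').mono le_rfl
      fun s₅ H₅ => ⟨_, _, H₅, ?_, ?_, ?_, fun x hx hx' => ?_, fun i hi => ?_⟩
    · simpa [upd_apply, h67, h61, h62] using hed.of_concat hv hn hp L.inj
    · have h1 := hcn.set L.inj hun (cnt s (.pal u))
      have h2 := CnTab.congr (g' := cnt s) h1 fun y _ => by
        by_cases e : y = .pal u
        · rw [if_pos e, e]
        · rw [if_neg e, cntNew, if_neg (fun h => e (by rw [← h.2, hlk])), Nat.add_zero]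
      have h3 := h2.change (lab' := lab) (D' := nodes s) (fun _ _ _ => rfl)
        (fun y hy hy' => absurd (nodes_subset_concat _ _ hy) hy') fun y hy hy' => by
          obtain rfl := ((nodes_concat hv y).1 hy).resolve_left hy'
          exact cnt_eq_zero hvp hv0 hn
      simpa [upd_apply, h71, h62] using h3
    · simp [upd_apply]
    · simp only [upd_apply]
      repeat rw [if_neg (by omega)]
    · simp only [upd_apply]
      repeat rw [if_neg (by omega)]
  · have hn : v ∈ pals s := (cnt_pos_iff hvp hv0).1 (by omega)
    have en := nodes_concat_old hv hn
    refine (Within.skip ⟨R, F, H.mono (by omega), ?_, ?_, ?_, fun _ _ _ => rfl, fun _ _ => rfl⟩ :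
      Within w N 1 _ _ _).mono (by norm_num) fun _ h => h
    · unfold EdTab at hed ⊢
      rwa [en] at hed
    · rw [en] at hcn
      exact CnTab.congr hcn fun y _ => by simp [cntNew, hn]
    · rw [h60, pals_concat, hv, Finset.insert_eq_self.2 hn]

/-- Remove the last letter for `d = true`, the first one for `d = false`, from the version in
register 0. -/
def popP (d : Bool) : Prog := seqs [loadHdr d, getM 68 52 58 62, loadM 69 68 0, loadM 71 68 1,
  loadM 67 68 3, loadM 72 71 0, getM 61 50 58 62, setM 50 58 62 62, setM 52 58 62 62,
  addD (!d) 75 58 69, addD d 75 75 63, addD d 77 75 72, addD (!d) 77 77 63, linkSurf,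
  setM 51 75 62 76, getM 74 54 68 62, .sub 74 74 63, setM 54 68 62 74, dropNode,
  addD (!d) 58 58 63, .sub 59 59 63, storeHdr d]

/-- The longest palindromic suffix `v` of the string is the only palindrome that may disappear, and
its surface the only one that does; the steps of `within_pushP` are undone. -/
theorem within_popP
    (V : VerAt w st.mem (st.reg 3) d (st.reg 0) (s ++ [c]) lab o ch pre suf ed cn)
    (h0 : TreeAt st.mem (st.reg 3) .nil 0) (h1 : st.reg 1 + 1 < 2 ^ w) (hlim : lim < 2 ^ w)
    (hfp : st.reg 3 + 70 * unitSpace N ≤ lim) (hN : s.length + 80 ≤ N) :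
    Within w N 57 (popP d) st fun st' => Updated w lim d s st st' := by
  classical
  have E := V.enc
  have L := E.labels
  have hlen := E.length
  simp only [List.length_append, List.length_singleton] at hlen
  have w1 : word w 1 = 1 := word_natCast (n := 1) (by omega)
  have hP : InjTo (posn w d o) s.length := injTo_posn (by omega)
  obtain ⟨v, hv⟩ : ∃ v, sufpal (s ++ [c]) = v := ⟨_, rfl⟩
  obtain ⟨u, hu⟩ : ∃ u, sufpal v.tail = u := ⟨_, rfl⟩
  obtain ⟨i₀, hi⟩ : ∃ i₀, i₀ = (s ++ [c]).length - v.length := ⟨_, rfl⟩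
  have hi' : i₀ = s.length + 1 - v.length := by simpa using hi
  have hv0 : v ≠ [] := hv ▸ sufpal_ne_nil (by simp)
  have hvp : v.Palindrome := hv ▸ sufpal_palindrome _
  have hvl : v.length ≤ s.length + 1 := by simpa [hv] using (sufpal_suffix (s ++ [c])).length_le
  have hul : u.length < v.length := hu ▸ length_sufpal_tail_lt hv0
  have hlk : Node.link (.pal v) = .pal u := by rw [link_eq hv0, hu]
  have hp : (core v).extend c = .pal v := extend_core hvp
      (hv ▸ suffix_sufpal (List.Palindrome.singleton c) (List.suffix_append _ _))
  have hvn : Node.pal v ∈ nodes (s ++ [c]) := (nodes_concat hv _).2 (Or.inr rfl)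
  have hun : Node.pal u ∈ nodes (s ++ [c]) := hlk ▸ link_mem_nodes hvn
  have rv := E.recs _ hvn
  have ru := E.recs _ hun
  have lv := rv.lt
  have lu := ru.lt
  refine Within.mono (k := 40) ?_ (by norm_num) fun _ h => h
  refine Within.step (within_loadHdr (j := 70) V h0 h1 hlim hfp (by simp; omega)) fun s₁ h₁ => ?_
  obtain ⟨R, H, hR, -⟩ := h₁
  have h58 : R 58 = posn w d o s.length := by
    rw [hR.lst]
    simp [posn]
  have g68 : suf (posn w d o s.length) 0 = lab (.pal v) := by
    have h := E.suf_last
    rw [if_neg (by simp), hv] at h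
    rw [← h]
    simp [posn]
  have g61 : ch (posn w d o s.length) 0 = c + 1 := E.ch.val ⟨rfl, _, c, by simp, rfl, rfl⟩
  refine Within.step (H.getM (y := lab (.pal v)) (by norm_num) (by norm_num) (by norm_num)
    (by norm_num) (by rw [h58, hR.zero, ← g68]; rfl)) fun s₂ H₂ => ?_
  refine Within.step (H₂.loadM (by norm_num) (by norm_num) (k := 0) (y := word w v.length)
    (by simp only [upd_apply]; simp; omega) (by simpa [upd_apply, Node.len] using rv.len))
    fun s₃ H₃ => ?_
  refine Within.step (H₃.loadM (by norm_num) (by norm_num) (k := 1) (y := lab (.pal u))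
    (by simp only [upd_apply]; simp; omega) (by simpa [upd_apply, hlk] using rv.link))
    fun s₄ H₄ => ?_
  refine Within.step (H₄.loadM (by norm_num) (by norm_num) (k := 3) (y := lab (core v))
    (by simp only [upd_apply]; simp; omega) (by simpa [upd_apply] using rv.core v rfl))
    fun s₅ H₅ => ?_
  refine Within.step (H₅.loadM (by norm_num) (by norm_num) (k := 0) (y := word w u.length)
    (by simp only [upd_apply]; simp; omega) (by simpa [upd_apply, Node.len] using ru.len))
    fun s₆ H₆ => ?_
  refine Within.step (H₆.getM (y := c + 1) (by norm_num) (by norm_num) (by norm_num)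
    (by norm_num) (by simp [upd_apply, h58, hR.zero, ← g61]; rfl)) fun s₇ H₇ => ?_
  refine Within.step (H₇.setM (by norm_num) (by norm_num) (by norm_num) (by norm_num))
    fun s₈ H₈ => ?_
  refine Within.step (H₈.setM (by norm_num) (by norm_num) (by norm_num) (by norm_num))
    fun s₉ H₉ => ?_
  refine Within.step (H₉.addD (x := o + dir d * s.length) (y := v.length) (by norm_num)
    (by norm_num) (by norm_num) (by simpa [upd_apply, posn] using h58) (by simp [upd_apply]))
    fun sA HA => ?_
  refine Within.step (HA.addD (d := d) (y := (1 : ℕ)) (by norm_num) (by norm_num) (by norm_num)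
    (upd_apply _ _ _ _) (by simp [upd_apply, hR.one, w1])) fun sB HB => ?_
  have e75 : o + dir d * s.length + dir (!d) * v.length + dir d * (1 : ℕ) = o + dir d * i₀ := by
    rw [dir_not, hi']
    push_cast [hvl]
    ring
  rw [e75] at HB
  refine Within.step (HB.addD (d := d) (y := u.length) (by norm_num) (by norm_num) (by norm_num)
    (upd_apply _ _ _ _) (by simp [upd_apply])) fun sC HC => ?_
  refine Within.step (HC.addD (d := !d) (y := (1 : ℕ)) (by norm_num) (by norm_num) (by norm_num)
    (upd_apply _ _ _ _) (by simp [upd_apply, hR.one, w1])) fun sD HD => ?_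
  have e77 : o + dir d * i₀ + dir d * u.length + dir (!d) * (1 : ℕ) =
      o + dir d * (i₀ + u.length - 1) := by
    rw [dir_not]
    push_cast
    ring
  rw [e77] at HD
  have mp : ∀ i, i = 50 ∨ i = 51 ∨ i = 52 ∨ i = 53 ∨ i = 54 →
      maps ch pre suf ed cn i = if i = 50 then ch else if i = 51 then pre else if i = 52 then suf
        else if i = 53 then ed else cn := by
    rintro i (rfl | rfl | rfl | rfl | rfl) <;> rfl
  have m50 := mp 50 (by norm_num)
  have m51 := mp 51 (by norm_num)
  have m52 := mp 52 (by norm_num)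
  have m53 := mp 53 (by norm_num)
  have m54 := mp 54 (by norm_num)
  norm_num at m50 m51 m52 m53 m54
  refine Within.seq (k := 9) (within_linkSurf (j := 50) (s := s) (c := c) (lab := lab) (u := u)
    (v := v) (i₀ := i₀) (suf := suf) (d := d) (o := o) HD (by omega) L hv hu hi E.suf ?_ ?_ ?_ ?_ ?_
    ?_ ?_) fun sE hE => ?_
  · simp [upd_apply, h58, hR.zero, m52]
  · simpa [upd_apply, m54] using E.cn
  · simp [upd_apply, hR.zero]
  · simp [upd_apply, hR.one]
  · simp [upd_apply]
  · simp [upd_apply]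
    exact word_natCast (by omega)
  · simp [upd_apply]
  obtain ⟨RE, FE, HE, hsf, hcE, hRE, hFE⟩ := hE
  have r58 : RE 58 = posn w d o s.length := by
    rw [hRE _ (by norm_num)]; simp [upd_apply, h58]
  have r62 : RE 62 = 0 := by rw [hRE _ (by norm_num)]; simp [upd_apply, hR.zero]
  have r63 : RE 63 = 1 := by rw [hRE _ (by norm_num)]; simp [upd_apply, hR.one]
  have r68 : RE 68 = lab (.pal v) := by rw [hRE _ (by norm_num)]; simp [upd_apply]
  have r75 : RE 75 = posn w d o i₀ := by rw [hRE _ (by norm_num)]; simp [upd_apply, posn]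
  have key : ∀ y, cntNew s v y = if y = .pal v then cnt s (.pal v) else cnt (s ++ [c]) y +
      if ∃ k, Surf s i₀ k ∧ Node.pal (sub s i₀ k) = y then 1 else 0 := by
    intro y
    rw [cnt_concat s c hv hi, cntNew]
    by_cases e : y = .pal v
    · subst e
      rw [if_pos rfl, if_neg, Nat.add_zero]
      rintro ⟨-, e⟩
      rw [hlk] at e
      injection e with e
      rw [e] at hul
      omega
    · rw [if_neg e, if_neg e, Nat.add_zero]
  have kv : cnt (s ++ [c]) (.pal v) + (if ∃ k, Surf s i₀ k ∧ Node.pal (sub s i₀ k) = .pal v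
      then 1 else 0) = cnt s (.pal v) + 1 := by
    rw [cnt_concat s c hv hi, if_pos rfl, if_neg, Nat.add_zero]
    rintro ⟨-, e⟩
    rw [hlk] at e
    injection e with e
    rw [e] at hul
    omega
  have gcv : FE 54 (lab (.pal v)) 0 = cnt s (.pal v) + 1 := by rw [hcE.apply hvn, kv]
  have hcl := cnt_le s (.pal v)
  refine Within.step (HE.setM (by norm_num) (by norm_num) (by norm_num) (by norm_num))
    fun sF HF => ?_
  refine Within.step (HF.getM (y := cnt s (.pal v) + 1) (by norm_num) (by norm_num) (by norm_num)
    (by norm_num) (by rw [← gcv, r68, r62]; simp [upd_apply])) fun sG HG => ?_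
  refine Within.step (HG.pred (x := cnt s (.pal v)) (by norm_num) (by norm_num)
    (by norm_num) (by simp [upd_apply]) (by simp [upd_apply, r63]) (by omega)) fun sH HH => ?_
  refine Within.step (HH.setM (by norm_num) (by norm_num) (by norm_num) (by norm_num))
    fun sI HI => ?_
  refine Within.seq (k := 6) (within_dropNode (j := 40) (s := s) (c := c) (lab := lab) (u := u)
    (v := v) (p := core v) (HI.mono (by norm_num)) (by omega) L hv hu ?_ ?_ ?_ ?_ ?_ ?_ hp ?_ ?_ ?_)
    fun sJ hJ => ?_
  · simp only [upd_apply]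
    simp
    rw [hFE 53 (by norm_num) (by norm_num)]
    simpa [upd_apply, m53] using E.ed
  · have h2 := CnTab.congr (g' := cntNew s v) (hcE.set L.inj hvn (cnt s (.pal v)))
      fun y _ => key y
    simpa [upd_apply, r68, r62] using h2
  · simp [upd_apply, hRE, hR.num]
  · simp [upd_apply, hRE]
  · simp [upd_apply, r62]
  · simp [upd_apply, r63]
  · simp [upd_apply, hRE]
  · simp [upd_apply, hRE]
  · simp [upd_apply]
  obtain ⟨RJ, FJ, HJ, hed, hcn, h60, hRJ, hFJ⟩ := hJ
  refine Within.step (HJ.addD (d := !d) (x := o + dir d * s.length) (y := (1 : ℕ)) (by norm_num)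
    (by norm_num) (by norm_num) ?_ ?_) fun sK HK => ?_
  · rw [hRJ _ (by norm_num) (by norm_num)]
    simp [upd_apply, r58, posn]
  · rw [hRJ _ (by norm_num) (by norm_num)]
    simp [upd_apply, r63, w1]
  refine Within.step (HK.pred (x := s.length) (by norm_num) (by norm_num) (by norm_num) ?_ ?_
    (by omega)) fun sL HL => ?_
  · rw [upd_apply, if_neg (by norm_num), hRJ _ (by norm_num) (by norm_num)]
    simp [upd_apply, hRE, hR.len]
  · rw [upd_apply, if_neg (by norm_num), hRJ _ (by norm_num) (by norm_num)]
    simp [upd_apply, r63]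
  refine (within_storeHdr (j := 30) (d := d) (o := o) (s := s) (lab := lab) (HL.mono (by norm_num))
    ⟨by omega, ?_, ?_, ?_, hed, hcn, ?_, ?_⟩ ?_).mono (by norm_num) fun _ h => h
  · rw [hFJ 50 (by norm_num)]
    simp only [upd_apply]
    simp
    rw [hFE 50 (by norm_num) (by norm_num)]
    simpa [upd_apply, h58, hR.zero, m50] using E.ch.of_concat hP
  · rw [hFJ 51 (by norm_num)]
    simp only [upd_apply]
    simp
    rw [hFE 51 (by norm_num) (by norm_num), r75, r62]
    simp [upd_apply, m51]
    refine E.pre.of_concat hv hi hP ?_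
    rcases hsf with ⟨k, h1, -, h2⟩ | ⟨h1, -, h2⟩
    exacts [Or.inl ⟨k, h1, h2⟩, Or.inr ⟨h1, h2⟩]
  · rw [hFJ 52 (by norm_num)]
    simp only [upd_apply]
    simp
    refine E.suf.of_concat hv hi hP ?_
    simp [upd_apply, m52, h58, hR.zero] at hsf
    rcases hsf with ⟨k, h1, h2, -⟩ | ⟨h1, h2, -⟩
    exacts [Or.inl ⟨k, h1, h2⟩, Or.inr ⟨h1, h2⟩]
  · exact ⟨L.inj.mono (nodes_subset_concat s c), fun y hy => L.ne y (nodes_subset_concat s c hy),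
      L.odd, L.even⟩
  · exact fun y hy => E.recs y (nodes_subset_concat s c hy)
  · refine ⟨?_, ?_, ?_, ?_, ?_, ?_⟩ <;> simp only [upd_apply]
    · simp
      rw [hRJ _ (by norm_num) (by norm_num)]
      simp [upd_apply, hRE, hR.fst]
    · simp
      rw [dir_not]
      congr 1
      ring
    · simp
    · simp
      exact h60
    · simp
      rw [hRJ _ (by norm_num) (by norm_num)]
      simp [upd_apply, r62]
    · simp
      rw [hRJ _ (by norm_num) (by norm_num)]
      simp [upd_apply, r63]

end Eer

namespace WordRAM

/-! ### Queries -/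

/-- The program writes neither to the memory nor to register 3. -/
def Prog.readOnly : Prog → Bool
  | .skip => true
  | .const r _ => r != 3
  | .move r _ => r != 3
  | .add r _ _ => r != 3
  | .sub r _ _ => r != 3
  | .load r _ => r != 3
  | .store _ _ => false
  | .seq p q => p.readOnly && q.readOnly
  | .ite _ p q => p.readOnly && q.readOnly
  | .loop _ p => p.readOnly

/-- A program that is read-only leaves the first free address unchanged: queries do not use up
memory. -/
theorem Exec.readOnly {w t : ℕ} {p : Prog} {st st' : State} (h : Exec w p st t st')
    (hp : p.readOnly = true) : st'.reg 3 = st.reg 3 ∧ st.space ≤ st'.space := by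
  induction h with
  | skip | loop_false => exact ⟨rfl, le_rfl⟩
  | const | move | add | sub =>
    simp only [Prog.readOnly, bne_iff_ne, ne_eq] at hp
    exact ⟨by rw [set_reg, if_neg (Ne.symm hp)], le_rfl⟩
  | load =>
    simp only [Prog.readOnly, bne_iff_ne, ne_eq] at hp
    exact ⟨by rw [set_reg, if_neg (Ne.symm hp), touch_reg], le_max_left _ _⟩
  | store => exact absurd hp (by simp [Prog.readOnly])
  | seq _ _ ih₁ ih₂ =>
    simp only [Prog.readOnly, Bool.and_eq_true] at hp
    have h1 := ih₁ hp.1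
    have h2 := ih₂ hp.2
    exact ⟨h2.1.trans h1.1, h1.2.trans h2.2⟩
  | ite_true _ _ ih =>
    simp only [Prog.readOnly, Bool.and_eq_true] at hp
    exact ih hp.1
  | ite_false _ _ ih =>
    simp only [Prog.readOnly, Bool.and_eq_true] at hp
    exact ih hp.2
  | loop_true _ _ _ ih₁ ih₂ =>
    have h1 := ih₁ hp
    have h2 := ih₂ hp
    exact ⟨h2.1.trans h1.1, h1.2.trans h2.2⟩

end WordRAM

namespace Eer

open WordRAM _root_.Eer.Tree

variable {w N lim j σ : ℕ} {st₀ st : State} {v : Version σ}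

/-- The version `v` is present in the state `st`. -/
def Present (w : ℕ) (st : State) (v : Version σ) : Prop :=
  ∃ o ch pre suf ed cn,
    VerAt w st.mem (st.reg 3) true v.handle v.str v.label o ch pre suf ed cn

/-- The program of a query: `p` is executed with the header in the registers 50 to 60 and the
arguments of the query in the registers 64 and 65, and returns the answer in register 64. -/
def queryP (p : Prog) : Prog := .seq (seqs [.move 64 1, .move 65 2]) (.seq (loadHdr true)
  (.seq p (.move 0 64)))

/-- The programs of the data structure. The initialization leaves zeros in the cells 0 to 4, which
represent the empty tree, and stores the record of `odd` at the address 5, the record of `even` at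
9, and the header of the empty string at 13; then 22 is the first free address. -/
def impl : Implementation where
  init := .seq (seqs [.const 3 5, .const 20 1, .const 62 0, .const 63 1,
      .sub 61 62 63, .const 60 5])
    (.seq (alloc 50 [61, 60, 62, 60, 62, 60, 62, 60, 62, 62, 62, 62, 62, 62, 61, 62, 63])
    (.const 0 13))
  pushBack := pushP true
  pushFront := pushP false
  popBack := popP true
  popFront := popP false
  length := queryP (.move 64 59)
  charAt := queryP (seqs [.add 66 57 64, getM 64 50 66 62, .sub 64 64 63])
  even := queryP (.const 64 9)
  odd := queryP (.const 64 5)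
  next := queryP (seqs [.add 65 65 63, getM 64 53 64 65])
  link := queryP (loadM 64 64 1)
  len := queryP (loadM 64 64 0)
  numPal := queryP (.move 64 60)
  prePal := queryP (getM 64 51 57 62)
  prePalUnique := queryP (seqs [getM 64 51 57 62, getM 64 54 64 62,
    .ite (.eq 64 63) .skip (.const 64 0)])
  sufPal := queryP (getM 64 52 58 62)
  sufPalUnique := queryP (seqs [getM 64 52 58 62, getM 64 54 64 62,
    .ite (.eq 64 63) .skip (.const 64 0)])

theorem readOnly_query (q : Query σ) : (impl.query q).readOnly = true := by
  cases q <;> rfl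

/-- It suffices to verify the part `p` of a query that computes the answer from the header. -/
theorem within_queryP {p : Prog} {x y z ans : ℕ} (V : Present w st v)
    (h0 : TreeAt st.mem (st.reg 3) .nil 0) (hx : x = v.handle) (hy : y + 1 < 2 ^ w)
    (hlim : lim < 2 ^ w) (hfp : st.reg 3 + 70 * unitSpace N ≤ lim) (hN : v.str.length + 80 ≤ N)
    (hp : ∀ s R o ch pre suf ed cn, HS w N lim (st.call x y z) 70 s R (maps ch pre suf ed cn) →
      Enc w st.mem (st.reg 3) true o v.str v.label ch pre suf ed cn → Regs w true o v.str R →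
      R 64 = y → R 65 = z →
      Within w N 5 p s fun s' => ∃ R' F', HS w N lim (st.call x y z) 1 s' R' F' ∧ R' 64 = ans) :
    Within w N 57 (queryP p) (st.call x y z) fun st' => Ext (st.call x y z) st' ∧
      st'.reg 0 = ans := by
  obtain ⟨o, ch, pre, suf, ed, cn, V⟩ := V
  have B : Runs w (seqs [.move 64 1, .move 65 2]) (st.call x y z) fun n s => n ≤ 210 ∧
      s.mem = st.mem ∧ s.space = st.space ∧ s.reg 0 = x ∧ s.reg 1 = y ∧ s.reg 3 = st.reg 3 ∧
      s.reg 64 = y ∧ s.reg 65 = z := by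
    refine Runs.straight (c := 2) (by simp [seqs, Prog.Straight]) (by simp [seqs, Prog.cost])
      fun n hn => ?_
    simp [seqs, Prog.eval, State.call, set_reg, set_mem, set_space]
    omega
  refine Within.mono (k := 8) ?_ (by norm_num) fun _ h => h
  have c3 : (st.call x y z).reg 3 = st.reg 3 := by simp [State.call, set_reg]
  have cm : (st.call x y z).mem = st.mem := rfl
  have cs : (st.call x y z).space = st.space := rfl
  refine Within.step (Within.of_runs le_rfl B) fun s₁ h₁ => ?_
  obtain ⟨b1, b2, b3, b4, b5, b6, b7⟩ := h₁
  refine Within.step (within_loadHdr (d := true) (j := 70) (N := N) (lim := lim)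
    (by rw [b1, b3, b5, hx]; exact V) (by rw [b1, b5]; exact h0) (by rw [b4]; exact hy) hlim
    (by rw [b5]; exact hfp) (by omega)) fun s₂ h₂ => ?_
  obtain ⟨R, H, hR, -, hr⟩ := h₂
  have X : Ext (st.call x y z) s₁ :=
    ⟨by rw [c3, b5], fun a _ => by rw [b1, cm], by rw [b2, cs]; exact le_max_left _ _⟩
  have H' : HS w N lim (st.call x y z) 70 s₂ R (maps ch pre suf ed cn) :=
    ⟨H.lt, X.trans H.ext, H.reg, H.map, H.supp, H.null, H.fp⟩
  refine Within.seq (k := 5) (hp _ _ _ _ _ _ _ _ H' V.enc hR (by rw [hr 64 le_rfl, b6])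
    (by rw [hr 65 (by norm_num), b7])) fun s₃ h₃ => ?_
  obtain ⟨R', F', H₃, e⟩ := h₃
  refine Within.of_runs (c := 1) (by norm_num) ⟨_, _, .move .., le_rfl, ⟨?_, ?_, ?_⟩, ?_⟩
  · rw [set_reg, if_neg (by norm_num)]
    exact H₃.ext.fp
  · exact H₃.ext.mem
  · rw [set_reg, if_neg (by norm_num)]
    exact H₃.ext.space
  · rw [set_reg, if_pos rfl, H₃.reg 64 (by norm_num), e]

theorem Enc.suf_sufpal {d : Bool} {o : ℤ} {s : List (Fin σ)} {lab : Node (Fin σ) → ℕ}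
    {M : ℕ → ℕ} {fp : ℕ} {ch pre suf ed cn : ℕ → ℕ → ℕ}
    (E : Enc w M fp d o s lab ch pre suf ed cn) (hs : s ≠ []) :
    suf (word w (o + dir d * (s.length - 1))) 0 = lab (.pal (sufpal s)) := by
  rw [E.suf_last, if_neg hs]

theorem Enc.pre_prepal {d : Bool} {o : ℤ} {s : List (Fin σ)} {lab : Node (Fin σ) → ℕ}
    {M : ℕ → ℕ} {fp : ℕ} {ch pre suf ed cn : ℕ → ℕ → ℕ}
    (E : Enc w M fp d o s lab ch pre suf ed cn) (hs : s ≠ []) :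
    pre (word w o) 0 = lab (.pal (prepal s)) := by
  rw [prepal_eq_sufpal_reverse, ← E.mirror.suf_sufpal (by simpa using hs), List.length_reverse,
    dir_not, neg_mul, add_neg_cancel_right]

/-- A palindrome whose node is found in the map in register `i`, and which is the longest
palindromic prefix or suffix, is unique if and only if its count is 1. -/
theorem within_unique {s : List (Fin σ)} {u : List (Fin σ)} {lab : Node (Fin σ) → ℕ} {M : ℕ → ℕ}
    {fp i k ans : ℕ} {o : ℤ} {ch pre suf ed cn : ℕ → ℕ → ℕ} {R : ℕ → ℕ}
    (H : HS w N lim st₀ 70 st R (maps ch pre suf ed cn))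
    (E : Enc w M fp true o s lab ch pre suf ed cn) (hR : Regs w true o s R)
    (hi : 50 ≤ i ∧ i < 56) (hk : 56 ≤ k) (h : maps ch pre suf ed cn i (R k) 0 = lab (.pal u))
    (hu : Node.pal u ∈ nodes s) (ha : ans = if cnt s (.pal u) = 1 then 1 else 0) :
    Within w N 5 (seqs [getM 64 i k 62, getM 64 54 64 62, .ite (.eq 64 63) .skip (.const 64 0)]) st
      fun s' => ∃ R' F', HS w N lim st₀ 1 s' R' F' ∧ R' 64 = ans := by
  refine (Within.step (H.getM (y := lab (.pal u)) (by norm_num) hi hk (by norm_num)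
    (by rw [hR.zero, h])) fun s₁ H₁ => Within.step (H₁.getM (y := cnt s (.pal u)) (by norm_num)
    (by norm_num) (by norm_num) (by norm_num) ?_) fun s₂ H₂ => ?_ :
    Within w N 4 _ _ _).mono (by norm_num) fun _ h => h
  · rw [← E.cn.apply hu]
    simp [upd_apply, hR.zero]
    rfl
  refine (Within.ite (fun t => ?_) fun t => ?_ : Within w N 2 _ _ _) <;>
    simp only [Test.Holds, H₂.reg 64 (by norm_num), H₂.reg 63 (by norm_num)] at t <;>
    simp [upd_apply, hR.one] at t
  · refine Within.skip ⟨_, _, H₂.mono (by norm_num), ?_⟩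
    rw [upd_apply, if_pos rfl, ha, if_pos t, t]
  · refine (H₂.const (by norm_num) (by positivity)).mono le_rfl fun s' H' =>
      ⟨_, _, H'.mono (by norm_num), ?_⟩
    rw [upd_apply, if_pos rfl, ha, if_neg t]

/-- Queries are answered by a constant number of steps on the level of maps. -/
theorem within_query (q : Query σ) (hq : q.Valid v.str) (V : Present w st v)
    (h0 : TreeAt st.mem (st.reg 3) .nil 0) (hσ : σ < 2 ^ w) (hlim : lim < 2 ^ w)
    (hfp : st.reg 3 + 70 * unitSpace N ≤ lim) (hN : v.str.length + 80 ≤ N) :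
    Within w N 57 (impl.query q) (st.call v.handle (q.arg₁ v.label) q.arg₂) fun st' =>
      Ext (st.call v.handle (q.arg₁ v.label) q.arg₂) st' ∧
      st'.reg 0 = q.answer w v.str v.label := by
  have c3 : ∀ x y z, (st.call x y z).reg 3 = st.reg 3 := fun x y z => by simp [State.call, set_reg]
  obtain ⟨o₀, ch₀, pre₀, suf₀, ed₀, cn₀, V'⟩ := id V
  have E₀ := V'.enc
  have hl := E₀.length
  have hlab : ∀ u ∈ nodes v.str, v.label u + 4 ≤ st.reg 3 := fun u hu => (E₀.recs u hu).lt
  have fin : ∀ (c : Fin σ), (c : ℕ) < σ := fun c => c.2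
  cases q with
  | length =>
    refine within_queryP V h0 rfl (by simp only [Query.arg₁]; omega) hlim hfp hN
      fun s R o ch pre suf ed cn H E hR h64 h65 => ?_
    refine (H.move (by norm_num) (by norm_num)).mono (by norm_num) fun s' H' =>
      ⟨_, _, H'.mono (by norm_num), ?_⟩
    simp [upd_apply, hR.len, Query.answer]
  | charAt i =>
    have hi : i < v.str.length := hq
    refine within_queryP V h0 rfl (by simp only [Query.arg₁]; omega) hlim hfp hN
      fun s R o ch pre suf ed cn H E hR h64 h65 => ?_
    have hch : ch (word w (o + i)) 0 = v.str[i] + 1 := by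
      have := E.ch.val ⟨rfl, i, _, List.getElem?_eq_getElem hi, rfl, rfl⟩
      simpa [posn, dir] using this
    have hc := fin v.str[i]
    refine (Within.step (H.add (x := o) (y := i) (by norm_num) (by norm_num) (by norm_num) hR.fst
      (by rw [h64, word_natCast (by omega)]; rfl)) fun s₁ H₁ => Within.step (H₁.getM
      (y := v.str[i] + 1) (by norm_num) (by norm_num) (by norm_num) (by norm_num)
      (by rw [← hch]; simp [upd_apply, hR.zero]; rfl)) fun s₂ H₂ => (H₂.pred (x := v.str[i])
      (by norm_num) (by norm_num) (by norm_num) (by simp [upd_apply]) (by simp [upd_apply, hR.one])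
      (by omega)).mono le_rfl fun s₃ H₃ => ⟨_, _, H₃.mono (by norm_num), ?_⟩ :
      Within w N 3 _ _ _).mono (by norm_num) fun _ h => h
    simp [upd_apply, Query.answer, hi]
  | even =>
    refine within_queryP V h0 rfl (by simp only [Query.arg₁]; omega) hlim hfp hN
      fun s R o ch pre suf ed cn H E hR h64 h65 => ?_
    refine (H.const (by norm_num) (by omega)).mono (by norm_num) fun s' H' =>
      ⟨_, _, H'.mono (by norm_num), ?_⟩
    rw [upd_apply, if_pos rfl]
    exact E.labels.even.symm
  | odd =>
    refine within_queryP V h0 rfl (by simp only [Query.arg₁]; omega) hlim hfp hN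
      fun s R o ch pre suf ed cn H E hR h64 h65 => ?_
    refine (H.const (by norm_num) (by omega)).mono (by norm_num) fun s' H' =>
      ⟨_, _, H'.mono (by norm_num), ?_⟩
    rw [upd_apply, if_pos rfl]
    exact E.labels.odd.symm
  | next u c =>
    have hu : u ∈ nodes v.str := hq
    have hlu := hlab u hu
    have hc := fin c
    refine within_queryP V h0 rfl (by simp only [Query.arg₁]; omega) hlim hfp hN
      fun s R o ch pre suf ed cn H E hR h64 h65 => ?_
    refine (Within.step (H.succ (x := c) (by norm_num) (by norm_num) (by norm_num) h65 hR.one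
      (by omega)) fun s₁ H₁ => (H₁.getM (by norm_num) (by norm_num) (by norm_num) (by norm_num)
      rfl).mono le_rfl fun s₂ H₂ => ⟨_, _, H₂.mono (by norm_num), ?_⟩ :
      Within w N 2 _ _ _).mono (by norm_num) fun _ h => h
    have e : maps ch pre suf ed cn 53 = ed := rfl
    simp only [upd_apply, e]
    simp only [h64, Query.arg₁, Query.answer, eertree]
    simp
    split_ifs with h
    · simpa using E.ed_apply h
    · simpa using (E.ed_eq_zero hu).2 h
  | link u =>
    have hu : u ∈ nodes v.str := hq
    have hlu := hlab u hu
    refine within_queryP V h0 rfl (by simp only [Query.arg₁]; omega) hlim hfp hN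
      fun s R o ch pre suf ed cn H E hR h64 h65 => ?_
    refine (H.loadM (k := 1) (y := v.label u.link) (by norm_num) (by norm_num)
      (by rw [h64, c3, Query.arg₁]; omega) (by rw [h64]; exact (E.recs u hu).link)).mono
      (by norm_num) fun s' H' => ⟨_, _, H'.mono (by norm_num), ?_⟩
    rw [upd_apply, if_pos rfl]
    rfl
  | len u =>
    have hu : u ∈ nodes v.str := hq
    have hlu := hlab u hu
    refine within_queryP V h0 rfl (by simp only [Query.arg₁]; omega) hlim hfp hN
      fun s R o ch pre suf ed cn H E hR h64 h65 => ?_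
    refine (H.loadM (k := 0) (y := word w u.len) (by norm_num) (by norm_num)
      (by rw [h64, c3, Query.arg₁]; omega) (by rw [h64]; exact (E.recs u hu).len)).mono
      (by norm_num) fun s' H' => ⟨_, _, H'.mono (by norm_num), ?_⟩
    rw [upd_apply, if_pos rfl]
    rfl
  | numPal =>
    refine within_queryP V h0 rfl (by simp only [Query.arg₁]; omega) hlim hfp hN
      fun s R o ch pre suf ed cn H E hR h64 h65 => ?_
    refine (H.move (by norm_num) (by norm_num)).mono (by norm_num) fun s' H' =>
      ⟨_, _, H'.mono (by norm_num), ?_⟩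
    rw [upd_apply, if_pos rfl, hR.num, Query.answer, numPal_eq]
  | prePal =>
    refine within_queryP V h0 rfl (by simp only [Query.arg₁]; omega) hlim hfp hN
      fun s R o ch pre suf ed cn H E hR h64 h65 => ?_
    refine (H.getM (y := v.label (.pal (prepal v.str))) (by norm_num) (by norm_num) (by norm_num)
      (by norm_num) (by rw [hR.fst, hR.zero]; exact E.pre_prepal hq)).mono (by norm_num)
      fun s' H' => ⟨_, _, H'.mono (by norm_num), ?_⟩
    rw [upd_apply, if_pos rfl]
    rfl
  | sufPal =>
    refine within_queryP V h0 rfl (by simp only [Query.arg₁]; omega) hlim hfp hN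
      fun s R o ch pre suf ed cn H E hR h64 h65 => ?_
    refine (H.getM (y := v.label (.pal (sufpal v.str))) (by norm_num) (by norm_num) (by norm_num)
      (by norm_num) (by rw [hR.lst, hR.zero]; exact E.suf_sufpal hq)).mono (by norm_num)
      fun s' H' => ⟨_, _, H'.mono (by norm_num), ?_⟩
    rw [upd_apply, if_pos rfl]
    rfl
  | prePalUnique =>
    refine within_queryP V h0 rfl (by simp only [Query.arg₁]; omega) hlim hfp hN
      fun s R o ch pre suf ed cn H E hR h64 h65 => ?_
    refine within_unique (k := 57) (u := prepal v.str) H E hR (by norm_num) (by norm_num) ?_ ?_ ?_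
    · rw [hR.fst]
      exact E.pre_prepal hq
    · rw [prepal_eq_sufpal_reverse, ← nodes_reverse]
      exact pal_mem_nodes.2 (sufpal_mem_pals _)
    · simp only [Query.answer, uniqueIn_prepal hq]
  | sufPalUnique =>
    refine within_queryP V h0 rfl (by simp only [Query.arg₁]; omega) hlim hfp hN
      fun s R o ch pre suf ed cn H E hR h64 h65 => ?_
    refine within_unique (k := 58) (u := sufpal v.str) H E hR (by norm_num) (by norm_num) ?_ ?_ ?_
    · rw [hR.lst]
      exact E.suf_sufpal hq
    · exact pal_mem_nodes.2 (sufpal_mem_pals _)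
    · simp only [Query.answer, uniqueIn_sufpal hq]

end Eer

namespace Eer

open WordRAM _root_.Eer.Tree

variable {w N lim σ : ℕ} {st : State} {v : Version σ}

/-! ### Sequences of operations -/

theorem call_reg_three (st : State) (x y z : ℕ) : (st.call x y z).reg 3 = st.reg 3 := by
  simp [State.call, set_reg]

theorem Updated.present {s : List (Fin σ)} {st' : State} (h : Updated w lim true s st st') :
    ∃ lab, Present w st' ⟨s, st'.reg 0, lab⟩ := by
  obtain ⟨-, -, -, lab, o, ch, pre, suf, ed, cn, h⟩ := h
  exact ⟨lab, o, ch, pre, suf, ed, cn, h⟩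

/-- An update of the mirrored version is an update at the other end. -/
theorem Updated.mirror {s : List (Fin σ)} {st' : State} (h : Updated w lim false s st st') :
    Updated w lim true s.reverse st st' := by
  obtain ⟨h1, h2, h3, lab, o, ch, pre, suf, ed, cn, h⟩ := h
  exact ⟨h1, h2, h3, lab, _, ch, suf, pre, ed, cn, h.mirror⟩

/-- Operations at the front are operations at the back of the mirrored version. -/
theorem within_update (u : Update σ) (hu : u.Valid v.str) (V : Present w st v)
    (h0 : TreeAt st.mem (st.reg 3) .nil 0) (hσ : σ < 2 ^ w) (hlim : lim < 2 ^ w)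
    (hlen : 3 * v.str.length + 13 < 2 ^ w)
    (hfp : st.reg 3 + 70 * unitSpace N ≤ lim) (hN : v.str.length + 80 ≤ N) :
    Within w N 57 (impl.update u) (st.call v.handle u.arg 0) fun st' =>
      Updated w lim true (u.apply v.str) (st.call v.handle u.arg 0) st' := by
  obtain ⟨o, ch, pre, suf, ed, cn, V⟩ := V
  have e := call_reg_three st
  have e0 : ∀ x y z, (st.call x y z).reg 0 = x := fun x y z => by simp [State.call, set_reg]
  have e1 : ∀ x y z, (st.call x y z).reg 1 = y := fun x y z => by simp [State.call, set_reg]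
  have em : ∀ x y z, (st.call x y z).mem = st.mem := fun x y z => rfl
  have fin : ∀ (c : Fin σ), (c : ℕ) < σ := fun c => c.2
  have M := V.mirror
  rw [Bool.not_true] at M
  cases u with
  | pushBack c =>
    have hc := fin c
    exact within_pushP (d := true) (by rw [em, e, e0]; exact V) (by rw [em, e]; exact h0)
      (e1 _ _ _) hlim hlen (by omega) (by rw [e]; exact hfp) hN
  | pushFront c =>
    have hc := fin c
    refine (within_pushP (d := false) (c := c) (by rw [em, e, e0]; exact M)
      (by rw [em, e]; exact h0) (e1 _ _ _) hlim (by simpa using hlen) (by omega)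
      (by rw [e]; exact hfp) (by simpa using hN)).mono le_rfl fun st' h => ?_
    simpa [Update.apply, Update.arg] using h.mirror
  | popBack =>
    obtain ⟨s, c, hs⟩ := (List.eq_nil_or_concat' v.str).resolve_left hu
    rw [hs] at V hN hlen
    simp only [List.length_append, List.length_singleton] at hN hlen
    rw [hs]
    simp only [Update.apply, List.dropLast_concat]
    exact within_popP (d := true) (by rw [em, e, e0]; exact V) (by rw [em, e]; exact h0)
      (by rw [e1]; simp only [Update.arg]; omega) hlim (by rw [e]; exact hfp) (by omega)
  | popFront =>
    obtain ⟨c, s, hs⟩ := List.exists_cons_of_ne_nil hu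
    rw [hs, List.reverse_cons] at M
    rw [hs] at hN hlen ⊢
    simp only [List.length_cons] at hN hlen
    refine (within_popP (d := false) (by rw [em, e, e0]; exact M) (by rw [em, e]; exact h0)
      (by rw [e1]; simp only [Update.arg]; omega) hlim (by rw [e]; exact hfp)
      (by simp; omega)).mono le_rfl fun st' h => ?_
    simpa [Update.apply] using h.mirror

theorem log_add_le (n : ℕ) : Nat.log 2 (n + 100) ≤ Nat.log 2 n + 7 := by
  have h : n < 2 ^ (Nat.log 2 n + 1) := Nat.lt_pow_succ_log_self one_lt_two n
  refine Nat.le_of_lt_succ (Nat.log_lt_of_lt_pow (by omega) ?_)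
  rw [show (Nat.log 2 n + 7).succ = Nat.log 2 n + 1 + 7 by omega, pow_add]
  omega

/-- The constant in the bounds on time and space. If `l` is the logarithm of `n`, that of `n + 100`
is at most `l + 7`, so that 57 steps on maps of size `n + 100` take time at most
`57 * (160 * (2 * (l + 7) + 2) + 210)`; the constant is the value for `l = 0`. -/
def bnd : ℕ := 157890

theorem time_le (n : ℕ) : 57 * unitTime (n + 100) ≤ bnd * (1 + Nat.log 2 n) := by
  have := log_add_le n
  unfold unitTime hgt bnd
  omega

theorem space_le (n : ℕ) : 70 * unitSpace (n + 100) ≤ bnd * (1 + Nat.log 2 n) := by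
  have := log_add_le n
  unfold unitSpace hgt bnd
  omega

theorem unitSpace_mono {n m : ℕ} (h : n ≤ m) : unitSpace n ≤ unitSpace m := by
  have := Nat.log_mono_right (b := 2) h
  unfold unitSpace hgt
  omega

/-- The invariant after `k` of `m` operations: an operation uses at most 70 units of space, and all
the versions are present. Nothing below the first free address, in register 3, is ever changed. -/
structure Inv (w m k : ℕ) (st : State) (vs : List (Version σ)) : Prop where
  null : TreeAt st.mem (st.reg 3) .nil 0
  space : st.reg 3 ≤ st.space
  fp : st.reg 3 ≤ 22 + k * (70 * unitSpace (m + 100))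
  ver : ∀ v ∈ vs, Present w st v ∧ v.str.length ≤ k

theorem Present.wellLabelled (h : Present w st v) : v.WellLabelled := by
  obtain ⟨o, ch, pre, suf, ed, cn, V⟩ := h
  exact ⟨V.enc.labels.inj, V.enc.labels.ne⟩

theorem Present.ext {st' : State} (h : Present w st v) (X : Ext st st') : Present w st' v := by
  obtain ⟨o, ch, pre, suf, ed, cn, V⟩ := h
  exact ⟨o, ch, pre, suf, ed, cn, V.mono X.mem X.fp⟩

theorem length_apply_le (u : Update σ) (s : List (Fin σ)) : (u.apply s).length ≤ s.length + 1 := by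
  cases u <;> simp [Update.apply] <;> omega

theorem log_le_bound (u : Update σ) (n : ℕ) : 1 + Nat.log 2 n ≤ u.bound n := by
  cases u <;> simp [Update.bound]

/-- A state with the invariant serves all the operations for which the memory suffices: each
operation extends the heap, hence preserves all the versions. -/
theorem Inv.serves {m : ℕ} (hσ : σ < 2 ^ w) (hm : 22 + m * (70 * unitSpace (m + 100)) < 2 ^ w) :
    ∀ (r k : ℕ) (st : State) (vs : List (Version σ)), k + r ≤ m → Inv w m k st vs →
      Serves impl bnd w r st vs := by
  intro r
  induction r with
  | zero => exact fun _ _ _ _ _ => trivial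
  | succ r ih =>
    intro k st vs hk I v hv
    obtain ⟨V, hl⟩ := I.ver v hv
    have hU := unitSpace_mono (show v.str.length + 100 ≤ m + 100 by omega)
    have hS := space_le v.str.length
    have hT := time_le v.str.length
    have hfp := I.fp
    have hsp := I.space
    have h2 : (k + 1) * (70 * unitSpace (m + 100)) ≤ m * (70 * unitSpace (m + 100)) :=
      Nat.mul_le_mul_right _ (by omega)
    rw [Nat.add_mul, Nat.one_mul] at h2
    have hlen : 3 * v.str.length + 13 < 2 ^ w := by
      have h3 : m * 70 ≤ m * (70 * unitSpace (m + 100)) :=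
        Nat.mul_le_mul_left _ (by unfold unitSpace; omega)
      omega
    -- The bound `n + 100` for the sizes of the maps, where `n` is the length of this version,
    -- yields the cost of this operation; `m + 100` bounds the memory used in the whole sequence.
    obtain ⟨lim, hL⟩ : ∃ lim, lim = st.reg 3 + 70 * unitSpace (v.str.length + 100) := ⟨_, rfl⟩
    have hlim : lim < 2 ^ w := by omega
    refine ⟨fun u hu => ?_, fun q hq => ?_⟩
    · obtain ⟨t, st', h1, h2, h3⟩ := within_update (N := v.str.length + 100) u hu V I.null hσ hlim
        hlen hL.ge (by omega)
      obtain ⟨lab, hP⟩ := h3.present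
      obtain ⟨X, x1, x2, -⟩ := h3
      have hB := Nat.mul_le_mul_left bnd (log_le_bound u v.str.length)
      have X' : Ext st st' := ⟨by rw [← call_reg_three st]; exact X.fp,
        fun a ha => X.mem a (by rw [call_reg_three]; exact ha), X.space⟩
      have hs := X'.space
      have hla := length_apply_le u v.str
      refine ⟨t, st', _, h1, h2.trans (hT.trans hB), by omega, rfl, rfl, hP.wellLabelled,
        ih (k + 1) _ _ (by omega) ⟨I.null.ext X', x2, by rw [Nat.add_mul]; omega, fun v' hv' => ?_⟩⟩
      rcases List.mem_append.1 hv' with h | h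
      · obtain ⟨g1, g2⟩ := I.ver v' h
        exact ⟨g1.ext X', by omega⟩
      · rw [List.mem_singleton.1 h]
        exact ⟨hP, by show (u.apply v.str).length ≤ _; omega⟩
    · obtain ⟨t, st', h1, h2, X, h3⟩ := within_query (N := v.str.length + 100) q hq V I.null hσ hlim
        hL.ge (by omega)
      obtain ⟨e3, e4⟩ := h1.readOnly (readOnly_query q)
      have e5 : st.space ≤ st'.space := e4
      rw [call_reg_three] at e3
      have X' : Ext st st' := ⟨e3.ge,
        fun a ha => X.mem a (by rw [call_reg_three]; exact ha), X.space⟩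
      have hs := X'.space
      have hB : bnd * (1 + Nat.log 2 v.str.length) ≤
          bnd * (1 + Nat.log 2 v.str.length + Nat.log 2 σ) := Nat.mul_le_mul_left _ (by omega)
      refine ⟨t, st', h1, h2.trans (hT.trans hB), by omega, h3, ih (k + 1) _ _ (by omega)
        ⟨I.null.ext X', by omega, by rw [Nat.add_mul]; omega, fun v' hv' => ?_⟩⟩
      obtain ⟨g1, g2⟩ := I.ver v' hv'
      exact ⟨g1.ext X', by omega⟩

/-- The pointers to the nodes of the empty string. -/
def labNil : Node (Fin σ) → ℕ
  | .odd => 5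
  | .pal _ => 9

theorem mem_nodes_nil {v : Node (Fin σ)} : v ∈ nodes [] ↔ v = .odd ∨ v = .pal [] := by
  cases v with
  | odd => simp [odd_mem_nodes]
  | pal t =>
    rw [pal_mem_nodes, mem_pals]
    constructor
    · rintro ⟨-, h⟩
      rw [List.infix_nil.1 h]
      exact Or.inr rfl
    · rintro (h | h)
      · cases h
      · injection h with h
        rw [h]
        exact ⟨.nil, List.infix_rfl⟩

theorem pals_nil : pals ([] : List (Fin σ)) = {[]} := by
  ext t
  rw [← pal_mem_nodes, mem_nodes_nil]
  simp

theorem cnt_nil (v : Node (Fin σ)) : cnt [] v = 0 := by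
  simp [cnt, surfs_nil, pals_nil]

/-- The representation of the empty string, with the records of `odd` at 5 and of `even` at 9. All
the tables are empty. The field for the parent of `even` points to `odd`, which `core []` is by
convention. -/
theorem enc_nil (hw : 22 < 2 ^ w) {M : ℕ → ℕ} (h0 : TreeAt M 22 .nil 0)
    (h5 : M 5 = word w (-1)) (h6 : M 6 = 5) (h7 : M 7 = 0) (h9 : M 9 = 0)
    (h10 : M 10 = 5) (h11 : M 11 = 0) (h12 : M 12 = 5) :
    Enc w M 22 true 0 ([] : List (Fin σ)) labNil (fun _ _ => 0) (fun _ _ => 0) (fun _ _ => 0)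
      (fun _ _ => 0) (fun _ _ => 0) := by
  have ns : ∀ i j, ¬ Surf ([] : List (Fin σ)) i j := fun i j h => by
    have := h.lt
    have := h.le
    simp at this
    omega
  have hd : ∀ u : Node (Fin σ), (∀ c, direct u c = .odd) → DTab labNil u fun _ _ => 0 := by
    intro u hu
    refine ⟨?_, fun h => absurd rfl h⟩
    rintro x y z ⟨-, c, h, -⟩
    exact absurd (hu c) h
  refine ⟨by simp; omega, ⟨?_, fun h => absurd rfl h⟩, ⟨?_, fun h => absurd rfl h⟩,
    ⟨?_, fun h => absurd rfl h⟩, ⟨?_, fun h => absurd rfl h⟩, ⟨?_, fun h => absurd rfl h⟩,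
    ⟨?_, ?_, rfl, rfl⟩, ?_⟩
  · rintro x y z ⟨-, k, c, h, -⟩
    simp at h
  · rintro x y z ⟨-, i, j, h, -⟩
    exact absurd h (ns i j)
  · rintro x y z ⟨-, i, j, h, -⟩
    exact absurd h (ns i j)
  · rintro x y z ⟨u, c, h, -⟩
    rw [mem_nodes_nil] at h
    cases u <;> simp [Node.extend] at h
  · rintro x y z ⟨-, u, -, -, rfl⟩
    rw [cnt_nil]
  · intro a ha b hb h
    rw [mem_nodes_nil] at ha hb
    rcases ha with rfl | rfl <;> rcases hb with rfl | rfl <;> first | rfl | cases h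
  · intro a ha
    cases a <;> simp [labNil]
  · intro u hu
    rcases mem_nodes_nil.1 hu with rfl | rfl
    · refine ⟨by simp [labNil], h5, h6, ⟨_, hd _ fun c => rfl,
        ⟨∅, by simp, fun _ _ h => absurd rfl h⟩,
        ?_⟩, fun t h => by cases h⟩
      simp only [labNil, h7]
      exact mapAt_zero h0
    · refine ⟨by simp [labNil], ?_, h10, ⟨_, hd _ fun c => ?_,
        ⟨∅, by simp, fun _ _ h => absurd rfl h⟩,
        ?_⟩, fun t h => ?_⟩
      · simp [labNil, h9, Node.len, word]
      · have h1 := direct_mem_nodes (s := ([] : List (Fin σ))) (mem_nodes_nil.2 (Or.inr rfl)) c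
        have h2 := congrArg Node.len (extend_direct ([] : List (Fin σ)) c)
        rcases mem_nodes_nil.1 h1 with h | h
        · exact h
        · rw [h] at h2
          have h3 := (sufpal_suffix ([] ++ [c])).length_le
          simp [Node.extend, Node.len] at h2 h3
          omega
      · simp only [labNil, h11]
        exact mapAt_zero h0
      · injection h with h
        rw [← h]
        exact h12

theorem runs_init (hw : 22 < 2 ^ w) (x : ℕ) : Runs w impl.init (State.initial.call x 0 0)
    fun t st => t ≤ 45 ∧ st.space ≤ 22 ∧ ∃ v : Version σ, v.str = [] ∧ v.handle = st.reg 0 ∧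
      ∀ m, Inv w m 0 st [v] := by
  have B : Runs w (seqs [.const 3 5, .const 20 1, .const 62 0, .const 63 1, .sub 61 62 63,
      .const 60 5]) (State.initial.call x 0 0) fun n s => n ≤ 6 ∧ s.mem = (fun _ => 0) ∧
      s.space = 0 ∧ s.reg 3 = 5 ∧ s.reg 20 = 1 ∧ s.reg 62 = 0 ∧ s.reg 63 = 1 ∧ s.reg 60 = 5 ∧
      s.reg 61 = word w (-1) := by
    refine Runs.straight (c := 6) (by simp [seqs, Prog.Straight]) (by simp [seqs, Prog.cost])
      fun n hn => ?_
    have m1 : 1 % 2 ^ w = 1 := Nat.mod_eq_of_lt (by omega)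
    have m5 : 5 % 2 ^ w = 5 := Nat.mod_eq_of_lt (by omega)
    have h := word_sub (w := w) (0 : ℕ) (1 : ℕ)
    rw [word_natCast (by omega), word_natCast (by omega)] at h
    simp [seqs, Prog.eval, set_reg, set_mem, set_space, hn, m1, m5, State.call, State.initial]
    simpa using h
  refine Runs.seq (B.mono ?_)
  rintro n s ⟨b1, b2, b3, b4, b5, b6, b7, b8, b9⟩
  refine Runs.seq ((runs_alloc b5 (by rw [b4]; exact hw) (by decide) (by norm_num)).mono ?_)
  rintro n' s' ⟨c1, X, c3, c4, c5, c6, c7⟩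
  simp only [List.length_cons, List.length_nil] at c1 c3
  rw [b4] at c3 c6
  have c7 := c7 (by simp)
  have hx := X.space
  refine ⟨_, _, .const .., by omega, by simp [set_space]; omega, ?_⟩
  have mlt : ∀ a < 5, s'.mem a = 0 := fun a ha => by rw [X.mem a (by omega), b2]
  have h0 : TreeAt s'.mem 22 .nil 0 := ⟨rfl, by norm_num, mlt 0 (by norm_num), mlt 3 (by norm_num)⟩
  have e3 : (s'.set 0 (13 % 2 ^ w)).reg 3 = 22 := by rw [set_reg, if_neg (by norm_num), c3]
  have e0 : (s'.set 0 (13 % 2 ^ w)).reg 0 = 13 := by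
    rw [set_reg, if_pos rfl, Nat.mod_eq_of_lt (by omega)]
  refine ⟨⟨[], _, labNil⟩, rfl, rfl, fun m => ⟨?_, ?_, ?_, fun v hv => ?_⟩⟩
  · rw [e3]; exact h0
  · rw [e3, set_space]; omega
  · rw [e3]; omega
  · rw [List.mem_singleton.1 hv]
    refine ⟨⟨0, fun _ _ => 0, fun _ _ => 0, fun _ _ => 0, fun _ _ => 0, fun _ _ => 0, ?_⟩, le_rfl⟩
    -- The two records and the header are stored one after the other from the cell 5 on.
    have g : ∀ i (h : i < 17), s'.mem (5 + i) = s.reg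
        [61, 60, 62, 60, 62, 60, 62, 60, 62, 62, 62, 62, 62, 62, 61, 62, 63][i] := c6
    have z : MapAt s'.mem 22 (fun _ _ => 0) 0 := mapAt_zero h0
    simp only [e3, e0, set_mem]
    refine ⟨by norm_num, enc_nil hw h0 ((g 0 (by norm_num)).trans b9) ((g 1 (by norm_num)).trans b8)
      ((g 2 (by norm_num)).trans b6) ((g 4 (by norm_num)).trans b6)
      ((g 5 (by norm_num)).trans b8) ((g 6 (by norm_num)).trans b6) ((g 7 (by norm_num)).trans b8),
      ?_, ?_, ?_, ?_, ?_, ?_, ?_, ?_, ?_⟩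
    · rw [(g 8 (by norm_num)).trans b6]; exact z
    · rw [show s'.mem (13 + _) = _ from (g 9 (by norm_num)).trans b6]; exact z
    · rw [show s'.mem (13 + _) = _ from (g 10 (by norm_num)).trans b6]; exact z
    · rw [show s'.mem (13 + _) = _ from (g 11 (by norm_num)).trans b6]; exact z
    · rw [show s'.mem (13 + _) = _ from (g 12 (by norm_num)).trans b6]; exact z
    · rw [show s'.mem (13 + _) = _ from (g 13 (by norm_num)).trans b6]; simp [word]
    · rw [show s'.mem (13 + _) = _ from (g 14 (by norm_num)).trans b9]; simp [dir]
    · exact (g 15 (by norm_num)).trans b6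
    · rw [pals_nil]
      exact (g 16 (by norm_num)).trans b7

/-- The memory suffices for `m` operations: `m` operations use at most `m * (2240 * m + 228340)`
cells, which is less than `2 ^ 18 * (m + 2) ^ 2`, whence the exponent 20. -/
theorem memory_lt {σ m w : ℕ} (h : (σ + m + 2) ^ 20 ≤ 2 ^ w) :
    22 + m * (70 * unitSpace (m + 100)) < 2 ^ w := by
  refine lt_of_lt_of_le ?_ h
  have hm : m + 2 ≤ σ + m + 2 := by omega
  generalize σ + m + 2 = x at hm
  have h1 : 70 * unitSpace (m + 100) ≤ 2240 * m + 228340 := by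
    have := Nat.log_le_self 2 (m + 100)
    unfold unitSpace hgt
    omega
  have h2 : 2 ^ 18 ≤ x ^ 18 := Nat.pow_le_pow_left (by omega) 18
  calc 22 + m * (70 * unitSpace (m + 100)) ≤ 22 + m * (2240 * m + 228340) := by gcongr
    _ < x ^ 2 * 2 ^ 18 := by nlinarith
    _ ≤ x ^ 2 * x ^ 18 := Nat.mul_le_mul_left _ h2
    _ = x ^ 20 := by ring

end Eer

/-- There are fixed programs for the word RAM that implement fully persistent double-ended eertrees,
for all alphabet sizes `σ`, all numbers `m` of operations and all word lengths
`w ≥ K * log₂ (σ + m + 2)`, with worst-case time and space `O(log n + log σ)` per operation, and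
`O(log n)` per pop operation. -/
theorem mainTheorem2 :
    ∃ (I : Eer.Implementation) (C K : ℕ), ∀ σ m w : ℕ, (σ + m + 2) ^ K ≤ 2 ^ w →
      Eer.Implements I C σ w m := by
  refine ⟨Eer.impl, Eer.bnd, 20, fun σ m w h => ?_⟩
  have hσ : σ < 2 ^ w := lt_of_lt_of_le (by omega) ((Nat.le_self_pow (by norm_num) _).trans h)
  have hm := Eer.memory_lt h
  have h22 : 22 < 2 ^ w := by
    have : 2 ^ 20 ≤ (σ + m + 2) ^ 20 := Nat.pow_le_pow_left (by omega) 20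
    omega
  obtain ⟨t, st, h1, h2, h3, v, h4, h5, I⟩ := Eer.runs_init h22 σ
  have hb : Eer.bnd * 1 ≤ Eer.bnd * (1 + Nat.log 2 σ) := Nat.mul_le_mul_left _ (by omega)
  have hb' : 45 ≤ Eer.bnd := by norm_num [Eer.bnd]
  exact ⟨t, st, v, h1, by omega, by omega, h4, h5,
    ((I m).ver v (List.mem_singleton_self v)).1.wellLabelled,
    Eer.Inv.serves hσ hm m 0 st [v] (by omega) (I m)⟩
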